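/- **Conventions.** PPT and QPT mean (uniform) probabilistic polynomial time and quantum polynomial time; all algorithms also receive the security parameter $1^\lambda$. An adversary is a QPT machine (its running time is at most a polynomial in $\lambda$, whatever its oracles answer) that makes classical queries and may receive quantum states. A function of $\lambda$ is negligible if it decays faster than every inverse polynomial. Plaintext and function spaces $\mathcal X_\lambda,\mathcal F_\lambda\subseteq\{0,1\}^*$ are polynomial-time recognizable, and $(f,x)\mapsto f(x)$ is polynomial-time computable. **Building blocks.** * An SKFE scheme $(\mathsf{Setup},\mathsf{KG},\mathsf{Enc},\mathsf{Dec})$ of PPT algorithms for $\mathcal X,\mathcal F$, such that the length of a functional key $\mathsf{KG}(\mathsf{msk},f)$, $\mathsf{msk}\leftarrow\mathsf{Setup}(1^\lambda,1^q)$, depends only on $(\lambda,q,f)$. It is *selectively indistinguishability-secure* if for every QPT adversary the probabilities of output $1$ in the following experiment with $\mathsf{coin}=0$ and $\mathsf{coin}=1$ differ negligibly: the adversary sends $(1^q,x_0^*,x_1^*)$; the challenger runs $\mathsf{msk}\leftarrow\mathsf{Setup}(1^\lambda,1^q)$ and returns $\mathsf{Enc}(\mathsf{msk},x^*_{\mathsf{coin}})$;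 the adversary may query $\mathsf{Enc}(\mathsf{msk},\cdot)$, and, at most $q$ times, $\mathsf{KG}(\mathsf{msk},f)$ for $f$ with $f(x_0^*)=f(x_1^*)$; it outputs a bit. * A secret-key encryption scheme with certified deletion $(\mathsf{CD.KG},\mathsf{CD.Enc},\mathsf{CD.Dec},\mathsf{CD.Del},\mathsf{CD.Vrfy})$ with plaintexts in $\{0,1\}^*$, where $\mathsf{CD.Enc}(\mathsf{sk},m)$ outputs a classical $\mathsf{vk}$ and a quantum ciphertext, and $\mathsf{CD.KG}$, $\mathsf{CD.Vrfy}$ are classical. It is *IND-CVA-CD secure* if for every QPT adversary the probabilities of output $1$ in the following experiment with $b=0$ and $b=1$ differ negligibly: $\mathsf{sk}\leftarrow\mathsf{CD.KG}(1^\lambda)$; the adversary may at any time query $m$ and obtain $(\mathsf{vk},\mathsf{ct})\leftarrow\mathsf{CD.Enc}(\mathsf{sk},m)$; it sends once $(m_0,m_1)$ with $|m_0|=|m_1|$ and obtains $\mathsf{ct}_b$, where $(\mathsf{vk}_b,\mathsf{ct}_b)\leftarrow\mathsf{CD.Enc}(\mathsf{sk},m_b)$; from then on it may send verification queries $\mathsf{cert}$,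 answered by $\mathsf{sk}$ if $\mathsf{CD.Vrfy}(\mathsf{vk}_b,\mathsf{cert})=\top$ and by $\bot$ otherwise; it outputs a bit. * A family of polynomial-time computable functions $\mathsf F_K:\{0,1\}^{a}\to\{0,1\}^{b}$, $K\in\{0,1\}^\lambda$, for all lengths $a,b$. It is a *PRF* if every QPT distinguisher that chooses $(1^a,1^b)$ and then makes classical queries distinguishes $\mathsf F_K$, for uniform $K$, from a uniformly random function $\{0,1\}^a\to\{0,1\}^b$ with negligible advantage only. **Construction** of $\mathsf{iSKFE\text{-}sbSKL}=(\mathsf{iSetup},\mathsf{iKG},\mathsf{iEnc},\mathsf{iDec},\mathsf{iCert},\mathsf{iVrfy})$. $\mathsf{iSetup}(1^\lambda,1^q,n)$, with $n$ in binary, outputs $(q,n,K)$ for $K\leftarrow\{0,1\}^\lambda$. For $j\in[n]$ put $r_j\|w_j:=\mathsf F_K(j)$ (with $j$ written with as many bits as $n$, and $r_j$, $w_j$ as long as the coins needed), $\mathsf{msk}_j:=\mathsf{Setup}(1^\lambda,1^q;r_j)$, $\mathsf{cd.sk}_j:=\mathsf{CD.KG}(1^\lambda;w_j)$. * $\mathsf{iKG}((q,n,K),f)$: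 for every $j\in[n]$ let $\mathsf{fsk}_j\leftarrow\mathsf{KG}(\mathsf{msk}_j,f)$ and $(\mathsf{vk}_j,\mathsf{cd.ct}_j)\leftarrow\mathsf{CD.Enc}(\mathsf{cd.sk}_j,\mathsf{fsk}_j)$; output the leased key $(\mathsf{cd.ct}_j)_{j\in[n]}$ and the verification key $(\mathsf{vk}_j)_{j\in[n]}$. * $\mathsf{iEnc}((q,n,K),j,x)$: output $(j,\mathsf{Enc}(\mathsf{msk}_j,x),\mathsf{cd.sk}_j)$. * $\mathsf{iDec}$: on a leased key $(\mathsf{cd.ct}_j)_j$ and a ciphertext $(j,\mathsf{ct}_j,\mathsf{cd.sk}_j)$, output $\mathsf{Dec}(\mathsf{CD.Dec}(\mathsf{cd.sk}_j,\mathsf{cd.ct}_j),\mathsf{ct}_j)$. * $\mathsf{iCert}$: output $(\mathsf{CD.Del}(\mathsf{cd.ct}_j))_{j\in[n]}$. * $\mathsf{iVrfy}$: output $\top$ iff $\mathsf{CD.Vrfy}(\mathsf{vk}_j,\mathsf{cert}_j)=\top$ for every $j\in[n]$. **Selective strong lessor security.** In the experiment with bit $\mathsf{coin}$, the adversary first sends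 $(1^q,n,j^*,x_0^*,x_1^*)$ with $n$ and $j^*\in[n]$ in binary, and the challenger runs $\mathsf{msk}\leftarrow\mathsf{iSetup}(1^\lambda,1^q,n)$. If the adversary uses the key generation or verification oracle, then $n$ must be at most $p(\lambda)$ for some polynomial $p$; $p$ is arbitrary. The oracles are: encryption, $(j,x)\mapsto\mathsf{iEnc}(\mathsf{msk},j,x)$ for $j\in[n]$; key generation, used at most $q$ times, which on $f$ runs $\mathsf{iKG}(\mathsf{msk},f)$, returns the leased key and stores $(f,\mathsf{vk},\bot)$ in a list; verification, which on $(f,\mathsf{cert})$ returns $\top$ if $\mathsf{iVrfy}(\mathsf{vk},\mathsf{cert})=\top$ for an entry $(f,\mathsf{vk},M)$ of the list, replacing $M$ by $\top$ in every such entry, and returns $\bot$ otherwise. The adversary may request the challenge ciphertext once. If at this point every entry with $f(x_0^*)\ne f(x_1^*)$ has $M=\top$ and the encryption oracle has not been queried with $j^*$, it receives $\mathsf{iEnc}(\mathsf{msk},j^*,x^*_{\mathsf{coin}})$; otherwise the experiment outputs $0$. Afterwards functions with $f(x_0^*)\ne f(x_1^*)$ are not allowed as key generation queries. The output of the experiment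 is the bit that the adversary outputs. The scheme is *selectively strong lessor secure* if for every QPT adversary (and every $p$) the probabilities of output $1$ with $\mathsf{coin}=0$ and with $\mathsf{coin}=1$ differ negligibly. **Theorem.** If the SKFE scheme is selectively indistinguishability-secure, the encryption scheme with certified deletion is IND-CVA-CD secure, and $\mathsf F$ is a PRF, then $\mathsf{iSKFE\text{-}sbSKL}$ is selectively strong lessor secure. -/

import Mathlib

open scoped ENNReal NNReal

noncomputable section

namespace Skl

/-! ### Bit strings -/

/-- Unary encoding `1^n`. -/
def unary (n : ℕ) : List Bool := List.replicate n true

/-- The pair of two bit strings as one bit string: every bit of the first component is preceded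
by the marker `1`, and the marker `0` announces the second component. -/
def pairS (a b : List Bool) : List Bool := a.flatMap (fun c => [true, c]) ++ false :: b

/-- First component of a pair. -/
def fstS : List Bool → List Bool
  | true :: c :: s => c :: fstS s
  | _ => []

/-- Second component of a pair. -/
def sndS : List Bool → List Bool
  | true :: _ :: s => sndS s
  | false :: s => s
  | _ => []

theorem fstS_pairS (a b : List Bool) : fstS (pairS a b) = a := by
  induction a with
  | nil => simp [pairS, fstS]
  | cons c a ih => simpa [pairS, fstS] using ih

theorem sndS_pairS (a b : List Bool) : sndS (pairS a b) = b := by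
  induction a with
  | nil => simp [pairS, sndS]
  | cons c a ih => simpa [pairS, sndS] using ih

/-- A list of bit strings as one bit string, by nested pairs. -/
def encList : List (List Bool) → List Bool
  | [] => []
  | x :: xs => pairS x (encList xs)

/-- The `k`-th item (counted from `0`) of an encoded list. -/
def item (k : ℕ) (s : List Bool) : List Bool := fstS (sndS^[k] s)

/-- Value of a bit string in binary, least significant bit first (inverse of `Nat.bits`). -/
def ofBits : List Bool → ℕ
  | [] => 0
  | b :: s => b.toNat + 2 * ofBits s

/-- The uniform distribution on `{0,1}^n`. -/
def uniformBits (n : ℕ) : PMF (List Bool) :=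
  (PMF.uniformOfFintype (Fin n → Bool)).map List.ofFn

/-- A coin that is `true` with probability `p`. -/
def biased (p : ℝ≥0) (h : p ≤ 1) : PMF Bool :=
  PMF.ofFintype (fun b => cond b (p : ℝ≥0∞) ((1 - p : ℝ≥0) : ℝ≥0∞)) (by
    simpa [Fintype.sum_bool] using add_tsub_cancel_of_le (ENNReal.coe_le_one_iff.2 h))

/-- Independent runs of `g` on the members of a list, from left to right. -/
def seqP {α β : Type} (g : α → PMF β) : List α → PMF (List β)
  | [] => PMF.pure []
  | a :: l => (g a).bind fun b => (seqP g l).map (b :: ·)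

/-! ### Quantum memory

Qubits are addressed by natural numbers, and all but finitely many of them are `|0⟩`.
A computational basis state is the finite set of the qubits that are `|1⟩`, and a pure state
is a finite combination of basis states (up to a nonzero scalar; measurement probabilities are
relative to the squared norm). A mixed state arises as a distribution on pure states. -/

/-- The quantum memory: the qubits with address below `next` have been handed out. -/
structure QMem where
  next : ℕ
  psi : Finset ℕ →₀ ℂ

namespace QMem

/-- No qubit has been handed out, and every qubit is `|0⟩`. -/
def init : QMem := ⟨0, Finsupp.single ∅ 1⟩

/-- The linear operator that maps every basis state `S` to `U S`. -/
def apply (U : Finset ℕ → (Finset ℕ →₀ ℂ)) (m : QMem) : QMem :=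
  { m with psi := m.psi.sum fun S a => a • U S }

/-- The Hadamard gate on qubit `i`. -/
def had (i : ℕ) : QMem → QMem :=
  apply fun S =>
    ((Real.sqrt 2 : ℝ) : ℂ)⁻¹ •
      (Finsupp.single (S.erase i) 1 + Finsupp.single (insert i S) (if i ∈ S then -1 else 1))

/-- The gate `T = diag(1, exp(iπ/4))` on qubit `i`. -/
def tgate (i : ℕ) : QMem → QMem :=
  apply fun S => Finsupp.single S (if i ∈ S then Complex.exp (Complex.I * Real.pi / 4) else 1)

/-- The controlled NOT with control `i` and target `j ≠ i`. -/
def cnot (i j : ℕ) (m : QMem) : QMem :=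
  if i = j then m
  else apply (fun S =>
    Finsupp.single (if i ∈ S then (if j ∈ S then S.erase j else insert j S) else S) 1) m

open Classical in
/-- The component of the state where qubit `i` has value `b`. -/
def branch (i : ℕ) (b : Bool) (m : QMem) : Finset ℕ →₀ ℂ :=
  m.psi.filter fun S => (i ∈ S ↔ b = true)

/-- The squared norm of that component. -/
def weight (i : ℕ) (b : Bool) (m : QMem) : ℝ≥0 := (m.branch i b).sum fun _ a => ‖a‖₊ ^ 2

theorem prob_le_one (i : ℕ) (m : QMem) :
    m.weight i true / (m.weight i false + m.weight i true) ≤ 1 :=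
  div_le_one_of_le₀ le_add_self zero_le

/-- Measurement of qubit `i` in the computational basis. The measured qubit is consumed: it is
reset to `|0⟩`. -/
def measure (i : ℕ) (m : QMem) : PMF (Bool × QMem) :=
  (biased _ (m.prob_le_one i)).map fun b =>
    (b, { m with psi := (m.branch i b).mapDomain fun S => S.erase i })

end QMem

/-! ### Machines

A machine has classical registers that hold bit strings, and quantum registers that hold lists of
qubits. Its program is finite and does not depend on the input. Loops are repeated as often as
the length of a register tells on entry. (A machine with a time bound can always be written like
this, with its clock as the loop register.) Every instruction costs one step plus the lengths of
the strings that it reads. -/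

inductive Instr
  /-- `c r := []` -/
  | nil (r : ℕ)
  /-- puts the bit `b` in front of `c r` -/
  | cons (b : Bool) (r : ℕ)
  /-- drops the first bit of `c r` -/
  | tail (r : ℕ)
  /-- `c r := c s` -/
  | copy (r s : ℕ)
  /-- `c r := c s ++ c t` -/
  | append (r s t : ℕ)
  /-- `c r :=` the first `|c t|` bits of `c s` -/
  | take (r s t : ℕ)
  /-- `c r :=` the bits of `c s` after the first `|c t|` ones -/
  | drop (r s t : ℕ)
  /-- `c r := ⟨c s, c t⟩` -/
  | pair (r s t : ℕ)
  /-- `c r :=` first component of `c s` -/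
  | fst (r s : ℕ)
  /-- `c r :=` second component of `c s` -/
  | snd (r s : ℕ)
  /-- `c r :=` the bit that tells whether `c s = c t` -/
  | eq (r s t : ℕ)
  /-- puts a fair random bit in front of `c r` -/
  | coin (r : ℕ)
  /-- puts a fresh qubit `|0⟩` in front of `q a` -/
  | qnew (a : ℕ)
  /-- Hadamard gate on the first qubit of `q a` -/
  | had (a : ℕ)
  /-- `T` gate on the first qubit of `q a` -/
  | tgate (a : ℕ)
  /-- controlled NOT from the first qubit of `q a` to the first qubit of `q b` -/
  | cnot (a b : ℕ)
  /-- measures and consumes the first qubit of `q a`, and puts the outcome in front of `c r` -/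
  | meas (a r : ℕ)
  /-- moves the first `|c r|` qubits of `q a` to the end of `q b` -/
  | qmove (a b r : ℕ)
  /-- `c r := 1^k` where `k` is the number of qubits in `q a` -/
  | qlen (r a : ℕ)
  /-- oracle call number `k` with query `c s`; of the answer, the first `|c t|` bits go to `c r`
  and the first `|c t|` qubits to the end of `q a` -/
  | call (k r s t a : ℕ)

inductive Prog
  | instr (i : Instr)
  | seq (p p' : Prog)
  /-- `p` if the first bit of `c r` exists and is `1`, otherwise `p'` -/
  | ifTrue (r : ℕ) (p p' : Prog)
  /-- `p` if `c r` is empty, otherwise `p'` -/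
  | ifNil (r : ℕ) (p p' : Prog)
  /-- `p` is repeated `|c r|` times, with `|c r|` taken on entry -/
  | loop (r : ℕ) (p : Prog)

/-- The state of a machine together with the state `env` of the oracle. -/
structure State (S : Type) where
  c : ℕ → List Bool
  q : ℕ → List ℕ
  mem : QMem
  env : S
  time : ℕ

/-- What an oracle returns: a bit string and a list of qubits. -/
abbrev Reply := List Bool × List ℕ

/-- A stateful oracle with classical queries: from the number of the call, the query, its state
and the quantum memory, it produces a reply, its new state and the new quantum memory. -/
abbrev Oracle (S : Type) := ℕ → List Bool → S → QMem → PMF (Reply × S × QMem)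

variable {S : Type}

def State.setC (s : State S) (r : ℕ) (v : List Bool) : State S :=
  { s with c := Function.update s.c r v }

def State.setQ (s : State S) (a : ℕ) (l : List ℕ) : State S :=
  { s with q := Function.update s.q a l }

def State.tick (s : State S) (k : ℕ) : State S := { s with time := s.time + k }

/-- The cost of an instruction. -/
def Instr.cost (s : State S) : Instr → ℕ
  | copy _ a => 1 + (s.c a).length
  | append _ a b => 1 + (s.c a).length + (s.c b).length
  | take _ a b => 1 + (s.c a).length + (s.c b).length
  | drop _ a b => 1 + (s.c a).length + (s.c b).length
  | pair _ a b => 1 + (s.c a).length + (s.c b).length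
  | fst _ a => 1 + (s.c a).length
  | snd _ a => 1 + (s.c a).length
  | eq _ a b => 1 + (s.c a).length + (s.c b).length
  | qmove _ _ r => 1 + (s.c r).length
  | qlen _ a => 1 + (s.q a).length
  | call _ _ a t _ => 1 + (s.c a).length + (s.c t).length
  | _ => 1

/-- The effect of an instruction, without its cost. -/
def Instr.effect (O : Oracle S) (s : State S) : Instr → PMF (State S)
  | nil r => PMF.pure (s.setC r [])
  | cons b r => PMF.pure (s.setC r (b :: s.c r))
  | tail r => PMF.pure (s.setC r (s.c r).tail)
  | copy r a => PMF.pure (s.setC r (s.c a))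
  | append r a b => PMF.pure (s.setC r (s.c a ++ s.c b))
  | take r a b => PMF.pure (s.setC r ((s.c a).take (s.c b).length))
  | drop r a b => PMF.pure (s.setC r ((s.c a).drop (s.c b).length))
  | pair r a b => PMF.pure (s.setC r (pairS (s.c a) (s.c b)))
  | fst r a => PMF.pure (s.setC r (fstS (s.c a)))
  | snd r a => PMF.pure (s.setC r (sndS (s.c a)))
  | eq r a b => PMF.pure (s.setC r [decide (s.c a = s.c b)])
  | coin r => (PMF.uniformOfFintype Bool).map fun b => s.setC r (b :: s.c r)
  | qnew a =>
      PMF.pure { s.setQ a (s.mem.next :: s.q a) with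
        mem := { s.mem with next := s.mem.next + 1 } }
  | had a =>
      match s.q a with
      | [] => PMF.pure s
      | i :: _ => PMF.pure { s with mem := s.mem.had i }
  | tgate a =>
      match s.q a with
      | [] => PMF.pure s
      | i :: _ => PMF.pure { s with mem := s.mem.tgate i }
  | cnot a b =>
      match s.q a, s.q b with
      | i :: _, j :: _ => PMF.pure { s with mem := s.mem.cnot i j }
      | _, _ => PMF.pure s
  | meas a r =>
      match s.q a with
      | [] => PMF.pure s
      | i :: l => (s.mem.measure i).map fun o =>
          { (s.setQ a l).setC r (o.1 :: s.c r) with mem := o.2 }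
  | qmove a b r =>
      let k := (s.c r).length
      let s' := s.setQ a ((s.q a).drop k)
      PMF.pure (s'.setQ b (s'.q b ++ (s.q a).take k))
  | qlen r a => PMF.pure (s.setC r (unary (s.q a).length))
  | call k r a t b =>
      let m := (s.c t).length
      (O k (s.c a) s.env s.mem).map fun o =>
        { (s.setC r (o.1.1.take m)).setQ b (s.q b ++ o.1.2.take m) with
          env := o.2.1, mem := o.2.2 }

/-- `k`-fold repetition of a random step. -/
def iterP {α : Type} (f : α → PMF α) : ℕ → α → PMF α
  | 0, a => PMF.pure a
  | k + 1, a => (f a).bind (iterP f k)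

/-- The distribution of the final state when a program runs with an oracle. -/
def Prog.run (O : Oracle S) : Prog → State S → PMF (State S)
  | instr i, s => i.effect O (s.tick (i.cost s))
  | seq p p', s => (p.run O s).bind (p'.run O)
  | ifTrue r p p', s =>
      if (s.c r).head? = some true then p.run O (s.tick 1) else p'.run O (s.tick 1)
  | ifNil r p p', s =>
      if s.c r = [] then p.run O (s.tick 1) else p'.run O (s.tick 1)
  | loop r p, s => iterP (fun s' => p.run O (s'.tick 1)) (s.c r).length (s.tick 1)

/-- Deterministic classical instructions without oracle. -/
def Instr.Classical : Instr → Prop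
  | nil _ | cons _ _ | tail _ | copy _ _ | append _ _ _ | take _ _ _ | drop _ _ _
  | pair _ _ _ | fst _ _ | snd _ _ | eq _ _ _ => True
  | _ => False

/-- Programs of deterministic classical machines without oracle. -/
def Prog.Classical : Prog → Prop
  | instr i => i.Classical
  | seq p p' | ifTrue _ p p' | ifNil _ p p' => p.Classical ∧ p'.Classical
  | loop _ p => p.Classical

/-- Instructions other than oracle calls. -/
def Instr.NoCall : Instr → Prop
  | call _ _ _ _ _ => False
  | _ => True

/-- Programs without oracle calls. -/
def Prog.NoCall : Prog → Prop
  | instr i => i.NoCall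
  | seq p p' | ifTrue _ p p' | ifNil _ p p' => p.NoCall ∧ p'.NoCall
  | loop _ p => p.NoCall

/-- The start state: the arguments are in the first classical registers, the input qubits in
quantum register `0`, and all other registers are empty. -/
def start {n : ℕ} (args : Fin n → List Bool) (l : List ℕ) (m : QMem) (e : S) : State S where
  c := fun i => if h : i < n then args ⟨i, h⟩ else []
  q := fun i => if i = 0 then l else []
  mem := m
  env := e
  time := 0

/-- The oracle of machines that have none. -/
def noOracle : Oracle Unit := fun _ _ _ m => PMF.pure (([], []), (), m)

/-- The function `out` of the arguments `args` is computed by a deterministic classical machine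
in time polynomial in the total length of the arguments. -/
def PolyTime {ι : Type} {n : ℕ} (args : ι → Fin n → List Bool) (out : ι → List Bool) : Prop :=
  ∃ (P : Prog) (p : Polynomial ℕ), P.Classical ∧
    ∀ i, ∀ s ∈ (P.run noOracle (start (args i) [] QMem.init ())).support,
      s.c 0 = out i ∧ s.time ≤ p.eval (∑ k, (args i k).length)

/-- A probabilistic polynomial-time algorithm with `n` arguments, with explicit random coins:
`out args r` is the output on coins `r ∈ {0,1}^(coins args)`. -/
structure PPT (n : ℕ) where
  coins : (Fin n → List Bool) → ℕ
  out : (Fin n → List Bool) → List Bool → List Bool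
  coins_poly : PolyTime (fun args => args) (fun args => unary (coins args))
  out_poly : PolyTime
    (fun i : (Fin n → List Bool) × List Bool => (Fin.cons i.2 i.1 : Fin (n + 1) → List Bool))
    (fun i => out i.1 i.2)

/-- The output distribution of a probabilistic algorithm. -/
def PPT.dist {n : ℕ} (A : PPT n) (args : Fin n → List Bool) : PMF (List Bool) :=
  (uniformBits (A.coins args)).map (A.out args)

/-- A polynomial-time quantum algorithm with `n` classical arguments and a list of input qubits. -/
structure QPT (n : ℕ) where
  prog : Prog
  noCall : prog.NoCall
  poly : ∃ p : Polynomial ℕ, ∀ (args : Fin n → List Bool) (l : List ℕ) (m : QMem),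
    ∀ s ∈ (prog.run noOracle (start args l m ())).support,
      s.time ≤ p.eval (∑ k, (args k).length + l.length)

/-- The final state of a quantum algorithm that is run on the quantum memory `m`. -/
def QPT.exec {n : ℕ} (A : QPT n) (args : Fin n → List Bool) (l : List ℕ) (m : QMem) :
    PMF (State Unit) :=
  A.prog.run noOracle (start args l m ())

/-! ### Adversaries and experiments -/

/-- `A` is a polynomial-time quantum oracle machine: on input `1^lam` its running time is at most
polynomial in `lam`, whatever the oracle does. -/
def IsQPTAdversary (A : Prog) : Prop :=
  ∃ p : Polynomial ℕ, ∀ (lam : ℕ) (S : Type) (O : Oracle S) (e : S),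
    ∀ s ∈ (A.run O (start ![unary lam] [] QMem.init e)).support, s.time ≤ p.eval lam

/-- The bit that an adversary outputs: the first bit of register `0`. -/
def State.guess (s : State S) : Bool := decide ((s.c 0).head? = some true)

/-- The final state when the adversary `A` on input `1^lam` interacts with the challenger `O`
whose initial state is `e`. -/
def interact (O : Oracle S) (e : S) (A : Prog) (lam : ℕ) : PMF (State S) :=
  A.run O (start ![unary lam] [] QMem.init e)

/-- The advantage between the experiments with `coin = 0` and `coin = 1` is negligible. -/
def NegligibleAdvantage (exper : ℕ → Bool → PMF Bool) : Prop :=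
  Asymptotics.SuperpolynomialDecay Filter.atTop (fun lam : ℕ => (lam : ℝ))
    (fun lam => |(exper lam false true).toReal - (exper lam true true).toReal|)

/-- The answer `⊥` of a challenger. -/
def bot : Reply := ([], [])

/-- The answer of a challenger that is the bit string `s` and the qubits `l`. -/
def reply (s : List Bool) (l : List ℕ) : Reply := (true :: s, l)

/-! ### Pseudorandom functions -/

/-- A polynomial-time computable family of functions `F_K : {0,1}^a → {0,1}^b` with
`K ∈ {0,1}^lam`, for all `lam`, `a` and `b`: `eval K x b` is the value at `x ∈ {0,1}^a`. -/
structure FunFamily where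
  eval : List Bool → List Bool → ℕ → List Bool
  length_eval : ∀ K x b, (eval K x b).length = b
  poly : PolyTime (fun i : List Bool × List Bool × ℕ => ![i.1, i.2.1, unary i.2.2])
    (fun i => eval i.1 i.2.1 i.2.2)

namespace FunFamily

/-- The function that the distinguisher can query: `F_K` for a uniform key `K`, or a uniformly
random function from `{0,1}^a` to `{0,1}^b`. -/
def sample (F : FunFamily) (lam : ℕ) (random : Bool) (a b : ℕ) : PMF (List Bool → List Bool) :=
  if random then
    (PMF.uniformOfFintype ((Fin a → Bool) → (Fin b → Bool))).map fun R x =>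
      List.ofFn (R fun i => x.getD i false)
  else
    (uniformBits lam).map fun K x => F.eval K x b

/-- Call `0` with `(1^a, 1^b)` fixes the lengths (once); call `1` queries the function. -/
def oracle (F : FunFamily) (lam : ℕ) (random : Bool) :
    Oracle (Option (ℕ × (List Bool → List Bool))) := fun k x e m =>
  match k, e with
  | 0, none =>
      (F.sample lam random (item 0 x).length (item 1 x).length).map fun g =>
        (reply [] [], some ((item 0 x).length, g), m)
  | 1, some (a, g) =>
      PMF.pure (if x.length = a then reply (g x) [] else bot, some (a, g), m)
  | _, e => PMF.pure (bot, e, m)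

def experiment (F : FunFamily) (A : Prog) (lam : ℕ) (random : Bool) : PMF Bool :=
  (interact (F.oracle lam random) none A lam).map State.guess

/-- `F` is a pseudorandom function. -/
def IsPRF (F : FunFamily) : Prop :=
  ∀ A : Prog, IsQPTAdversary A → NegligibleAdvantage (F.experiment A)

end FunFamily

/-! ### Secret-key functional encryption -/

/-- Plaintext and function spaces `X lam`, `F lam ⊆ {0,1}^*` that are recognizable in polynomial
time, with polynomial-time evaluation `eval lam f x` of `f` at `x`. -/
structure FunctionClass where
  X : ℕ → List Bool → Bool
  F : ℕ → List Bool → Bool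
  eval : ℕ → List Bool → List Bool → List Bool
  X_poly : PolyTime (fun i : ℕ × List Bool => ![unary i.1, i.2]) (fun i => [X i.1 i.2])
  F_poly : PolyTime (fun i : ℕ × List Bool => ![unary i.1, i.2]) (fun i => [F i.1 i.2])
  eval_poly : PolyTime (fun i : ℕ × List Bool × List Bool => ![unary i.1, i.2.1, i.2.2])
    (fun i => eval i.1 i.2.1 i.2.2)

/-- The algorithms of a secret-key functional encryption scheme (all of them get `1^lam`). -/
structure SKFE where
  /-- arguments `1^lam, 1^q`; output `msk` -/
  setup : PPT 2
  /-- arguments `1^lam, msk, f`; output `sk_f` -/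
  keyGen : PPT 3
  /-- arguments `1^lam, msk, x`; output `ct` -/
  enc : PPT 3
  /-- arguments `1^lam, sk_f, ct`; output `y` -/
  dec : PPT 3

namespace SKFE

/-- The length of a functional key is public: it depends only on `lam`, `q` and `f`, and not on
the coins of setup and key generation. -/
def PublicKeyLength (E : SKFE) (C : FunctionClass) : Prop :=
  ∀ (lam q : ℕ) (f : List Bool), C.F lam f = true → ∃ len : ℕ, ∀ r r' : List Bool,
    r.length = E.setup.coins ![unary lam, unary q] →
    r'.length = E.keyGen.coins ![unary lam, E.setup.out ![unary lam, unary q] r, f] →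
    (E.keyGen.out ![unary lam, E.setup.out ![unary lam, unary q] r, f] r').length = len

/-- The state of the challenger of the selective indistinguishability experiment; `keys` counts
the functional keys that were given out. -/
structure IndState where
  q : ℕ
  x0 : List Bool
  x1 : List Bool
  msk : List Bool
  keys : ℕ

/-- Call `0` with `(1^q, x0, x1)` starts the experiment (once) and returns the challenge
ciphertext; call `1` is the encryption oracle; call `2` is the key generation oracle. -/
def indOracle (E : SKFE) (C : FunctionClass) (lam : ℕ) (coin : Bool) :
    Oracle (Option IndState) := fun k x e m =>
  match k, e with
  | 0, none =>
      let q := (item 0 x).length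
      let x0 := item 1 x
      let x1 := item 2 x
      if C.X lam x0 = true ∧ C.X lam x1 = true then
        (E.setup.dist ![unary lam, unary q]).bind fun msk =>
          (E.enc.dist ![unary lam, msk, if coin then x1 else x0]).map fun ct =>
            (reply ct [], some ⟨q, x0, x1, msk, 0⟩, m)
      else PMF.pure (bot, none, m)
  | 1, some st =>
      if C.X lam x = true then
        (E.enc.dist ![unary lam, st.msk, x]).map fun ct => (reply ct [], some st, m)
      else PMF.pure (bot, some st, m)
  | 2, some st =>
      if C.F lam x = true ∧ st.keys < st.q ∧ C.eval lam x st.x0 = C.eval lam x st.x1 then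
        (E.keyGen.dist ![unary lam, st.msk, x]).map fun sk =>
          (reply sk [], some { st with keys := st.keys + 1 }, m)
      else PMF.pure (bot, some st, m)
  | _, e => PMF.pure (bot, e, m)

def indExperiment (E : SKFE) (C : FunctionClass) (A : Prog) (lam : ℕ) (coin : Bool) : PMF Bool :=
  (interact (E.indOracle C lam coin) none A lam).map State.guess

/-- Selective indistinguishability-security. -/
def SelectivelyIndSecure (E : SKFE) (C : FunctionClass) : Prop :=
  ∀ A : Prog, IsQPTAdversary A → NegligibleAdvantage (E.indExperiment C A)

end SKFE

/-! ### Secret-key encryption with certified deletion -/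

/-- The algorithms of a reusable secret-key encryption scheme with certified deletion for
plaintexts in `{0,1}^*`. A ciphertext consists of a bit string and a list of qubits. -/
structure CDSKE where
  /-- argument `1^lam`; output `sk` -/
  keyGen : PPT 1
  /-- arguments `1^lam, sk, m`; outputs `vk` in classical register `0` and the ciphertext in
  classical register `1` and quantum register `0` -/
  enc : QPT 3
  /-- arguments `1^lam, sk` and the ciphertext (bit string and qubits); output the plaintext in
  classical register `0` -/
  dec : QPT 3
  /-- arguments `1^lam` and the ciphertext (bit string and qubits); output `cert` in classical
  register `0` -/
  del : QPT 2
  /-- arguments `1^lam, vk, cert`; accepts if the output is `1` -/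
  vrfy : PPT 3

/-- A ciphertext with certified deletion: bit string and qubits. -/
abbrev CDCt := List Bool × List ℕ

namespace CDSKE

def encDist (D : CDSKE) (lam : ℕ) (sk msg : List Bool) (m : QMem) :
    PMF ((List Bool × CDCt) × QMem) :=
  (D.enc.exec ![unary lam, sk, msg] [] m).map fun s => ((s.c 0, (s.c 1, s.q 0)), s.mem)

def decDist (D : CDSKE) (lam : ℕ) (sk : List Bool) (ct : CDCt) (m : QMem) :
    PMF (List Bool × QMem) :=
  (D.dec.exec ![unary lam, sk, ct.1] ct.2 m).map fun s => (s.c 0, s.mem)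

def delDist (D : CDSKE) (lam : ℕ) (ct : CDCt) (m : QMem) : PMF (List Bool × QMem) :=
  (D.del.exec ![unary lam, ct.1] ct.2 m).map fun s => (s.c 0, s.mem)

def vrfyDist (D : CDSKE) (lam : ℕ) (vk cert : List Bool) : PMF Bool :=
  (D.vrfy.dist ![unary lam, vk, cert]).map fun o => decide (o = [true])

/-- The state of the challenger of the IND-CVA-CD experiment: the secret key and, after the
challenge, its verification key. -/
structure CvaState where
  sk : List Bool
  vk : Option (List Bool)

/-- Call `0` is an encryption query and returns `(vk, ct)`; call `1` with `(m0, m1)` of equal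
length returns the challenge ciphertext (once); call `2`, after the challenge, is a verification
query and returns `sk` if the certificate is accepted. -/
def cvaOracle (D : CDSKE) (lam : ℕ) (coin : Bool) : Oracle CvaState := fun k x e m =>
  match k, e.vk with
  | 0, _ =>
      (D.encDist lam e.sk x m).map fun o =>
        (reply (pairS o.1.1 o.1.2.1) o.1.2.2, e, o.2)
  | 1, none =>
      let m0 := item 0 x
      let m1 := item 1 x
      if m0.length = m1.length then
        (D.encDist lam e.sk (if coin then m1 else m0) m).map fun o =>
          (reply o.1.2.1 o.1.2.2, { e with vk := some o.1.1 }, o.2)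
      else PMF.pure (bot, e, m)
  | 2, some vk =>
      (D.vrfyDist lam vk x).map fun ok => (if ok then reply e.sk [] else bot, e, m)
  | _, _ => PMF.pure (bot, e, m)

def cvaExperiment (D : CDSKE) (A : Prog) (lam : ℕ) (coin : Bool) : PMF Bool :=
  (D.keyGen.dist ![unary lam]).bind fun sk =>
    (interact (D.cvaOracle lam coin) ⟨sk, none⟩ A lam).map State.guess

/-- IND-CVA-CD security. -/
def IndCvaCdSecure (D : CDSKE) : Prop :=
  ∀ A : Prog, IsQPTAdversary A → NegligibleAdvantage (D.cvaExperiment A)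

end CDSKE

/-! ### Index-based SKFE with static-bound secure key leasing -/

/-- The six algorithms of an index-based scheme, as random processes. The leased key consists of
a bit string and a list of qubits. -/
structure IndexSKL where
  /-- master secret keys -/
  MSK : Type
  /-- verification keys -/
  VK : Type
  /-- `setup lam q n` -/
  setup : ℕ → ℕ → ℕ → PMF MSK
  /-- `keyGen lam msk f` -/
  keyGen : ℕ → MSK → List Bool → QMem → PMF ((VK × List Bool × List ℕ) × QMem)
  /-- `enc lam msk j x` -/
  enc : ℕ → MSK → ℕ → List Bool → PMF (List Bool)
  /-- `dec lam fsk ct` -/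
  dec : ℕ → List Bool × List ℕ → List Bool → QMem → PMF (List Bool × QMem)
  /-- `cert lam fsk` -/
  cert : ℕ → List Bool × List ℕ → QMem → PMF (List Bool × QMem)
  /-- `vrfy lam vk cert` -/
  vrfy : ℕ → VK → List Bool → PMF Bool

namespace IndexSKL

/-- An entry `(f, vk, M)` of the list of leased keys; `returned` tells whether `M = ⊤`. -/
structure Entry (V : Type) where
  f : List Bool
  vk : V
  returned : Bool

/-- The state of the challenger of the selective strong lessor experiment. -/
structure LessorState (I : IndexSKL) where
  q : ℕ
  n : ℕ
  /-- the challenge index -/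
  j : ℕ
  x0 : List Bool
  x1 : List Bool
  msk : I.MSK
  /-- the leased keys -/
  leased : List (Entry I.VK)
  /-- an encryption query with the challenge index was made -/
  usedJ : Bool
  /-- the challenge ciphertext was given out -/
  challenged : Bool
  /-- the challenge was requested although it was not allowed: the experiment outputs `0` -/
  failed : Bool

/-- Verifies a certificate against the entries for `f`, and marks those where it is accepted. The
Boolean in the result tells whether there is such an entry. -/
def verifyEntries (I : IndexSKL) (lam : ℕ) (f cert : List Bool) (l : List (Entry I.VK)) :
    PMF (List (Entry I.VK) × Bool) :=
  (seqP (fun t : Entry I.VK =>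
    if t.f = f then
      (I.vrfy lam t.vk cert).map fun ok => ({ t with returned := t.returned || ok }, ok)
    else PMF.pure (t, false)) l).map fun o => (o.map Prod.fst, o.any Prod.snd)

open Classical in
/-- The challenger. Call `0` with `(1^q, n, j, x0, x1)`, where `n` and `j ∈ [n]` are in binary,
starts the experiment (once); call `1` with `(j', x)` is the encryption oracle; call `2` with `f`
is the key generation oracle; call `3` with `(f, cert)` is the verification oracle; call `4`
requests the challenge ciphertext. The key generation and verification oracles are available only
if `n ≤ p(lam)`. -/
def lessorOracle (I : IndexSKL) (C : FunctionClass) (p : Polynomial ℕ) (lam : ℕ) (coin : Bool) :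
    Oracle (Option (LessorState I)) := fun k x e m =>
  match k, e with
  | 0, none =>
      let q := (item 0 x).length
      let n := ofBits (item 1 x)
      let j := ofBits (item 2 x)
      let x0 := item 3 x
      let x1 := item 4 x
      if 1 ≤ j ∧ j ≤ n ∧ C.X lam x0 = true ∧ C.X lam x1 = true then
        (I.setup lam q n).map fun msk =>
          (reply [] [], some ⟨q, n, j, x0, x1, msk, [], false, false, false⟩, m)
      else PMF.pure (bot, none, m)
  | 1, some st =>
      let j := ofBits (item 0 x)
      let y := item 1 x
      if st.failed = false ∧ 1 ≤ j ∧ j ≤ st.n ∧ C.X lam y = true then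
        (I.enc lam st.msk j y).map fun ct =>
          (reply ct [], some { st with usedJ := st.usedJ || decide (j = st.j) }, m)
      else PMF.pure (bot, some st, m)
  | 2, some st =>
      if st.failed = false ∧ st.n ≤ p.eval lam ∧ C.F lam x = true ∧ st.leased.length < st.q ∧
          (st.challenged = true → C.eval lam x st.x0 = C.eval lam x st.x1) then
        (I.keyGen lam st.msk x m).map fun o =>
          (reply o.1.2.1 o.1.2.2,
            some { st with leased := st.leased ++ [⟨x, o.1.1, false⟩] }, o.2)
      else PMF.pure (bot, some st, m)
  | 3, some st =>
      if st.failed = false ∧ st.n ≤ p.eval lam then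
        (I.verifyEntries lam (item 0 x) (item 1 x) st.leased).map fun o =>
          (if o.2 then reply [] [] else bot, some { st with leased := o.1 }, m)
      else PMF.pure (bot, some st, m)
  | 4, some st =>
      if st.failed = true ∨ st.challenged = true then PMF.pure (bot, some st, m)
      else if st.usedJ = false ∧
          ∀ t ∈ st.leased, C.eval lam t.f st.x0 ≠ C.eval lam t.f st.x1 → t.returned = true then
        (I.enc lam st.msk st.j (if coin then st.x1 else st.x0)).map fun ct =>
          (reply ct [], some { st with challenged := true }, m)
      else PMF.pure (bot, some { st with failed := true }, m)
  | _, e => PMF.pure (bot, e, m)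

/-- The output of the experiment: `0` if the challenger has stopped it, otherwise the bit of the
adversary. -/
def lessorOutput (I : IndexSKL) (s : State (Option (LessorState I))) : Bool :=
  match s.env with
  | some st => !st.failed && s.guess
  | none => s.guess

def lessorExperiment (I : IndexSKL) (C : FunctionClass) (p : Polynomial ℕ) (A : Prog)
    (lam : ℕ) (coin : Bool) : PMF Bool :=
  (interact (I.lessorOracle C p lam coin) none A lam).map (lessorOutput I)

/-- Selective strong lessor security. The adversary may declare any `n`; if it uses the key
generation or verification oracle, then `n` has to be bounded by a polynomial, which is
arbitrary. -/
def SelectivelyStrongLessorSecure (I : IndexSKL) (C : FunctionClass) : Prop :=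
  ∀ (p : Polynomial ℕ) (A : Prog), IsQPTAdversary A →
    NegligibleAdvantage (I.lessorExperiment C p A)

end IndexSKL

/-! ### The construction -/

/-- The master secret key `(q, n, K)`. -/
structure MasterKey where
  q : ℕ
  n : ℕ
  K : List Bool

namespace Construction

variable (E : SKFE) (D : CDSKE) (F : FunFamily)

/-- The index `j ∈ [n]` as a bit string whose length is the bit length of `n`. -/
def indexBits (n j : ℕ) : List Bool := List.ofFn fun i : Fin n.size => j.testBit i

/-- The length of the coins `r_j` of the SKFE setup. -/
def setupCoins (lam q : ℕ) : ℕ := E.setup.coins ![unary lam, unary q]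

/-- The length of the coins `w_j` of the key generation with certified deletion. -/
def cdCoins (lam : ℕ) : ℕ := D.keyGen.coins ![unary lam]

/-- `r_j ‖ w_j = F_K(j)`. -/
def block (lam : ℕ) (k : MasterKey) (j : ℕ) : List Bool :=
  F.eval k.K (indexBits k.n j) (setupCoins E lam k.q + cdCoins D lam)

/-- `msk_j`, generated with the coins `r_j`. -/
def mskAt (lam : ℕ) (k : MasterKey) (j : ℕ) : List Bool :=
  E.setup.out ![unary lam, unary k.q] ((block E D F lam k j).take (setupCoins E lam k.q))

/-- `cd.sk_j`, generated with the coins `w_j`. -/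
def cdKeyAt (lam : ℕ) (k : MasterKey) (j : ℕ) : List Bool :=
  D.keyGen.out ![unary lam] ((block E D F lam k j).drop (setupCoins E lam k.q))

/-- The list `1, …, n`. -/
def indices (n : ℕ) : List ℕ := List.range' 1 n

/-- Runs of `g` on the members of a list, from left to right, on a common quantum memory. -/
def seqQ {α β : Type} (g : α → QMem → PMF (β × QMem)) : List α → QMem → PMF (List β × QMem)
  | [], m => PMF.pure ([], m)
  | a :: l, m => (g a m).bind fun o => (seqQ g l o.2).map fun o' => (o.1 :: o'.1, o'.2)

/-- For the index `j`: a functional key for `f` under `msk_j`, encrypted under `cd.sk_j`. -/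
def keyGenAt (lam : ℕ) (k : MasterKey) (f : List Bool) (j : ℕ) (m : QMem) :
    PMF ((List Bool × CDCt) × QMem) :=
  (E.keyGen.dist ![unary lam, mskAt E D F lam k j, f]).bind fun fsk =>
    D.encDist lam (cdKeyAt E D F lam k j) fsk m

/-- A list of ciphertexts as one bit string and one list of qubits. The bit string contains, for
every ciphertext, its bit string and its number of qubits. -/
def packCts (l : List CDCt) : List Bool × List ℕ :=
  (encList (l.map fun ct => pairS ct.1 (unary ct.2.length)), l.flatMap Prod.snd)

/-- The ciphertext number `j` (counted from `1`) in a list of ciphertexts. -/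
def unpackCt (fsk : List Bool × List ℕ) (j : ℕ) : CDCt :=
  let len := fun i => (sndS (item i fsk.1)).length
  (fstS (item (j - 1) fsk.1),
    (fsk.2.drop (∑ i ∈ Finset.range (j - 1), len i)).take (len (j - 1)))

/-- The number of items of an encoded list. -/
def countItems (s : List Bool) : ℕ :=
  ((List.range s.length).takeWhile fun k => !(sndS^[k] s).isEmpty).length

/-- The index-based SKFE scheme with static-bound secure key leasing that is built from the SKFE
scheme `E`, the encryption scheme with certified deletion `D` and the function family `F`. -/
def scheme : IndexSKL where
  MSK := MasterKey
  VK := List (List Bool)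
  setup := fun lam q n => (uniformBits lam).map fun K => ⟨q, n, K⟩
  keyGen := fun lam k f m =>
    (seqQ (keyGenAt E D F lam k f) (indices k.n) m).map fun o =>
      ((o.1.map Prod.fst, packCts (o.1.map Prod.snd)), o.2)
  enc := fun lam k j x =>
    (E.enc.dist ![unary lam, mskAt E D F lam k j, x]).map fun ct =>
      encList [j.bits, ct, cdKeyAt E D F lam k j]
  dec := fun lam fsk ct m =>
    (D.decDist lam (item 2 ct) (unpackCt fsk (ofBits (item 0 ct))) m).bind fun o =>
      (E.dec.dist ![unary lam, o.1, item 1 ct]).map fun y => (y, o.2)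
  cert := fun lam fsk m =>
    (seqQ (D.delDist lam) ((indices (countItems fsk.1)).map (unpackCt fsk)) m).map fun o =>
      (encList o.1, o.2)
  vrfy := fun lam vk cert =>
    (seqP (fun i : ℕ × List Bool => D.vrfyDist lam i.2 (item i.1 cert))
      ((List.range vk.length).zip vk)).map fun l => l.all id

end Construction

end Skl

end

noncomputable section

namespace Skl

local notation "Str" => List Bool

local notation "fp" => by fun_prop

open Polynomial
open PMF (map_comp mem_support_map_iff bind_map pure_map support_pure mem_support_bind_iff
  mem_support_pure_iff)
open Function (update comp_apply iterate_succ_apply' update_apply update_of_ne)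
open Set (mem_singleton_iff)
open IndexSKL (Entry LessorState lessorOracle)
open Construction (scheme seqQ indexBits)
open List (take_of_length_le getI_eq_getElem length_cons foldl_cons map_append tail_cons map_map
  length_take length_singleton length_append take_nil length_map mem_append mem_singleton mem_map
  getI_append ext_getElem)

/-! ### Couplings -/

/-- The distributions `μ` and `ν` have a coupling that is supported on the relation `R`. -/
def Lift {α β : Type} (R : α → β → Prop) (μ : PMF α) (ν : PMF β) : Prop :=
  ∃ ρ : PMF (α × β), ρ.map Prod.fst = μ ∧ ρ.map Prod.snd = ν ∧ ∀ x ∈ ρ.support, R x.1 x.2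

namespace Lift

variable {α β γ δ : Type} {R : α → β → Prop} {μ : PMF α} {ν : PMF β}

lemma pure {a : α} {b : β} (h : R a b) : Lift R (PMF.pure a) (PMF.pure b) :=
  ⟨PMF.pure (a, b), pure_map _ _, pure_map _ _, by
    rintro x hx; rw [support_pure, mem_singleton_iff] at hx; simpa [hx] using h⟩

lemma mono {Q : α → β → Prop} (h : Lift R μ ν) (hQ : ∀ a b, R a b → Q a b) : Lift Q μ ν := by
  obtain ⟨ρ, h1, h2, h3⟩ := h; exact ⟨ρ, h1, h2, fun x hx => hQ _ _ (h3 x hx)⟩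

lemma mem (h : Lift R μ ν) : Lift (fun a b => R a b ∧ a ∈ μ.support ∧ b ∈ ν.support) μ ν := by
  obtain ⟨ρ, h1, h2, h3⟩ := h; refine ⟨ρ, h1, h2, fun x hx => ⟨h3 x hx, ?_, ?_⟩⟩
  · rw [← h1, mem_support_map_iff]; exact ⟨x, hx, rfl⟩
  · rw [← h2, mem_support_map_iff]; exact ⟨x, hx, rfl⟩

lemma symm (h : Lift R μ ν) : Lift (fun b a => R a b) ν μ := by
  obtain ⟨ρ, h1, h2, h3⟩ := h; refine ⟨ρ.map Prod.swap, ?_, ?_, ?_⟩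
  · rw [map_comp]; exact h2
  · rw [map_comp]; exact h1
  · intro x hx; rw [mem_support_map_iff] at hx; obtain ⟨y, hy, rfl⟩ := hx; exact h3 y hy

open Classical in
lemma bind {Q : γ → δ → Prop} {f : α → PMF γ} {g : β → PMF δ} (h : Lift R μ ν)
    (hfg : ∀ a b, R a b → Lift Q (f a) (g b)) : Lift Q (μ.bind f) (ν.bind g) := by
  obtain ⟨ρ, h1, h2, h3⟩ := h
  have key : ∀ x : α × β, ∃ τ : PMF (γ × δ), x ∈ ρ.support →
      τ.map Prod.fst = f x.1 ∧ τ.map Prod.snd = g x.2 ∧ ∀ y ∈ τ.support, Q y.1 y.2 := by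
    intro x
    by_cases hx : x ∈ ρ.support
    · obtain ⟨τ, hτ⟩ := hfg _ _ (h3 x hx); exact ⟨τ, fun _ => hτ⟩
    · exact ⟨(f x.1).bind fun c => (g x.2).map fun d => (c, d), fun h => absurd h hx⟩
  choose τ hτ using key
  have congr : ∀ {ε : Type} (u v : α × β → PMF ε), (∀ x ∈ ρ.support, u x = v x) →
      ρ.bind u = ρ.bind v := by
    intro ε u v huv; ext e; simp only [PMF.bind_apply]; refine tsum_congr fun x => ?_
    by_cases hx : x ∈ ρ.support
    · rw [huv x hx]
    · rw [PMF.mem_support_iff, not_not] at hx; simp [hx]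
  refine ⟨ρ.bind τ, ?_, ?_, ?_⟩
  · rw [PMF.map_bind, congr _ (fun x => f x.1) fun x hx => (hτ x hx).1, ← h1, bind_map]; rfl
  · rw [PMF.map_bind, congr _ (fun x => g x.2) fun x hx => (hτ x hx).2.1, ← h2, bind_map]; rfl
  · intro y hy; rw [mem_support_bind_iff] at hy; obtain ⟨x, hx, hy⟩ := hy; exact (hτ x hx).2.2 y hy

lemma map {Q : γ → δ → Prop} {f : α → γ} {g : β → δ} (h : Lift (fun a b => Q (f a) (g b)) μ ν) :
    Lift Q (μ.map f) (ν.map g) := by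
  rw [← PMF.bind_pure_comp, ← PMF.bind_pure_comp]; exact h.bind fun a b hab => Lift.pure hab

lemma refl {R : α → α → Prop} (h : ∀ a ∈ μ.support, R a a) : Lift R μ μ := by
  refine ⟨μ.map fun a => (a, a), ?_, ?_, ?_⟩
  · rw [map_comp]; exact PMF.map_id μ
  · rw [map_comp]; exact PMF.map_id μ
  · intro x hx; rw [mem_support_map_iff] at hx; obtain ⟨a, ha, rfl⟩ := hx; exact h a ha

/-- Both sides are images of the same distribution. -/
lemma map_same {Q : γ → δ → Prop} {f : α → γ} {g : α → δ} (h : ∀ a ∈ μ.support, Q (f a) (g a)) :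
    Lift Q (μ.map f) (μ.map g) :=
  Lift.map (Lift.refl (R := fun a b => Q (f a) (g b)) h)

lemma bind_same {Q : γ → δ → Prop} {f : α → PMF γ} {g : α → PMF δ}
    (h : ∀ a ∈ μ.support, Lift Q (f a) (g a)) : Lift Q (μ.bind f) (μ.bind g) :=
  (Lift.refl (R := fun a b => a = b ∧ a ∈ μ.support) fun a ha => ⟨rfl, ha⟩).bind
    fun a b ⟨hab, ha⟩ => hab ▸ h a ha

lemma bind_left {Q : γ → β → Prop} {f : α → PMF γ} (h : ∀ a ∈ μ.support, Lift Q (f a) ν) : Lift Q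
    (μ.bind f) ν := by
  have := bind_same (μ := μ) (f := f) (g := fun _ => ν) h
  rwa [PMF.bind_const] at this

lemma bind_right {Q : α → δ → Prop} {g : β → PMF δ} (h : ∀ b ∈ ν.support, Lift Q μ (g b)) : Lift Q μ
    (ν.bind g) := by
  have := bind_same (μ := ν) (f := fun _ => μ) (g := g) h
  rwa [PMF.bind_const] at this

lemma of_map_right {Q : α → γ → Prop} {f : β → γ} (h : Lift (fun a b => Q a (f b)) μ ν) : Lift Q μ
    (ν.map f) := by
  have := Lift.map (Q := Q) (f := id) (g := f) h
  rwa [PMF.map_id] at this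

lemma map_eq {f : α → γ} {g : β → γ} (h : Lift R μ ν) (hfg : ∀ a b, R a b → f a = g b) : μ.map f =
    ν.map g := by
  obtain ⟨ρ, h1, h2, h3⟩ := (h.mono (Q := fun a b => f a = g b) hfg)
  rw [← h1, ← h2, map_comp, map_comp, ← PMF.bind_pure_comp, ← PMF.bind_pure_comp]; ext e
  simp only [PMF.bind_apply]; refine tsum_congr fun x => ?_
  by_cases hx : x ∈ ρ.support
  · simp [h3 x hx]
  · rw [PMF.mem_support_iff, not_not] at hx; simp [hx]

lemma exists_right (h : Lift R μ ν) {a : α} (ha : a ∈ μ.support) : ∃ b ∈ ν.support, R a b := by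
  obtain ⟨ρ, h1, h2, h3⟩ := h.mem; rw [← h1, mem_support_map_iff] at ha; obtain ⟨x, hx, rfl⟩ := ha
  exact ⟨x.2, (h3 x hx).2.2, (h3 x hx).1⟩

lemma exists_left (h : Lift R μ ν) {b : β} (hb : b ∈ ν.support) : ∃ a ∈ μ.support, R a b :=
  h.symm.exists_right hb

end Lift

/-! ### Runs of programs -/

/-- The registers that an instruction mentions. -/
def Instr.regs : Instr → List ℕ
  | nil r | cons _ r | tail r | coin r | qnew r | had r | tgate r => [r]
  | copy r a | fst r a | snd r a | cnot r a | meas r a | qlen r a => [r, a]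
  | append r a b | take r a b | drop r a b | pair r a b | eq r a b | qmove r a b => [r, a, b]
  | call _ r a t b => [r, a, t, b]

/-- All registers of the instruction are below `M`. -/
def Instr.Below (M : ℕ) (i : Instr) : Prop := ∀ r ∈ i.regs, r < M

/-- All registers of the program are below `M`. -/
def Prog.Below (M : ℕ) : Prog → Prop
  | instr i => i.Below M
  | seq p p' => p.Below M ∧ p'.Below M
  | ifTrue r p p' | ifNil r p p' => r < M ∧ p.Below M ∧ p'.Below M
  | loop r p => r < M ∧ p.Below M

/-- All instructions of the program have the property `I`. -/
def Prog.All (I : Instr → Prop) : Prog → Prop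
  | instr i => I i
  | seq p p' | ifTrue _ p p' | ifNil _ p p' => p.All I ∧ p'.All I
  | loop _ p => p.All I

lemma Prog.NoCall.all : ∀ {P : Prog}, P.NoCall → P.All Instr.NoCall
  | instr _, h => h
  | seq _ _, h | ifTrue _ _ _, h | ifNil _ _ _, h => ⟨h.1.all, h.2.all⟩
  | loop _ p, h => Prog.NoCall.all (P := p) h

lemma Prog.Below.mono {M M' : ℕ} (h : M ≤ M') : ∀ {P : Prog}, P.Below M → P.Below M'
  | instr _, hP => fun r hr => (hP r hr).trans_le h
  | seq _ _, hP => ⟨hP.1.mono h, hP.2.mono h⟩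
  | ifTrue _ _ _, hP => ⟨hP.1.trans_le h, hP.2.1.mono h, hP.2.2.mono h⟩
  | ifNil _ _ _, hP => ⟨hP.1.trans_le h, hP.2.1.mono h, hP.2.2.mono h⟩
  | loop _ _, hP => ⟨hP.1.trans_le h, hP.2.mono h⟩

lemma Prog.exists_below : ∀ P : Prog, ∃ M, P.Below M
  | instr i => ⟨i.regs.sum + 1, fun _ hr => Nat.lt_succ_of_le (List.le_sum_of_mem hr)⟩
  | seq p p' => by
    obtain ⟨M, h⟩ := p.exists_below; obtain ⟨M', h'⟩ := p'.exists_below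
    exact ⟨M + M', h.mono (by omega), h'.mono (by omega)⟩
  | ifTrue r p p' => by
    obtain ⟨M, h⟩ := p.exists_below; obtain ⟨M', h'⟩ := p'.exists_below
    exact ⟨M + M' + r + 1, by omega, h.mono (by omega), h'.mono (by omega)⟩
  | ifNil r p p' => by
    obtain ⟨M, h⟩ := p.exists_below; obtain ⟨M', h'⟩ := p'.exists_below
    exact ⟨M + M' + r + 1, by omega, h.mono (by omega), h'.mono (by omega)⟩
  | loop r p => by obtain ⟨M, h⟩ := p.exists_below; exact ⟨M + r + 1, by omega, h.mono (by omega)⟩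

lemma iterP_inv {α : Type} {f : α → PMF α} {J : α → Prop}
    (h : ∀ a, J a → ∀ b ∈ (f a).support, J b) :
    ∀ k a, J a → ∀ b ∈ (iterP f k a).support, J b
  | 0, a, ha, b, hb => by rw [iterP, support_pure, mem_singleton_iff] at hb; exact hb ▸ ha
  | k + 1, a, ha, b, hb => by
    rw [iterP, mem_support_bind_iff] at hb; obtain ⟨c, hc, hb⟩ := hb
    exact iterP_inv h k c (h a ha c hc) b hb

/-- Invariants of runs. -/
lemma Prog.run_inv {S : Type} {O : Oracle S} {J : State S → Prop} (ht : ∀ s k, J s → J (s.tick k))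
    (hi : ∀ i s, J s → ∀ s' ∈ (Instr.effect O (s.tick (i.cost s)) i).support, J s') :
    ∀ (P : Prog) (s : State S), J s → ∀ s' ∈ (P.run O s).support, J s'
  | instr i, s, hs, s', h => hi i s hs s' h
  | seq p p', s, hs, s', h => by
    rw [Prog.run, mem_support_bind_iff] at h; obtain ⟨u, hu, h⟩ := h
    exact p'.run_inv ht hi u (p.run_inv ht hi s hs u hu) s' h
  | ifTrue r p p', s, hs, s', h | ifNil r p p', s, hs, s', h => by
    rw [Prog.run] at h; split_ifs at h
    · exact p.run_inv ht hi _ (ht _ _ hs) s' h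
    · exact p'.run_inv ht hi _ (ht _ _ hs) s' h
  | loop r p, s, hs, s', h =>
    iterP_inv (fun a ha b hb => p.run_inv ht hi _ (ht _ _ ha) b hb) _ _ (ht _ _ hs) s' h

section Effect

variable {S : Type} {O : Oracle S}

@[simp] lemma State.tick_c (s : State S) (k : ℕ) : (s.tick k).c = s.c := rfl
@[simp] lemma State.tick_q (s : State S) (k : ℕ) : (s.tick k).q = s.q := rfl
@[simp] lemma State.tick_time (s : State S) (k : ℕ) : (s.tick k).time = s.time + k := rfl
@[simp] lemma State.setC_c (s : State S) (r : ℕ) (v : Str) :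
    (s.setC r v).c = update s.c r v := rfl
@[simp] lemma State.setQ_c (s : State S) (r : ℕ) (v : List ℕ) : (s.setQ r v).c = s.c := rfl
@[simp] lemma State.setQ_q (s : State S) (r : ℕ) (v : List ℕ) :
    (s.setQ r v).q = update s.q r v := rfl
@[simp] lemma State.setC_time (s : State S) (r : ℕ) (v : Str) : (s.setC r v).time = s.time := rfl
@[simp] lemma State.setC_q (s : State S) (r : ℕ) (v : Str) : (s.setC r v).q = s.q := rfl
@[simp] lemma State.setQ_time (s : State S) (r : ℕ) (v : List ℕ) : (s.setQ r v).time = s.time := rfl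
@[simp] lemma State.setQ_mem (s : State S) (r : ℕ) (v : List ℕ) : (s.setQ r v).mem = s.mem := rfl
@[simp] lemma State.setQ_env (s : State S) (r : ℕ) (v : List ℕ) : (s.setQ r v).env = s.env := rfl

lemma Instr.effect_time {i : Instr} {s s' : State S} (h : s' ∈ (i.effect O s).support) : s'.time =
    s.time := by
  cases i <;> simp only [Instr.effect, support_pure, mem_singleton_iff, mem_support_map_iff] at h
  case coin => obtain ⟨_, _, rfl⟩ := h; rfl
  case call => obtain ⟨_, _, rfl⟩ := h; rfl
  case had a => split at h <;> (simp only [support_pure, mem_singleton_iff] at h; subst h; rfl)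
  case tgate a => split at h <;> (simp only [support_pure, mem_singleton_iff] at h; subst h; rfl)
  case cnot a b => split at h <;> (simp only [support_pure, mem_singleton_iff] at h; subst h; rfl)
  case meas a r =>
    split at h
    · simp only [support_pure, mem_singleton_iff] at h; subst h; rfl
    · simp only [mem_support_map_iff] at h; obtain ⟨_, _, rfl⟩ := h; rfl
  all_goals (subst h; rfl)

lemma Prog.run_time_le (P : Prog) {s s' : State S} (h : s' ∈ (P.run O s).support) : s.time ≤ s'.time
    :=
  P.run_inv (J := fun u => s.time ≤ u.time) (fun _ _ h => h.trans (Nat.le_add_right _ _))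
    (fun i u hu u' hu' => by
      rw [Instr.effect_time hu']; exact hu.trans (Nat.le_add_right _ _)) s le_rfl s' h

lemma length_pairS (a b : Str) : (pairS a b).length = 2 * a.length + 1 + b.length := by
  induction a with
  | nil => simp [pairS]; omega
  | cons c a ih => simp [pairS] at ih ⊢; omega

lemma length_fstS_le : ∀ s : Str, (fstS s).length ≤ s.length
  | true :: c :: s => by have := length_fstS_le s; simp [fstS]; omega
  | [] => by simp [fstS]
  | [true] => by simp [fstS]
  | false :: s => by simp [fstS]

lemma length_sndS_le : ∀ s : Str, (sndS s).length ≤ s.length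
  | true :: c :: s => by have := length_sndS_le s; simp [sndS]; omega
  | [] => by simp [sndS]
  | [true] => by simp [sndS]
  | false :: s => by simp [sndS]

/-- All registers have at most `B` items more than twice the running time. -/
def State.Small (B : ℕ) (s : State S) : Prop :=
  ∀ r, (s.c r).length ≤ B + 2 * s.time ∧ (s.q r).length ≤ B + 2 * s.time

lemma length_update_le {α : Type} {f : ℕ → List α} {r : ℕ} {v : List α} {B : ℕ}
    (hf : ∀ r, (f r).length ≤ B) (hv : v.length ≤ B) (x : ℕ) : (update f r v x).length ≤ B
    := by
  by_cases h : x = r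
  · subst h; simpa using hv
  · simpa [h] using hf x

lemma Prog.run_small (P : Prog) {B : ℕ} {s s' : State S} (hs : s.Small B)
    (h : s' ∈ (P.run O s).support) : s'.Small B := by
  refine P.run_inv (J := State.Small B) ?_ ?_ s hs s' h
  · intro s k hs r; have := hs r; simp only [State.tick_c, State.tick_q, State.tick_time]; omega
  · intro i u hu u' hu'
    have hc : ∀ r, (u.c r).length ≤ B + 2 * u'.time := fun r => by
      have := Instr.effect_time hu'; have := hu r; simp at *; omega
    have hq : ∀ r, (u.q r).length ≤ B + 2 * u'.time := fun r => by
      have := Instr.effect_time hu'; have := hu r; simp at *; omega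
    have ht := Instr.effect_time hu'; simp only [State.tick_time] at ht
    generalize hN : B + 2 * u'.time = N at hc hq
    suffices h : ∀ r, (u'.c r).length ≤ N ∧ (u'.q r).length ≤ N by intro r; rw [hN]; exact h r
    have key : ∀ (v : State S), u' = v → (∀ r, (v.c r).length ≤ N) → (∀ r, (v.q r).length ≤ N) →
      ∀ r, (u'.c r).length ≤ N ∧ (u'.q r).length ≤ N := by
      rintro v rfl h1 h2 r; exact ⟨h1 r, h2 r⟩
    have len : ∀ (r k : ℕ), u.time + k = u'.time → (u.c r).length + k ≤ N := fun r k hk => by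
      have := (hu r).1; omega
    have lenq : ∀ (r k : ℕ), u.time + k = u'.time → (u.q r).length + k ≤ N := fun r k hk => by
      have := (hu r).2; omega
    cases i <;> simp only [Instr.effect, support_pure, mem_singleton_iff,
      mem_support_map_iff, Instr.cost] at hu' ht
    case had a =>
      split at hu' <;> (simp only [support_pure, mem_singleton_iff] at hu')
      all_goals exact key _ hu' hc hq
    case tgate a =>
      split at hu' <;> (simp only [support_pure, mem_singleton_iff] at hu')
      all_goals exact key _ hu' hc hq
    case cnot a b =>
      split at hu' <;> (simp only [support_pure, mem_singleton_iff] at hu')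
      all_goals exact key _ hu' hc hq
    case nil r => exact key _ hu' (length_update_le hc (by simp)) hq
    case cons b r =>
      exact key _ hu' (length_update_le hc (by have := len r _ ht.symm; simpa using this)) hq
    case tail r => exact key _ hu' (length_update_le hc (by have := hc r; simp; omega)) hq
    case copy r a => exact key _ hu' (length_update_le hc (hc a)) hq
    case append r a b => exact key _ hu' (length_update_le hc (by simp; omega)) hq
    case take r a b => exact key _ hu' (length_update_le hc (by have := hc a; simp; omega)) hq
    case drop r a b => exact key _ hu' (length_update_le hc (by have := hc a; simp; omega)) hq
    case pair r a b => exact key _ hu' (length_update_le hc (by simp [length_pairS]; omega)) hq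
    case fst r a => exact key _ hu' (length_update_le hc ((length_fstS_le _).trans (hc a))) hq
    case snd r a => exact key _ hu' (length_update_le hc ((length_sndS_le _).trans (hc a))) hq
    case eq r a b => exact key _ hu' (length_update_le hc (by simp; omega)) hq
    case coin r =>
      obtain ⟨b, _, rfl⟩ := hu'
      exact key _ rfl (length_update_le hc (by have := len r _ ht.symm; simpa using this)) hq
    case qnew a =>
      exact key _ hu' hc (length_update_le hq (by have := lenq a _ ht.symm; simpa using this))
    case meas a r =>
      split at hu'
      · simp only [support_pure, mem_singleton_iff] at hu'; exact key _ hu' hc hq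
      · rename_i i l hl
        simp only [mem_support_map_iff] at hu'; obtain ⟨b, _, rfl⟩ := hu'
        refine key _ rfl (length_update_le hc (by have := len r _ ht.symm; simpa using this))
          (length_update_le hq ?_)
        have := hq a; simp only [State.tick_q] at hl; rw [hl] at this; simp at this; omega
    case qmove a b r =>
      refine key _ hu' hc (length_update_le (length_update_le hq ?_) ?_)
      · have := hq a; simp; omega
      · have h1 : (update u.q a ((u.q a).drop (u.c r).length) b).length + (u.c r).length
            ≤ N := by
          by_cases hab : b = a
          · subst hab; have := (hu b).2; simp; omega
          · have := (hu b).2; simp [hab]; omega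
        simp only [State.setQ_q, State.tick_q, State.tick_c, length_append, length_take]; omega
    case qlen r a =>
      refine key _ hu' (length_update_le hc ?_) hq; have := hq a; simpa [unary] using this
    case call k r a t b =>
      obtain ⟨o, _, rfl⟩ := hu'; refine key _ rfl (length_update_le hc ?_) (length_update_le hq ?_)
      · have := hc t; simp; omega
      · have := (hu b).2; simp; omega

end Effect

/-! ### Simulation of runs -/

/-- Replaces every instruction by a program and renames the registers of tests and loops. -/
def Prog.subst (ρ : ℕ → ℕ) (tr : Instr → Prog) : Prog → Prog
  | instr i => tr i
  | seq p p' => seq (p.subst ρ tr) (p'.subst ρ tr)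
  | ifTrue r p p' => ifTrue (ρ r) (p.subst ρ tr) (p'.subst ρ tr)
  | ifNil r p p' => ifNil (ρ r) (p.subst ρ tr) (p'.subst ρ tr)
  | loop r p => loop (ρ r) (p.subst ρ tr)

section Simulation

variable {SA SB : Type} {OA : Oracle SA} {OB : Oracle SB}

/-- A relation between states that is preserved by single instructions is preserved by programs.
Only runs within the time `T` are considered. -/
lemma Prog.run_lift {ρ : ℕ → ℕ} {tr : Instr → Prog} {M T : ℕ}
    {I : Instr → Prop} {R : State SA → State SB → Prop}
    (hc : ∀ a b r, r < M → R a b → b.c (ρ r) = a.c r)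
    (ht : ∀ a b k, R a b → R (a.tick k) (b.tick k))
    (hi : ∀ i a b, I i → i.Below M → R a b → a.time + i.cost a ≤ T →
      Lift R (i.effect OA (a.tick (i.cost a))) ((tr i).run OB b)) :
    ∀ (P : Prog), P.All I → P.Below M → ∀ a b, R a b → (∀ a' ∈ (P.run OA a).support, a'.time ≤ T) →
      Lift R (P.run OA a) ((P.subst ρ tr).run OB b)
  | instr i, hI, hP, a, b, hab, hT => by
    refine hi i a b hI hP hab ?_; obtain ⟨a', ha'⟩ := ((instr i).run OA a).support_nonempty
    have := hT a' ha'; rw [Prog.run] at ha'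
    rwa [Instr.effect_time ha'] at this
  | seq p p', hI, hP, a, b, hab, hT => by
    rw [Prog.run] at hT
    have h1 : ∀ u ∈ (p.run OA a).support, ∀ v ∈ (p'.run OA u).support, v.time ≤ T :=
      fun u hu v hv => hT v ((mem_support_bind_iff _ _ _).2 ⟨u, hu, hv⟩)
    refine (p.run_lift hc ht hi hI.1 hP.1 a b hab ?_).mem.bind ?_
    · intro u hu; obtain ⟨v, hv⟩ := (p'.run OA u).support_nonempty
      exact (p'.run_time_le hv).trans (h1 u hu v hv)
    · rintro u w ⟨huw, hu, _⟩; exact p'.run_lift hc ht hi hI.2 hP.2 u w huw (h1 u hu)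
  | ifTrue r p p', hI, hP, a, b, hab, hT | ifNil r p p', hI, hP, a, b, hab, hT => by
    rw [Prog.run] at hT ⊢; rw [Prog.subst, Prog.run, hc a b r hP.1 hab]; split_ifs at hT ⊢
    · exact p.run_lift hc ht hi hI.1 hP.2.1 _ _ (ht _ _ _ hab) hT
    · exact p'.run_lift hc ht hi hI.2 hP.2.2 _ _ (ht _ _ _ hab) hT
  | loop r p, hI, hP, a, b, hab, hT => by
    rw [Prog.run] at hT ⊢; rw [Prog.subst, Prog.run, hc a b r hP.1 hab]
    have ih := p.run_lift hc ht hi hI hP.2; generalize (a.c r).length = k at hT ⊢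
    have hab' := ht _ _ 1 hab; generalize a.tick 1 = a at hT hab' ⊢
    generalize b.tick 1 = b at hab' ⊢; clear hab
    have mono : ∀ k (u : State SA), ∀ v ∈ (iterP (fun s' => p.run OA (s'.tick 1)) k u).support,
        u.time ≤ v.time := fun k u v hv =>
      iterP_inv (J := fun v => u.time ≤ v.time) (fun x hx y hy =>
        (hx.trans (Nat.le_add_right _ 1)).trans (p.run_time_le hy)) k u le_rfl v hv
    induction k generalizing a b with
    | zero => exact Lift.pure hab'
    | succ k ihk =>
      rw [iterP] at hT
      have h1 : ∀ u ∈ (p.run OA (a.tick 1)).support, ∀ v ∈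
          (iterP (fun s' => p.run OA (s'.tick 1)) k u).support, v.time ≤ T :=
        fun u hu v hv => hT v ((mem_support_bind_iff _ _ _).2 ⟨u, hu, hv⟩)
      refine (ih _ _ (ht _ _ 1 hab') ?_).mem.bind ?_
      · intro u hu; obtain ⟨v, hv⟩ := (iterP (fun s' => p.run OA (s'.tick 1)) k u).support_nonempty
        exact (mono k u v hv).trans (h1 u hu v hv)
      · rintro u w ⟨huw, hu, _⟩; exact ihk u (h1 u hu) w huw

end Simulation

/-! ### Deterministic classical programs -/

/-- The effect of a classical instruction on the classical registers. -/
def Instr.upd (c : ℕ → Str) : Instr → ℕ → Str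
  | nil r => update c r []
  | cons b r => update c r (b :: c r)
  | tail r => update c r (c r).tail
  | copy r a => update c r (c a)
  | append r a b => update c r (c a ++ c b)
  | take r a b => update c r ((c a).take (c b).length)
  | drop r a b => update c r ((c a).drop (c b).length)
  | pair r a b => update c r (pairS (c a) (c b))
  | fst r a => update c r (fstS (c a))
  | snd r a => update c r (sndS (c a))
  | eq r a b => update c r [decide (c a = c b)]
  | _ => c

/-- The state without quantum registers and time. -/
def classicalState (c : ℕ → Str) : State Unit := ⟨c, fun _ => [], QMem.init, (), 0⟩

/-- The cost of a classical instruction. -/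
def Instr.costC (c : ℕ → Str) (i : Instr) : ℕ := i.cost (classicalState c)

open Instr (upd cost costC)

/-- The final classical registers and the running time of a classical program. -/
def Prog.det : Prog → (ℕ → Str) → (ℕ → Str) × ℕ
  | instr i, c => (i.upd c, i.costC c)
  | seq p p', c => ((p'.det (p.det c).1).1, (p.det c).2 + (p'.det (p.det c).1).2)
  | ifTrue r p p', c =>
      if (c r).head? = some true then ((p.det c).1, 1 + (p.det c).2)
      else ((p'.det c).1, 1 + (p'.det c).2)
  | ifNil r p p', c =>
      if c r = [] then ((p.det c).1, 1 + (p.det c).2) else ((p'.det c).1, 1 + (p'.det c).2)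
  | loop r p, c =>
      (fun o : (ℕ → Str) × ℕ => ((p.det o.1).1, o.2 + 1 + (p.det o.1).2))^[(c r).length] (c, 1)

lemma Instr.upd_copy (c : ℕ → Str) (r a : ℕ) : upd c (copy r a) = update c r (c a) := rfl

lemma Instr.costC_copy (c : ℕ → Str) (r a : ℕ) : costC c (copy r a) = 1 + (c a).length := rfl

lemma Instr.effect_det {S : Type} {O : Oracle S} {i : Instr} (hi : i.Classical) (s : State S) :
    i.effect O (s.tick (i.cost s)) =
      PMF.pure { s with c := i.upd s.c, time := s.time + i.costC s.c } := by
  cases i <;> first | exact hi.elim | rfl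

lemma Prog.run_det {S : Type} {O : Oracle S} : ∀ {P : Prog}, P.Classical → ∀ s : State S,
      P.run O s = PMF.pure { s with c := (P.det s.c).1, time := s.time + (P.det s.c).2 }
  | instr _, hP, s => Instr.effect_det hP s
  | seq p p', hP, s => by
    rw [Prog.run, run_det hP.1, PMF.pure_bind, run_det hP.2]; simp only [Prog.det, add_assoc]
  | ifTrue r p p', hP, s | ifNil r p p', hP, s => by
    rw [Prog.run, run_det hP.1, run_det hP.2]; simp only [Prog.det, State.tick]
    split_ifs <;> simp only [add_assoc]
  | loop r p, hP, s => by
    have key : ∀ k (c : ℕ → Str) (t : ℕ),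
        iterP (fun s' => p.run O (s'.tick 1)) k { s with c := c, time := s.time + t } =
          PMF.pure { s with
            c := ((fun o : (ℕ → Str) × ℕ => ((p.det o.1).1, o.2 + 1 + (p.det o.1).2))^[k] (c, t)).1
            time := s.time + ((fun o : (ℕ → Str) × ℕ =>
              ((p.det o.1).1, o.2 + 1 + (p.det o.1).2))^[k] (c, t)).2 } := by
      intro k
      induction k with
      | zero => intro c t; rfl
      | succ k ih =>
        intro c t; rw [iterP, run_det (P := p) hP, PMF.pure_bind]
        simp only [State.tick, Function.iterate_succ, comp_apply, ← ih]; simp only [add_assoc]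
    exact key _ s.c 1

lemma Prog.det_small {P : Prog} (hP : P.Classical) {c : ℕ → Str} {B : ℕ}
    (hc : ∀ r, (c r).length ≤ B) (r : ℕ) : ((P.det c).1 r).length ≤ B + 2 * (P.det c).2 := by
  have h := P.run_small (O := noOracle) (B := B) (s := classicalState c) (s' := _)
    (fun r => ⟨by have := hc r; simp [classicalState, this], by simp [classicalState]⟩)
    (by rw [Prog.run_det hP, support_pure]; exact rfl)
  simpa [classicalState] using (h r).1

lemma Instr.upd_of_le {M : ℕ} {i : Instr} (hi : i.Below M) (c : ℕ → Str) {r : ℕ} (hr : M ≤ r) :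
    i.upd c r = c r := by
  have h : ∀ x ∈ i.regs, r ≠ x := fun x hx => ((hi x hx).trans_le hr).ne'
  cases i <;> simp_all [upd, Instr.regs]

lemma Prog.det_of_le {M : ℕ} : ∀ {P : Prog}, P.Below M → ∀ (c : ℕ → Str) {r : ℕ},
    M ≤ r → (P.det c).1 r = c r
  | instr _, hP, c, r, hr => Instr.upd_of_le hP c hr
  | seq p p', hP, c, r, hr => by rw [Prog.det, det_of_le hP.2 _ hr, det_of_le hP.1 _ hr]
  | ifTrue _ p p', hP, c, r, hr => by
    rw [Prog.det]; split_ifs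
    · exact det_of_le hP.2.1 _ hr
    · exact det_of_le hP.2.2 _ hr
  | ifNil _ p p', hP, c, r, hr => by
    rw [Prog.det]; split_ifs
    · exact det_of_le hP.2.1 _ hr
    · exact det_of_le hP.2.2 _ hr
  | loop a p, hP, c, r, hr => by
    rw [Prog.det]; generalize (c a).length = k
    induction k with
    | zero => rfl
    | succ k ih => rw [iterate_succ_apply']; exact (det_of_le hP.2 _ hr).trans ih

lemma Prog.det_congr {M : ℕ} : ∀ {P : Prog}, P.Below M → ∀ {c c' : ℕ → Str}, (∀ r < M, c r = c' r) →
      (∀ r < M, (P.det c).1 r = (P.det c').1 r) ∧ (P.det c).2 = (P.det c').2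
  | instr i, hP, c, c', h => by
    have hr : ∀ r ∈ i.regs, c r = c' r := fun r hr => h r (hP r hr)
    constructor
    · intro x hx; have := h x hx; cases i <;> simp_all [Prog.det, upd, Instr.regs, update_apply]
    · cases i <;> simp_all [Prog.det, costC, cost, classicalState, Instr.regs]
  | seq p p', hP, c, c', h => by
    have h1 := det_congr hP.1 h; have h2 := det_congr hP.2 h1.1
    exact ⟨h2.1, by rw [Prog.det, Prog.det, h1.2, h2.2]⟩
  | ifTrue a p p', hP, c, c', h | ifNil a p p', hP, c, c', h => by
    have h1 := det_congr hP.2.1 h; have h2 := det_congr hP.2.2 h; rw [Prog.det, Prog.det, h a hP.1]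
    split_ifs
    · exact ⟨h1.1, by rw [h1.2]⟩
    · exact ⟨h2.1, by rw [h2.2]⟩
  | loop a p, hP, c, c', h => by
    rw [Prog.det, Prog.det, h a hP.1]; generalize (c' a).length = k
    induction k with
    | zero => exact ⟨h, rfl⟩
    | succ k ih =>
      rw [iterate_succ_apply', iterate_succ_apply']; have h1 := det_congr hP.2 ih.1
      exact ⟨h1.1, by simp only [ih.2, h1.2]⟩

/-! ### Functions on bit strings that are computable in polynomial time -/

lemma eval_mono (p : ℕ[X]) {a b : ℕ} (h : a ≤ b) : p.eval a ≤ p.eval b := by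
  induction p using Polynomial.induction_on' with
  | add p q hp hq => simpa using Nat.add_le_add hp hq
  | monomial n k => simpa using Nat.mul_le_mul_left k (Nat.pow_le_pow_left h n)

/-- The program `P` replaces the content of register `0` by its image under `f`, whatever the
other registers contain, and uses only the registers below `M`. -/
structure Computes (P : Prog) (M : ℕ) (p : ℕ[X]) (f : Str → Str) : Prop where
  classical : P.Classical
  out : ∀ c, (P.det c).1 0 = f (c 0)
  frame : ∀ c r, M ≤ r → (P.det c).1 r = c r
  time : ∀ c, (P.det c).2 ≤ p.eval (c 0).length
  size : ∀ x, (f x).length ≤ p.eval x.length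

/-- The final registers and the running time of `P` on `c` satisfy `Q`. -/
def Prog.Ends (P : Prog) (c : ℕ → Str) (Q : (ℕ → Str) → ℕ → Prop) : Prop :=
  Q (P.det c).1 (P.det c).2

lemma Prog.Ends.seq {P P' : Prog} {c : ℕ → Str} {Q : (ℕ → Str) → ℕ → Prop}
    (h : P.Ends c fun c1 t1 => P'.Ends c1 fun c2 t2 => Q c2 (t1 + t2)) :
    (Prog.seq P P').Ends c Q := h

lemma Prog.Ends.seq' {P P' : Prog} {c : ℕ → Str} {Q : (ℕ → Str) → ℕ → Prop}
    (h : P'.Ends (P.det c).1 fun c2 t2 => Q c2 ((P.det c).2 + t2)) :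
    (Prog.seq P P').Ends c Q := h

lemma Prog.Ends.instr {i : Instr} {c : ℕ → Str} {Q : (ℕ → Str) → ℕ → Prop}
    (h : Q (i.upd c) (i.costC c)) : (Prog.instr i).Ends c Q := h

lemma Computes.ends {P : Prog} {M : ℕ} {p : ℕ[X]} {f : Str → Str} (h : Computes P M p f)
    {c : ℕ → Str} {Q : (ℕ → Str) → ℕ → Prop} (hQ : ∀ c' t, c' 0 = f (c 0) → (∀ r, M ≤ r → c' r = c
    r) → t ≤ p.eval (c 0).length → (f (c 0)).length ≤ p.eval (c 0).length → Q c' t) : P.Ends c Q :=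
  hQ _ _ (h.out c) (h.frame c) (h.time c) (h.size _)

lemma Computes.of_ends {P : Prog} {M : ℕ} {p : ℕ[X]} {f : Str → Str} (hP : P.Classical) (h : ∀ c,
    P.Ends c fun c' t => c' 0 = f (c 0) ∧ (∀ r, M ≤ r → c' r = c r) ∧ t ≤ p.eval (c 0).length)
    (hs : ∀ x, (f x).length ≤ p.eval x.length) : Computes P M p f :=
  ⟨hP, fun c => (h c).1, fun c => (h c).2.1, fun c => (h c).2.2, hs⟩

lemma Computes.mono {P : Prog} {M M' : ℕ} {p p' : ℕ[X]} {f : Str → Str} (h : Computes P M p f)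
    (hM : M ≤ M') (hp : ∀ n, p.eval n ≤ p'.eval n) : Computes P M' p' f :=
  ⟨h.classical, h.out, fun c r hr => h.frame c r (hM.trans hr), fun c => (h.time c).trans (hp _),
    fun x => (h.size x).trans (hp _)⟩

/-- The function `f` is computable in polynomial time. -/
def FP (f : Str → Str) : Prop := ∃ (P : Prog) (M : ℕ) (p : ℕ[X]), Computes P M p f

namespace FP

lemma common {f g : Str → Str} (hf : FP f) (hg : FP g) : ∃ (P Q : Prog) (M : ℕ) (p : ℕ[X]), 0 < M ∧
    Computes P M p f ∧ Computes Q M p g := by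
  obtain ⟨P, M, p, hP⟩ := hf; obtain ⟨Q, M', p', hQ⟩ := hg
  exact ⟨P, Q, M + M' + 1, p + p', by omega, hP.mono (by omega) (by simp),
    hQ.mono (by omega) (by simp)⟩

lemma id : FP fun x => x :=
  ⟨.instr (.copy 0 0), 1, X + 1, trivial, fun c => by simp [Prog.det, upd],
    fun c r hr => by simp [Prog.det, upd],
    fun c => by simp [Prog.det, costC, cost, classicalState]; omega,
    fun x => by simp⟩

lemma op1 {f : Str → Str} (hf : FP f) (i : Instr) (op : Str → Str) (hi : i.Classical)
    (hu : ∀ c, i.upd c = update c 0 (op (c 0))) (hcost : ∀ c, i.costC c ≤ 1 + (c 0).length)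
    (hop : ∀ u, (op u).length ≤ u.length + 1) : FP fun x => op (f x) := by
  obtain ⟨P, M, p, hP⟩ := hf
  refine ⟨.seq P (.instr i), M + 1, 2 * p + 1, ⟨hP.classical, hi⟩, fun c => ?_, fun c r hr => ?_,
    fun c => ?_, fun x => ?_⟩
  · simp [Prog.det, hu, hP.out]
  · have h0 : r ≠ 0 := by omega
    simp [Prog.det, hu, h0, hP.frame c r (by omega)]
  · have h1 := hcost (P.det c).1; have h2 := hP.time c; have h3 := hP.size (c 0); rw [hP.out] at h1
    simp [Prog.det]; omega
  · have := hP.size x; have := hop (f x); simp; omega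

lemma tail {f : Str → Str} (hf : FP f) : FP fun x => (f x).tail :=
  hf.op1 (.tail 0) _ trivial (fun _ => rfl) (fun c => by simp [costC, cost])
    fun u => by simp; omega

lemma cons (b : Bool) {f : Str → Str} (hf : FP f) : FP fun x => b :: f x :=
  hf.op1 (.cons b 0) (b :: ·) trivial (fun _ => rfl) (fun c => by simp [costC, cost])
    fun u => by simp

lemma fst {f : Str → Str} (hf : FP f) : FP fun x => fstS (f x) :=
  hf.op1 (.fst 0 0) _ trivial (fun _ => rfl) (fun c => by simp [costC, cost, classicalState])
    fun u => by have := length_fstS_le u; omega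

lemma snd {f : Str → Str} (hf : FP f) : FP fun x => sndS (f x) :=
  hf.op1 (.snd 0 0) _ trivial (fun _ => rfl) (fun c => by simp [costC, cost, classicalState])
    fun u => by have := length_sndS_le u; omega

lemma const (w : Str) : FP fun _ => w := by
  induction w with
  | nil =>
    exact id.op1 (.nil 0) (fun _ => []) trivial (fun _ => rfl)
      (fun c => by simp [costC, cost]) (fun u => by simp)
  | cons b w ih => exact ih.cons b

lemma comp {f g : Str → Str} (hf : FP f) (hg : FP g) : FP fun x => f (g x) := by
  obtain ⟨P, Q, M, p, -, hP, hQ⟩ := common hf hg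
  refine ⟨.seq Q P, M, p + p.comp p, ⟨hQ.classical, hP.classical⟩, fun c => ?_, fun c r hr => ?_,
    fun c => ?_, fun x => ?_⟩
  · simp [Prog.det, hP.out, hQ.out]
  · simp [Prog.det, hP.frame _ r hr, hQ.frame _ r hr]
  · have h1 := hQ.time c; have h2 := hP.time (Q.det c).1; have h3 := eval_mono p (hQ.size (c 0))
    rw [hQ.out] at h2; simp [Prog.det]; omega
  · have h3 := eval_mono p (hQ.size x); have := hP.size (g x); simp; omega

lemma op2 {f g : Str → Str} (hf : FP f) (hg : FP g) (i : ℕ → ℕ → ℕ → Instr) (op : Str → Str → Str)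
    (hi : ∀ r a b, (i r a b).Classical) (hu : ∀ r a b c, (i r a b).upd c = update c r (op
    (c a) (c b))) (hcost : ∀ r a b c, (i r a b).costC c = 1 + (c a).length + (c b).length)
    (hop : ∀ u v, (op u v).length ≤ 2 * u.length + 2 * v.length + 1) : FP fun x => op (f x) (g x)
    := by
  obtain ⟨P, Q, M, p, hM, hP, hQ⟩ := common hf hg
  refine ⟨.seq (.instr (.copy M 0)) (.seq P (.seq (.instr (.copy (M + 1) 0))
    (.seq (.instr (.copy 0 M)) (.seq Q (.instr (i 0 (M + 1) 0)))))), M + 2, 2 * X + 6 * p + 6,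
    .of_ends ⟨trivial, hP.classical, trivial, trivial, hQ.classical, hi _ _ _⟩ (fun c => ?_)
    (fun x => ?_)⟩
  · refine .seq (.instr (.seq (hP.ends fun c1 t1 o1 f1 l1 s1 => .seq (.instr (.seq (.instr
      (.seq (hQ.ends fun c2 t2 o2 f2 l2 s2 => .instr ?_))))))))
    have e1 := f1 M le_rfl; have e2 := f2 (M + 1) (by omega)
    simp [Instr.upd_copy, hM.ne] at o1 l1 s1 o2 l2 s2 e1 e2; rw [o1] at e2
    refine ⟨by simp [hu, e2, o2, e1], fun r hr => ?_, ?_⟩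
    · have h0 : r ≠ 0 := by omega
      have h1 : r ≠ M := by omega
      have h2 : r ≠ M + 1 := by omega
      have h3 : M ≤ r := by omega
      simp [hu, Instr.upd_copy, h0, h1, h2, f2 r h3, f1 r h3]
    · simp only [hcost, Instr.costC_copy, Instr.upd_copy, update_apply]
      simp [o1, o2, e1, e2]; rw [e1] at l2 s2; omega
  · have := hP.size x; have := hQ.size x; have := hop (f x) (g x); simp; omega

lemma append {f g : Str → Str} (hf : FP f) (hg : FP g) : FP fun x => f x ++ g x :=
  hf.op2 hg .append (· ++ ·) (fun _ _ _ => trivial) (fun _ _ _ _ => rfl) (fun _ _ _ _ => rfl)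
    fun u v => by simp; omega

lemma take {f g : Str → Str} (hf : FP f) (hg : FP g) : FP fun x => (f x).take (g x).length :=
  hf.op2 hg .take (fun u v => u.take v.length) (fun _ _ _ => trivial) (fun _ _ _ _ => rfl)
    (fun _ _ _ _ => rfl) fun u v => by simp; omega

lemma drop {f g : Str → Str} (hf : FP f) (hg : FP g) : FP fun x => (f x).drop (g x).length :=
  hf.op2 hg .drop (fun u v => u.drop v.length) (fun _ _ _ => trivial) (fun _ _ _ _ => rfl)
    (fun _ _ _ _ => rfl) fun u v => by simp; omega

lemma pair {f g : Str → Str} (hf : FP f) (hg : FP g) : FP fun x => pairS (f x) (g x) :=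
  hf.op2 hg .pair pairS (fun _ _ _ => trivial) (fun _ _ _ _ => rfl)
    (fun _ _ _ _ => rfl) fun u v => by simp [length_pairS]; omega

lemma eq {f g : Str → Str} (hf : FP f) (hg : FP g) : FP fun x => [decide (f x = g x)] :=
  hf.op2 hg .eq (fun u v => [decide (u = v)]) (fun _ _ _ => trivial) (fun _ _ _ _ => rfl)
    (fun _ _ _ _ => rfl) fun u v => by simp

/-- A function can be computed into a register `M > N`, with the argument kept. -/
lemma prelude {h : Str → Str} (hh : FP h) (N : ℕ) : ∃ (R : Prog) (M : ℕ) (p : ℕ[X]), N < M ∧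
    R.Classical ∧ ∀ c, R.Ends c fun c' t => c' M = h (c 0) ∧ c' 0 = c 0 ∧
      (∀ r, M < r → c' r = c r) ∧ t ≤ p.eval (c 0).length ∧
      (h (c 0)).length ≤ p.eval (c 0).length := by
  obtain ⟨H, M, p, hH⟩ := hh; replace hH := hH.mono (M' := M + N + 1) (by omega) fun _ => le_rfl
  have hM : 0 < M + N + 1 := by omega
  have hN : N < M + N + 1 + 1 := by omega
  generalize M + N + 1 = M at *
  refine ⟨.seq (.instr (.copy M 0)) (.seq H (.seq (.instr (.copy (M + 1) 0)) (.instr (.copy 0 M)))),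
    M + 1, 2 * X + 2 * p + 3, hN, ⟨trivial, hH.classical, trivial, trivial⟩, fun c => ?_⟩
  refine .seq (.instr (.seq (hH.ends fun c1 t1 o1 f1 l1 s1 => .seq (.instr (.instr ?_)))))
  have e1 := f1 M le_rfl; simp [upd, hM.ne] at o1 l1 s1 e1
  have e6 : (upd c1 (.copy (M + 1) 0)) M = c 0 := by simp [upd, e1]
  simp only [Instr.costC_copy, e6, o1, eval_add, eval_mul, eval_X, eval_ofNat]
  refine ⟨by simp [upd, o1], by simp [upd, e1], fun r hr => ?_, by omega,
    by omega⟩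
  simp [upd, show r ≠ 0 by omega, show r ≠ M by omega, show r ≠ M + 1 by omega, f1 r (by omega)]

lemma ite {h f g : Str → Str} (hh : FP h) (hf : FP f) (hg : FP g) : FP fun x => if (h x).head? =
    some true then f x else g x := by
  obtain ⟨P, Q, M, p, hM, hP, hQ⟩ := common hf hg; obtain ⟨R, N, q, hN, hR, h1⟩ := prelude hh M
  refine ⟨.seq R (.ifTrue N P Q), N + 1, q + p + 1,
    .of_ends ⟨hR, hP.classical, hQ.classical⟩ (fun c => .seq' ?_) (fun x => ?_)⟩
  · obtain ⟨e3, e4, e5, e6, -⟩ := h1 c; generalize (R.det c).1 = c2 at *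
    simp only [Prog.Ends, Prog.det, eval_add, eval_one, e3]; have h1 := hP.time c2
    have h2 := hQ.time c2; rw [e4] at h1 h2; split_ifs
    · exact ⟨by rw [hP.out, e4], fun r hr => by rw [hP.frame _ r (by omega), e5 r hr],
        by simp only; omega⟩
    · exact ⟨by rw [hQ.out, e4], fun r hr => by rw [hQ.frame _ r (by omega), e5 r hr],
        by simp only; omega⟩
  · have := hP.size x; have := hQ.size x; simp; split_ifs <;> omega

lemma iterate {h g : Str → Str} (hh : FP h) (hg : FP g) (B : ℕ[X])
    (hB : ∀ x, ∀ i ≤ (h x).length, (g^[i] x).length ≤ B.eval x.length) : FP fun x =>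
    g^[(h x).length] x := by
  obtain ⟨Q, M, p, hQ⟩ := hg; obtain ⟨R, N, q, hN, hR, h1⟩ := prelude hh M
  refine ⟨.seq R (.loop N Q), N + 1, B + (q + 1 + q * (1 + p.comp B)),
    .of_ends ⟨hR, hQ.classical⟩ (fun c => .seq' ?_) (fun x => ?_)⟩
  rotate_left
  · have := hB x _ le_rfl; simp; omega
  obtain ⟨e3, e4, e5, e6, s1⟩ := h1 c; generalize (R.det c).1 = c2 at *
  simp only [Prog.Ends, Prog.det, eval_add, eval_mul, eval_one, eval_comp, e3]
  obtain ⟨F, hF⟩ : ∃ F, F = fun o : (ℕ → Str) × ℕ => ((Q.det o.1).1, o.2 + 1 + (Q.det o.1).2) :=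
    ⟨_, rfl⟩
  have key : ∀ k ≤ (h (c 0)).length, (F^[k] (c2, 1)).1 0 = g^[k] (c 0) ∧
      (∀ r, M ≤ r → (F^[k] (c2, 1)).1 r = c2 r) ∧
      (F^[k] (c2, 1)).2 ≤ 1 + k * (1 + p.eval (B.eval (c 0).length)) := by
    intro k hk
    induction k with
    | zero => simp [e4]
    | succ k ih =>
      obtain ⟨h1, h2, h3⟩ := ih (by omega); rw [iterate_succ_apply']
      have h4 := hQ.time (F^[k] (c2, 1)).1; rw [h1] at h4
      have h5 := h4.trans (eval_mono p (hB (c 0) k (by omega)))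
      generalize F^[k] (c2, 1) = o at *; rw [hF]
      refine ⟨?_, fun r hr => (hQ.frame _ r hr).trans (h2 r hr), ?_⟩
      · rw [iterate_succ_apply', ← h1]; exact hQ.out _
      · rw [Nat.add_mul, Nat.one_mul]; dsimp only; omega
  rw [← hF]; obtain ⟨k1, k2, k3⟩ := key _ le_rfl
  refine ⟨k1, fun r hr => (k2 r (by omega)).trans (e5 r hr), ?_⟩
  have := Nat.mul_le_mul_right (1 + p.eval (B.eval (c 0).length)) s1; omega

lemma unaryLength {f : Str → Str} (hf : FP f) : FP fun x => unary (f x).length := by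
  suffices h : FP fun x => unary x.length from comp h hf
  refine ⟨.seq (.instr (.nil 1)) (.seq (.loop 0 (.instr (.cons true 1))) (.instr (.copy 0 1))), 2,
    3 * X + 3, .of_ends ⟨trivial, trivial, trivial⟩ (fun c => .seq (.instr (.seq' ?_)))
    fun x => by simp [unary]; omega⟩
  have key : ∀ k (c' : ℕ → Str) (t : ℕ), (fun o : (ℕ → Str) × ℕ => (((Prog.instr
      (.cons true 1)).det o.1).1, o.2 + 1 + ((Prog.instr (.cons true 1)).det o.1).2))^[k] (c', t) =
      (update c' 1 (unary k ++ c' 1), t + 2 * k) := by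
    intro k c' t
    induction k with
    | zero => simp [unary]
    | succ k ih =>
      rw [iterate_succ_apply', ih]
      simp [Prog.det, upd, costC, cost, unary, List.replicate_succ]; omega
  rw [Prog.det, key]
  refine .instr ⟨by simp [upd], fun r hr => ?_, ?_⟩
  · simp [upd, show r ≠ 0 by omega, show r ≠ 1 by omega]
  · simp [upd, costC, cost, classicalState, unary]; omega

/-- Several functions can be computed one after the other into the registers from `L + 1` on. -/
lemma vector {n : ℕ} {f : Fin n → Str → Str} (hf : ∀ k, FP (f k)) : ∃ (P : Prog) (L : ℕ) (p : ℕ[X]),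
    n < L ∧ P.Classical ∧ ∀ c, (∀ k : Fin n, (P.det c).1 (L + k) = f k (c 0)) ∧
    (∀ r, L + n < r → (P.det c).1 r = c r) ∧ (P.det c).2 ≤ p.eval (c 0).length ∧ ∀ k,
    (f k (c 0)).length ≤ p.eval (c 0).length := by
  choose P M p hP using hf
  set L := n + 1 + ∑ k, M k with hL
  have hML : ∀ k, M k ≤ L := fun k => by
    have := Finset.single_le_sum (f := M) (fun _ _ => Nat.zero_le _) (Finset.mem_univ k); omega
  have hpL : ∀ k x, (p k).eval x ≤ (∑ k, p k).eval x := fun k x => by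
    rw [Polynomial.eval_finsetSum]
    exact Finset.single_le_sum (f := fun k => (p k).eval x) (fun _ _ => Nat.zero_le _)
      (Finset.mem_univ k)
  set q := ∑ k, p k
  have hP' : ∀ k, Computes (P k) L q (f k) := fun k => (hP k).mono (hML k) (hpL k)
  have hL0 : 0 < L := by omega
  have key : ∀ m ≤ n, ∃ Q : Prog, Q.Classical ∧ ∀ c,
      Q.Ends c fun c' t => (∀ k : Fin n, k.1 < m → c' (L + k) = f k (c 0)) ∧
        c' (L + n) = c 0 ∧ (∀ r, L + n < r → c' r = c r) ∧
        t ≤ (X + 1 + (m : ℕ[X]) * (X + 2 + 2 * q)).eval (c 0).length := by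
    intro m hm
    induction m with
    | zero =>
      refine ⟨.instr (.copy (L + n) 0), trivial, fun c => ⟨by simp, ?_, ?_, ?_⟩⟩
      · simp [Prog.det, upd]
      · intro r hr; simp [Prog.det, upd, hr.ne']
      · simp [Prog.det, costC, cost, classicalState]; omega
    | succ m ih =>
      obtain ⟨Q, hQ, h⟩ := ih (by omega)
      let km : Fin n := ⟨m, hm⟩
      refine ⟨.seq Q (.seq (.instr (.copy 0 (L + n))) (.seq (P km) (.instr (.copy (L + m) 0)))),
        ⟨hQ, trivial, (hP' km).classical, trivial⟩, fun c => ?_⟩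
      obtain ⟨h1, h2, h3, h4⟩ := h c; refine .seq' ?_
      refine .seq (.instr (.seq ((hP' km).ends fun c1 t1 o1 f1 l1 s1 => .instr ?_)))
      simp only [upd, Function.update_self, h2] at o1 f1 l1 s1
      refine ⟨fun k hk => ?_, ?_, fun r hr => ?_, ?_⟩
      · by_cases hkm : k = km
        · subst hkm; simp [upd, o1, km]
        · have hk' : k.1 ≠ m := fun h => hkm (Fin.ext h)
          have : L + k.1 ≠ L + m := by omega
          have h0 : L + k.1 ≠ 0 := by omega
          rw [← h1 k (by omega)]; simp only [upd, update_of_ne this]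
          rw [f1 _ (by omega), update_of_ne h0]
      · have : L + n ≠ L + m := by omega
        have h0 : L + n ≠ 0 := by omega
        rw [← h2]; simp only [upd, update_of_ne this]; rw [f1 _ (by omega), update_of_ne h0, h2]
      · have : r ≠ L + m := by omega
        have h0 : r ≠ 0 := by omega
        rw [← h3 r hr]; simp only [upd, update_of_ne this]; rw [f1 _ (by omega), update_of_ne h0]
      · simp only [costC, cost, classicalState, h2, o1, eval_add, eval_mul,
          eval_natCast, eval_X, eval_one, eval_ofNat, Nat.cast_add, Nat.cast_one, Nat.cast_id,
          add_mul, one_mul] at h4 ⊢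
        omega
  obtain ⟨Q, hQ, h⟩ := key n le_rfl
  refine ⟨Q, L, X + 1 + (n : ℕ[X]) * (X + 2 + 2 * q) + q, by omega, hQ, fun c =>
    ⟨fun k => (h c).1 k k.2, (h c).2.2.1, ?_, fun k => ?_⟩⟩
  · have := (h c).2.2.2; simp at this ⊢; omega
  · have := (hP' k).size (c 0); simp; omega

/-- Clears the registers `n, …, n + m`. -/
lemma clear (n : ℕ) : ∀ m, ∃ P : Prog, P.Classical ∧ ∀ c, P.Ends c fun c' t =>
    (∀ r, c' r = if n ≤ r ∧ r ≤ n + m then [] else c r) ∧ t = m + 1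
  | 0 => by
    refine ⟨.instr (.nil n), trivial, fun c => .instr ⟨fun r => ?_, rfl⟩⟩
    simp only [upd, update_apply]; split_ifs <;> first | rfl | omega
  | m + 1 => by
    obtain ⟨P, hP, h⟩ := clear n m
    refine ⟨.seq P (.instr (.nil (n + (m + 1)))), ⟨hP, trivial⟩, fun c => ?_⟩
    obtain ⟨h1, h2⟩ := h c; refine .seq' ?_; refine .instr ⟨fun r => ?_, ?_⟩
    · simp only [upd, update_apply, h1]; split_ifs <;> first | rfl | omega
    · rw [h2]; rfl

/-- Copies the registers `L, …, L + m - 1` to `0, …, m - 1`, with scratch register `N`. -/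
lemma copies (L N : ℕ) : ∀ m, m < L → L + m < N → ∃ P : Prog, P.Classical ∧
    ∀ (c : ℕ → Str) (B : ℕ), (∀ k < m, (c (L + k)).length ≤ B) → P.Ends c fun c' t =>
      (∀ r, r ≠ N → c' r = if r < m then c (L + r) else c r) ∧ t ≤ 1 + m * (1 + B)
  | 0, _, _ => ⟨.instr (.nil N), trivial, fun c B hB => .instr
      ⟨fun r hr => by simp [upd, hr], by simp [costC, cost]⟩⟩
  | m + 1, hm, hN => by
    obtain ⟨P, hP, h⟩ := copies L N m (by omega) (by omega)
    refine ⟨.seq P (.instr (.copy m (L + m))), ⟨hP, trivial⟩, fun c B hB => ?_⟩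
    obtain ⟨h1, h2⟩ := h c B fun k hk => hB k (by omega)
    have h3 : (P.det c).1 (L + m) = c (L + m) := by rw [h1 _ (by omega), if_neg (by omega)]
    refine .seq' (.instr ⟨fun r hr => ?_, ?_⟩)
    · simp only [Instr.upd_copy, update_apply, h1 r hr, h3]; split_ifs <;> first | omega | simp_all
    · have := hB m (by omega); rw [Instr.costC_copy, h3, add_mul, one_mul]; omega

lemma of_polyTime {ι : Type} {n : ℕ} {args : ι → Fin n → Str} {out : ι → Str}
    (h : PolyTime args out) (φ : Str → ι) (hφ : ∀ k, FP fun x => args (φ x) k) : FP fun x => out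
    (φ x) := by
  obtain ⟨P, p, hP, h⟩ := h; obtain ⟨MP, hMP⟩ := P.exists_below
  obtain ⟨V, L, q, hnL, hV, hv⟩ := vector hφ
  obtain ⟨W, hW, hw⟩ := copies L (n + (MP + L + 1)) n hnL (by omega)
  obtain ⟨U, hU, hu⟩ := clear n (MP + L + 1)
  have hdet : ∀ i, (P.det (start (args i) [] QMem.init ()).c).1 0 = out i ∧
      (P.det (start (args i) [] QMem.init ()).c).2 ≤ p.eval (∑ k, (args i k).length) := by
    intro i; have := h i _ (by rw [Prog.run_det hP, support_pure]; exact rfl)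
    simpa [start] using this
  have hsum : ∀ x, (∀ k, (args (φ x) k).length ≤ q.eval x.length) →
      ∑ k, (args (φ x) k).length ≤ n * q.eval x.length := fun x hx => by
    have := Finset.sum_le_card_nsmul Finset.univ _ _ fun k _ => hx k
    simpa using this
  refine ⟨.seq V (.seq W (.seq U P)), n + (MP + L + 1) + 1,
    q + (1 + (n : ℕ[X]) * (1 + q)) + ((MP : ℕ[X]) + (L : ℕ[X]) + 2) +
      (2 * p.comp ((n : ℕ[X]) * q) + (n : ℕ[X]) * q) + X, ?_⟩
  refine .of_ends ⟨hV, hW, hU, hP⟩ (fun c => ?_) (fun x => ?_)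
  · obtain ⟨v1, v2, v3, v4⟩ := hv c; refine .seq' ?_; generalize hc1 : (V.det c).1 = c1 at *
    generalize (V.det c).2 = t1 at *
    obtain ⟨w1, w2⟩ := hw c1 (q.eval (c 0).length) fun k hk => by rw [v1 ⟨k, hk⟩]; exact v4 ⟨k, hk⟩
    refine .seq' ?_; generalize (W.det c1).1 = c2 at *
    generalize (W.det c1).2 = t2 at *
    obtain ⟨u1, u2⟩ := hu c2; refine .seq' ?_; generalize (U.det c2).1 = c3 at *
    generalize (U.det c2).2 = t3 at *
    have hagree : ∀ r < n + (MP + L + 1) + 1,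
        c3 r = (start (args (φ (c 0))) [] QMem.init ()).c r := by
      intro r hr; simp only [start]; rw [u1]; split_ifs with h1 h2 h2
      · omega
      · rfl
      · rw [w1 _ (by omega), if_pos h2, v1 ⟨r, h2⟩]
      · omega
    obtain ⟨d1, d2⟩ := Prog.det_congr (hMP.mono (by omega)) hagree
    obtain ⟨e1, e2⟩ := hdet (φ (c 0)); refine ⟨by rw [d1 0 (by omega), e1], fun r hr => ?_, ?_⟩
    · rw [Prog.det_of_le hMP _ (by omega), u1, if_neg (by omega), w1 r (by omega), if_neg (by omega),
        v2 r (by omega)]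
    · have e3 := e2.trans (eval_mono p (hsum _ v4)); rw [d2]; simp; omega
  · have hv4 := (hv (fun _ => x)).2.2.2; obtain ⟨e1, e2⟩ := hdet (φ x)
    have h1 := Prog.det_small hP (c := (start (args (φ x)) [] QMem.init ()).c)
      (B := ∑ k, (args (φ x) k).length) (fun r => by
        simp only [start]; split_ifs with hr
        · exact Finset.single_le_sum (f := fun k => (args (φ x) k).length)
            (fun _ _ => Nat.zero_le _) (Finset.mem_univ (⟨r, hr⟩ : Fin n))
        · simp) 0
    rw [e1] at h1; have h2 := hsum x hv4; have h3 := e2.trans (eval_mono p h2); simp; omega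

end FP

/-! ### Loops over lists in polynomial time -/

namespace FP

lemma mulUnary {f g : Str → Str} (hf : FP f) (hg : FP g) : FP fun x => unary
    ((f x).length * (g x).length) := by
  set G : Str → Str := fun y => pairS (fstS y) (sndS y ++ sndS (fstS y)) with hG
  have key : ∀ i y, i ≠ 0 → G^[i] y =
      pairS (fstS y) (sndS y ++ (List.replicate i (sndS (fstS y))).flatten) := by
    intro i y hi
    induction i with
    | zero => exact absurd rfl hi
    | succ i ih =>
      rw [iterate_succ_apply']
      by_cases h0 : i = 0
      · subst h0; simp [hG]
      · rw [ih h0]; simp only [hG, fstS_pairS, sndS_pairS, List.append_assoc]; congr 2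
        rw [List.replicate_succ', List.flatten_append]; simp
  have h := iterate (h := fun y => fstS (fstS y)) (g := G) id.fst.fst
    (id.fst.pair (id.snd.append id.fst.snd)) (4 * X + 1 + X * X) ?_
  · have h2 := (comp h ((hf.pair hg).pair (const []))).snd.unaryLength
    have : ∀ x, (sndS (G^[(fstS (fstS (pairS (pairS (f x) (g x)) []))).length]
        (pairS (pairS (f x) (g x)) []))).length = (f x).length * (g x).length := by
      intro x; rw [fstS_pairS, fstS_pairS]
      by_cases h0 : (f x).length = 0
      · simp [h0, sndS_pairS]
      · rw [key _ _ h0]; simp [sndS_pairS, fstS_pairS]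
    simpa only [this] using h2
  · intro y i hi
    by_cases h0 : i = 0
    · subst h0; simp; omega
    · rw [key _ _ h0]; have h1 := length_fstS_le y; have h2 := length_sndS_le y
      have h3 := length_fstS_le (fstS y); have h4 := length_sndS_le (fstS y)
      have h5 : i * (sndS (fstS y)).length ≤ y.length * y.length :=
        Nat.mul_le_mul (by omega) (by omega)
      simp [length_pairS]; omega

lemma polyUnary (p : ℕ[X]) {f : Str → Str} (hf : FP f) : FP fun x => unary (p.eval (f x).length)
    := by
  induction p using Polynomial.induction_on' with
  | add p q hp hq =>
    have := hp.append hq; simpa only [unary, ← List.replicate_add, eval_add] using this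
  | monomial n k =>
    simp only [eval_monomial]
    have h : ∀ n, FP fun x => unary ((f x).length ^ n) := by
      intro n
      induction n with
      | zero => simpa using const (unary 1)
      | succ n ih => have := ih.mulUnary hf; simpa [unary, pow_succ] using this
    have := (const (unary k)).mulUnary (h n); simpa [unary] using this

/-- One step of a loop: the state `((U, A), (s, R))` consists of a length bound `U`, the parameter
`A`, the accumulator `s` and the rest `R` of the data. -/
def foldStep (f hd tl : Str → Str) (y : Str) : Str :=
  if sndS (sndS y) = [] then y
  else pairS (fstS y)
    (pairS ((f (pairS (sndS (fstS y)) (pairS (fstS (sndS y)) (hd (sndS (sndS y)))))).take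
      (fstS (fstS y)).length) (tl (sndS (sndS y))))

lemma fold {f hd tl : Str → Str} (hf : FP f) (hhd : FP hd) (htl : FP tl)
    (hlen : ∀ r, (tl r).length ≤ r.length) : FP fun y => (foldStep f hd tl)^[(sndS (sndS y)).length]
    y := by
  refine iterate (h := fun y => sndS (sndS y)) id.snd.snd (g := foldStep f hd tl) ?_ (5 * X + 2) ?_
  · have h1 : FP fun y => pairS (fstS y)
        (pairS ((f (pairS (sndS (fstS y)) (pairS (fstS (sndS y)) (hd (sndS (sndS y)))))).take
        (fstS (fstS y)).length) (tl (sndS (sndS y)))) :=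
      id.fst.pair (((hf.comp (id.fst.snd.pair (id.snd.fst.pair (hhd.comp id.snd.snd)))).take
        id.fst.fst).pair (htl.comp id.snd.snd))
    have h2 := ((id.snd.snd).eq (const [])).ite id h1
    have h3 : foldStep f hd tl = fun y => if ([decide (sndS (sndS y) = [])].head? = some true) then y
        else pairS (fstS y)
        (pairS ((f (pairS (sndS (fstS y)) (pairS (fstS (sndS y)) (hd (sndS (sndS y)))))).take
        (fstS (fstS y)).length) (tl (sndS (sndS y)))) := by
      funext y
      simp [foldStep]
    rw [h3]; exact h2
  · intro x i hi; clear hi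
    have key : (foldStep f hd tl)^[i] x = x ∨ ∃ s r : Str,
        (foldStep f hd tl)^[i] x = pairS (fstS x) (pairS s r) ∧ s.length ≤ x.length ∧
          r.length ≤ x.length := by
      induction i with
      | zero => exact Or.inl rfl
      | succ i ih =>
        have hfst : fstS ((foldStep f hd tl)^[i] x) = fstS x := by
          rcases ih with h | ⟨s, r, h, _⟩
          · rw [h]
          · rw [h, fstS_pairS]
        have hR : (sndS (sndS ((foldStep f hd tl)^[i] x))).length ≤ x.length := by
          rcases ih with h | ⟨s, r, h, hs, hr⟩
          · rw [h]; exact (length_sndS_le _).trans (length_sndS_le _)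
          · rw [h, sndS_pairS, sndS_pairS]; exact hr
        rw [iterate_succ_apply']; generalize (foldStep f hd tl)^[i] x = y at *
        rw [foldStep]; split_ifs
        · exact ih
        · refine Or.inr ⟨_, _, by rw [hfst], ?_, (hlen _).trans hR⟩
          have h1 := length_fstS_le (fstS x); have h2 := length_fstS_le x; rw [length_take]; omega
    have h2 := length_fstS_le x; rcases key with h | ⟨s, r, h, hs, hr⟩
    · rw [h]; simp; omega
    · rw [h, length_pairS, length_pairS]; simp; omega

end FP

/-! ### Encodings and polynomial-time functions between encoded types -/

/-- An encoding of the elements of `α` as bit strings. -/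
class Code (α : Type) where
  /-- the bit string that encodes an element -/
  enc : α → Str

open Code (enc)

instance {α : Type} [Code α] : Code (List α) := ⟨fun l => encList (l.map enc)⟩
instance : Code Str := ⟨id⟩
instance : Code ℕ := ⟨unary⟩
instance : Code Bool := ⟨fun b => [b]⟩
instance {α β : Type} [Code α] [Code β] : Code (α × β) := ⟨fun x => pairS (enc x.1) (enc x.2)⟩

section

variable {α β γ δ σ : Type} [Code α] [Code β] [Code γ] [Code δ] [Code σ]

lemma enc_pair (a : α) (b : β) : enc (a, b) = pairS (enc a) (enc b) := rfl
lemma enc_str (s : Str) : enc s = s := rfl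
lemma enc_nat (n : ℕ) : enc n = unary n := rfl
lemma enc_bool (b : Bool) : enc b = [b] := rfl
lemma enc_nil : enc ([] : List α) = [] := rfl
lemma enc_cons (a : α) (l : List α) : enc (a :: l) = pairS (enc a) (enc l) := rfl
@[simp] lemma length_unary (n : ℕ) : (unary n).length = n := by simp [unary]

lemma pairS_ne_nil (a b : Str) : pairS a b ≠ [] := by simp [pairS]

lemma encList_append (l l' : List Str) : encList (l ++ l') = encList l ++ encList l' := by
  induction l with
  | nil => rfl
  | cons a l ih => simp [encList, ih, pairS]

lemma enc_append (l l' : List α) : enc (l ++ l') = enc l ++ enc l' := by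
  change encList _ = encList _ ++ encList _; rw [map_append, encList_append]

lemma length_le_enc (l : List α) : l.length ≤ (enc l).length := by
  induction l with
  | nil => simp
  | cons a l ih => rw [enc_cons, length_pairS, length_cons]; omega

lemma length_enc_pair (a : α) (b : β) :
    (enc (a, b)).length = 2 * (enc a).length + 1 + (enc b).length := length_pairS _ _

lemma length_enc_le {l : List α} {N : ℕ} (h : ∀ a ∈ l, (enc a).length ≤ N) : (enc l).length ≤
    l.length * (2 * N + 1) := by
  induction l with
  | nil => simp [enc_nil]
  | cons a l ih =>
    have h1 := h a (by simp); have h2 := ih fun b hb => h b (by simp [hb])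
    rw [enc_cons, length_pairS, length_cons, add_mul]; omega

lemma length_enc_mem {l : List α} {a : α} (h : a ∈ l) : (enc a).length ≤ (enc l).length := by
  induction l with
  | nil => simp at h
  | cons b l ih =>
    rw [enc_cons, length_pairS]; rcases List.mem_cons.1 h with rfl | h
    · omega
    · have := ih h; omega

/-- The function `f` between encoded types is computable in polynomial time. -/
@[fun_prop] def PT (f : α → β) : Prop := ∃ g, FP g ∧ ∀ a, g (enc a) = enc (f a)

namespace PT

@[fun_prop] lemma id : PT fun a : α => a := ⟨_, FP.id, fun _ => rfl⟩

@[fun_prop] lemma const (b : β) : PT fun _ : α => b := ⟨_, FP.const (enc b), fun _ => rfl⟩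

@[fun_prop] lemma comp {f : β → γ} {g : α → β} (hf : PT f) (hg : PT g) : PT fun a => f (g a) := by
  obtain ⟨f', hf', hf⟩ := hf; obtain ⟨g', hg', hg⟩ := hg
  exact ⟨_, hf'.comp hg', fun a => by rw [hg, hf]⟩

@[fun_prop] lemma pair {f : α → β} {g : α → γ} (hf : PT f) (hg : PT g) : PT fun a => (f a, g a)
    := by
  obtain ⟨f', hf', hf⟩ := hf; obtain ⟨g', hg', hg⟩ := hg
  exact ⟨_, hf'.pair hg', fun a => by rw [hg, hf]; rfl⟩

@[fun_prop] lemma fst {f : α → β × γ} (hf : PT f) : PT fun a => (f a).1 := by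
  obtain ⟨f', hf', hf⟩ := hf; exact ⟨_, hf'.fst, fun a => by rw [hf]; exact fstS_pairS _ _⟩

@[fun_prop] lemma snd {f : α → β × γ} (hf : PT f) : PT fun a => (f a).2 := by
  obtain ⟨f', hf', hf⟩ := hf; exact ⟨_, hf'.snd, fun a => by rw [hf]; exact sndS_pairS _ _⟩

@[fun_prop] lemma cond {c : α → Bool} {f g : α → β} (hc : PT c) (hf : PT f) (hg : PT g) : PT fun a
    => cond (c a) (f a) (g a) := by
  obtain ⟨c', hc', hc⟩ := hc; obtain ⟨f', hf', hf⟩ := hf; obtain ⟨g', hg', hg⟩ := hg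
  refine ⟨_, hc'.ite hf' hg', fun a => ?_⟩; rw [hc, enc_bool]; cases h : c a
  · simpa [h] using hg a
  · simpa [h] using hf a

lemma size {f : α → β} (hf : PT f) : ∃ p : ℕ[X], ∀ a, (enc (f a)).length ≤ p.eval (enc a).length
    := by
  obtain ⟨f', ⟨P, M, p, h⟩, hf⟩ := hf; exact ⟨p, fun a => by rw [← hf]; exact h.size _⟩

lemma of_enc_eq {f : α → β} {g : α → γ} (hg : PT g) (h : ∀ a, enc (g a) = enc (f a)) : PT f := by
  obtain ⟨g', hg', hg⟩ := hg; exact ⟨g', hg', fun a => by rw [hg, h]⟩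

/-! Booleans -/

@[fun_prop] lemma not {f : α → Bool} (hf : PT f) : PT fun a => !f a := by
  have h : PT fun a => _root_.cond (f a) false true := by fun_prop
  exact h.of_enc_eq fun a => by cases f a <;> rfl

@[fun_prop] lemma and {f g : α → Bool} (hf : PT f) (hg : PT g) : PT fun a => f a && g a := by
  have h : PT fun a => _root_.cond (f a) (g a) false := by fun_prop
  exact h.of_enc_eq fun a => by cases f a <;> rfl

@[fun_prop] lemma or {f g : α → Bool} (hf : PT f) (hg : PT g) : PT fun a => f a || g a := by
  have h : PT fun a => _root_.cond (f a) true (g a) := by fun_prop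
  exact h.of_enc_eq fun a => by cases f a <;> rfl

end PT

/-- Equality of bit strings. -/
def eqS (s t : Str) : Bool := decide (s = t)

/-- Comparison of natural numbers. -/
def ltN (m n : ℕ) : Bool := decide (m < n)

namespace PT

@[fun_prop] lemma eqS {f g : α → Str} (hf : PT f) (hg : PT g) : PT fun a => Skl.eqS (f a) (g a)
    := by
  obtain ⟨f', hf', hf⟩ := hf; obtain ⟨g', hg', hg⟩ := hg
  exact ⟨_, hf'.eq hg', fun a => by rw [hg, hf]; rfl⟩

/-! Bit strings -/

@[fun_prop] lemma appendS {f g : α → Str} (hf : PT f) (hg : PT g) : PT fun a => f a ++ g a := by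
  obtain ⟨f', hf', hf⟩ := hf; obtain ⟨g', hg', hg⟩ := hg
  exact ⟨_, hf'.append hg', fun a => by rw [hg, hf]; rfl⟩

@[fun_prop] lemma consS {f : α → Bool} {g : α → Str} (hf : PT f) (hg : PT g) : PT fun a => f a :: g
    a := by
  obtain ⟨f', hf', hf⟩ := hf; obtain ⟨g', hg', hg⟩ := hg
  exact ⟨_, hf'.append hg', fun a => by rw [hg, hf]; rfl⟩

@[fun_prop] lemma tailS {f : α → Str} (hf : PT f) : PT fun a => (f a).tail := by
  obtain ⟨f', hf', hf⟩ := hf; exact ⟨_, hf'.tail, fun a => by rw [hf]; rfl⟩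

@[fun_prop] lemma fstS {f : α → Str} (hf : PT f) : PT fun a => fstS (f a) := by
  obtain ⟨f', hf', hf⟩ := hf; exact ⟨_, hf'.fst, fun a => by rw [hf]; rfl⟩

@[fun_prop] lemma sndS {f : α → Str} (hf : PT f) : PT fun a => sndS (f a) := by
  obtain ⟨f', hf', hf⟩ := hf; exact ⟨_, hf'.snd, fun a => by rw [hf]; rfl⟩

@[fun_prop] lemma pairS {f g : α → Str} (hf : PT f) (hg : PT g) : PT fun a => pairS (f a) (g a)
    := by
  obtain ⟨f', hf', hf⟩ := hf; obtain ⟨g', hg', hg⟩ := hg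
  exact ⟨_, hf'.pair hg', fun a => by rw [hg, hf]; rfl⟩

@[fun_prop] lemma item (k : ℕ) {f : α → Str} (hf : PT f) : PT fun a => item k (f a) := by
  have h : PT fun a => Skl.sndS^[k] (f a) := by
    induction k with
    | zero => exact hf
    | succ k ih => simpa only [iterate_succ_apply'] using ih.sndS
  exact h.fstS

@[fun_prop] lemma takeS {n : α → ℕ} {f : α → Str} (hn : PT n) (hf : PT f) : PT fun a => (f a).take
    (n a) := by
  obtain ⟨f', hf', hf⟩ := hf; obtain ⟨n', hn', hn⟩ := hn
  exact ⟨_, hf'.take hn', fun a => by rw [hn, hf, enc_nat, length_unary]; rfl⟩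

@[fun_prop] lemma dropS {n : α → ℕ} {f : α → Str} (hn : PT n) (hf : PT f) : PT fun a => (f a).drop
    (n a) := by
  obtain ⟨f', hf', hf⟩ := hf; obtain ⟨n', hn', hn⟩ := hn
  exact ⟨_, hf'.drop hn', fun a => by rw [hn, hf, enc_nat, length_unary]; rfl⟩

lemma encLength {f : α → β} (hf : PT f) : PT fun a => (enc (f a)).length := by
  obtain ⟨f', hf', hf⟩ := hf; exact ⟨_, hf'.unaryLength, fun a => by rw [hf]; rfl⟩

@[fun_prop] lemma lengthS {f : α → Str} (hf : PT f) : PT fun a => (f a).length := hf.encLength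

@[fun_prop] lemma unary {f : α → ℕ} (hf : PT f) : PT fun a => unary (f a) :=
  hf.of_enc_eq fun _ => rfl

/-- The string as an element of another type with the same encoding. -/
lemma encode {f : α → β} (hf : PT f) : PT fun a => enc (f a) := hf.of_enc_eq fun _ => rfl

/-! Natural numbers -/

@[fun_prop] lemma add {f g : α → ℕ} (hf : PT f) (hg : PT g) : PT fun a => f a + g a :=
  (hf.unary.appendS hg.unary).of_enc_eq fun a => by simp [enc_str, enc_nat, Skl.unary]

@[fun_prop] lemma sub {f g : α → ℕ} (hf : PT f) (hg : PT g) : PT fun a => f a - g a :=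
  (hg.dropS hf.unary).of_enc_eq fun a => by simp [enc_str, enc_nat, Skl.unary]

@[fun_prop] lemma polyEval (p : ℕ[X]) {f : α → ℕ} (hf : PT f) : PT fun a => p.eval (f a) := by
  obtain ⟨f', hf', hf⟩ := hf
  exact ⟨_, FP.polyUnary p hf', fun a => by rw [hf, enc_nat, length_unary]; rfl⟩

@[fun_prop] lemma mul {f g : α → ℕ} (hf : PT f) (hg : PT g) : PT fun a => f a * g a := by
  obtain ⟨f', hf', hf⟩ := hf; obtain ⟨g', hg', hg⟩ := hg
  exact ⟨_, FP.mulUnary hf' hg', fun a => by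
    rw [hf, hg, enc_nat, length_unary, enc_nat, length_unary]; rfl⟩

lemma isNil {f : α → List β} (hf : PT f) : PT fun a => (f a).isEmpty :=
  (hf.encode.eqS (const [])).of_enc_eq fun a => by
    cases h : f a with
    | nil => rfl
    | cons b l => simp [Skl.eqS, enc_bool, enc_cons, pairS_ne_nil]

lemma isNilS {f : α → Str} (hf : PT f) : PT fun a => (f a).isEmpty :=
  (hf.eqS (const [])).of_enc_eq fun a => by cases h : f a <;> simp [Skl.eqS, enc_bool]

@[fun_prop] lemma ltN {f g : α → ℕ} (hf : PT f) (hg : PT g) : PT fun a => Skl.ltN (f a) (g a) :=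
  ((hg.sub hf).unary.isNilS.not).of_enc_eq fun a => by
    simp only [enc_bool, Skl.ltN, Skl.unary]
    by_cases h : f a < g a
    · have : g a - f a ≠ 0 := by omega
      simp [h, this]
    · have : g a - f a = 0 := by omega
      simp [h, this]

/-! Lists -/

@[fun_prop] lemma append {f g : α → List β} (hf : PT f) (hg : PT g) : PT fun a => f a ++ g a :=
  (hf.encode.appendS hg.encode).of_enc_eq fun a => (enc_append _ _).symm

@[fun_prop] lemma cons {f : α → β} {g : α → List β} (hf : PT f) (hg : PT g) : PT fun a => f a :: g a
    :=
  (hf.encode.pairS hg.encode).of_enc_eq fun _ => rfl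

lemma foldl_aux {f' : Str → Str} {f : α → σ → γ → σ}
    (hf : ∀ a s c, f' (enc (a, s, c)) = enc (f a s c)) (U : Str) (a : α) :
    ∀ (l : List γ) (s : σ) (k : ℕ), l.length ≤ k →
      (∀ l', l' <+: l → (enc (l'.foldl (f a) s)).length ≤ U.length) →
      (FP.foldStep f' Skl.fstS Skl.sndS)^[k]
          (Skl.pairS (Skl.pairS U (enc a)) (Skl.pairS (enc s) (enc l))) =
        Skl.pairS (Skl.pairS U (enc a)) (Skl.pairS (enc (l.foldl (f a) s)) [])
  | [], s, k, _, _ => by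
    have : ∀ y, Skl.sndS (Skl.sndS y) = [] → FP.foldStep f' Skl.fstS Skl.sndS y = y := fun y hy => by
      rw [FP.foldStep, if_pos hy]
    exact Function.iterate_fixed (this _ (by simp [sndS_pairS, enc_nil])) k
  | c :: l, s, 0, h, _ => by simp at h
  | c :: l, s, k + 1, h, hU => by
    have h1 : FP.foldStep f' Skl.fstS Skl.sndS
        (Skl.pairS (Skl.pairS U (enc a)) (Skl.pairS (enc s) (enc (c :: l)))) =
        Skl.pairS (Skl.pairS U (enc a)) (Skl.pairS (enc (f a s c)) (enc l)) := by
      rw [FP.foldStep, if_neg (by simp [sndS_pairS, enc_cons, pairS_ne_nil])]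
      simp only [sndS_pairS, fstS_pairS, enc_cons]; have h2 := hf a s c
      rw [enc_pair, enc_pair] at h2; rw [h2, take_of_length_le]; simpa using hU [c] (by simp)
    rw [Function.iterate_succ_apply, h1, foldl_aux hf U a l (f a s c) k (by simpa using h)
      fun l' hl' => by simpa using hU (c :: l') (by simpa using hl')]
    rfl

lemma foldl {l : α → List γ} {init : α → σ} {f : α → σ → γ → σ} (hl : PT l) (hi : PT init)
    (hf : PT fun x : α × σ × γ => f x.1 x.2.1 x.2.2) (p : ℕ[X]) (hp : ∀ a l', l' <+: l a → (Code.enc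
    (l'.foldl (f a) (init a))).length ≤ p.eval (Code.enc a).length) : PT fun a => (l a).foldl (f a)
    (init a) := by
  obtain ⟨l', hl', hl⟩ := hl; obtain ⟨i', hi', hi⟩ := hi; obtain ⟨f', hf', hf⟩ := hf
  refine ⟨_, ((FP.fold hf' FP.id.fst FP.id.snd length_sndS_le).comp
    (((FP.polyUnary p FP.id).pair FP.id).pair (hi'.pair hl'))).snd.fst, fun a => ?_⟩
  have := foldl_aux (f := f) (fun a s c => hf (a, s, c)) (Skl.unary (p.eval (Code.enc a).length)) a
    (l a) (init a) (Code.enc (l a)).length (length_le_enc _) (fun l' h => by simpa using hp a l' h)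
  simp only [hl, hi, sndS_pairS]; rw [this, sndS_pairS, fstS_pairS]

lemma foldlS_aux {f' : Str → Str} {f : α → σ → Bool → σ}
    (hf : ∀ a s c, f' (enc (a, s, c)) = enc (f a s c)) (U : Str) (a : α) :
    ∀ (l : Str) (s : σ) (k : ℕ), l.length ≤ k →
      (∀ l', l' <+: l → (enc (l'.foldl (f a) s)).length ≤ U.length) →
      (FP.foldStep f' (fun r => r.take 1) List.tail)^[k]
          (Skl.pairS (Skl.pairS U (enc a)) (Skl.pairS (enc s) l)) =
        Skl.pairS (Skl.pairS U (enc a)) (Skl.pairS (enc (l.foldl (f a) s)) [])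
  | [], s, k, _, _ => by
    have : ∀ y, Skl.sndS (Skl.sndS y) = [] →
        FP.foldStep f' (fun r => r.take 1) List.tail y = y := fun y hy => by
      rw [FP.foldStep, if_pos hy]
    exact Function.iterate_fixed (this _ (by simp [sndS_pairS])) k
  | c :: l, s, 0, h, _ => by simp at h
  | c :: l, s, k + 1, h, hU => by
    have h1 : FP.foldStep f' (fun r => r.take 1) List.tail
        (Skl.pairS (Skl.pairS U (enc a)) (Skl.pairS (enc s) (c :: l))) =
        Skl.pairS (Skl.pairS U (enc a)) (Skl.pairS (enc (f a s c)) l) := by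
      rw [FP.foldStep, if_neg (by simp [sndS_pairS])]
      simp only [sndS_pairS, fstS_pairS, List.take_succ_cons, List.take_zero, tail_cons]
      have h2 := hf a s c; rw [enc_pair, enc_pair, enc_bool] at h2; rw [h2, take_of_length_le]
      simpa using hU [c] (by simp)
    rw [Function.iterate_succ_apply, h1, foldlS_aux hf U a l (f a s c) k (by simpa using h)
      fun l' hl' => by simpa using hU (c :: l') (by simpa using hl')]
    rfl

/-- Loops over the bits of a string. -/
lemma foldlS {l : α → Str} {init : α → σ} {f : α → σ → Bool → σ} (hl : PT l) (hi : PT init)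
    (hf : PT fun x : α × σ × Bool => f x.1 x.2.1 x.2.2) (p : ℕ[X]) (hp : ∀ a l', l' <+: l a →
    (Code.enc (l'.foldl (f a) (init a))).length ≤ p.eval (Code.enc a).length) : PT fun a =>
    (l a).foldl (f a) (init a) := by
  obtain ⟨l', hl', hl⟩ := hl; obtain ⟨i', hi', hi⟩ := hi; obtain ⟨f', hf', hf⟩ := hf
  refine ⟨_, ((FP.fold hf' (hd := fun r => r.take 1) (FP.id.take (FP.const [true])) FP.id.tail
    (fun r => by simp)).comp
    (((FP.polyUnary p FP.id).pair FP.id).pair (hi'.pair hl'))).snd.fst, fun a => ?_⟩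
  have := foldlS_aux (f := f) (fun a s c => hf (a, s, c)) (Skl.unary (p.eval (Code.enc a).length)) a
    (l a) (init a) (l a).length le_rfl (fun l' h => by simpa using hp a l' h)
  simp only [hl, hi, sndS_pairS]; rw [enc_str, this, sndS_pairS, fstS_pairS]

lemma map {l : α → List γ} {f : α → γ → δ} (hl : PT l) (hf : PT fun x : α × γ => f x.1 x.2) : PT fun
    a => (l a).map (f a) := by
  obtain ⟨p, hp⟩ := hf.size; obtain ⟨q, hq⟩ := hl.size
  have key : ∀ (f : γ → δ) (l : List γ) (s : List δ),
      l.foldl (fun s c => s ++ [f c]) s = s ++ l.map f := by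
    intro f l
    induction l with
    | nil => simp
    | cons c l ih => intro s; rw [foldl_cons, ih]; simp
  have := foldl (l := l) (init := fun _ => ([] : List δ)) (f := fun a s c => s ++ [f a c]) hl
    (const _) (by
      refine append fp (cons ?_ (const _))
      exact comp (f := fun x : α × γ => f x.1 x.2) (g := fun x : α × List δ × γ => (x.1, x.2.2))
        hf fp) (q * (2 * p.comp (2 * X + 1 + q) + 1)) (fun a l' h => by
      rw [key, List.nil_append]
      have h1 := length_enc_le (l := l'.map (f a))
        (N := p.eval (2 * (Code.enc a).length + 1 + q.eval (Code.enc a).length)) (by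
          intro d hd; obtain ⟨c, hc, rfl⟩ := List.mem_map.1 hd
          refine (hp (a, c)).trans (eval_mono p ?_); rw [length_enc_pair]
          have := (length_enc_mem (h.subset hc)).trans (hq a); omega)
      refine h1.trans ?_; have h2 := (h.length_le.trans (length_le_enc (l a))).trans (hq a); simp
      gcongr)
  simpa [key] using this

/-- The bits of a string as a list. -/
lemma mapS {l : α → Str} (hl : PT l) : PT fun a => (l a).map fun b => ([b], b) := by
  have key : ∀ (l : Str) (s : List (Str × Bool)),
      l.foldl (fun s b => s ++ [([b], b)]) s = s ++ l.map fun b => ([b], b) := by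
    intro l
    induction l with
    | nil => simp
    | cons c l ih => intro s; rw [foldl_cons, ih]; simp
  obtain ⟨q, hq⟩ := hl.size
  have := foldlS (l := l) (init := fun _ => ([] : List (Str × Bool)))
    (f := fun _ s b => s ++ [([b], b)]) hl (const _) (by
      refine append fp (cons (pair (consS fp (const _)) fp) (const _))) (q * 9) (fun a l' h => by
      rw [key, List.nil_append]
      have h1 := length_enc_le (l := l'.map fun b => ([b], b)) (N := 4) (by
        intro x hx; obtain ⟨b, _, rfl⟩ := List.mem_map.1 hx
        simp [length_enc_pair, enc_bool, enc_str])
      have h2 := h.length_le.trans (hq a); simp at h1 ⊢; omega)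
  simpa [key] using this

lemma length {l : α → List γ} (hl : PT l) : PT fun a => (l a).length := by
  have key : ∀ (l : List γ) (s : ℕ), l.foldl (fun s _ => s + 1) s = s + l.length := by
    intro l
    induction l with
    | nil => simp
    | cons c l ih => intro s; rw [foldl_cons, ih]; simp; omega
  obtain ⟨q, hq⟩ := hl.size
  have := foldl (l := l) (init := fun _ => 0) (f := fun _ s _ => s + 1) hl (const _)
    fp q (fun a l' h => by
      have h2 := (h.length_le.trans (length_le_enc (l a))).trans (hq a)
      rw [key, enc_nat, length_unary]; omega)
  simpa [key] using this

lemma all {l : α → List γ} {f : α → γ → Bool} (hl : PT l) (hf : PT fun x : α × γ => f x.1 x.2) : PT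
    fun a => (l a).all (f a) := by
  have key : ∀ (f : γ → Bool) (l : List γ) (s : Bool),
      l.foldl (fun s c => s && f c) s = (s && l.all f) := by
    intro f l
    induction l with
    | nil => simp
    | cons c l ih => intro s; rw [foldl_cons, ih]; simp [Bool.and_assoc]
  have := foldl (l := l) (init := fun _ => true) (f := fun a s c => s && f a c) hl (const _) (by
      refine and fp ?_
      exact comp (f := fun x : α × γ => f x.1 x.2) (g := fun x : α × Bool × γ => (x.1, x.2.2))
        hf fp) 1 (fun a l' h => by simp [enc_bool])
  simpa [key] using this

lemma any {l : α → List γ} {f : α → γ → Bool} (hl : PT l) (hf : PT fun x : α × γ => f x.1 x.2) : PT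
    fun a => (l a).any (f a) := by
  have := (all (f := fun a c => !f a c) hl hf.not).not; simpa [List.any_eq_not_all_not] using this

lemma countP {l : α → List γ} {f : α → γ → Bool} (hl : PT l) (hf : PT fun x : α × γ => f x.1 x.2) :
    PT fun a => (l a).countP (f a) := by
  have key : ∀ (f : γ → Bool) (l : List γ) (s : ℕ),
      l.foldl (fun s c => _root_.cond (f c) (s + 1) s) s = s + l.countP f := by
    intro f l
    induction l with
    | nil => simp
    | cons c l ih => intro s; rw [foldl_cons, ih, List.countP_cons]; cases f c <;> simp; omega
  obtain ⟨q, hq⟩ := hl.size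
  have := foldl (l := l) (init := fun _ => 0) (f := fun a s c => _root_.cond (f a c) (s + 1) s) hl
    (const _) (by
      refine cond ?_ fp fp
      exact comp (f := fun x : α × γ => f x.1 x.2) (g := fun x : α × ℕ × γ => (x.1, x.2.2))
        hf fp) q (fun a l' h => by
      have h2 := (h.length_le.trans (length_le_enc (l a))).trans (hq a)
      have h3 := List.countP_le_length (p := f a) (l := l'); rw [key, enc_nat, length_unary]; omega)
  simpa [key] using this

/-- A list with the positions of its members, counted from `k`. -/
lemma zipIdx {l : α → List γ} (hl : PT l) : PT fun a => (l a).zipIdx := by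
  have key : ∀ (l : List γ) (s : List (γ × ℕ)) (k : ℕ),
      l.foldl (fun (s : List (γ × ℕ) × ℕ) c => (s.1 ++ [(c, s.2)], s.2 + 1)) (s, k) =
        (s ++ l.zipIdx k, k + l.length) := by
    intro l
    induction l with
    | nil => simp
    | cons c l ih => intro s k; rw [foldl_cons, ih]; simp; omega
  obtain ⟨q, hq⟩ := hl.size
  have := foldl (l := l) (init := fun _ => (([] : List (γ × ℕ)), 0))
    (f := fun _ s c => (s.1 ++ [(c, s.2)], s.2 + 1)) hl (const _)
    (by
      refine pair (append fp (cons fp (const _))) fp)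
      (2 * (q * (2 * (3 * q + 1) + 1)) + 1 + q) (fun a l' h => by
      have h2 := (h.length_le.trans (length_le_enc (l a))).trans (hq a)
      rw [key, List.nil_append, length_enc_pair, enc_nat, length_unary]
      have h1 := length_enc_le (l := l'.zipIdx) (N := 3 * q.eval (Code.enc a).length + 1) (by
          rintro ⟨c, k⟩ hd; have h3 := List.mem_zipIdx' hd
          have h4 : c ∈ l' := by rw [h3.2]; exact List.getElem_mem _
          have h5 := (length_enc_mem (h.subset h4)).trans (hq a)
          rw [length_enc_pair, enc_nat, length_unary]; omega)
      rw [List.length_zipIdx] at h1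
      have h3 : l'.length * (2 * (3 * q.eval (Code.enc a).length + 1) + 1) ≤
        q.eval (Code.enc a).length * (2 * (3 * q.eval (Code.enc a).length + 1) + 1) := by gcongr
      simp; omega)
  have h2 := this.fst; simpa [key] using h2

lemma replicate {n : α → ℕ} (hn : PT n) (b : Bool) : PT fun a => List.replicate (n a) b := by
  have key : ∀ (l s : Str), l.foldl (fun s _ => b :: s) s = List.replicate l.length b ++ s := by
    intro l
    induction l with
    | nil => simp
    | cons c l ih => intro s; rw [foldl_cons, ih, length_cons, List.replicate_succ']; simp
  obtain ⟨q, hq⟩ := hn.size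
  have := foldlS (l := fun a => Skl.unary (n a)) (init := fun _ => ([] : Str))
    (f := fun _ s _ => b :: s) hn.unary (const _) fp q (fun a l' h => by
      have h2 := h.length_le.trans (hq a); rw [key, enc_str]; simpa using h2)
  simpa [key] using this

lemma range {n : α → ℕ} (hn : PT n) : PT fun a => List.range (n a) := by
  have h := (((replicate hn true).mapS).zipIdx).map (f := fun _ x => x.2) fp
  refine h.of_enc_eq fun a => ?_
  congr 1; simp [List.zipIdx_map_snd, List.range_eq_range']

end PT

end

/-! ### Programs that run on shifted registers -/

/-- Renames every register `r` to `r + w`. -/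
def Instr.shift (w : ℕ) : Instr → Instr
  | nil r => nil (r + w)
  | cons b r => cons b (r + w)
  | tail r => tail (r + w)
  | copy r s => copy (r + w) (s + w)
  | append r s t => append (r + w) (s + w) (t + w)
  | take r s t => take (r + w) (s + w) (t + w)
  | drop r s t => drop (r + w) (s + w) (t + w)
  | pair r s t => pair (r + w) (s + w) (t + w)
  | fst r s => fst (r + w) (s + w)
  | snd r s => snd (r + w) (s + w)
  | eq r s t => eq (r + w) (s + w) (t + w)
  | coin r => coin (r + w)
  | qnew a => qnew (a + w)
  | had a => had (a + w)
  | tgate a => tgate (a + w)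
  | cnot a b => cnot (a + w) (b + w)
  | meas a r => meas (a + w) (r + w)
  | qmove a b r => qmove (a + w) (b + w) (r + w)
  | qlen r a => qlen (r + w) (a + w)
  | call k r s t a => call k (r + w) (s + w) (t + w) (a + w)

section Shift

variable {SA SB : Type} {OA : Oracle SA} {OB : Oracle SB}

/-- The registers `w, …, w + M - 1` of `b` are the registers `0, …, M - 1` of `a`, and the quantum
memories coincide. -/
structure ShiftRel (w M : ℕ) (a : State SA) (b : State SB) : Prop where
  c : ∀ r < M, b.c (r + w) = a.c r
  q : ∀ r < M, b.q (r + w) = a.q r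
  mem : b.mem = a.mem

/-- The states differ only in the registers `w, …, w + M - 1` and in the quantum memory. -/
structure SameOutside (w M : ℕ) (b b' : State SB) : Prop where
  c : ∀ r, r < w ∨ w + M ≤ r → b'.c r = b.c r
  q : ∀ r, r < w ∨ w + M ≤ r → b'.q r = b.q r
  env : b'.env = b.env
  time : b'.time = b.time

variable {w M : ℕ} {a : State SA} {b : State SB}

lemma update_shift {α : Type} {f g : ℕ → α} (h : ∀ r < M, g (r + w) = f r) (x : ℕ) (v : α) : ∀ r <
    M, update g (x + w) v (r + w) = update f x v r := by
  intro r hr; simp only [update_apply, h r hr, add_left_inj]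

lemma update_outside {α : Type} {g g' : ℕ → α} (h : ∀ r, r < w ∨ w + M ≤ r → g' r = g r) {x : ℕ}
    (hx : x < M) (v : α) : ∀ r, r < w ∨ w + M ≤ r → update g' (x + w) v r = g r := by
  intro r hr; rw [update_of_ne (by omega), h r hr]

lemma Instr.cost_shift {i : Instr} (hi : i.Below M) (h : ShiftRel w M a b) : (i.shift w).cost b =
    i.cost a := by
  cases i <;> simp_all [Instr.shift, cost, Instr.Below, Instr.regs, h.c, h.q]

lemma Instr.effect_shift {i : Instr} (hn : i.NoCall) (hi : i.Below M) (h : ShiftRel w M a b) : Lift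
    (fun a' b' => (ShiftRel w M a' b' ∧ SameOutside w M b b') ∧ a'.env = a.env ∧ a'.time = a.time)
    (i.effect OA a) ((i.shift w).effect OB b) := by
  have hc := h.c; have hq := h.q; have hm := h.mem
  have same : SameOutside w M b b := ⟨fun _ _ => rfl, fun _ _ => rfl, rfl, rfl⟩
  cases i <;> simp only [Instr.Below, Instr.regs, List.forall_mem_cons, List.not_mem_nil,
    false_imp_iff, implies_true, and_true] at hi <;>
    simp only [Instr.shift, Instr.effect]
  case call => exact hn.elim
  case coin r =>
    refine Lift.map_same fun v _ => ⟨⟨⟨?_, hq, hm⟩, ?_, fun _ _ => rfl, rfl, rfl⟩, rfl, rfl⟩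
    · rw [hc r hi]; exact update_shift hc r _
    · exact update_outside (fun _ _ => rfl) hi _
  case qnew r =>
    refine Lift.pure ⟨⟨⟨hc, ?_, ?_⟩, fun _ _ => rfl, ?_, rfl, rfl⟩, rfl, rfl⟩
    · rw [hq r hi, hm]; exact update_shift hq r _
    · simp [hm]
    · exact update_outside (fun _ _ => rfl) hi _
  case had r =>
    rw [hq r hi]; split
    · exact Lift.pure ⟨⟨h, same⟩, rfl, rfl⟩
    · exact Lift.pure ⟨⟨⟨hc, hq, by simp [hm]⟩, fun _ _ => rfl, fun _ _ => rfl, rfl, rfl⟩, rfl, rfl⟩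
  case tgate r =>
    rw [hq r hi]; split
    · exact Lift.pure ⟨⟨h, same⟩, rfl, rfl⟩
    · exact Lift.pure ⟨⟨⟨hc, hq, by simp [hm]⟩, fun _ _ => rfl, fun _ _ => rfl, rfl, rfl⟩, rfl, rfl⟩
  case cnot r x =>
    rw [hq r hi.1, hq x hi.2]; split
    · exact Lift.pure ⟨⟨⟨hc, hq, by simp [hm]⟩, fun _ _ => rfl, fun _ _ => rfl, rfl, rfl⟩, rfl, rfl⟩
    · exact Lift.pure ⟨⟨h, same⟩, rfl, rfl⟩
  case meas r x =>
    rw [hq r hi.1]; split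
    · exact Lift.pure ⟨⟨h, same⟩, rfl, rfl⟩
    · rw [hm]; refine Lift.map_same fun v _ => ⟨⟨⟨?_, ?_, rfl⟩, ?_, ?_, rfl, rfl⟩, rfl, rfl⟩
      · simp only [State.setC_c, State.setQ_c]; rw [hc x hi.2]; exact update_shift hc x _
      · exact update_shift hq r _
      · exact update_outside (fun _ _ => rfl) hi.2 _
      · exact update_outside (fun _ _ => rfl) hi.1 _
  case qmove r x y =>
    refine Lift.pure ⟨⟨⟨hc, ?_, hm⟩, fun _ _ => rfl, ?_, rfl, rfl⟩, rfl, rfl⟩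
    · simp only [State.setQ_q]; rw [hc y hi.2.2, hq r hi.1]
      have h1 := update_shift hq r ((a.q r).drop (a.c y).length); rw [h1 x hi.2.1]
      exact update_shift h1 x _
    · exact update_outside (update_outside (fun _ _ => rfl) hi.1 _) hi.2.1 _
  case qlen r x =>
    refine Lift.pure ⟨⟨⟨?_, hq, hm⟩, ?_, fun _ _ => rfl, rfl, rfl⟩, rfl, rfl⟩
    · simp only [State.setC_c]; rw [hq x hi.2]; exact update_shift hc r _
    · exact update_outside (fun _ _ => rfl) hi.1 _
  all_goals
    refine Lift.pure ⟨⟨⟨?_, hq, hm⟩, ?_, fun _ _ => rfl, rfl, rfl⟩, rfl, rfl⟩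
    · simp only [State.setC_c]
      first
      | exact update_shift hc _ _
      | (rw [hc _ hi]; exact update_shift hc _ _)
      | (rw [hc _ hi.2]; exact update_shift hc _ _)
      | (rw [hc _ hi.2.1, hc _ hi.2.2]; exact update_shift hc _ _)
    · first
      | exact update_outside (fun _ _ => rfl) hi _
      | exact update_outside (fun _ _ => rfl) hi.1 _

end Shift

/-! ### Uniform bit strings -/

lemma map_uniform_equiv {α β : Type} [Fintype α] [Nonempty α] [Fintype β] [Nonempty β] (e : α ≃ β) :
    (PMF.uniformOfFintype α).map e = PMF.uniformOfFintype β := by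
  classical
  ext b; rw [PMF.map_apply, tsum_eq_single (e.symm b)]
  · simp [Fintype.card_congr e]
  · intro a ha; rw [if_neg]; rintro rfl; simp at ha

lemma uniform_prod {α β : Type} [Fintype α] [Nonempty α] [Fintype β] [Nonempty β] :
    PMF.uniformOfFintype (α × β) = (PMF.uniformOfFintype β).bind fun b =>
    (PMF.uniformOfFintype α).map fun a => (a, b) := by
  classical
  ext ⟨a, b⟩; rw [PMF.bind_apply, tsum_eq_single b]
  · rw [PMF.map_apply, tsum_eq_single a]
    · simp [ENNReal.mul_inv, mul_comm]
    · intro a' ha; simp [ha.symm]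
  · intro b' hb; rw [PMF.map_apply, ENNReal.tsum_eq_zero.2, mul_zero]; intro a'; simp [hb.symm]

lemma uniformBits_zero : uniformBits 0 = PMF.pure [] := by
  rw [uniformBits]
  have : (List.ofFn : (Fin 0 → Bool) → Str) = fun _ => [] := by funext f; simp
  rw [this]; exact PMF.map_const _ _

lemma uniformBits_succ (n : ℕ) : uniformBits (n + 1) = (PMF.uniformOfFintype Bool).bind fun b =>
    (uniformBits n).map fun r => r ++ [b] := by
  rw [uniformBits, ← map_uniform_equiv ((Equiv.prodComm _ _).trans (Fin.snocEquiv fun _ => Bool)),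
    uniform_prod, PMF.map_bind, PMF.map_bind]
  congr 1
  funext b
  rw [map_comp, map_comp, uniformBits, map_comp]; congr 1
  funext f
  change List.ofFn (Fin.snoc f b : Fin (n + 1) → Bool) = List.ofFn f ++ [b]; rw [List.ofFn_succ']
  simp

lemma length_of_mem_uniformBits {n : ℕ} {r : Str} (h : r ∈ (uniformBits n).support) : r.length = n
    := by
  rw [uniformBits, mem_support_map_iff] at h; obtain ⟨f, _, rfl⟩ := h; simp

lemma uniformBits_add (m n : ℕ) : uniformBits (m + n) = (uniformBits n).bind fun r =>
    (uniformBits m).map fun s => s ++ r := by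
  induction n with
  | zero => rw [uniformBits_zero, PMF.pure_bind]; simp only [List.append_nil]; exact (PMF.map_id _).symm
  | succ n ih =>
    rw [← add_assoc, uniformBits_succ, ih, uniformBits_succ, PMF.bind_bind]; congr 1
    funext b
    rw [PMF.map_bind, bind_map]; congr 1
    funext r
    rw [map_comp]; simp [Function.comp_def]

/-! ### Random processes with oracle and quantum memory -/

/-- The qubits of the reply that is being prepared, the state of the oracle, and the quantum
memory. -/
abbrev World (S : Type) := List ℕ × S × QMem

/-- A random process that changes the world. -/
def Act (S α : Type) := World S → PMF (α × World S)

namespace Act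

variable {S α β : Type}

instance : Monad (Act S) where
  pure a := fun w => PMF.pure (a, w)
  bind x f := fun w => (x w).bind fun o => f o.1 o.2

lemma pure_run (a : α) (w : World S) : (pure a : Act S α) w = PMF.pure (a, w) := rfl

lemma bind_run (x : Act S α) (f : α → Act S β) (w : World S) :
    (x >>= f) w = (x w).bind fun o => f o.1 o.2 := rfl

/-- A random choice. -/
def lift (μ : PMF α) : Act S α := fun w => μ.map fun a => (a, w)

/-- Oracle call `k` with query `s`. At most `t` bits and `t` qubits of the reply are used; the
result is the string and the number of qubits. -/
def call (O : Oracle S) (k : ℕ) (s : Str) (t : ℕ) : Act S (Str × ℕ) := fun w =>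
  (O k s w.2.1 w.2.2).map fun o =>
    ((o.1.1.take t, (o.1.2.take t).length), (w.1 ++ o.1.2.take t, o.2.1, o.2.2))

/-- Encryption with certified deletion. The result consists of the verification key, the bit
string of the ciphertext and the number of its qubits. -/
def encrypt (D : CDSKE) (lam : ℕ) (sk m : Str) : Act S (Str × Str × ℕ) :=
  fun w => (D.encDist lam sk m w.2.2).map fun o =>
    ((o.1.1, o.1.2.1, o.1.2.2.length), (w.1 ++ o.1.2.2, w.2.1, o.2))

/-- Runs of `g` on the members of a list, from left to right. -/
def mapA (g : α → Act S β) : List α → Act S (List β)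
  | [] => pure []
  | a :: l => g a >>= fun b => mapA g l >>= fun bs => pure (b :: bs)

end Act

open Act (bind_run pure_run lift)

/-- A random process with input in `α`, result in `β` and access to an arbitrary oracle. -/
abbrev Sem (α β : Type) := ∀ S : Type, Oracle S → α → Act S β

/-- Relation between the final state `s'` of a program that started in `s` and the outcome of a
random process. -/
structure Post {S β : Type} [Code β] (M N : ℕ) (s s' : State S) (o : β × World S) : Prop where
  out : s'.c 0 = enc o.1
  world : o.2 = (s'.q 0, s'.env, s'.mem)
  frame_c : ∀ r, M ≤ r → s'.c r = s.c r
  frame_q : ∀ r, M ≤ r → s'.q r = s.q r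
  clean : ∀ r, 2 ≤ r → r < M → s'.q r = []
  time : s'.time ≤ s.time + N
  size : (enc o.1).length ≤ N
  qubits : (s'.q 0).length ≤ (s.q 0).length + N

lemma Post.mono {S β : Type} [Code β] {M M' N N' : ℕ} {s t s' : State S} {o : β × World S}
    (h : Post M N t s' o) (hM : M ≤ M') (hc : ∀ r, M' ≤ r → t.c r = s.c r)
    (hq : ∀ r, M' ≤ r → t.q r = s.q r) (hcl : ∀ r, 2 ≤ r → r < M' → M ≤ r → t.q r = [])
    (ht : t.time + N ≤ s.time + N') (hN : N ≤ N') (hq0 : (t.q 0).length + N ≤ (s.q 0).length + N') :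
    Post M' N' s s' o where
  out := h.out
  world := h.world
  frame_c r hr := (h.frame_c r (hM.trans hr)).trans (hc r hr)
  frame_q r hr := (h.frame_q r (hM.trans hr)).trans (hq r hr)
  clean r h2 hr := by
    by_cases h' : r < M
    · exact h.clean r h2 h'
    · rw [h.frame_q r (by omega)]; exact hcl r h2 hr (by omega)
  time := h.time.trans ht
  size := h.size.trans hN
  qubits := h.qubits.trans hq0

section

variable {α β γ : Type} [Code α] [Code β] [Code γ]

/-- The program `P` implements the process `g`: input and result are in classical register `0`, the
qubits of the reply in quantum register `0`; quantum register `1` is waste. -/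
def Implements (P : Prog) (M : ℕ) (p : ℕ[X]) (g : Sem α β) : Prop :=
  ∀ (S : Type) (O : Oracle S) (s : State S) (a : α), s.c 0 = enc a →
    (∀ r, 2 ≤ r → r < M → s.q r = []) →
      Lift (Post M (p.eval (enc a).length) s) (P.run O s) (g S O a (s.q 0, s.env, s.mem))

/-- The process `g` can be implemented in polynomial time. -/
def Impl (g : Sem α β) : Prop := ∃ P M p, Implements P M p g

lemma Implements.mono {P : Prog} {M M' : ℕ} {p p' : ℕ[X]} {g : Sem α β}
    (h : Implements P M p g) (hM : M ≤ M') (hp : ∀ n, p.eval n ≤ p'.eval n) :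
    Implements P M' p' g := fun S O s a ha hq =>
  (h S O s a ha fun r h2 hr => hq r h2 (by omega)).mono fun s' o ho =>
    ho.mono hM (fun _ _ => rfl) (fun _ _ => rfl) (fun r h2 hr _ => hq r h2 hr)
      (by have := hp (enc a).length; omega) (hp _) (by have := hp (enc a).length; omega)

section Steps

variable {S : Type} {O : Oracle S} {δ : Type} {R : State S → δ → Prop} {ν : PMF δ} {s : State S}

lemma lift_seq_computes {P P' : Prog} {M : ℕ} {p : ℕ[X]} {f : Str → Str} (hP : Computes P M p f)
    (h : ∀ c t, c 0 = f (s.c 0) → (∀ r, M ≤ r → c r = s.c r) → t ≤ p.eval (s.c 0).length →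
      (f (s.c 0)).length ≤ p.eval (s.c 0).length →
      Lift R (P'.run O { s with c := c, time := s.time + t }) ν) :
    Lift R ((Prog.seq P P').run O s) ν := by
  rw [Prog.run, Prog.run_det hP.classical, PMF.pure_bind]
  exact h _ _ (hP.out _) (hP.frame _) (hP.time _) (hP.size _)

lemma lift_seq_instr {i : Instr} {P' : Prog} (hi : i.Classical)
    (h : Lift R (P'.run O { s with c := i.upd s.c, time := s.time + i.costC s.c }) ν) :
    Lift R ((Prog.seq (.instr i) P').run O s) ν := by
  rw [Prog.run, Prog.run_det (P := .instr i) hi, PMF.pure_bind]; exact h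

lemma lift_instr {i : Instr} (hi : i.Classical)
    (h : Lift R (PMF.pure { s with c := i.upd s.c, time := s.time + i.costC s.c }) ν) :
    Lift R ((Prog.instr i).run O s) ν := by
  rw [Prog.run_det (P := .instr i) hi]; exact h

lemma lift_seq_pure {P P' : Prog} {s' : State S} (hP : P.run O s = PMF.pure s')
    (h : Lift R (P'.run O s') ν) : Lift R ((Prog.seq P P').run O s) ν := by
  rw [Prog.run, hP, PMF.pure_bind]; exact h

lemma lift_seq {P P' : Prog} {ε : Type} {Q : State S → ε → Prop} {μ : PMF ε} {f : ε → PMF δ}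
    (h : Lift Q (P.run O s) μ) (hf : ∀ s' o, Q s' o → Lift R (P'.run O s') (f o)) : Lift R
    ((Prog.seq P P').run O s) (μ.bind f) := by
  rw [Prog.run]; exact h.bind hf

end Steps

namespace Impl

lemma congr {g g' : Sem α β} (hg : Impl g) (h : ∀ S O a w, g S O a w = g' S O a w) : Impl g' := by
  obtain ⟨P, M, p, hP⟩ := hg
  exact ⟨P, M, p, fun S O s a ha hq => by rw [← h]; exact hP S O s a ha hq⟩

lemma common {g : Sem α β} {α' β' : Type} [Code α'] [Code β'] {g' : Sem α' β'} (hg : Impl g)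
    (hg' : Impl g') : ∃ P P' M p, 4 ≤ M ∧ Implements P M p g ∧ Implements P' M p g' := by
  obtain ⟨P, M, p, hP⟩ := hg; obtain ⟨P', M', p', hP'⟩ := hg'
  exact ⟨P, P', M + M' + 4, p + p', by omega, hP.mono (by omega) (by simp),
    hP'.mono (by omega) (by simp)⟩

lemma common' {g : Sem α β} {f : Str → Str} (hg : Impl g) (hf : FP f) : ∃ P P' M p, 4 ≤ M ∧
    Implements P M p g ∧ Computes P' M p f := by
  obtain ⟨P, M, p, hP⟩ := hg; obtain ⟨P', M', p', hP'⟩ := hf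
  exact ⟨P, P', M + M' + 4, p + p', by omega, hP.mono (by omega) (by simp),
    hP'.mono (by omega) (by simp)⟩

lemma pure {f : α → β} (hf : PT f) : Impl fun _ _ a => Pure.pure (f a) := by
  obtain ⟨f', ⟨P, M, p, hP⟩, hf⟩ := hf; refine ⟨P, M + 1, p, fun S O s a ha hq => ?_⟩
  rw [Prog.run_det hP.classical]
  refine Lift.pure ⟨?_, rfl, fun r hr => hP.frame _ _ (by omega), fun _ _ => rfl, hq, ?_, ?_, ?_⟩
  · dsimp only; rw [hP.out, ha, hf]
  · have := hP.time s.c; rw [ha] at this; dsimp only; omega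
  · have := hP.size (enc a)
    rwa [hf] at this
  · dsimp only; omega

lemma bind {g : Sem α β} {g' : ∀ S : Type, Oracle S → α → β → Act S γ} (hg : Impl g)
    (hg' : Impl fun S O (x : α × β) => g' S O x.1 x.2) : Impl fun S O a => g S O a >>= g' S O a
    := by
  obtain ⟨P, P', M, p, hM, hP, hP'⟩ := common hg hg'
  refine ⟨.seq (.instr (.copy M 0)) (.seq P (.seq (.instr (.pair 0 M 0)) P')), M + 1,
    3 * X + 5 + 3 * p + p.comp (2 * X + 1 + p), fun S O s a ha hq => ?_⟩
  refine lift_seq_instr trivial ?_; have hM0 : 0 ≠ M := by omega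
  refine lift_seq (hP S O _ a (by simpa [upd, hM0] using ha)
    fun r h2 hr => hq r h2 (by omega)) fun s2 o h => lift_seq_instr trivial ?_
  have e1 : s2.c M = enc a := by rw [h.frame_c M le_rfl]; simpa [upd] using ha
  have h3 := hP' S O { s2 with c := upd s2.c (.pair 0 M 0),
                               time := s2.time + costC s2.c (.pair 0 M 0) } (a, o.1)
    (by simp [upd, e1, h.out, enc_pair]) h.clean
  have hw := h.world; rw [show (s2.q 0, s2.env, s2.mem) = o.2 from hw.symm] at h3; have ht := h.time
  have hs := h.size; have hqb := h.qubits; have e2 : s2.c 0 = enc o.1 := h.out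
  have hmono := eval_mono p (a := (enc (a, o.1)).length)
    (b := 2 * (enc a).length + 1 + p.eval (enc a).length)
    (by rw [length_enc_pair]; omega)
  have hcost : costC s2.c (.pair 0 M 0) = 1 + (enc a).length + (enc o.1).length := by
    simp [costC, cost, classicalState, e1, e2]
  refine h3.mono fun s' o' h' => h'.mono (by omega) (fun r hr => ?_) (fun r hr => ?_)
    (fun r h2 hr hr' => ?_) ?_ ?_ ?_
  · have h1 : r ≠ 0 := by omega
    have h2 : r ≠ M := by omega
    simp [upd, h1, h2, h.frame_c r (by omega)]
  · exact h.frame_q r (by omega)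
  · exact (h.frame_q r hr').trans (hq r h2 hr)
  · rw [Instr.costC_copy, ha] at ht; simp [hcost] at ht ⊢; omega
  · simp; omega
  · simp at hqb ⊢; omega

lemma comp {g : Sem β γ} {f : α → β} (hg : Impl g) (hf : PT f) : Impl fun S O a => g S O (f a) := by
  obtain ⟨f', hf', hf⟩ := hf; obtain ⟨P, P', M, p, hM, hP, hP'⟩ := common' hg hf'
  refine ⟨.seq P' P, M, p + p.comp p, fun S O s a ha hq => ?_⟩
  refine lift_seq_computes hP' fun c t hc hfr ht hs => ?_
  rw [ha] at hc ht hs; rw [hf] at hc hs; have hmono := eval_mono p hs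
  refine (hP S O { s with c := c, time := s.time + t } (f a) hc hq).mono fun s' o h =>
    h.mono le_rfl hfr (fun _ _ => rfl) (fun r h2 hr _ => hq r h2 hr) ?_ ?_ ?_
  all_goals simp; omega

lemma cond {c : α → Bool} {g g' : Sem α β} (hc : PT c) (hg : Impl g) (hg' : Impl g') : Impl fun S O
    a => cond (c a) (g S O a) (g' S O a) := by
  obtain ⟨c', ⟨Pc, Mc, pc, hPc⟩, hc⟩ := hc; obtain ⟨P, P', M, p, hM, hP, hP'⟩ := common hg hg'
  replace hPc := hPc.mono (M' := M + Mc) (p' := p + pc) (by omega) (by simp)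
  replace hP := hP.mono (M' := M + Mc) (p' := p + pc) (by omega) (by simp)
  replace hP' := hP'.mono (M' := M + Mc) (p' := p + pc) (by omega) (by simp)
  replace hM : 4 ≤ M + Mc := by omega
  generalize M + Mc = M at *
  generalize p + pc = p at *
  refine ⟨.seq (.instr (.copy M 0)) (.seq Pc (.seq (.instr (.copy (M + 1) 0))
    (.seq (.instr (.copy 0 M)) (.ifTrue (M + 1) P P')))), M + 2, 2 * X + 3 * p + 6,
    fun S O s a ha hq => ?_⟩
  have hM0 : 0 ≠ M := by omega
  refine lift_seq_instr trivial (lift_seq_computes hPc fun c1 t1 o1 f1 l1 s1 =>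
    lift_seq_instr trivial (lift_seq_instr trivial ?_))
  have e1 := f1 M le_rfl; simp [upd, hM0] at o1 l1 s1 e1; rw [ha] at o1 l1 s1 e1; rw [hc] at o1 s1
  have e3 : (upd (upd c1 (.copy (M + 1) 0)) (.copy 0 M)) (M + 1) = enc (c a) := by simp [upd, o1]
  have e4 : (upd (upd c1 (.copy (M + 1) 0)) (.copy 0 M)) 0 = enc a := by simp [upd, e1]
  have e5 : ∀ r, M + 2 ≤ r → (upd (upd c1 (.copy (M + 1) 0)) (.copy 0 M)) r =
      s.c r := fun r hr => by
    have h0 : r ≠ 0 := by omega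
    have h1 : r ≠ M := by omega
    have h2 : r ≠ M + 1 := by omega
    simp [upd, h0, h1, h2, f1 r (by omega)]
  have e6 : (upd c1 (.copy (M + 1) 0)) M = enc a := by simp [upd, e1]
  simp only [Instr.costC_copy, e6, o1, ha]
  generalize upd (upd c1 (.copy (M + 1) 0)) (.copy 0 M) = c2 at *
  rw [Prog.run]; simp only [e3, enc_bool]; cases hca : c a
  · simp only [List.head?_cons, Option.some.injEq, Bool.false_eq_true, if_false, cond_false]
    refine (hP' S O ⟨c2, s.q, s.mem, s.env, _⟩ a e4 fun r h2 hr => hq r h2 (by omega)).mono fun s' o h =>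
      h.mono (by omega) e5 (fun _ _ => rfl) (fun r h2 hr _ => hq r h2 hr) ?_ ?_ ?_
    all_goals simp; omega
  · simp only [List.head?_cons, if_true, cond_true]
    refine (hP S O ⟨c2, s.q, s.mem, s.env, _⟩ a e4 fun r h2 hr => hq r h2 (by omega)).mono fun s' o h =>
      h.mono (by omega) e5 (fun _ _ => rfl) (fun r h2 hr _ => hq r h2 hr) ?_ ?_ ?_
    all_goals simp; omega

/-- The results of an implementable process have polynomial length. -/
lemma size {g : Sem α β} (hg : Impl g) : ∃ p : ℕ[X], ∀ S O a w, ∀ o ∈ (g S O a w).support,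
    (enc o.1).length ≤ p.eval (enc a).length := by
  obtain ⟨P, M, p, hP⟩ := hg; refine ⟨p, fun S O a w o ho => ?_⟩
  have h := hP S O ⟨fun _ => enc a, fun r => if r = 0 then w.1 else [], w.2.2, w.2.1, 0⟩ a rfl
    (fun r h2 _ => by simp; omega)
  obtain ⟨s, _, hs⟩ := h.exists_left (b := o) (by simpa using ho); exact hs.size

lemma call (k : ℕ) {s : α → Str} {t : α → ℕ} (hs : PT s) (ht : PT t) : Impl fun _ O a => Act.call O
    k (s a) (t a) := by
  obtain ⟨f, ⟨P, M, p, hP⟩, hf⟩ := hs.pair ht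
  replace hP := hP.mono (M' := M + 4) (p' := p) (by omega) (by simp)
  generalize M + 4 = M, (by omega : 4 ≤ M + 4) = hM at hP
  refine ⟨.seq P (.seq (.instr (.fst 1 0)) (.seq (.instr (.snd 2 0))
    (.seq (.instr (.call k 3 1 2 2)) (.seq (.instr (.qlen 1 2))
      (.seq (.instr (.qmove 2 0 1)) (.instr (.pair 0 3 1))))))), M, 12 * p + 12,
    fun S O s0 a ha hq => ?_⟩
  refine lift_seq_computes hP fun c1 t1 o1 f1 l1 s1 =>
    lift_seq_instr trivial (lift_seq_instr trivial ?_)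
  rw [ha] at o1 l1 s1; rw [hf] at o1 s1
  have hlen : 2 * (s a).length + 1 + t a ≤ p.eval (enc a).length := by
    rw [length_enc_pair, enc_nat, length_unary] at s1; exact s1
  have hc0 : (enc (s a, t a)).length = 2 * (s a).length + 1 + t a := by
    rw [length_enc_pair, enc_nat, length_unary]; rfl
  have e1 : upd (upd c1 (.fst 1 0)) (.snd 2 0) 1 = s a := by
    simp [upd, o1, enc_pair, fstS_pairS, enc_str]
  have e2 : upd (upd c1 (.fst 1 0)) (.snd 2 0) 2 = unary (t a) := by
    simp [upd, o1, enc_pair, sndS_pairS, enc_nat]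
  have e3 : ∀ r, 3 ≤ r → upd (upd c1 (.fst 1 0)) (.snd 2 0) r = c1 r := fun r hr => by
    simp [upd, show r ≠ 1 by omega, show r ≠ 2 by omega]
  have e4 : costC c1 (.fst 1 0) = 1 + (2 * (s a).length + 1 + t a) := by
    simp [costC, cost, classicalState, o1, hc0]
  have e5 : costC (upd c1 (.fst 1 0)) (.snd 2 0) = 1 + (2 * (s a).length + 1 + t a) := by
    simp [costC, cost, classicalState, upd, o1, hc0]
  rw [e4, e5]; generalize upd (upd c1 (.fst 1 0)) (.snd 2 0) = c2 at *
  rw [Prog.run]; have hq2 : s0.q 2 = [] := hq 2 le_rfl (by omega)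
  simp only [Prog.run, Instr.effect, State.tick, bind_map, PMF.pure_bind,
    Function.comp_def, Act.call]
  rw [← PMF.bind_pure_comp]; refine Lift.bind (R := Eq) ?_ ?_
  · simp only [e1]; exact Lift.refl fun _ _ => rfl
  · rintro o _ rfl
    refine Lift.pure ⟨?_, ?_, fun r hr => ?_, fun r hr => ?_, fun r h2 hr => ?_, ?_, ?_, ?_⟩
    · simp [cost, e2, hq2, enc_pair, enc_nat, enc_str]
    · simp [cost, e2, hq2, State.setC, State.setQ]
    · simp [show r ≠ 0 by omega, show r ≠ 1 by omega, show r ≠ 3 by omega, e3 r (by omega), f1 r hr]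
    · simp [show r ≠ 0 by omega, show r ≠ 2 by omega]
    · by_cases h2' : r = 2
      · subst h2'; simp [hq2, e2]
      · simp [show r ≠ 0 by omega, h2', hq r h2 hr]
    · simp [cost, e1, e2, hq2]; omega
    · rw [length_enc_pair, enc_nat, length_unary, enc_str]; simp; omega
    · simp [e2, hq2]; omega

lemma iterP_coin {S : Type} (O : Oracle S) (k : ℕ) (s : State S) :
    iterP (fun s' => (Prog.instr (.coin 0)).run O (s'.tick 1)) k s = (uniformBits k).map fun r =>
        { s with c := update s.c 0 (r ++ s.c 0), time := s.time + 2 * k } := by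
  induction k generalizing s with
  | zero => simp [iterP, uniformBits_zero, pure_map]
  | succ k ih =>
    rw [iterP, uniformBits_succ, Prog.run, Instr.effect, bind_map, PMF.map_bind]; congr 1
    funext b
    rw [comp_apply, ih, map_comp]; congr 1
    funext r
    simp [State.setC, State.tick, cost, Function.update_idem]; ring

lemma coins {n : α → ℕ} (hn : PT n) : Impl fun _ _ a => lift (uniformBits (n a)) := by
  obtain ⟨f, ⟨P, M, p, hP⟩, hf⟩ := hn
  replace hP := hP.mono (M' := M + 4) (p' := p) (by omega) (by simp)
  generalize M + 4 = M, (by omega : 4 ≤ M + 4) = hM at hP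
  refine ⟨.seq P (.seq (.instr (.copy 1 0)) (.seq (.instr (.nil 0)) (.loop 1 (.instr (.coin 0))))),
    M, 4 * p + 4, fun S O s0 a ha hq => ?_⟩
  refine lift_seq_computes hP fun c1 t1 o1 f1 l1 s1 =>
    lift_seq_instr trivial (lift_seq_instr trivial ?_)
  rw [ha] at o1 l1 s1; rw [hf, enc_nat] at o1 s1; rw [length_unary] at s1; rw [Prog.run, iterP_coin]
  have e1 : (upd (upd c1 (.copy 1 0)) (.nil 0) 1).length = n a := by simp [upd, o1]
  simp only [e1, lift]
  refine Lift.map_same fun r hr => ⟨?_, rfl, fun r hr => ?_, fun _ _ => rfl, hq, ?_, ?_, ?_⟩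
  · simp [upd, enc_str]
  · simp [upd, show r ≠ 0 by omega, show r ≠ 1 by omega, f1 r hr]
  · simp [costC, cost, classicalState, o1]; omega
  · rw [enc_str, length_of_mem_uniformBits hr]; simp; omega
  · simp

end Impl

end

/-! ### Further implementable processes -/

/-- The program on the registers `w, w + 1, …`. -/
def Prog.shift (w : ℕ) (P : Prog) : Prog := P.subst (· + w) fun i => .instr (i.shift w)

lemma Prog.run_shift {SB : Type} {OB : Oracle SB} {P : Prog} {w M T : ℕ} (hP : P.NoCall)
    (hM : P.Below M) {a : State Unit} {b : State SB} (h : ShiftRel w M a b)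
    (hT : ∀ a' ∈ (P.run noOracle a).support, a'.time ≤ T) : Lift (fun a' b' => ShiftRel w M a' b' ∧
    (∀ r, r < w ∨ w + M ≤ r → b'.c r = b.c r) ∧ (∀ r, r < w ∨ w + M ≤ r → b'.q r = b.q r) ∧ b'.env =
    b.env ∧ b'.time + a.time = b.time + a'.time) (P.run noOracle a) ((P.shift w).run OB b) := by
  refine Prog.run_lift (I := Instr.NoCall) (M := M) (T := T) ?_ ?_ ?_ P hP.all hM a b
    ⟨h, fun _ _ => rfl, fun _ _ => rfl, rfl, rfl⟩ hT
  · exact fun a b r hr h => h.1.c r hr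
  · rintro a b k ⟨⟨h1, h2, h3⟩, hc, hq, he, ht⟩
    exact ⟨⟨h1, h2, h3⟩, hc, hq, he, by simp [State.tick]; omega⟩
  · rintro i a1 b1 hi hiM ⟨h1, hc, hq, he, ht⟩ _; rw [Prog.run, Instr.cost_shift hiM h1]
    have h2 : ShiftRel w M (a1.tick (i.cost a1)) (b1.tick (i.cost a1)) := ⟨h1.c, h1.q, h1.mem⟩
    refine (Instr.effect_shift hi hiM h2).mono fun a' b' h' => ⟨h'.1.1, fun r hr => ?_, fun r hr => ?_,
      h'.1.2.env.trans he, ?_⟩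
    · exact (h'.1.2.c r hr).trans (hc r hr)
    · exact (h'.1.2.q r hr).trans (hq r hr)
    · rw [h'.1.2.time, h'.2.2]; simp [State.tick]; omega

/-- Moves the qubits of the registers `w, …, w + m - 1` to register `1`. -/
def gather (w : ℕ) : ℕ → Prog
  | 0 => .instr (.nil 1)
  | m + 1 => .seq (gather w m) (.seq (.instr (.qlen 1 (w + m))) (.instr (.qmove (w + m) 1 1)))

lemma run_gather {S : Type} {O : Oracle S} {w : ℕ} (hw : 2 ≤ w) (m B : ℕ) {s : State S}
    (hB : ∀ r, w ≤ r → r < w + m → (s.q r).length ≤ B) : ∃ s' : State S, (gather w m).run O s =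
    PMF.pure s' ∧ (∀ r, r ≠ 1 → s'.c r = s.c r) ∧ (∀ r, w ≤ r → r < w + m → s'.q r = []) ∧
    (∀ r, r ≠ 1 → r < w ∨ w + m ≤ r → s'.q r = s.q r) ∧ s'.env = s.env ∧ s'.mem = s.mem ∧ s'.time ≤
    s.time + 1 + m * (2 + 2 * B) := by
  induction m with
  | zero =>
    refine ⟨_, rfl, fun r hr => ?_, fun r h1 h2 => by omega, fun _ _ _ => rfl, rfl, rfl, ?_⟩
    · simp [hr]
    · simp [cost]
  | succ m ih =>
    obtain ⟨s1, h1, hc, hq, hf, he, hm, ht⟩ := ih fun r h1 h2 => hB r h1 (by omega)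
    have e1 : s1.q (w + m) = s.q (w + m) := hf _ (by omega) (by omega)
    have e2 := hB (w + m) (by omega) (by omega)
    refine ⟨_, by rw [gather, Prog.run, h1, PMF.pure_bind, Prog.run, Prog.run, Instr.effect,
      PMF.pure_bind, Prog.run, Instr.effect], fun r hr => ?_, fun r h1 h2 => ?_, fun r hr h2 => ?_,
      ?_, ?_, ?_⟩
    · simp [hr, hc r hr]
    · by_cases h3 : r = w + m
      · subst h3; simp [show w + m ≠ 1 by omega]
      · simp [show r ≠ 1 by omega, h3, hq r h1 (by omega)]
    · simp [hr, show r ≠ w + m by omega, hf r hr (by omega)]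
    · exact he
    · exact hm
    · simp [cost, e1]; rw [add_mul]; omega

lemma lift_gather {S δ : Type} {O : Oracle S} {R : State S → δ → Prop} {o : δ} {w : ℕ} (hw : 2 ≤ w)
    {m B : ℕ} {s : State S} (hB : ∀ r, w ≤ r → r < w + m → (s.q r).length ≤ B) (h : ∀ s' : State S,
    (∀ r, r ≠ 1 → s'.c r = s.c r) → (∀ r, w ≤ r → r < w + m → s'.q r = []) → (∀ r, r ≠ 1 → r < w ∨ w
    + m ≤ r → s'.q r = s.q r) → s'.env = s.env → s'.mem = s.mem → s'.time ≤ s.time + 1 + m * (2 + 2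
    * B) → R s' o) : Lift R ((gather w m).run O s) (PMF.pure o) := by
  obtain ⟨s', h0, h1, h2, h3, h4, h5, h6⟩ := run_gather (O := O) hw m B hB; rw [h0]
  exact Lift.pure (h s' h1 h2 h3 h4 h5 h6)

/-- `k` repetitions of a random process. -/
def Act.iter {S α : Type} (g : α → Act S α) : ℕ → α → Act S α
  | 0, a => pure a
  | k + 1, a => g a >>= iter g k

namespace Impl

variable {α β γ σ : Type} [Code α] [Code β] [Code γ] [Code σ]

lemma encrypt_aux (D : CDSKE) : Impl fun _ _ (a : ℕ × Str × Str) => Act.encrypt D a.1 a.2.1 a.2.2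
    := by
  obtain ⟨MD, hMD⟩ := D.enc.prog.exists_below
  replace hMD := hMD.mono (M' := MD + 4) (by omega)
  have hM4 : 4 ≤ MD + 4 := by omega
  generalize MD + 4 = MD at hMD hM4; obtain ⟨pe, hpe⟩ := D.enc.poly
  obtain ⟨W, hW, hWe⟩ := FP.clear 7 MD
  refine ⟨.seq (.instr (.fst 4 0)) (.seq (.instr (.snd 0 0)) (.seq (.instr (.fst 5 0))
    (.seq (.instr (.snd 6 0)) (.seq W (.seq (D.enc.prog.shift 4) (.seq (.instr (.qlen 0 4))
    (.seq (.instr (.qmove 4 0 0)) (.seq (.instr (.pair 0 5 0)) (.seq (.instr (.pair 0 4 0))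
      (gather 4 MD)))))))))), MD + 8,
    C (40 + 10 * MD) * (X + 1 + pe), fun S O s a ha hq => ?_⟩
  obtain ⟨lam, sk, m⟩ := a
  refine lift_seq_instr trivial (lift_seq_instr trivial (lift_seq_instr trivial
    (lift_seq_instr trivial ?_)))
  rw [Prog.run, Prog.run_det hW, PMF.pure_bind]
  have ha' : s.c 0 = pairS (unary lam) (pairS sk m) := ha
  have hn : (enc (lam, sk, m)).length = 2 * lam + 1 + (2 * sk.length + 1 + m.length) := by
    rw [length_enc_pair, length_enc_pair, enc_nat, length_unary]; rfl
  have hq1 : ∀ r, 2 ≤ r → r < MD + 8 → s.q r = [] := hq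
  set n := (enc (lam, sk, m)).length with hn'
  set c1 := upd s.c (.fst 4 0) with hc1
  set c2 := upd c1 (.snd 0 0) with hc2
  set c3 := upd c2 (.fst 5 0) with hc3
  set c4 := upd c3 (.snd 6 0) with hc4
  have g1 : c1 0 = s.c 0 := by simp [hc1, upd]
  have g2 : c2 0 = pairS sk m := by simp [hc2, upd, g1, ha', sndS_pairS]
  have g3 : c3 0 = pairS sk m := by simp [hc3, upd, g2]
  have k1 : costC s.c (.fst 4 0) = 1 + n := by simp [costC, cost, classicalState, ha, hn']
  have k2 : costC c1 (.snd 0 0) = 1 + n := by simp [costC, cost, classicalState, g1, ha, hn']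
  have k3 : costC c2 (.fst 5 0) ≤ 1 + n := by
    simp [costC, cost, classicalState, g2, length_pairS]; omega
  have k4 : costC c3 (.snd 6 0) ≤ 1 + n := by
    simp [costC, cost, classicalState, g3, length_pairS]; omega
  have f4 : c4 4 = unary lam := by simp [hc4, hc3, hc2, hc1, upd, ha', fstS_pairS]
  have f5 : c4 5 = sk := by simp [hc4, hc3, upd, g2, fstS_pairS]
  have f6 : c4 6 = m := by simp [hc4, upd, g3, sndS_pairS]
  have f8 : ∀ r, 7 ≤ r → c4 r = s.c r := fun r hr => by
    simp [hc4, hc3, hc2, hc1, upd, show r ≠ 6 by omega, show r ≠ 5 by omega,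
      show r ≠ 0 by omega, show r ≠ 4 by omega]
  have hWc := hWe c4; rw [Prog.Ends] at hWc; obtain ⟨hWc, hWt⟩ := hWc; dsimp only
  generalize (W.det c4).1 = c5 at *
  generalize (W.det c4).2 = tW at *
  generalize costC s.c (.fst 4 0) = t1 at *
  generalize costC c1 (.snd 0 0) = t2 at *
  generalize costC c2 (.fst 5 0) = t3 at *
  generalize costC c3 (.snd 6 0) = t4 at *
  clear_value c1 c2 c3 c4
  set args : Fin 3 → Str := ![unary lam, sk, m] with hargs
  have hrel : ShiftRel 4 MD (start args [] s.mem ())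
      (⟨c5, s.q, s.mem, s.env, s.time + t1 + t2 + t3 + t4 + tW⟩ : State S) := by
    refine ⟨fun r hr => ?_, fun r hr => ?_, rfl⟩
    · dsimp only [start]; rw [hWc]; rcases r with _ | _ | _ | r
      · simp [f4, args]
      · simp [f5, args]
      · simp [f6, args]
      · rw [if_pos (by omega), dif_neg (by omega)]
    · dsimp only [start]; rw [hq1 _ (by omega) (by omega), ite_self]
  have hsum : ∑ k, (args k).length + ([] : List ℕ).length ≤ n := by
    simp [args, Fin.sum_univ_three]; omega
  have hT : ∀ a' ∈ (D.enc.prog.run noOracle (start args [] s.mem ())).support,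
      a'.time ≤ pe.eval n := fun a' ha' => (hpe args [] s.mem a' ha').trans (eval_mono pe hsum)
  have hsm : ∀ a' ∈ (D.enc.prog.run noOracle (start args [] s.mem ())).support, a'.Small n := by
    intro a' ha'; refine Prog.run_small _ (fun r => ?_) ha'; simp only [start]; refine ⟨?_, by simp⟩
    split
    · next h =>
      have := Finset.single_le_sum (f := fun k => (args k).length) (fun _ _ => Nat.zero_le _)
        (Finset.mem_univ (⟨r, h⟩ : Fin 3))
      have h0 : ([] : List ℕ).length = 0 := rfl; simp only [List.length_nil] at hsum; omega
    · simp
  rw [Act.encrypt, CDSKE.encDist, map_comp, ← PMF.bind_pure_comp]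
  refine lift_seq (Q := fun s' a' => _) (Lift.symm (Lift.mem
    (Prog.run_shift D.enc.noCall hMD hrel hT))) ?_
  rintro b a ⟨⟨h1, h2, h3, h4, h5⟩, ha, -⟩; have hta := hT a ha; have hsa := hsm a ha
  simp only [start] at h5
  have hlc : ∀ r, (a.c r).length ≤ n + 2 * pe.eval n := fun r => by have := (hsa r).1; omega
  have hlq : ∀ r, (a.q r).length ≤ n + 2 * pe.eval n := fun r => by have := (hsa r).2; omega
  have c0 : b.c 4 = a.c 0 := h1.c 0 (by omega); have c1' : b.c 5 = a.c 1 := h1.c 1 (by omega)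
  have q0 : b.q 4 = a.q 0 := h1.q 0 (by omega); have hb0 : b.q 0 = s.q 0 := h3 0 (by omega)
  have hl0 := hlc 0; have hl1 := hlc 1; have hl2 := hlq 0
  refine lift_seq_pure (s' := _) rfl (lift_seq_pure (s' := _) rfl
    (lift_seq_pure (s' := _) rfl (lift_seq_pure (s' := _) rfl ?_)))
  refine lift_gather (B := n + 2 * pe.eval n) (by omega) (fun r h1' h2' => ?_)
    fun s' r2 r3 r4 r5 r6 r7 => ?_
  · obtain ⟨r, rfl⟩ := Nat.exists_eq_add_of_le' h1'; have := hlq r; rw [← h1.q r (by omega)] at this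
    by_cases hr : r = 0
    · subst hr; simp
    · simpa [hr] using this
  · simp [cost, c0, c1', q0] at r2 r3 r4 r5 r6 r7; rw [length_pairS, length_unary] at r7
    refine ⟨?_, ?_, fun r hr => ?_, fun r hr => ?_, fun r h2' hr => ?_, ?_, ?_, ?_⟩
    · rw [r2 0 (by omega)]; simp [enc_pair, enc_str, enc_nat]
    · rw [r4 0 (by omega) (by omega), r5, r6]; simp [hb0, h4, h1.mem, State.setC, State.setQ, State.tick]
    · rw [r2 r (by omega)]
      simp [show r ≠ 0 by omega, h2 r (by omega), hWc, show ¬ r ≤ 7 + MD by omega, f8 r (by omega)]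
    · rw [r4 r (by omega) (by omega)]
      simp [show r ≠ 0 by omega, show r ≠ 4 by omega, h3 r (by omega)]
    · by_cases h' : r < 4
      · rw [r4 r (by omega) (by omega)]
        simp [show r ≠ 0 by omega, show r ≠ 4 by omega, h3 r (by omega), hq r h2' hr]
      · by_cases h'' : r < 4 + MD
        · exact r3 r (by omega) h''
        · rw [r4 r (by omega) (by omega)]
          simp [show r ≠ 0 by omega, show r ≠ 4 by omega, h3 r (by omega), hq r h2' hr]
    · have e1 := Nat.mul_le_mul_left MD (show 2 + 2 * (n + 2 * pe.eval n) ≤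
        6 * (n + 1 + pe.eval n) by omega)
      have e2 := Nat.le_mul_of_pos_right MD (show 0 < n + 1 + pe.eval n by omega)
      have e3 : eval n (C (40 + 10 * MD) * (X + 1 + pe)) =
          40 * (n + 1 + pe.eval n) + 10 * (MD * (n + 1 + pe.eval n)) := by
        simp; ring
      rw [e3]
      rw [show MD * (6 * (n + 1 + pe.eval n)) = 6 * (MD * (n + 1 + pe.eval n)) by ring] at e1; omega
    · rw [length_enc_pair, length_enc_pair, enc_str, enc_str, enc_nat, length_unary]
      simp only [eval_mul, eval_C, eval_add, eval_X, eval_one]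
      refine le_trans ?_ (Nat.mul_le_mul_right _ (Nat.le_add_right 40 (10 * MD)))
      change 2 * (a.c 0).length + 1 + (2 * (a.c 1).length + 1 + (a.q 0).length) ≤ _; omega
    · rw [r4 0 (by omega) (by omega)]; simp only [eval_mul, eval_C, eval_add, eval_X, eval_one]
      have := Nat.mul_le_mul_right (n + 1 + pe.eval n) (Nat.le_add_right 40 (10 * MD)); simp [hb0]
      omega

lemma encrypt (D : CDSKE) {lam : α → ℕ} {sk m : α → Str} (hl : PT lam) (hs : PT sk) (hm : PT m) :
    Impl fun _ _ a => Act.encrypt D (lam a) (sk a) (m a) :=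
  (encrypt_aux D).comp (f := fun a => (lam a, sk a, m a)) fp

/-- Loops whose states have polynomial size. -/
lemma iter {n : α → ℕ} {init : α → σ} {g : Sem σ σ} (hn : PT n) (hi : PT init) (hg : Impl g)
    (J : α → ℕ → σ → Prop) (B : ℕ[X]) (h0 : ∀ a, J a 0 (init a)) (h1 : ∀ a k u, k < n a → J a k u →
    ∀ S O w, ∀ o ∈ (g S O u w).support, J a (k + 1) o.1) (hB : ∀ a k u, k ≤ n a → J a k u → (enc
    u).length ≤ B.eval (enc a).length) : Impl fun S O a => Act.iter (g S O) (n a) (init a) := by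
  obtain ⟨f, ⟨P, M, p, hP⟩, hf⟩ := hn.pair hi; obtain ⟨G, M', p', hG⟩ := hg
  replace hP := hP.mono (M' := M + M' + 4) (p' := p) (by omega) (by simp)
  replace hG := hG.mono (M' := M + M' + 4) (p' := p') (by omega) (by simp)
  have hM : 4 ≤ M + M' + 4 := by omega
  generalize M + M' + 4 = M at *
  refine ⟨.seq P (.seq (.instr (.fst M 0)) (.seq (.instr (.snd 0 0)) (.loop M G))), M + 1,
    4 * p + 4 + B + p * (1 + p'.comp B), fun S O s a ha hq => ?_⟩
  change Lift _ _ (Act.iter (g S O) (n a) (init a) (s.q 0, s.env, s.mem))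
  refine lift_seq_computes hP fun c1 t1 o1 f1 l1 s1 =>
    lift_seq_instr trivial (lift_seq_instr trivial ?_)
  rw [ha] at o1 l1 s1; rw [hf] at o1 s1; have hB' := hB a; set N := (enc a).length with hN
  rw [length_enc_pair, enc_nat, length_unary] at s1
  have o1' : c1 0 = pairS (unary (n a)) (enc (init a)) := o1
  have lc : (c1 0).length = 2 * n a + 1 + (enc (init a)).length := by
    rw [o1', length_pairS, length_unary]
  have e1 : upd (upd c1 (.fst M 0)) (.snd 0 0) M = unary (n a) := by
    simp [upd, o1', fstS_pairS, show M ≠ 0 by omega]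
  have e2 : upd (upd c1 (.fst M 0)) (.snd 0 0) 0 = enc (init a) := by
    simp [upd, o1', sndS_pairS, show 0 ≠ M by omega]
  have e3 : ∀ r, M + 1 ≤ r → upd (upd c1 (.fst M 0)) (.snd 0 0) r = s.c r := by
    intro r hr; simp [upd, show r ≠ 0 by omega, show r ≠ M by omega, f1 r (by omega)]
  have k1 : costC c1 (.fst M 0) = 1 + (2 * n a + 1 + (enc (init a)).length) := by
    simp [costC, cost, classicalState, lc]
  have k2 : costC (upd c1 (.fst M 0)) (.snd 0 0) = 1 + (2 * n a + 1 + (enc (init a)).length) := by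
    simp [costC, cost, classicalState, upd, lc, show 0 ≠ M by omega]
  rw [k1, k2]; generalize upd (upd c1 (.fst M 0)) (.snd 0 0) = c2 at *
  rw [Prog.run]; simp only [e1, length_unary]
  have key : ∀ k j u (s1 : State S), j + k = n a → J a j u → s1.c 0 = enc u →
      (∀ r, 2 ≤ r → r < M + 1 → s1.q r = []) →
      Lift (fun s' o => s'.c 0 = enc o.1 ∧ o.2 = (s'.q 0, s'.env, s'.mem) ∧
          (∀ r, M + 1 ≤ r → s'.c r = s1.c r) ∧ (∀ r, M + 1 ≤ r → s'.q r = s1.q r) ∧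
          (∀ r, 2 ≤ r → r < M + 1 → s'.q r = []) ∧
          s'.time ≤ s1.time + k * (1 + p'.eval (B.eval N)) ∧
          (enc o.1).length ≤ B.eval N ∧
          (s'.q 0).length ≤ (s1.q 0).length + k * (1 + p'.eval (B.eval N)))
        (iterP (fun s' => G.run O (s'.tick 1)) k s1)
        (Act.iter (g S O) k u (s1.q 0, s1.env, s1.mem)) := by
    intro k
    induction k with
    | zero =>
      intro j u s1 hj hJ hu hq1
      exact Lift.pure ⟨hu, rfl, fun _ _ => rfl, fun _ _ => rfl, hq1, by simp,
        hB' j u (by omega) hJ, by simp⟩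
    | succ k ih =>
      intro j u s1 hj hJ hu hq1; rw [iterP, Act.iter, bind_run]
      have h2 := (hG S O (s1.tick 1) u hu fun r h2 hr => hq1 r h2 (by omega)).mem
      refine h2.bind fun s2 o ⟨h3, hs2, ho⟩ => ?_
      have hw := h3.world; have hz := eval_mono p' (hB' j u (by omega) hJ)
      have h4 := ih (j + 1) o.1 s2 (by omega) (h1 a j u (by omega) hJ _ _ _ o ho) h3.out
        (fun r h2 hr => by
          by_cases hr' : r < M
          · exact h3.clean r h2 hr'
          · rw [h3.frame_q r (by omega)]; exact hq1 r h2 hr)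
      rw [← hw] at h4
      refine h4.mono fun s3 o3 ⟨a1, a2, a3, a4, a5, a6, a7, a8⟩ => ⟨a1, a2, fun r hr => ?_,
        fun r hr => ?_, a5, ?_, a7, ?_⟩
      · rw [a3 r hr, h3.frame_c r (by omega)]; rfl
      · rw [a4 r hr, h3.frame_q r (by omega)]; rfl
      · have := h3.time; simp only [State.tick] at this; rw [add_one_mul]; omega
      · have := h3.qubits; simp only [State.tick] at this; rw [add_one_mul]; omega
  refine Lift.mono (key (n a) 0 (init a) _ (by omega) (h0 a) ?_ ?_) fun s' o ⟨a1, a2, a3, a4, a5, a6, a7, a8⟩ => ⟨a1, a2, fun r hr => ?_,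
    fun r hr => ?_, a5, ?_, ?_, ?_⟩
  · exact e2
  · exact hq
  · rw [a3 r hr]; exact e3 r hr
  · exact a4 r hr
  all_goals
    have := Nat.mul_le_mul_right (1 + p'.eval (B.eval N)) (show n a ≤ p.eval N by omega)
    have hev : eval N (4 * p + 4 + B + p * (1 + p'.comp B)) =
        4 * p.eval N + 4 + B.eval N + p.eval N * (1 + p'.eval (B.eval N)) := by simp
    rw [hev]; simp only [State.tick] at a6 a8; omega

end Impl

namespace PT

variable {α β γ δ : Type} [Code α] [Code β] [Code γ] [Code δ]

@[fun_prop] lemma tail {f : α → List β} (hf : PT f) : PT fun a => (f a).tail :=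
  hf.encode.sndS.of_enc_eq fun a => by
    cases f a with
    | nil => rfl
    | cons b l => exact sndS_pairS _ _

@[fun_prop] lemma headI [Inhabited β] {f : α → List β} (hf : PT f) : PT fun a => (f a).headI := by
  obtain ⟨g, hg, h⟩ := hf.encode.fstS
  have h' : PT fun a => _root_.cond (f a).isEmpty (enc (default : β)) (Skl.fstS (enc (f a))) :=
    hf.isNil.cond (const _) hf.encode.fstS
  refine h'.of_enc_eq fun a => ?_
  cases f a with
  | nil => rfl
  | cons b l => exact fstS_pairS _ _

/-- Composition with a polynomial-time function of bit strings; `ν` reads the arguments. -/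
lemma of_polyTime {ι : Type} {n : ℕ} {args : ι → Fin n → Str} {out : ι → Str}
    (h : PolyTime args out) (ν : (Fin n → Str) → ι)
    (hν : ∀ k, ∃ f, FP f ∧ ∀ v, args (ν v) k = f (v k)) (hinv : ∀ i, ν (args i) = i) {φ : α → ι}
    (hφ : ∀ k, PT fun a => args (φ a) k) : PT fun a => out (φ a) := by
  choose g hg hgφ using hφ
  refine ⟨_, FP.of_polyTime h (fun x => ν fun k => g k x) fun k => ?_, fun a => ?_⟩
  · obtain ⟨f, hf, hfk⟩ := hν k; simp only [hfk]; exact hf.comp (hg k)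
  · simp only [hgφ, enc_str]; rw [hinv]

lemma coins {n : ℕ} (A : PPT n) {args : α → Fin n → Str} (h : ∀ k, PT fun a => args a k) : PT fun a
    => A.coins (args a) := by
  have : PT fun a => Skl.unary (A.coins (args a)) :=
    of_polyTime A.coins_poly (fun v => v) (fun k => ⟨_, FP.id, fun _ => rfl⟩) (fun _ => rfl) h
  exact this.of_enc_eq fun _ => rfl

lemma out {n : ℕ} (A : PPT n) {args : α → Fin n → Str} {r : α → Str} (h : ∀ k, PT fun a => args a k)
    (hr : PT r) : PT fun a => A.out (args a) (r a) := by
  refine of_polyTime A.out_poly (φ := fun a => (args a, r a)) (fun v => (fun k => v k.succ, v 0))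
    (fun k => ⟨_, FP.id, fun v => ?_⟩) (fun _ => rfl) fun k => ?_
  · cases k using Fin.cases <;> rfl
  · cases k using Fin.cases with
    | zero => exact hr
    | succ k => exact h k

@[fun_prop] lemma plaintext (C : FunctionClass) {lam : α → ℕ} {f : α → Str} (hl : PT lam)
    (hf : PT f) : PT fun a => C.X (lam a) (f a) := by
  have : PT fun a => [C.X (lam a) (f a)] := by
    refine of_polyTime C.X_poly (φ := fun a => (lam a, f a)) (fun v => ((v 0).length, v 1))
      (fun k => ?_) (fun i => by simp) fun k => ?_
    · fin_cases k
      · exact ⟨_, FP.id.unaryLength, fun _ => rfl⟩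
      · exact ⟨_, FP.id, fun _ => rfl⟩
    · fin_cases k
      · exact hl.unary
      · exact hf
  exact this.of_enc_eq fun _ => rfl

@[fun_prop] lemma function (C : FunctionClass) {lam : α → ℕ} {f : α → Str} (hl : PT lam) (hf : PT f)
    : PT fun a => C.F (lam a) (f a) := by
  have : PT fun a => [C.F (lam a) (f a)] := by
    refine of_polyTime C.F_poly (φ := fun a => (lam a, f a)) (fun v => ((v 0).length, v 1))
      (fun k => ?_) (fun i => by simp) fun k => ?_
    · fin_cases k
      · exact ⟨_, FP.id.unaryLength, fun _ => rfl⟩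
      · exact ⟨_, FP.id, fun _ => rfl⟩
    · fin_cases k
      · exact hl.unary
      · exact hf
  exact this.of_enc_eq fun _ => rfl

@[fun_prop] lemma evalC (C : FunctionClass) {lam : α → ℕ} {f x : α → Str} (hl : PT lam) (hf : PT f)
    (hx : PT x) : PT fun a => C.eval (lam a) (f a) (x a) := by
  refine of_polyTime C.eval_poly (φ := fun a => (lam a, f a, x a))
    (fun v => ((v 0).length, v 1, v 2)) (fun k => ?_) (fun i => by simp) fun k => ?_
  · fin_cases k
    · exact ⟨_, FP.id.unaryLength, fun _ => rfl⟩
    · exact ⟨_, FP.id, fun _ => rfl⟩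
    · exact ⟨_, FP.id, fun _ => rfl⟩
  · fin_cases k
    · exact hl.unary
    · exact hf
    · exact hx

end PT

namespace Act

variable {S α β γ : Type}

instance : LawfulMonad (Act S) := LawfulMonad.mk' (id_map := fun x => by
    funext w
    change (x w).bind (fun o => PMF.pure (o.1, o.2)) = x w; exact PMF.bind_pure _)
  (pure_bind := fun a f => by funext w; exact PMF.pure_bind _ _)
  (bind_assoc := fun x f g => by funext w; exact PMF.bind_bind _ _ _)

lemma lift_bind (μ : PMF α) (f : α → PMF β) : lift (S := S) (μ.bind f) = lift μ >>= fun a => lift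
    (f a) := by
  funext w
  simp only [lift, bind_run, PMF.map_bind, bind_map]; rfl

lemma lift_pure (a : α) : lift (S := S) (PMF.pure a) = pure a := by
  funext w
  simp only [lift, pure_map]; rfl

lemma lift_map (μ : PMF α) (f : α → β) : lift (S := S) (μ.map f) = lift μ >>= fun a => pure (f a)
    := by
  rw [← PMF.bind_pure_comp, lift_bind]; simp only [comp_apply, lift_pure]

/-- One step of `mapA`, as a loop. -/
def mapStep [Inhabited β] (g : α → β → Act S γ) (u : α × List β × List γ) : Act S
    (α × List β × List γ) :=
  cond u.2.1.isEmpty (pure u) (g u.1 u.2.1.headI >>= fun y => pure (u.1, u.2.1.tail, u.2.2 ++ [y]))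

lemma iter_mapStep [Inhabited β] (g : α → β → Act S γ) (a : α) (l : List β) (acc : List γ) : iter
    (mapStep g) l.length (a, l, acc) = mapA (g a) l >>= fun bs => pure (a, [], acc ++ bs) := by
  induction l generalizing acc with
  | nil => simp [iter, mapA]
  | cons b l ih => simp [iter, mapA, mapStep, ih]

end Act

namespace Impl

variable {α β γ : Type} [Code α] [Code β] [Code γ]

lemma ppt {n : ℕ} (A : PPT n) {args : α → Fin n → Str} (h : ∀ k, PT fun a => args a k) : Impl fun _
    _ a => lift (A.dist (args a)) := by
  have h1 := (coins (PT.coins A h)).bind (g' := fun _ _ a r => Pure.pure (A.out (args a) r))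
    (Impl.pure (f := fun x : α × Str => A.out (args x.1) x.2)
      (PT.out A (fun k => (h k).comp PT.id.fst) fp))
  exact h1.congr fun S O a w => by rw [PPT.dist, Act.lift_map]

lemma mapA [Inhabited β] {l : α → List β} {g : ∀ S : Type, Oracle S → α → β → Act S γ} (hl : PT l)
    (hg : Impl fun S O (x : α × β) => g S O x.1 x.2) : Impl fun S O a => Act.mapA (g S O a) (l a)
    := by
  obtain ⟨ql, hql⟩ := hl.size; obtain ⟨pg, hpg⟩ := hg.size
  have hstep : Impl fun S O (u : α × List β × List γ) => Act.mapStep (g S O) u := by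
    refine Impl.cond (PT.isNil fp) (Impl.pure PT.id) ?_
    refine Impl.bind (Impl.comp (f := fun u : α × List β × List γ => (u.1, u.2.1.headI)) hg fp) ?_
    refine Impl.pure (f := fun x : (α × List β × List γ) × γ =>
      (x.1.1, x.1.2.1.tail, x.1.2.2 ++ [x.2])) ?_
    exact PT.pair fp (PT.pair fp (PT.append fp (PT.cons fp (PT.const []))))
  have h := Impl.iter (n := fun a => (l a).length) (init := fun a => (a, l a, ([] : List γ)))
    hl.length fp hstep
    (fun a k u => u.1 = a ∧ u.2.1 = (l a).drop k ∧ u.2.2.length = k ∧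
      ∀ y ∈ u.2.2, (enc y).length ≤ pg.eval (2 * (enc a).length + 1 + ql.eval (enc a).length))
    (2 * X + 1 + 2 * ql + 1 + ql * (2 * pg.comp (2 * X + 1 + ql) + 1))
    (fun a => ⟨rfl, rfl, rfl, by simp⟩) ?_ ?_
  · refine (h.bind (g' := fun S O a u => Pure.pure u.2.2) (Impl.pure
      (f := fun x : α × α × List β × List γ => x.2.2.2) fp)).congr fun S O a w => ?_
    simp [Act.iter_mapStep]
  · rintro a k ⟨a', r, acc⟩ hk ⟨h1, h2, h3, h4⟩ S O w o ho; dsimp only at *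
    subst h1 h2; have hne : (l a').drop k ≠ [] := by simpa using hk
    obtain ⟨b, t, hbt⟩ := List.exists_cons_of_ne_nil hne
    have hmem : b ∈ l a' := List.mem_of_mem_drop (i := k) (by rw [hbt]; simp)
    rw [Act.mapStep] at ho
    simp only [hbt, List.isEmpty_cons, cond_false, List.headI_cons, tail_cons,
      bind_run, pure_run, mem_support_bind_iff, support_pure,
      mem_singleton_iff] at ho
    obtain ⟨y, hy, rfl⟩ := ho; refine ⟨rfl, ?_, by simp [h3], fun z hz => ?_⟩
    · rw [← List.tail_drop, hbt]; rfl
    · rw [mem_append, mem_singleton] at hz; obtain hz | rfl := hz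
      · exact h4 z hz
      · refine (hpg S O (a', b) w y hy).trans (eval_mono pg ?_); rw [length_enc_pair]
        have := (length_enc_mem hmem).trans (hql a'); omega
  · rintro a k ⟨a', r, acc⟩ hk ⟨h1, h2, h3, h4⟩; dsimp only at *
    subst h1 h2; have h5 := length_enc_le h4
    have h6 : (enc ((l a').drop k)).length ≤ (enc (l a')).length := by
      conv_rhs => rw [← List.take_append_drop k (l a'), enc_append]
      simp
    have h7 := hql a'; have h8 := length_le_enc (l a'); rw [h3] at h5
    rw [length_enc_pair, length_enc_pair]
    have h9 := Nat.mul_le_mul_right (2 * pg.eval (2 * (enc a').length + 1 +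
      ql.eval (enc a').length) + 1) (show k ≤ ql.eval (enc a').length by omega)
    simp; omega

end Impl

/-! ### Machines that answer the oracle calls of another machine -/

/-- The number of an oracle call (`0` for other instructions). -/
def Instr.number : Instr → ℕ
  | call k _ _ _ _ => k
  | _ => 0

lemma Prog.All.mono {I J : Instr → Prop} (h : ∀ i, I i → J i) : ∀ {P : Prog}, P.All I → P.All J
  | instr i, hP => h i hP
  | seq _ _, hP => ⟨hP.1.mono h, hP.2.mono h⟩
  | ifTrue _ _ _, hP => ⟨hP.1.mono h, hP.2.mono h⟩
  | ifNil _ _ _, hP => ⟨hP.1.mono h, hP.2.mono h⟩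
  | loop _ p, hP => Prog.All.mono (P := p) h hP

lemma Prog.exists_number (P : Prog) : ∃ K, P.All fun i => i.number < K := by
  induction P with
  | instr i => exact ⟨i.number + 1, Nat.lt_succ_self i.number⟩
  | loop _ p h => exact h
  | seq p p' h h' | ifTrue _ p p' h h' | ifNil _ p p' h h' =>
    obtain ⟨K, h⟩ := h; obtain ⟨K', h'⟩ := h'
    exact ⟨K + K', h.mono fun _ _ => by omega, h'.mono fun _ _ => by omega⟩

/-- Processes that answer oracle calls, given the private state and the query. -/
abbrev Handlers (α : Type) := ℕ → Sem (α × Str) (Str × α)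

/-- The oracle that consists of the private state of the handlers and an inner oracle. -/
def Handlers.oracle {α S : Type} (h : Handlers α) (O : Oracle S) : Oracle (α × S) :=
  fun k x e m => (h k S O (e.1, x) ([], e.2, m)).map fun o =>
    ((o.1.1, o.2.1), (o.1.2, o.2.2.1), o.2.2.2)

section

variable {α S : Type} [Code α] {O : Oracle S}

/-- Relation between a state `a` of a machine with handlers and a state `b` of the machine that
runs both: register `w - 1` contains the private state. -/
structure SimRel (w M : ℕ) (Inv : ℕ → α → Prop) (c K : ℕ) (a : State (α × S)) (b : State S) :
    Prop where
  rel : ShiftRel w M a b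
  env : b.env = a.env.2
  priv : b.c (w - 1) = enc a.env.1
  clean : ∀ r, r ≠ 1 → r < w → b.q r = []
  inv : ∃ j ≤ a.time, Inv j a.env.1
  time : b.time ≤ c + K * a.time

/-- Distributes the result of a handler, an encoded pair in register `0`: the private state goes
to `c h`, and the reply, cut to length `|c t|`, to `c r` and `q d`. -/
def returnProg (h r t d : ℕ) : Prog :=
  .seq (.instr (.snd h 0)) (.seq (.instr (.fst 0 0)) (.seq (.instr (.qmove 0 d t))
    (.seq (.instr (.qlen 2 0)) (.seq (.instr (.qmove 0 1 2)) (.instr (.take r 0 t))))))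

lemma lift_returnProg {δ : Type} {R : State S → δ → Prop} {o : δ} {h r t d : ℕ} (h0 : h ≠ 0)
    (h2 : h ≠ 2) (hr : h ≠ r) (r0 : r ≠ 0) (t0 : t ≠ 0) (t2 : t ≠ 2) (ht : t ≠ h) (d0 : d ≠ 0)
    (d1 : d ≠ 1) {s : State S} (hR : ∀ s' : State S, s'.c h = sndS (s.c 0) → s'.c r = (fstS (s.c
    0)).take (s.c t).length → (∀ x, x ≠ 0 → x ≠ 2 → x ≠ h → x ≠ r → s'.c x = s.c x) → s'.q 0 = [] →
    s'.q d = s.q d ++ (s.q 0).take (s.c t).length → (∀ x, x ≠ 0 → x ≠ 1 → x ≠ d → s'.q x = s.q x) →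
    s'.env = s.env → s'.mem = s.mem → s'.time ≤ s.time + 6 + 3 * (s.c 0).length + 2 * (s.c t).length
    + 2 * (s.q 0).length → R s' o) : Lift R ((returnProg h r t d).run O s) (PMF.pure o) := by
  refine lift_seq_pure (s' := _) rfl (lift_seq_pure (s' := _) rfl (lift_seq_pure (s' := _) rfl
    (lift_seq_pure (s' := _) rfl (lift_seq_pure (s' := _) rfl (lift_instr trivial (Lift.pure
    (hR _ ?_ ?_ (fun x x0 x2 xh xr => ?_) ?_ ?_ (fun x x0 x1 xd => ?_) rfl rfl ?_)))))))
  · simp [upd, h0, h2, hr]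
  · simp [upd, h0.symm, t0, t2, ht]
  · simp [upd, x0, x2, xh, xr]
  · simp [d0.symm, h0.symm, t0, ht]; omega
  · simp [d0, d1, h0.symm, t0, ht]
  · simp [x0, x1, xd]
  · have := length_fstS_le (s.c 0)
    simp [costC, classicalState, cost, h0.symm, t0, t2, ht, d0.symm]; omega

/-- The program for an oracle call that is answered by the program `P`. -/
def callProg (w : ℕ) (P : Prog) (r s t d : ℕ) : Prog :=
  .seq (.instr (.pair 0 (w - 1) (s + w))) (.seq P (returnProg (w - 1) (r + w) (t + w) (d + w)))

lemma lift_callProg {h : Handlers α} {k w M : ℕ} {p : ℕ[X]} {P : Prog}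
    (hP : Implements P (w - 1) p (h k)) (hw : 4 < w) {Inv : ℕ → α → Prop} {c K B T : ℕ} (hInv : ∀ j
    a x u, ∀ o ∈ (h k S O (a, x) u).support, Inv j a → x.length ≤ T → Inv (j + 1) o.1.2)
    (hB : ∀ j a, j ≤ T → Inv j a → (enc a).length ≤ B)
    (hK : 20 + B + 4 * T + 8 * p.eval (2 * B + 1 + T) ≤ K) {r s t d : ℕ} {a : State (α × S)}
    {b : State S} (hi : (Instr.call k r s t d).Below M) (hab : SimRel w M Inv c K a b)
    (hT : a.time + (Instr.call k r s t d).cost a ≤ T) : Lift (SimRel w M Inv c K) ((Instr.call k r s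
    t d).effect (h.oracle O) (a.tick ((Instr.call k r s t d).cost a)))
    ((callProg w P r s t d).run O b) := by
  simp only [Instr.Below, Instr.regs, List.forall_mem_cons, List.not_mem_nil,
    false_imp_iff, implies_true, and_true] at hi
  obtain ⟨hr, hs, ht, hd⟩ := hi; obtain ⟨j, hj, hinv⟩ := hab.inv; simp only [cost] at hT
  have hBa := hB j _ (by omega) hinv; have cs := hab.rel.c s hs; have ct := hab.rel.c t ht
  have q0 := hab.clean 0 (by omega) (by omega); refine Lift.symm ?_
  rw [Instr.effect, Handlers.oracle, map_comp, ← PMF.bind_pure_comp]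
  refine lift_seq_instr trivial ?_
  have e0 : upd b.c (.pair 0 (w - 1) (s + w)) 0 = enc (a.env.1, a.c s) := by
    simp [upd, hab.priv, cs, enc_pair, enc_str]
  have ef : ∀ x, x ≠ 0 → upd b.c (.pair 0 (w - 1) (s + w)) x = b.c x := fun x hx => by
    simp [upd, hx]
  have ek : costC b.c (.pair 0 (w - 1) (s + w)) = 1 + (enc a.env.1).length + (a.c s).length
    := by simp [costC, cost, classicalState, hab.priv, cs]
  generalize upd b.c (.pair 0 (w - 1) (s + w)) = c1 at *
  rw [ek]
  have hrun := hP S O ⟨c1, b.q, b.mem, b.env, b.time + (1 + (enc a.env.1).length +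
    (a.c s).length)⟩ (a.env.1, a.c s) e0
    (fun x h2 hx => hab.clean x (by omega) (by omega))
  have hz : p.eval (enc (a.env.1, a.c s)).length ≤ p.eval (2 * B + 1 + T) := eval_mono p (by
    rw [length_enc_pair, enc_str]; omega)
  dsimp only at hrun
  rw [show (b.q 0, b.env, b.mem) = ([], a.env.2, a.mem) by rw [q0, hab.env, hab.rel.mem]] at hrun
  refine lift_seq (Lift.mem hrun) ?_; rintro s2 ⟨⟨rep, a'⟩, qs, e', m'⟩ ⟨h2, hs2, ho⟩
  have hw2 := h2.world; have ho2 := h2.out; simp only [Prod.mk.injEq] at hw2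
  obtain ⟨rfl, rfl, rfl⟩ := hw2; have hsz := h2.size; have hqb := h2.qubits; have htm := h2.time
  rw [q0] at hqb
  have fw : s2.c (t + w) = a.c t := by
    rw [h2.frame_c _ (by omega)]; exact (ef _ (by omega)).trans ct
  have e5 : enc (rep, a') = pairS rep (enc a') := rfl; rw [e5] at ho2 hsz
  have l1 := length_fstS_le (pairS rep (enc a')); rw [fstS_pairS] at l1
  simp only [List.length_nil, zero_add] at hqb
  refine lift_returnProg (by omega) (by omega) (by omega)
    (by omega) (by omega) (by omega) (by omega) (by omega) (by omega)
    fun s3 ch cr cx qz qd qx en me ti => ?_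
  rw [ho2, sndS_pairS] at ch; rw [ho2, fstS_pairS, fw] at cr; rw [fw] at qd; rw [ho2, fw] at ti
  refine ⟨⟨fun x hx => ?_, fun x hx => ?_, ?_⟩, ?_, ?_, fun x h1 hx => ?_, ?_, ?_⟩
  · by_cases hxr : x = r
    · subst hxr; simp [cr]
    · rw [cx _ (by omega) (by omega) (by omega) (by omega), h2.frame_c _ (by omega)]
      simpa [hxr] using (ef _ (by omega)).trans (hab.rel.c x hx)
  · by_cases hxr : x = d
    · subst hxr; simp [qd, h2.frame_q (x + w) (by omega), hab.rel.q x hx]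
    · rw [qx _ (by omega) (by omega) (by omega), h2.frame_q _ (by omega)]
      simpa [hxr] using hab.rel.q x hx
  · simp [me]
  · simp [en]
  · simp [ch]
  · by_cases hx0 : x = 0
    · subst hx0; exact qz
    · rw [qx x hx0 h1 (by omega)]
      by_cases hx' : x < w - 1
      · exact h2.clean x (by omega) hx'
      · rw [h2.frame_q x (by omega)]; exact hab.clean x h1 hx
  · exact ⟨j + 1, by simp [State.tick, cost]; omega,
      hInv j _ _ _ _ ho hinv (show (a.c s).length ≤ T by omega)⟩
  · have h3 := hab.time
    have h4 : K ≤ K * (1 + (a.c s).length + (a.c t).length) := Nat.le_mul_of_pos_right _ (by omega)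
    change s3.time ≤ c + K * (a.time + (1 + (a.c s).length + (a.c t).length)); rw [mul_add]
    dsimp only at htm; omega

lemma SimRel.tick {w M : ℕ} {Inv : ℕ → α → Prop} {c K : ℕ} (hK : 1 ≤ K) {a : State (α × S)}
    {b : State S} (h : SimRel w M Inv c K a b) (k : ℕ) : SimRel w M Inv c K (a.tick k) (b.tick k)
    where
  rel := ⟨h.rel.c, h.rel.q, h.rel.mem⟩
  env := h.env
  priv := h.priv
  clean := h.clean
  inv := by obtain ⟨j, hj, hi⟩ := h.inv; exact ⟨j, hj.trans (Nat.le_add_right _ _), hi⟩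
  time := by
    have := h.time; have h2 : k ≤ K * k := Nat.le_mul_of_pos_left k hK
    simp only [State.tick_time, mul_add]; omega

lemma lift_shift_simRel {O' : Oracle (α × S)} {w M : ℕ} (hw : 0 < w) {Inv : ℕ → α → Prop} {c K : ℕ}
    (hK : 1 ≤ K) {i : Instr} (hn : i.NoCall) (hi : i.Below M) {a : State (α × S)} {b : State S}
    (hab : SimRel w M Inv c K a b) : Lift (SimRel w M Inv c K) (i.effect O' (a.tick (i.cost a)))
    ((Prog.instr (i.shift w)).run O b) := by
  rw [Prog.run, Instr.cost_shift hi hab.rel]; have h := hab.tick hK (i.cost a)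
  refine (Instr.effect_shift hn hi h.rel).mono fun a' b' h' => ?_
  obtain ⟨⟨h1, h2⟩, he, ht⟩ := h'; refine ⟨h1, ?_, ?_, fun r hr hw => ?_, ?_, ?_⟩
  · rw [h2.env, h.env, he]
  · rw [h2.c _ (by omega), h.priv, he]
  · rw [h2.q _ (by omega), h.clean r hr hw]
  · rw [ht, he]; exact h.inv
  · rw [h2.time, ht]; exact h.time

end

/-- The program that runs a machine on the registers `w, w + 1, …` and answers the calls by the
programs `P`. -/
def Prog.withHandlers (w : ℕ) (P : ℕ → Prog) (A : Prog) : Prog :=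
  A.subst (· + w) fun
    | .call k r s t d => callProg w (P k) r s t d
    | i => .instr (i.shift w)

/-- The machine that samples a private state, runs the machine `A` with handlers, and computes its
output from the final private state and the output of `A`. -/
def reductionProg (w : ℕ) (PI : Prog) (P : ℕ → Prog) (A PF : Prog) : Prog :=
  .seq (.instr (.copy w 0)) (.seq PI (.seq (.instr (.copy (w - 1) 0)) (.seq (A.withHandlers w P)
    (.seq (.instr (.nil 0)) (.seq (.ifTrue w (.instr (.cons true 0)) (.instr (.cons false 0)))
      (.seq (.instr (.pair 0 (w - 1) 0)) PF))))))

lemma exists_reduction {α : Type} [Code α] {A : Prog} {T : ℕ[X]} (hA : ∀ (lam : ℕ) (S : Type) (O :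
    Oracle S) (e : S), ∀ s ∈ (A.run O (start ![unary lam] [] QMem.init e)).support, s.time ≤ T.eval
    lam) {h : Handlers α} (hh : ∀ k, Impl (h k)) {μ : ℕ → PMF α}
    (hμ : Impl fun _ _ lam => lift (μ lam)) {fin : α × Bool → Bool} (hfin : PT fin)
    (Inv : ℕ → ℕ → α → Prop) (B : ℕ[X]) (h0 : ∀ lam, ∀ a ∈ (μ lam).support, Inv lam 0 a) (h1 : ∀ lam
    j a k x (S : Type) (O : Oracle S) u, ∀ o ∈ (h k S O (a, x) u).support, Inv lam j a → x.length ≤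
    T.eval lam → Inv lam (j + 1) o.1.2) (hB : ∀ lam j a, j ≤ T.eval lam → Inv lam j a → (enc
    a).length ≤ B.eval lam) : ∃ P, IsQPTAdversary P ∧ ∀ (lam : ℕ) (S : Type) (O : Oracle S) (e : S),
    (interact O e P lam).map (fun s => (s.guess, s.env)) = (μ lam).bind fun a =>
    (interact (h.oracle O) (a, e) A lam).map fun s => (fin (s.env.1, s.guess), s.env.2) := by
  choose P Mk pk hP using hh
  obtain ⟨PI, MI, pI, hPI⟩ := hμ; obtain ⟨f, ⟨PF, MF, pF, hPF⟩, hf⟩ := hfin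
  obtain ⟨MA, hMA⟩ := A.exists_below; obtain ⟨n, hn⟩ := A.exists_number
  obtain ⟨M, hM, hMA⟩ : ∃ M, 0 < M ∧ A.Below M := ⟨MA + 1, by omega, hMA.mono (Nat.le_succ MA)⟩
  set w := (∑ k ∈ Finset.range n, Mk k) + MI + MF + 8 with hw
  set p := ∑ k ∈ Finset.range n, pk k with hp
  have hPk : ∀ k < n, Implements (P k) (w - 1) p (h k) := fun k hk => by
    refine (hP k).mono ?_ fun x => ?_
    · have := Finset.single_le_sum (f := Mk) (fun _ _ => Nat.zero_le _) (Finset.mem_range.2 hk)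
      omega
    · rw [hp, Polynomial.eval_finsetSum]
      exact Finset.single_le_sum (f := fun k => (pk k).eval x) (fun _ _ => Nat.zero_le _)
        (Finset.mem_range.2 hk)
  replace hPI := hPI.mono (M' := w - 1) (p' := pI) (by omega) fun _ => le_rfl
  replace hPF := hPF.mono (M' := w - 1) (p' := pF) (by omega) fun _ => le_rfl
  have hw' : 4 < w := by omega
  clear_value w p
  set K : ℕ[X] := 20 + B + 4 * T + 8 * p.comp (2 * B + 1 + T) with hK
  set c : ℕ[X] := X + 2 * pI + 2 with hc
  set Z : ℕ[X] := c + K * T + B + 10 + pF.comp (2 * B + 10) with hZ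
  have key : ∀ (lam : ℕ) (S : Type) (O : Oracle S) (e : S),
      Lift (fun s o => s.time ≤ Z.eval lam ∧ (s.guess, s.env) = o)
        (interact O e (reductionProg w PI P A PF) lam)
        ((μ lam).bind fun a => (interact (h.oracle O) (a, e) A lam).map fun s =>
          (fin (s.env.1, s.guess), s.env.2)) := by
    intro lam S O e
    have hKe : K.eval lam = 20 + B.eval lam + 4 * T.eval lam +
        8 * p.eval (2 * B.eval lam + 1 + T.eval lam) := by simp [hK]
    have hce : c.eval lam = lam + 2 * pI.eval lam + 2 := by simp [hc]
    have hZe : Z.eval lam = c.eval lam + K.eval lam * T.eval lam + B.eval lam + 10 +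
      pF.eval (2 * B.eval lam + 10) := by simp [hZ]
    rw [interact, reductionProg]; set s0 : State S := start ![unary lam] [] QMem.init e with hs0
    have hs0q : ∀ r, s0.q r = [] := fun r => by simp [hs0, start]
    have hs0c : ∀ r, s0.c r = if r = 0 then unary lam else [] := fun r => by
      simp only [hs0, start]
      by_cases hr : r = 0
      · subst hr; simp
      · rw [dif_neg (by omega), if_neg hr]
    refine lift_seq_instr trivial ?_
    have i0 : upd s0.c (.copy w 0) 0 = enc lam := by simp [upd, hs0c, show 0 ≠ w by omega, enc_nat]
    have iw : upd s0.c (.copy w 0) w = unary lam := by simp [upd, hs0c]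
    have ix : ∀ x, w < x → upd s0.c (.copy w 0) x = [] := fun x hx => by
      simp [upd, hs0c, show x ≠ w by omega, show x ≠ 0 by omega]
    have it : costC s0.c (.copy w 0) = 1 + lam := by simp [Instr.costC_copy, hs0c]
    rw [it]; generalize upd s0.c (.copy w 0) = c0 at *
    have hI := hPI S O ⟨c0, s0.q, s0.mem, s0.env, s0.time + (1 + lam)⟩ lam i0 fun r _ _ => hs0q r
    have hlam : (enc lam).length = lam := length_unary lam; rw [hlam] at hI
    have hbind : ∀ F : α → PMF (Bool × S), (μ lam).bind F =
        (lift (μ lam) (s0.q 0, s0.env, s0.mem)).bind fun o => F o.1 := fun F => by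
      rw [lift, bind_map]; rfl
    rw [hbind]; refine lift_seq hI.mem ?_; rintro s1 ⟨a, wd⟩ ⟨hpost, -, ha⟩
    obtain ⟨a0, ha0, ha1⟩ := (mem_support_map_iff _ _ _).1 ha; simp only [Prod.mk.injEq] at ha1
    obtain ⟨rfl, rfl⟩ := ha1; have hwd := hpost.world; simp only [Prod.mk.injEq] at hwd
    have hsz := hpost.size; have htm := hpost.time; have hout := hpost.out
    have hfw := (hpost.frame_c w (by omega)).trans iw
    have hfx : ∀ x, w < x → s1.c x = [] := fun x hx => (hpost.frame_c x (by omega)).trans (ix x hx)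
    dsimp only at hsz htm hout; refine lift_seq_instr trivial ?_
    have j0 : upd s1.c (.copy (w - 1) 0) (w - 1) = enc a0 := by simp [upd, hout]
    have jx : ∀ x, w ≤ x → upd s1.c (.copy (w - 1) 0) x = s1.c x := fun x hx => by
      simp [upd, show x ≠ w - 1 by omega]
    have jt : costC s1.c (.copy (w - 1) 0) = 1 + (enc a0).length := by rw [Instr.costC_copy, hout]
    rw [jt]; generalize upd s1.c (.copy (w - 1) 0) = c1 at *
    set sA : State (α × S) := start ![unary lam] [] QMem.init (a0, e) with hsA
    have hrel : SimRel w M (Inv lam) (c.eval lam) (K.eval lam) sA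
        ⟨c1, s1.q, s1.mem, s1.env, s1.time + (1 + (enc a0).length)⟩ := by
      refine ⟨⟨fun r hr => ?_, fun r hr => ?_, ?_⟩, ?_, j0, fun r h1 hr => ?_,
        ⟨0, le_rfl, h0 lam a0 ha0⟩, ?_⟩
      · dsimp only; rw [jx _ (by omega)]
        by_cases hr0 : r = 0
        · subst hr0; simp [hfw, hsA, start]
        · rw [hfx _ (by omega)]; simp [hsA, start, hr0]
      · dsimp only; rw [hpost.frame_q _ (by omega)]; simp [hs0q, hsA, start]
      · exact hwd.2.2.symm
      · exact hwd.2.1.symm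
      · dsimp only
        by_cases hr0 : r = 0
        · subst hr0; rw [← hwd.1]; exact hs0q 0
        · by_cases hr' : r < w - 1
          · exact hpost.clean r (by omega) hr'
          · rw [hpost.frame_q _ (by omega)]; exact hs0q r
      · simp only [hsA, start, hs0] at htm ⊢; omega
    have hT := hA lam (α × S) (h.oracle O) (a0, e)
    have hrun := Prog.run_lift (OA := h.oracle O) (OB := O) (ρ := (· + w)) (tr := fun
        | .call k r s t d => callProg w (P k) r s t d
        | i => .instr (i.shift w)) (M := M) (T := T.eval lam) (I := fun i => i.number < n)
      (R := SimRel w M (Inv lam) (c.eval lam) (K.eval lam))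
      (fun a b r hr hab => hab.rel.c r hr) (fun a b k hab => hab.tick (by omega) k)
      (fun i a b hi hiM hab hiT => by
        by_cases hcall : i.NoCall
        · have := lift_shift_simRel (O' := h.oracle O) (O := O) (by omega) (by omega) hcall hiM hab
          cases i <;> first | exact this | exact hcall.elim
        · cases i <;> first | exact (hcall trivial).elim | skip
          exact lift_callProg (hPk _ hi) hw' (fun j a x u o ho hj hx => h1 lam j a _ x S O u o ho hj hx)
            (fun j a hj => hB lam j a hj) hKe.ge hiM hab hiT)
      A hn hMA sA _ hrel hT
    rw [← PMF.bind_pure_comp]; refine lift_seq hrun.symm.mem ?_; rintro s2 s3 ⟨h3, -, hs3⟩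
    have h3T := hT s3 hs3; obtain ⟨j, hj, hinv⟩ := h3.inv
    have hBa := hB lam j _ (hj.trans h3T) hinv
    have h3w : s2.c w = s3.c 0 := by simpa using h3.rel.c 0 hM
    refine lift_seq_instr trivial ?_
    have hif : (Prog.ifTrue w (.instr (.cons true 0)) (.instr (.cons false 0))).run O
        ⟨upd s2.c (.nil 0), s2.q, s2.mem, s2.env, s2.time + costC s2.c (.nil 0)⟩ =
        PMF.pure ⟨update s2.c 0 [s3.guess], s2.q, s2.mem, s2.env, s2.time + 3⟩ := by
      rw [Prog.run]; simp only [upd, update_of_ne (show w ≠ 0 by omega), h3w]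
      by_cases hg : (s3.c 0).head? = some true
      · rw [if_pos hg]
        simp [Prog.run, Instr.effect, State.guess, hg, State.tick, State.setC, cost, costC]
      · rw [if_neg hg]
        simp [Prog.run, Instr.effect, State.guess, hg, State.tick, State.setC, cost, costC]
    refine lift_seq_pure hif (lift_seq_instr trivial ?_); rw [Prog.run_det hPF.classical]
    have k0 : upd (update s2.c 0 [s3.guess]) (.pair 0 (w - 1) 0) 0 =
        enc (s3.env.1, s3.guess) := by
      simp [upd, show w - 1 ≠ 0 by omega, h3.priv, enc_pair, enc_bool]
    have kt : costC (update s2.c 0 [s3.guess]) (.pair 0 (w - 1) 0) =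
        2 + (enc s3.env.1).length := by
      simp [costC, cost, classicalState, show w - 1 ≠ 0 by omega, h3.priv]; omega
    have kl : (enc (s3.env.1, s3.guess)).length ≤ 2 * B.eval lam + 10 := by
      rw [length_enc_pair, enc_bool, length_singleton]; omega
    dsimp only; rw [kt]
    generalize upd (update s2.c 0 [s3.guess]) (.pair 0 (w - 1) 0) = c3 at *
    refine Lift.pure ⟨?_, ?_⟩
    · have l1 := hPF.time c3; have l2 := eval_mono pF kl; have l3 := h3.time
      have l4 := Nat.mul_le_mul_left (K.eval lam) h3T; rw [k0] at l1; dsimp only; omega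
    · simp only [State.guess, hPF.out, k0, hf, enc_bool, h3.env, Prod.mk.injEq, and_true]; simp
  refine ⟨reductionProg w PI P A PF, ⟨Z, fun lam S O e s hs => ?_⟩, fun lam S O e => ?_⟩
  · obtain ⟨o, _, ho⟩ := (key lam S O e).exists_right hs; exact ho.1
  · have := (key lam S O e).map_eq (f := fun s => (s.guess, s.env)) (g := fun o => o)
      fun s o ho => ho.2
    rw [this]; exact PMF.map_id _

/-! ### Comparison of oracles -/

lemma PMF.bind_congr_support {α β : Type} {μ : PMF α} {f g : α → PMF β}
    (h : ∀ a ∈ μ.support, f a = g a) : μ.bind f = μ.bind g := by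
  ext b; rw [PMF.bind_apply, PMF.bind_apply]; refine tsum_congr fun a => ?_
  by_cases ha : μ a = 0
  · rw [ha, zero_mul, zero_mul]
  · rw [h a ((PMF.mem_support_iff _ _).2 ha)]

section Oracles

variable {SA SB : Type}

/-- The state with another state of the oracle. -/
def State.withEnv (a : State SA) (e : SB) : State SB := ⟨a.c, a.q, a.mem, e, a.time⟩

lemma Instr.effect_withEnv {i : Instr} (hi : i.NoCall) (OA : Oracle SA) (OB : Oracle SB)
    (a : State SA) (e : SB) : i.effect OB (a.withEnv e) = (i.effect OA a).map fun s => s.withEnv e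
    := by
  cases i <;> simp only [Instr.effect, State.withEnv, pure_map] <;> try rfl
  case coin => rw [map_comp]; rfl
  case meas x r =>
    cases h : a.q x with
    | nil => rw [pure_map]
    | cons i l => simp only [map_comp]; rfl
  case had x => cases a.q x <;> rw [pure_map]
  case tgate x => cases a.q x <;> rw [pure_map]
  case cnot x y => cases a.q x <;> cases a.q y <;> rw [pure_map]
  case call => exact hi.elim

lemma Instr.cost_withEnv (i : Instr) (a : State SA) (e : SB) : i.cost (a.withEnv e) = i.cost a := by
  cases i <;> rfl

lemma Instr.effect_env {i : Instr} (hi : i.NoCall) {O : Oracle SA} {a a' : State SA}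
    (h : a' ∈ (i.effect O a).support) : a'.env = a.env := by
  have := Instr.effect_withEnv hi O O a a.env; rw [show a.withEnv a.env = a from rfl] at this
  rw [this, mem_support_map_iff] at h; obtain ⟨_, _, rfl⟩ := h; rfl

/-- A property of the state of an oracle that no call destroys. -/
def Oracle.Stable (O : Oracle SA) (B : SA → Prop) : Prop :=
  ∀ k x e m, B e → ∀ o ∈ (O k x e m).support, B o.2.1

lemma Prog.run_stable {O : Oracle SA} {B : SA → Prop} (h : O.Stable B) (P : Prog) {a a' : State SA}
    (ha : B a.env) (h' : a' ∈ (P.run O a).support) : B a'.env := by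
  refine P.run_inv (J := fun s => B s.env) (fun s k hs => hs) (fun i s hs s' hs' => ?_) a ha a' h'
  by_cases hi : i.NoCall
  · rw [Instr.effect_env hi hs']; exact hs
  · cases i <;> first | exact (hi trivial).elim | skip
    rw [Instr.effect, mem_support_map_iff] at hs'; obtain ⟨o, ho, rfl⟩ := hs'
    exact h _ _ _ _ hs o ho

/-- Relation between the runs of a machine with two oracles: they agree up to the states of the
oracles, unless both runs have become bad. -/
def EnvRel (R : SA → SB → Prop) (BA : SA → Prop) (BB : SB → Prop) (a : State SA) (b : State SB) :
    Prop :=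
  (b = a.withEnv b.env ∧ R a.env b.env) ∨ (BA a.env ∧ BB b.env)

lemma Lift.of_bad {α β : Type} {R : α → β → Prop} {μ : PMF α} {ν : PMF β}
    (h : ∀ a ∈ μ.support, ∀ b ∈ ν.support, R a b) : Lift R μ ν := by
  rw [← PMF.bind_pure μ, ← PMF.bind_pure ν]
  exact Lift.bind_left fun a ha => Lift.bind_right fun b hb => Lift.pure (h a ha b hb)

lemma iterP_lift {α β : Type} {R : α → β → Prop} {f : α → PMF α} {g : β → PMF β} {C : α → Prop}
    (hC : ∀ k a, (∀ a' ∈ (iterP f k a).support, C a') → C a)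
    (h : ∀ a b, R a b → (∀ a' ∈ (f a).support, C a') → Lift R (f a) (g b)) :
    ∀ k a b, R a b → (∀ a' ∈ (iterP f k a).support, C a') → Lift R (iterP f k a) (iterP g k b)
  | 0, a, b, hab, _ => Lift.pure hab
  | k + 1, a, b, hab, hT => by
    rw [iterP] at hT
    have h1 : ∀ u ∈ (f a).support, ∀ v ∈ (iterP f k u).support, C v :=
      fun u hu v hv => hT v ((mem_support_bind_iff _ _ _).2 ⟨u, hu, hv⟩)
    refine (h a b hab fun u hu => hC k u (h1 u hu)).mem.bind ?_; rintro u w ⟨huw, hu, _⟩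
    exact iterP_lift hC h k u w huw (h1 u hu)

lemma Prog.run_envRel {OA : Oracle SA} {OB : Oracle SB} {R : SA → SB → Prop} {BA : SA → Prop}
    {BB : SB → Prop} {T : ℕ} (hA : OA.Stable BA) (hB : OB.Stable BB) (h : ∀ k x e e' m, R e e' →
    x.length ≤ T → Lift (fun o o' => (o'.1 = o.1 ∧ o'.2.2 = o.2.2 ∧ R o.2.1 o'.2.1) ∨ (BA o.2.1 ∧ BB
    o'.2.1)) (OA k x e m) (OB k x e' m)) : ∀ (P : Prog) (a : State SA) (b : State SB), EnvRel R BA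
    BB a b → (∀ a' ∈ (P.run OA a).support, a'.time ≤ T) → Lift (EnvRel R BA BB) (P.run OA a)
    (P.run OB b) := by
  have hbad : ∀ (P : Prog) (a : State SA) (b : State SB), BA a.env → BB b.env →
      Lift (EnvRel R BA BB) (P.run OA a) (P.run OB b) := fun P a b ha hb =>
    Lift.of_bad fun a' ha' b' hb' => Or.inr ⟨P.run_stable hA ha ha', P.run_stable hB hb hb'⟩
  intro P
  induction P with
  | instr i =>
    rintro a b (⟨hab, hR⟩ | ⟨ha, hb⟩) hT
    · obtain ⟨c, q, mem, e', time⟩ := b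
      obtain ⟨rfl, rfl, rfl, -, rfl⟩ := State.mk.injEq _ _ _ _ _ _ _ _ _ _ ▸ hab; dsimp only at hR
      rw [Prog.run, Prog.run]
      by_cases hi : i.NoCall
      · have hc := Instr.cost_withEnv i a e'
        have he := Instr.effect_withEnv hi OA OB (a.tick (i.cost a)) e'
        rw [← PMF.map_id (p := i.effect OA (a.tick (i.cost a)))]
        change Lift _ _ (i.effect OB (State.tick (a.withEnv e') (i.cost (a.withEnv e')))); rw [hc]
        change Lift _ _ (i.effect OB (State.withEnv (a.tick (i.cost a)) e')); rw [he]
        refine Lift.map_same fun s hs => Or.inl ⟨rfl, ?_⟩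
        have := Instr.effect_env hi hs; simp only [State.withEnv, id_eq, this]; exact hR
      · cases i <;> first | exact (hi trivial).elim | skip
        next k r s t d =>
        have hlen : (a.c s).length ≤ T := by
          obtain ⟨a', ha'⟩ := ((instr (.call k r s t d)).run OA a).support_nonempty
          have := hT a' ha'; rw [Prog.run] at ha'
          rw [Instr.effect_time ha', State.tick_time, cost] at this; omega
        rw [Instr.effect, Instr.effect]
        refine Lift.map ((h k (a.c s) a.env e' a.mem hR hlen).mono ?_)
        rintro o o' (⟨h1, h2, h3⟩ | h')
        · refine Or.inl ⟨?_, h3⟩; simp only [State.withEnv, h1, h2]; rfl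
        · exact Or.inr h'
    · exact hbad _ a b ha hb
  | seq p p' ih ih' =>
    intro a b hab hT; rw [Prog.run] at hT
    have h1 : ∀ u ∈ (p.run OA a).support, ∀ v ∈ (p'.run OA u).support, v.time ≤ T :=
      fun u hu v hv => hT v ((mem_support_bind_iff _ _ _).2 ⟨u, hu, hv⟩)
    refine (ih a b hab fun u hu => ?_).mem.bind ?_
    · obtain ⟨v, hv⟩ := (p'.run OA u).support_nonempty
      exact (p'.run_time_le hv).trans (h1 u hu v hv)
    · rintro u w ⟨huw, hu, _⟩; exact ih' u w huw (h1 u hu)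
  | ifTrue r p p' ih ih' =>
    rintro a b (⟨hab, hR⟩ | ⟨ha, hb⟩) hT
    · have hc : b.c = a.c := by rw [hab]; rfl
      have hab' : EnvRel R BA BB (a.tick 1) (b.tick 1) := Or.inl ⟨by rw [hab]; rfl, hR⟩
      rw [Prog.run] at hT; rw [Prog.run, Prog.run, hc]; split_ifs at hT ⊢
      · exact ih _ _ hab' hT
      · exact ih' _ _ hab' hT
    · exact hbad _ a b ha hb
  | ifNil r p p' ih ih' =>
    rintro a b (⟨hab, hR⟩ | ⟨ha, hb⟩) hT
    · have hc : b.c = a.c := by rw [hab]; rfl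
      have hab' : EnvRel R BA BB (a.tick 1) (b.tick 1) := Or.inl ⟨by rw [hab]; rfl, hR⟩
      rw [Prog.run] at hT; rw [Prog.run, Prog.run, hc]; split_ifs at hT ⊢
      · exact ih _ _ hab' hT
      · exact ih' _ _ hab' hT
    · exact hbad _ a b ha hb
  | loop r p ih =>
    rintro a b (⟨hab, hR⟩ | ⟨ha, hb⟩) hT
    · have hc : b.c = a.c := by rw [hab]; rfl
      have hab' : EnvRel R BA BB (a.tick 1) (b.tick 1) := Or.inl ⟨by rw [hab]; rfl, hR⟩
      rw [Prog.run] at hT; rw [Prog.run, Prog.run, hc]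
      refine iterP_lift (C := fun s => s.time ≤ T) (fun k u hu => ?_) (fun u w huw hu => ?_) _ _ _
        hab' hT
      · obtain ⟨v, hv⟩ := (iterP (fun s' => p.run OA (s'.tick 1)) k u).support_nonempty
        refine le_trans ?_ (hu v hv)
        exact iterP_inv (J := fun s => u.time ≤ s.time) (fun s hs s' hs' =>
          hs.trans ((Nat.le_add_right _ 1).trans (p.run_time_le hs'))) k u le_rfl v hv
      · refine ih _ _ ?_ hu; rcases huw with ⟨huw, hR'⟩ | huw
        · exact Or.inl ⟨by rw [huw]; rfl, hR'⟩
        · exact Or.inr huw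
    · exact hbad _ a b ha hb

/-- Randomness that one oracle has sampled already and the other has not sampled yet. -/
lemma Prog.run_kernel {OA : Oracle SA} {OB : Oracle SB} (φ : SA → PMF SB) (h : ∀ k x e m, ((OA k x e
    m).bind fun o => (φ o.2.1).map fun e' => (o.1, e', o.2.2)) = (φ e).bind fun e' => OB k x e' m) :
    ∀ (P : Prog) (a : State SA), ((P.run OA a).bind fun s => (φ s.env).map fun e' => s.withEnv e') =
    (φ a.env).bind fun e' => P.run OB (a.withEnv e') := by
  intro P
  induction P with
  | instr i =>
    intro a; simp only [Prog.run, Instr.cost_withEnv]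
    change _ = (φ a.env).bind fun e' => i.effect OB (State.withEnv (a.tick (i.cost a)) e')
    by_cases hi : i.NoCall
    · simp only [Instr.effect_withEnv hi OA OB]
      rw [PMF.bind_congr_support (g := fun s => (φ a.env).map fun e' => s.withEnv e')
        fun s hs => by rw [Instr.effect_env hi hs]; rfl]
      simp only [← PMF.bind_pure_comp]; exact PMF.bind_comm _ _ _
    · cases i <;> first | exact (hi trivial).elim | skip
      next k r s t d =>
      simp only [Instr.effect, bind_map, State.withEnv]
      have := congrArg (fun μ => μ.map fun o : Reply × SB × QMem =>
        ({ (((a.tick ((Instr.call k r s t d).cost a)).setC r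
          (o.1.1.take (a.c t).length)).setQ d (a.q d ++ o.1.2.take (a.c t).length)).withEnv o.2.1
            with mem := o.2.2 } : State SB)) (h k (a.c s) a.env a.mem)
      simp only [PMF.map_bind, map_comp] at this; exact this
  | seq p p' ih ih' =>
    intro a; simp only [Prog.run, PMF.bind_bind]; simp only [ih']
    have := congrArg (fun μ => μ.bind (p'.run OB)) (ih a)
    simp only [PMF.bind_bind, bind_map] at this; exact this
  | ifTrue r p p' ih ih' =>
    intro a; simp only [Prog.run]
    change _ = (φ a.env).bind fun e' => if (a.c r).head? = some true then
      p.run OB (State.withEnv (a.tick 1) e') else p'.run OB (State.withEnv (a.tick 1) e')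
    split_ifs
    · exact ih (a.tick 1)
    · exact ih' (a.tick 1)
  | ifNil r p p' ih ih' =>
    intro a; simp only [Prog.run]
    change _ = (φ a.env).bind fun e' => if a.c r = [] then
      p.run OB (State.withEnv (a.tick 1) e') else p'.run OB (State.withEnv (a.tick 1) e')
    split_ifs
    · exact ih (a.tick 1)
    · exact ih' (a.tick 1)
  | loop r p ih =>
    intro a; simp only [Prog.run]
    have key : ∀ k (a : State SA), ((iterP (fun s' => p.run OA (s'.tick 1)) k a).bind
        fun s => (φ s.env).map fun e' => s.withEnv e') = (φ a.env).bind fun e' =>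
          iterP (fun s' => p.run OB (s'.tick 1)) k (a.withEnv e') := by
      intro k
      induction k with
      | zero => intro a; simp only [iterP, PMF.pure_bind]; rfl
      | succ k hk =>
        intro a; simp only [iterP, PMF.bind_bind]; simp only [hk]
        have := congrArg (fun μ => μ.bind (iterP (fun s' => p.run OB (s'.tick 1)) k))
          (ih (a.tick 1))
        simp only [PMF.bind_bind, bind_map] at this; exact this
    exact key _ (a.tick 1)

end Oracles

/-- Equality of natural numbers. -/
def eqN (m n : ℕ) : Bool := decide (m = n)

namespace PT

variable {α β γ : Type} [Code α] [Code β] [Code γ]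

@[fun_prop] lemma eqN {f g : α → ℕ} (hf : PT f) (hg : PT g) : PT fun a => Skl.eqN (f a) (g a) :=
  (hf.unary.eqS hg.unary).of_enc_eq fun a => by simp [Skl.eqS, Skl.eqN, Skl.unary, enc_bool]

lemma drop {n : α → ℕ} {l : α → List β} (hn : PT n) (hl : PT l) : PT fun a => (l a).drop (n a) := by
  have key : ∀ (s : Str) (l : List β), s.foldl (fun l _ => l.tail) l = l.drop s.length := by
    intro s
    induction s with
    | nil => simp
    | cons b s ih => intro l; simp [ih]
  obtain ⟨p, hp⟩ := hl.size
  have h := foldlS (l := fun a => Skl.unary (n a)) (init := l) (f := fun _ l _ => l.tail)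
    hn.unary hl fp p fun a l' _ => by
      rw [key]; refine le_trans ?_ (hp a)
      conv_rhs => rw [← List.take_append_drop l'.length (l a), enc_append]
      simp
  exact h.of_enc_eq fun a => by rw [key, length_unary]

lemma getI [Inhabited β] {n : α → ℕ} {l : α → List β} (hn : PT n) (hl : PT l) : PT fun a =>
    (l a).getI (n a) :=
  (hn.drop hl).headI.of_enc_eq fun a => by
    rw [List.getI_eq_getElem?_getD]
    cases h : (l a).drop (n a) with
    | nil => have := List.drop_eq_nil_iff.1 h; rw [List.getElem?_eq_none this]; rfl
    | cons b t =>
      have : (l a)[n a]? = some b := by rw [← List.head?_drop, h]; rfl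
      rw [this]; rfl

end PT

/-! ### Single-index games

The part of a game state that does not depend on secrets. -/

structure Pub where
  lam : ℕ
  on : Bool
  q : ℕ
  x0 : Str
  x1 : Str
  jb : Str
  /-- for every key, its function and whether a certificate was accepted -/
  keys : List (Str × Bool)
  usedJ : Bool
  challenged : Bool

namespace Pub

def init (lam : ℕ) : Pub := ⟨lam, false, 0, [], [], [], [], false, false⟩

instance : Code Pub := ⟨fun p =>
  enc (p.lam, p.on, p.q, p.x0, p.x1, p.jb, p.keys, p.usedJ, p.challenged)⟩

/-- The function separates the two challenge plaintexts. -/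
def sep (C : FunctionClass) (p : Pub) (f : Str) : Bool :=
  !eqS (C.eval p.lam f p.x0) (C.eval p.lam f p.x1)

/-- The number of keys whose functions separate the challenge plaintexts. -/
def cnt (C : FunctionClass) (p : Pub) : ℕ := p.keys.countP fun e => p.sep C e.1

/-- The calls that are answered. -/
def guard (C : FunctionClass) : ℕ → Pub → Str → Bool
  | 0, p, x => !p.on && (C.X p.lam (item 2 x) && C.X p.lam (item 3 x))
  | 1, p, x => p.on && (eqN x.length p.jb.length && !eqS x p.jb)
  | 2, p, x => p.on && C.X p.lam x
  | 3, p, x => p.on && (C.F p.lam x && (ltN p.keys.length p.q && (!p.challenged || !p.sep C x)))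
  | 4, p, x => p.on && ltN (item 0 x).length p.keys.length
  | 5, p, _ => p.on && (!p.challenged && (!p.usedJ && p.keys.all fun e => !p.sep C e.1 || e.2))
  | _, _, _ => false

/-- The new state after an answered call with query `x` and result `r`. -/
def update : ℕ → Pub → Str → Str → Pub
  | 0, p, x, _ => { p with on := true, q := (item 0 x).length, jb := item 1 x, x0 := item 2 x,
                           x1 := item 3 x }
  | 2, p, _, _ => { p with usedJ := true }
  | 3, p, x, _ => { p with keys := p.keys ++ [(x, false)] }
  | 4, p, x, r => { p with keys := p.keys.zipIdx.map fun e =>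
      (e.1.1, e.1.2 || (eqN e.2 (item 0 x).length && eqS r [true])) }
  | 5, p, _, _ => { p with challenged := true }
  | _, p, _, _ => p

end Pub

namespace PT

variable {α : Type} [Code α] {f : α → Pub}

lemma pubTuple (hf : PT f) : PT fun a => ((f a).lam, (f a).on, (f a).q, (f a).x0, (f a).x1,
    (f a).jb, (f a).keys, (f a).usedJ, (f a).challenged) := hf.of_enc_eq fun _ => rfl

@[fun_prop] lemma lam (hf : PT f) : PT fun a => (f a).lam := hf.pubTuple.fst
@[fun_prop] lemma on (hf : PT f) : PT fun a => (f a).on := hf.pubTuple.snd.fst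
@[fun_prop] lemma q (hf : PT f) : PT fun a => (f a).q := hf.pubTuple.snd.snd.fst
@[fun_prop] lemma x0 (hf : PT f) : PT fun a => (f a).x0 := hf.pubTuple.snd.snd.snd.fst
@[fun_prop] lemma x1 (hf : PT f) : PT fun a => (f a).x1 := hf.pubTuple.snd.snd.snd.snd.fst
@[fun_prop] lemma jb (hf : PT f) : PT fun a => (f a).jb := hf.pubTuple.snd.snd.snd.snd.snd.fst
@[fun_prop] lemma keys (hf : PT f) : PT fun a => (f a).keys :=
  hf.pubTuple.snd.snd.snd.snd.snd.snd.fst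
@[fun_prop] lemma usedJ (hf : PT f) : PT fun a => (f a).usedJ :=
  hf.pubTuple.snd.snd.snd.snd.snd.snd.snd.fst
@[fun_prop] lemma challenged (hf : PT f) : PT fun a => (f a).challenged :=
  hf.pubTuple.snd.snd.snd.snd.snd.snd.snd.snd

@[fun_prop] lemma pub {l q : α → ℕ} {o u c : α → Bool} {x0 x1 j : α → Str}
    {k : α → List (Str × Bool)} (hl : PT l) (ho : PT o) (hq : PT q) (h0 : PT x0) (h1 : PT x1)
    (hj : PT j) (hk : PT k) (hu : PT u) (hc : PT c) : PT fun a => Pub.mk (l a) (o a) (q a) (x0 a)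
    (x1 a) (j a) (k a) (u a) (c a) :=
  (hl.pair (ho.pair (hq.pair (h0.pair (h1.pair (hj.pair (hk.pair (hu.pair hc)))))))).of_enc_eq
    fun _ => rfl

@[fun_prop] lemma sep (C : FunctionClass) {x : α → Str} (hf : PT f) (hx : PT x) : PT fun a =>
    (f a).sep C (x a) := by
  unfold Pub.sep; fun_prop

@[fun_prop] lemma cnt (C : FunctionClass) (hf : PT f) : PT fun a => (f a).cnt C := by
  unfold Pub.cnt; exact countP (f := fun a (e : Str × Bool) => (f a).sep C e.1) fp fp

lemma guard (C : FunctionClass) : ∀ k, PT fun g : Pub × Str => Pub.guard C k g.1 g.2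
  | 0 => by unfold Pub.guard; fun_prop
  | 1 => by unfold Pub.guard; fun_prop
  | 2 => by unfold Pub.guard; fun_prop
  | 3 => by
    unfold Pub.guard; have : PT fun g : Pub × Str => g.1.keys.length := length fp
    fun_prop
  | 4 => by
    unfold Pub.guard; have : PT fun g : Pub × Str => g.1.keys.length := length fp
    fun_prop
  | 5 => by
    unfold Pub.guard
    have : PT fun g : Pub × Str => g.1.keys.all fun e => !g.1.sep C e.1 || e.2 :=
      all (f := fun (g : Pub × Str) (e : Str × Bool) => !g.1.sep C e.1 || e.2) fp fp
    fun_prop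
  | n + 6 => by unfold Pub.guard; fun_prop

lemma update : ∀ k, PT fun g : Pub × Str × Str => Pub.update k g.1 g.2.1 g.2.2
  | 0 => by unfold Pub.update; fun_prop
  | 1 => by unfold Pub.update; fun_prop
  | 2 => by unfold Pub.update; fun_prop
  | 3 => by
    unfold Pub.update
    have : PT fun g : Pub × Str × Str => g.1.keys ++ [(g.2.1, false)] :=
      append fp (cons fp (const _))
    fun_prop
  | 4 => by
    unfold Pub.update
    have : PT fun g : Pub × Str × Str => g.1.keys.zipIdx.map fun e =>
        (e.1.1, e.1.2 || (Skl.eqN e.2 (Skl.item 0 g.2.1).length && Skl.eqS g.2.2 [true])) :=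
      map (f := fun (g : Pub × Str × Str) (e : (Str × Bool) × ℕ) =>
        (e.1.1, e.1.2 || (Skl.eqN e.2 (Skl.item 0 g.2.1).length && Skl.eqS g.2.2 [true])))
        (zipIdx fp) fp
    fun_prop
  | 5 => by unfold Pub.update; fun_prop
  | n + 6 => by unfold Pub.update; fun_prop

end PT

/-- The procedures that produce the answers. They get and return the secret part of the state. -/
abbrev Procs (S X : Type) := ℕ → Pub → X → Str → Act S (Str × X)

/-- The handlers of a single-index game. -/
def answer {S X : Type} (C : FunctionClass) (P : Procs S X) (k : ℕ) (a : (Pub × X) × Str) : Act S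
    (Str × (Pub × X)) :=
  cond (Pub.guard C k a.1.1 a.2)
    (P k a.1.1 a.1.2 a.2 >>= fun o => pure (true :: o.1, (a.1.1.update k a.2 o.1, o.2)))
    (pure ([], a.1))

lemma Impl.answer {X : Type} [Code X] (C : FunctionClass) {k : ℕ}
    {P : ∀ S : Type, Oracle S → Procs S X}
    (hP : Impl fun S O (a : (Pub × X) × Str) => P S O k a.1.1 a.1.2 a.2) : Impl fun S O a =>
    Skl.answer C (P S O) k a := by
  refine Impl.cond ((PT.guard C k).comp (g := fun a : (Pub × X) × Str => (a.1.1, a.2))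
    fp) (Impl.bind hP ?_)
    (Impl.pure fp)
  refine Impl.pure (f := fun x : ((Pub × X) × Str) × Str × X =>
    (true :: x.2.1, (x.1.1.1.update k x.1.2 x.2.1, x.2.2))) ?_
  have := (PT.update k).comp (g := fun x : ((Pub × X) × Str) × Str × X =>
    (x.1.1.1, x.1.2, x.2.1)) fp
  fun_prop

/-- Answers of games with related procedures. -/
lemma lift_answer {SA SB XA XB : Type} {C : FunctionClass} {PA : Procs SA XA} {PB : Procs SB XB}
    {R : Pub → XA → SA → XB → SB → Prop} {BA : Pub → XA → SA → Prop} {BB : Pub → XB → SB → Prop}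
    {k : ℕ} {p : Pub} {xa : XA} {xb : XB} {x : Str} {ea : SA} {eb : SB} {m : QMem}
    (hR : R p xa ea xb eb) (h : p.guard C k x = true → Lift (fun o o' => (o'.1.1 = o.1.1 ∧ o'.2.1 =
    o.2.1 ∧ o'.2.2.2 = o.2.2.2 ∧ R (p.update k x o.1.1) o.1.2 o.2.2.1 o'.1.2 o'.2.2.1) ∨ (BA
    (p.update k x o.1.1) o.1.2 o.2.2.1 ∧ BB (p.update k x o'.1.1) o'.1.2 o'.2.2.1)) (PA k p xa x
    ([], ea, m)) (PB k p xb x ([], eb, m))) : Lift (fun o o' => (o'.1.1 = o.1.1 ∧ o'.2.1 = o.2.1 ∧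
    o'.2.2.2 = o.2.2.2 ∧ o'.1.2.1 = o.1.2.1 ∧ R o.1.2.1 o.1.2.2 o.2.2.1 o'.1.2.2 o'.2.2.1) ∨ (BA
    o.1.2.1 o.1.2.2 o.2.2.1 ∧ BB o'.1.2.1 o'.1.2.2 o'.2.2.1))
    (answer C PA k ((p, xa), x) ([], ea, m)) (answer C PB k ((p, xb), x) ([], eb, m)) := by
  rw [answer, answer]; dsimp only; cases hg : p.guard C k x
  · exact Lift.pure (Or.inl ⟨rfl, rfl, rfl, rfl, hR⟩)
  · refine (h hg).bind ?_; rintro o o' (⟨h1, h2, h3, h4⟩ | h')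
    · refine Lift.pure (Or.inl ⟨?_, h2, h3, ?_, h4⟩)
      · dsimp only; rw [h1]
      · dsimp only; rw [h1]
    · exact Lift.pure (Or.inr h')

/-- The handlers of a single-index game, as an oracle that consists of the game state and an inner
oracle. -/
def game {S X : Type} (C : FunctionClass) (P : Procs S X) : Oracle ((Pub × X) × S) :=
  fun k x e m => (answer C P k (e.1, x) ([], e.2, m)).map fun o =>
    ((o.1.1, o.2.1), (o.1.2, o.2.2.1), o.2.2.2)

lemma lift_game {SA SB XA XB : Type} {C : FunctionClass} {PA : Procs SA XA} {PB : Procs SB XB}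
    {R : Pub → XA → SA → XB → SB → Prop} {BA : Pub → XA → SA → Prop} {BB : Pub → XB → SB → Prop}
    {T : ℕ} (h : ∀ k p xa ea xb eb x m, R p xa ea xb eb → x.length ≤ T → p.guard C k x = true → Lift
    (fun o o' => (o'.1.1 = o.1.1 ∧ o'.2.1 = o.2.1 ∧ o'.2.2.2 = o.2.2.2 ∧ R (p.update k x o.1.1)
    o.1.2 o.2.2.1 o'.1.2 o'.2.2.1) ∨ (BA (p.update k x o.1.1) o.1.2 o.2.2.1 ∧ BB (p.update k x
    o'.1.1) o'.1.2 o'.2.2.1)) (PA k p xa x ([], ea, m)) (PB k p xb x ([], eb, m)))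
    (hA : (game C PA).Stable fun e => BA e.1.1 e.1.2 e.2)
    (hB : (game C PB).Stable fun e => BB e.1.1 e.1.2 e.2) (P : Prog) {a : State ((Pub × XA) × SA)}
    {b : State ((Pub × XB) × SB)} (hab : b = a.withEnv b.env) (hpub : b.env.1.1 = a.env.1.1)
    (hR : R a.env.1.1 a.env.1.2 a.env.2 b.env.1.2 b.env.2)
    (hT : ∀ a' ∈ (P.run (game C PA) a).support, a'.time ≤ T) : Lift (EnvRel (fun e e' => e'.1.1 =
    e.1.1 ∧ R e.1.1 e.1.2 e.2 e'.1.2 e'.2) (fun e => BA e.1.1 e.1.2 e.2) (fun e => BB e.1.1 e.1.2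
    e.2)) (P.run (game C PA) a) (P.run (game C PB) b) := by
  refine Prog.run_envRel hA hB ?_ P a b (Or.inl ⟨hab, hpub, hR⟩) hT
  rintro k x ⟨⟨p, xa⟩, ea⟩ ⟨⟨p', xb⟩, eb⟩ m ⟨hp, hR⟩ hx; dsimp only at hp hR; subst hp
  refine Lift.map ((lift_answer hR fun hg => h k p' xa ea xb eb x m hR hx hg).mono ?_)
  rintro o o' (⟨h1, h2, h3, h4, h5⟩ | h')
  · exact Or.inl ⟨by dsimp only; rw [h1, h2], h3, h4, h5⟩
  · exact Or.inr h'

namespace Pub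

/-- Size invariant: `j` bounds the number of calls, `T` the length of the queries. -/
structure Bounded (T j : ℕ) (p : Pub) : Prop where
  q : p.q ≤ T
  x0 : p.x0.length ≤ T
  x1 : p.x1.length ≤ T
  jb : p.jb.length ≤ T
  keys : p.keys.length ≤ j
  key : ∀ e ∈ p.keys, e.1.length ≤ T

lemma length_item_le (k : ℕ) (s : Str) : (item k s).length ≤ s.length := by
  refine (length_fstS_le _).trans ?_
  induction k generalizing s with
  | zero => exact le_rfl
  | succ k ih => exact (ih _).trans (length_sndS_le s)

lemma bounded_init (T j lam : ℕ) : (init lam).Bounded T j :=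
  ⟨by simp [init], by simp [init], by simp [init], by simp [init], by simp [init], by simp [init]⟩

lemma Bounded.succ {T j : ℕ} {p : Pub} (h : p.Bounded T j) : p.Bounded T (j + 1) :=
  { h with keys := h.keys.trans (Nat.le_succ j) }

lemma Bounded.update {T j : ℕ} {p : Pub} (h : p.Bounded T j) {x : Str}
    (hx : x.length ≤ T) (r : Str) : ∀ k, (p.update k x r).Bounded T (j + 1)
  | 0 => { h.succ with
      q := (length_item_le _ _).trans hx
      x0 := (length_item_le _ _).trans hx
      x1 := (length_item_le _ _).trans hx
      jb := (length_item_le _ _).trans hx }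
  | 1 => h.succ
  | 2 => { h.succ with }
  | 3 => { h.succ with
      keys := by simpa [Pub.update] using h.keys
      key := fun e he => by
        simp only [Pub.update, mem_append, mem_singleton] at he; obtain he | rfl := he
        · exact h.key e he
        · exact hx }
  | 4 => { h.succ with
      keys := by simpa [Pub.update] using h.succ.keys
      key := fun e he => by
        simp only [Pub.update, mem_map] at he; obtain ⟨e', he', rfl⟩ := he
        exact h.key e'.1 (List.fst_mem_of_mem_zipIdx he') }
  | 5 => { h.succ with }
  | _ + 6 => h.succ

lemma update_lam (p : Pub) (x r : Str) : ∀ k, (p.update k x r).lam = p.lam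
  | 0 | 1 | 2 | 3 | 4 | 5 | _ + 6 => rfl

lemma Bounded.size {T j : ℕ} {p : Pub} (h : p.Bounded T j) : (enc p).length ≤ 2 * p.lam + 20 + 8 * T
    + 2 * (j * (4 * T + 5)) := by
  have hk : (enc p.keys).length ≤ j * (4 * T + 5) := by
    refine (length_enc_le (N := 2 * T + 2) fun e he => ?_).trans
      ((Nat.mul_le_mul_right _ h.keys).trans (by ring_nf; exact le_rfl))
    rw [length_enc_pair, enc_str, enc_bool, length_singleton]; have := h.key e he; omega
  change (enc (p.lam, p.on, p.q, p.x0, p.x1, p.jb, p.keys, p.usedJ, p.challenged)).length ≤ _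
  simp only [length_enc_pair, enc_nat, enc_bool, enc_str, length_unary, length_singleton]
  have h1 := h.q; have h2 := h.x0; have h3 := h.x1; have h4 := h.jb; omega

end Pub

/-- A machine that plays a single-index game whose secret part `P` of the handlers is efficient. -/
lemma exists_game_reduction {σ : Type} [Code σ] {A : Prog} {T : ℕ[X]} (hA : ∀ (lam : ℕ) (S : Type)
    (O : Oracle S) (e : S), ∀ s ∈ (A.run O (start ![unary lam] [] QMem.init e)).support, s.time ≤
    T.eval lam) (C : FunctionClass) {P : ∀ S : Type, Oracle S → Procs S σ} (hP : ∀ k, Impl fun S O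
    (a : (Pub × σ) × Str) => P S O k a.1.1 a.1.2 a.2) {μ : ℕ → PMF σ}
    (hμ : Impl fun _ _ lam => lift (μ lam)) {fin : (Pub × σ) × Bool → Bool} (hfin : PT fin)
    (Inv : ℕ → ℕ → σ → Prop) (B : ℕ[X]) (h0 : ∀ lam, ∀ x ∈ (μ lam).support, Inv lam 0 x) (h1 : ∀ lam
    j p y k x (S : Type) (O : Oracle S) u, p.lam = lam → p.Bounded (T.eval lam) j → Inv lam j y →
    x.length ≤ T.eval lam → ∀ o ∈ (P S O k p y x u).support, Inv lam (j + 1) o.1.2)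
    (hs : ∀ lam j y, Inv lam j y → Inv lam (j + 1) y) (hB : ∀ lam j y, j ≤ T.eval lam → Inv lam j y
    → (enc y).length ≤ B.eval lam) : ∃ P', IsQPTAdversary P' ∧ ∀ (lam : ℕ) (S : Type) (O : Oracle S)
    (e : S), (interact O e P' lam).map (fun s => (s.guess, s.env)) = (μ lam).bind fun y =>
    (interact (game C (P S O)) ((Pub.init lam, y), e) A lam).map fun s =>
    (fin (s.env.1, s.guess), s.env.2) := by
  have hμ' : Impl fun _ _ lam => lift ((μ lam).map fun y => (Pub.init lam, y)) := by
    refine (hμ.bind (g' := fun _ _ lam y => pure (Pub.init lam, y)) (Impl.pure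
      (f := fun x : ℕ × σ => (Pub.init x.1, x.2)) ?_)).congr fun S O a w => by rw [Act.lift_map]
    unfold Pub.init; fun_prop
  refine (exists_reduction hA (h := fun k S O a => answer C (P S O) k a)
    (fun k => Impl.answer C (hP k)) hμ' hfin
    (fun lam j a => a.1.lam = lam ∧ a.1.Bounded (T.eval lam) j ∧ Inv lam j a.2)
    (2 * (2 * X + 20 + 8 * T + 2 * (T * (4 * T + 5))) + 1 + B) ?_ ?_ ?_).imp fun P' h => ⟨h.1, fun lam S O e => ?_⟩
  rotate_right
  · rw [h.2, bind_map]; rfl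
  · intro lam a ha; obtain ⟨y, hy, rfl⟩ := (mem_support_map_iff _ _ _).1 ha
    exact ⟨rfl, Pub.bounded_init _ _ _, h0 lam y hy⟩
  · rintro lam j ⟨p, y⟩ k x S O u o ho ⟨hl, hb, hi⟩ hx; dsimp only at hl hb hi ho; rw [answer] at ho
    dsimp only at ho; cases hg : p.guard C k x
    · rw [hg, cond_false, pure_run, support_pure, mem_singleton_iff] at ho; subst ho
      exact ⟨hl, hb.succ, hs _ _ _ hi⟩
    · rw [hg, cond_true, bind_run, mem_support_bind_iff] at ho; obtain ⟨o', ho', ho⟩ := ho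
      rw [pure_run, support_pure, mem_singleton_iff] at ho; subst ho
      exact ⟨(p.update_lam _ _ _).trans hl, hb.update hx _ _,
        h1 lam j p y k x S O u hl hb hi hx o' ho'⟩
  · rintro lam j ⟨p, y⟩ hj ⟨hl, hb, hi⟩; dsimp only at hl hb hi; have h2 := hb.size
    have h3 := hB lam j y hj hi; have h4 := Nat.mul_le_mul_right (4 * T.eval lam + 5) hj
    rw [length_enc_pair]; rw [hl] at h2; simp; omega

/-! ### The core game -/

variable {E : SKFE} {D : CDSKE} {F : FunFamily} {C : FunctionClass}

section Core

variable (E D F C)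

/-- The length of `F_K(j)`. -/
def blockLen (lam q : ℕ) : ℕ := Construction.setupCoins E lam q + Construction.cdCoins D lam

/-- The keys `msk_j` and `cd.sk_j` that are generated with the coins `u`. -/
def starKeys (lam q : ℕ) (u : Str) : Str × Str :=
  (E.setup.out ![unary lam, unary q] (u.take (Construction.setupCoins E lam q)),
    D.keyGen.out ![unary lam] (u.drop (Construction.setupCoins E lam q)))

/-- The function that gives the blocks of the other indices, and the keys of the challenge index;
they are independent of the function if `c` is true. -/
def sampler (lam : ℕ) (random c : Bool) (q : ℕ) (jb : Str) : PMF ((Str → Str) × Str × Str) :=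
  (F.sample lam random jb.length (blockLen E D lam q)).bind fun g =>
    (bif c then uniformBits (blockLen E D lam q) else PMF.pure (g jb)).map fun u =>
      (g, starKeys E D lam q u)

/-- Encryption at the challenge index. -/
def encStep {S : Type} (lam : ℕ) (msk cdsk x : Str) : Act S Str :=
  lift (E.enc.dist ![unary lam, msk, x]) >>= fun ct => pure (pairS ct cdsk)

/-- The string that is encrypted instead of `s`. -/
def blank (z : Bool) (s : Str) : Str := bif z then List.replicate s.length false else s

/-- Key generation at the challenge index; the result consists of verification key and
ciphertext. If `z` is true then zeros are encrypted. -/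
def keyStep {S : Type} (lam : ℕ) (msk cdsk f : Str) (z : Bool) : Act S (Str × Str) :=
  lift (E.keyGen.dist ![unary lam, msk, f]) >>= fun fsk =>
    Act.encrypt D lam cdsk (blank z fsk) >>= fun o => pure (o.1, o.2.1)

def vrfyStep {S : Type} (lam : ℕ) (vk cert : Str) : Act S Str :=
  lift (D.vrfyDist lam vk cert) >>= fun ok => pure [ok]

/-- The secrets of the core game. -/
structure Secrets where
  blk : Str → Str
  msk : Str
  cdsk : Str
  vks : List Str

/-- The core game. The first `hyb` keys whose functions separate the challenge plaintexts are
replaced by zeros. -/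
def coreProcs {S : Type} (smp : ℕ → ℕ → Str → PMF ((Str → Str) × Str × Str))
    (hyb : ℕ) (coin : Bool) : Procs S Secrets
  | 0, p, _, x => lift (smp p.lam (item 0 x).length (item 1 x)) >>= fun o =>
      pure ([], ⟨o.1, o.2.1, o.2.2, []⟩)
  | 1, _, s, x => pure (s.blk x, s)
  | 2, p, s, x => encStep E p.lam s.msk s.cdsk x >>= fun r => pure (r, s)
  | 3, p, s, x => keyStep E D p.lam s.msk s.cdsk x (p.sep C x && ltN (p.cnt C) hyb) >>= fun o =>
      pure (o.2, { s with vks := s.vks ++ [o.1] })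
  | 4, p, s, x => vrfyStep D p.lam (s.vks.getI (item 0 x).length) (item 1 x) >>= fun r =>
      pure (r, s)
  | 5, p, s, _ => encStep E p.lam s.msk s.cdsk (bif coin then p.x1 else p.x0) >>= fun r =>
      pure (r, s)
  | _, _, s, _ => pure ([], s)

/-- The final state of the core game. -/
def coreRun (smp : ℕ → ℕ → Str → PMF ((Str → Str) × Str × Str)) (hyb : ℕ) (coin : Bool) (A : Prog)
    (lam : ℕ) : PMF (State ((Pub × Secrets) × Unit)) :=
  interact (game C (coreProcs E D C smp hyb coin)) ((Pub.init lam, ⟨id, [], [], []⟩), ()) A lam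

/-- The output of the core game. -/
def coreExp (smp : ℕ → ℕ → Str → PMF ((Str → Str) × Str × Str)) (hyb : ℕ) (coin : Bool) (A : Prog)
    (lam : ℕ) : PMF Bool :=
  (coreRun E D C smp hyb coin A lam).map fun s => s.guess && s.env.1.1.challenged

end Core

section

variable {α : Type} [Code α]

lemma forall_fin1 {f : Fin 1 → α → Str} (h0 : PT (f 0)) : ∀ k, PT (f k) := fun k => by
  fin_cases k; exact h0

lemma forall_fin2 {f : Fin 2 → α → Str} (h0 : PT (f 0)) (h1 : PT (f 1)) :
    ∀ k, PT (f k) := fun k => by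
  fin_cases k
  exacts [h0, h1]

lemma forall_fin3 {f : Fin 3 → α → Str} (h0 : PT (f 0)) (h1 : PT (f 1)) (h2 : PT (f 2)) :
    ∀ k, PT (f k) := fun k => by
  fin_cases k
  exacts [h0, h1, h2]

namespace PT

@[fun_prop] lemma setupCoins {lam q : α → ℕ} (hl : PT lam) (hq : PT q) : PT fun a =>
    Construction.setupCoins E (lam a) (q a) :=
  coins E.setup (forall_fin2 (f := fun k a => ![Skl.unary (lam a), Skl.unary (q a)] k)
    hl.unary hq.unary)

@[fun_prop] lemma cdCoins {lam : α → ℕ} (hl : PT lam) : PT fun a => Construction.cdCoins D (lam a)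
    :=
  coins D.keyGen (forall_fin1 (f := fun k a => ![Skl.unary (lam a)] k) hl.unary)

@[fun_prop] lemma blockLen {lam q : α → ℕ} (hl : PT lam) (hq : PT q) : PT fun a => Skl.blockLen E D
    (lam a) (q a) := by
  unfold Skl.blockLen; fun_prop

@[fun_prop] lemma starKeys {lam q : α → ℕ} {u : α → Str} (hl : PT lam) (hq : PT q) (hu : PT u) : PT
    fun a => Skl.starKeys E D (lam a) (q a) (u a) :=
  pair (out E.setup (forall_fin2 (f := fun k a => ![Skl.unary (lam a), Skl.unary (q a)] k)
      hl.unary hq.unary) fp)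
    (out D.keyGen (forall_fin1 (f := fun k a => ![Skl.unary (lam a)] k) hl.unary) fp)

@[fun_prop] lemma blank {z : α → Bool} {s : α → Str} (hz : PT z) (hs : PT s) : PT fun a => Skl.blank
    (z a) (s a) := by
  unfold Skl.blank; have := replicate hs.lengthS false; fun_prop

end PT

namespace Impl

lemma skEnc {lam : α → ℕ} {msk x : α → Str} (hl : PT lam) (hm : PT msk) (hx : PT x) : Impl fun _ _ a
    => lift (E.enc.dist ![unary (lam a), msk a, x a]) :=
  ppt E.enc (forall_fin3 (f := fun k a => ![unary (lam a), msk a, x a] k) hl.unary hm hx)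

lemma skKeyGen {lam : α → ℕ} {msk x : α → Str} (hl : PT lam) (hm : PT msk) (hx : PT x) : Impl fun _
    _ a => lift (E.keyGen.dist ![unary (lam a), msk a, x a]) :=
  ppt E.keyGen (forall_fin3 (f := fun k a => ![unary (lam a), msk a, x a] k) hl.unary hm hx)

lemma encStep {lam : α → ℕ} {msk cdsk x : α → Str} (hl : PT lam) (hm : PT msk) (hc : PT cdsk)
    (hx : PT x) : Impl fun _ _ a => Skl.encStep E (lam a) (msk a) (cdsk a) (x a) :=
  (skEnc hl hm hx).bind (g' := fun _ _ a ct => Pure.pure (pairS ct (cdsk a)))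
    (Impl.pure (f := fun x : α × Str => pairS x.2 (cdsk x.1)) fp)

lemma keyStep {lam : α → ℕ} {msk cdsk f : α → Str} {z : α → Bool} (hl : PT lam) (hm : PT msk)
    (hc : PT cdsk) (hf : PT f) (hz : PT z) : Impl fun _ _ a => Skl.keyStep E D (lam a) (msk a)
    (cdsk a) (f a) (z a) := by
  refine (skKeyGen hl hm hf).bind (g' := fun _ _ a fsk =>
    Act.encrypt D (lam a) (cdsk a) (Skl.blank (z a) fsk) >>= fun o => Pure.pure (o.1, o.2.1)) ?_
  refine Impl.bind (g := fun _ _ (x : α × Str) =>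
    Act.encrypt D (lam x.1) (cdsk x.1) (Skl.blank (z x.1) x.2))
    (Impl.encrypt D fp fp fp) ?_
  exact Impl.pure (f := fun x : (α × Str) × Str × Str × ℕ => (x.2.1, x.2.2.1)) fp

lemma vrfyStep {lam : α → ℕ} {vk cert : α → Str} (hl : PT lam) (hv : PT vk) (hc : PT cert) : Impl
    fun _ _ a => Skl.vrfyStep D (lam a) (vk a) (cert a) := by
  refine ((ppt D.vrfy (forall_fin3 (f := fun k a => ![unary (lam a), vk a, cert a] k)
    hl.unary hv hc)).bind (g' := fun _ _ a o => Pure.pure [eqS o [true]])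
    (Impl.pure (f := fun x : α × Str => [eqS x.2 [true]]) fp)).congr fun S O a w => ?_
  rw [Skl.vrfyStep, CDSKE.vrfyDist, Act.lift_map]; simp [eqS]

end Impl

end

/-! ### Sizes and common distributions -/

lemma Impl.size_qubits {α β : Type} [Code α] [Code β] {g : Sem α β} (hg : Impl g) : ∃ p : ℕ[X], ∀ S
    O a w, ∀ o ∈ (g S O a w).support, (enc o.1).length ≤ p.eval (enc a).length ∧ o.2.1.length ≤
    w.1.length + p.eval (enc a).length := by
  obtain ⟨P, M, p, hP⟩ := hg; refine ⟨p, fun S O a w o ho => ?_⟩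
  have h := hP S O ⟨fun _ => enc a, fun r => if r = 0 then w.1 else [], w.2.2, w.2.1, 0⟩ a rfl
    (fun r h2 _ => by simp; omega)
  obtain ⟨s, _, hs⟩ := h.exists_left (b := o) (by simpa using ho); refine ⟨hs.size, ?_⟩
  rw [hs.world]; simpa using hs.qubits

section

variable {S : Type} (E D F C)

lemma encStep_run (lam : ℕ) (msk cdsk x : Str) (w : World S) : encStep E lam msk cdsk x w =
    (E.enc.dist ![unary lam, msk, x]).map fun ct => (pairS ct cdsk, w) := by
  rw [encStep, bind_run, lift, bind_map, ← PMF.bind_pure_comp]; rfl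

lemma vrfyStep_run (lam : ℕ) (vk cert : Str) (w : World S) : vrfyStep D lam vk cert w =
    (D.vrfyDist lam vk cert).map fun ok => ([ok], w) := by
  rw [vrfyStep, bind_run, lift, bind_map, ← PMF.bind_pure_comp]; rfl

/-- Key generation as a distribution of verification key, ciphertext, qubits and memory. -/
def keyDist (lam : ℕ) (msk cdsk f : Str) (z : Bool) (m : QMem) : PMF ((Str × Str) × List ℕ × QMem)
    :=
  (E.keyGen.dist ![unary lam, msk, f]).bind fun fsk =>
    (D.encDist lam cdsk (blank z fsk) m).map fun o => ((o.1.1, o.1.2.1), o.1.2.2, o.2)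

lemma keyStep_run (lam : ℕ) (msk cdsk f : Str) (z : Bool) (w : World S) : keyStep E D lam msk cdsk f
    z w = (keyDist E D lam msk cdsk f z w.2.2).map fun o => (o.1, (w.1 ++ o.2.1, w.2.1, o.2.2))
    := by
  rw [keyStep, bind_run, lift, bind_map, keyDist, PMF.map_bind]; congr 1
  funext fsk
  simp only [comp_apply, bind_run, Act.encrypt,
    ← PMF.bind_pure_comp, PMF.bind_bind, PMF.pure_bind, pure_run]

lemma starKeys_size : ∃ p : ℕ[X], ∀ lam q T u, q ≤ T → u.length ≤ blockLen E D lam q →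
    (starKeys E D lam q u).1.length ≤ p.eval (lam + T) ∧ (starKeys E D lam q u).2.length ≤ p.eval
    (lam + T) := by
  obtain ⟨p, hp⟩ := PT.size (α := ℕ × ℕ × Str) (f := fun a => starKeys E D a.1 a.2.1 a.2.2) fp
  obtain ⟨l, hl⟩ := PT.size (α := ℕ × ℕ) (f := fun a => blockLen E D a.1 a.2) fp
  refine ⟨p.comp (2 * X + 2 + l.comp (2 * X + 1)), fun lam q T u hq hu => ?_⟩
  have h1 := hp (lam, q, u); have h2 := hl (lam, q); rw [length_enc_pair] at h1
  simp only [length_enc_pair, enc_nat, length_unary, enc_str] at h1 h2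
  have h3 := eval_mono l (show 2 * lam + 1 + q ≤ 2 * (lam + T) + 1 by omega)
  have h4 := eval_mono p (show 2 * lam + 1 + (2 * q + 1 + u.length) ≤
    2 * (lam + T) + 2 + l.eval (2 * (lam + T) + 1) by omega)
  simp; omega

lemma blockLen_size : ∃ p : ℕ[X], ∀ lam q T, q ≤ T → blockLen E D lam q ≤ p.eval (lam + T) := by
  obtain ⟨l, hl⟩ := PT.size (α := ℕ × ℕ) (f := fun a => blockLen E D a.1 a.2) fp
  refine ⟨l.comp (2 * X + 1), fun lam q T hq => ?_⟩; have h2 := hl (lam, q)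
  simp only [length_enc_pair, enc_nat, length_unary] at h2
  have h3 := eval_mono l (show 2 * lam + 1 + q ≤ 2 * (lam + T) + 1 by omega); simp; omega

lemma keyDist_size : ∃ p : ℕ[X], ∀ lam msk cdsk f z m N, msk.length ≤ N → cdsk.length ≤ N → f.length
    ≤ N → ∀ o ∈ (keyDist E D lam msk cdsk f z m).support, o.1.1.length ≤ p.eval (lam + N) ∧
    o.1.2.length ≤ p.eval (lam + N) ∧ o.2.1.length ≤ p.eval (lam + N) := by
  obtain ⟨p, hp⟩ := (Impl.keyStep (E := E) (D := D)
    (α := ℕ × Str × Str × Str × Bool) (lam := fun a => a.1)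
    (msk := fun a => a.2.1) (cdsk := fun a => a.2.2.1) (f := fun a => a.2.2.2.1)
    (z := fun a => a.2.2.2.2) fp fp fp fp
    fp).size_qubits
  refine ⟨p.comp (8 * X + 8), fun lam msk cdsk f z m N h1 h2 h3 o ho => ?_⟩
  have h := hp Unit noOracle (lam, msk, cdsk, f, z) ([], (), m) (o.1, (o.2.1, (), o.2.2)) (by
    rw [keyStep_run, mem_support_map_iff]; exact ⟨o, ho, rfl⟩)
  simp only [length_enc_pair, enc_nat, length_unary, enc_str, enc_bool, List.length_nil,
    length_singleton] at h
  have h4 := eval_mono p (show 2 * lam + 1 + (2 * msk.length + 1 + (2 * cdsk.length + 1 +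
    (2 * f.length + 1 + 1))) ≤ 8 * (lam + N) + 8 by omega)
  have h5 : (enc o.1).length = 2 * o.1.1.length + 1 + o.1.2.length := length_enc_pair o.1.1 o.1.2
  simp; omega

end

/-! ### The reduction to the pseudorandom function -/

section PRF

variable (E D F C)

/-- The core game with blocks from an oracle. -/
def prfProcs (c coin : Bool) (S : Type) (O : Oracle S) : Procs S (Str × Str × List Str)
  | 0, p, _, x =>
    Act.call O 0 (encList [unary (item 1 x).length,
      unary (blockLen E D p.lam (item 0 x).length)]) 0 >>= fun _ =>
    (cond c (lift (uniformBits (blockLen E D p.lam (item 0 x).length)))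
      (Act.call O 1 (item 1 x) (blockLen E D p.lam (item 0 x).length + 1) >>= fun r =>
        pure r.1.tail)) >>= fun u =>
    pure ([], ((starKeys E D p.lam (item 0 x).length u).1,
      (starKeys E D p.lam (item 0 x).length u).2, []))
  | 1, p, s, x => Act.call O 1 x (blockLen E D p.lam p.q + 1) >>= fun r => pure (r.1.tail, s)
  | 2, p, s, x => encStep E p.lam s.1 s.2.1 x >>= fun r => pure (r, s)
  | 3, p, s, x => keyStep E D p.lam s.1 s.2.1 x false >>= fun o =>
      pure (o.2, (s.1, s.2.1, s.2.2 ++ [o.1]))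
  | 4, p, s, x => vrfyStep D p.lam (s.2.2.getI (item 0 x).length) (item 1 x) >>= fun r =>
      pure (r, s)
  | 5, p, s, _ => encStep E p.lam s.1 s.2.1 (bif coin then p.x1 else p.x0) >>= fun r => pure (r, s)
  | _, _, s, _ => pure ([], s)

lemma impl_prfProcs (c coin : Bool) (k : ℕ) : Impl fun S O (a : (Pub × Str × Str × List Str) × Str)
    => prfProcs E D c coin S O k a.1.1 a.1.2 a.2 := by
  rcases k with _ | _ | _ | _ | _ | _ | k <;> unfold prfProcs
  · refine Impl.bind (Impl.call 0 ?_ (PT.const 0)) (Impl.bind (Impl.cond (PT.const c)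
      (Impl.coins fp) (Impl.bind (Impl.call 1 fp fp) (Impl.pure fp))) (Impl.pure ?_))
    · simp only [encList]; fun_prop
    · have h := PT.starKeys (E := E) (D := D)
        (α := (((Pub × Str × Str × List Str) × Str) × Str × ℕ) ×
          Str) (lam := fun a => a.1.1.1.1.lam) (q := fun a => (item 0 a.1.1.2).length)
        (u := fun a => a.2) fp fp fp
      exact PT.pair (PT.const _) (PT.pair h.fst (PT.pair h.snd (PT.const _)))
  · exact Impl.bind (Impl.call 1 fp fp) (Impl.pure fp)
  · exact Impl.bind (Impl.encStep fp fp fp fp) (Impl.pure fp)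
  · refine Impl.bind (Impl.keyStep fp fp fp fp fp) (Impl.pure ?_)
    refine PT.pair fp (PT.pair fp (PT.pair fp (PT.append fp (PT.cons fp (PT.const _)))))
  · exact Impl.bind (Impl.vrfyStep fp (PT.getI fp fp) fp) (Impl.pure fp)
  · exact Impl.bind (Impl.encStep fp fp fp fp) (Impl.pure fp)
  · exact Impl.pure fp

end PRF

lemma Act.bind_pure_run {S α β : Type} (g : Act S α) (f : α → β) (w : World S) :
    (g >>= fun a => pure (f a)) w = (g w).map fun o => (f o.1, o.2) := by
  rw [bind_run, ← PMF.bind_pure_comp]; rfl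

open Act (bind_pure_run)

lemma Pub.on_of_guard {C : FunctionClass} {p : Pub} {x : Str} {k : ℕ}
    (h : p.guard C (k + 1) x = true) : p.on = true := by
  rcases k with _ | _ | _ | _ | _ | k <;> first
    | exact ((Bool.and_eq_true _ _).mp h).1
    | cases h

lemma Pub.off_of_guard {C : FunctionClass} {p : Pub} {x : Str} (h : p.guard C 0 x = true) : p.on =
    false := by
  simpa using ((Bool.and_eq_true _ _).mp h).1

section Runs

variable {S β : Type}

lemma lift_bind_run {α : Type} (μ : PMF α) (f : α → β) (w : World S) :
    (lift μ >>= fun r => pure (f r)) w = μ.map fun a => (f a, w) := by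
  rw [bind_pure_run, lift, map_comp]; rfl

lemma call_bind_run (O : Oracle S) (k : ℕ) (s : Str) (t : ℕ) (f : Str × ℕ → β) (w : World S) :
    (Act.call O k s t >>= fun r => pure (f r)) w = (O k s w.2.1 w.2.2).map fun o => (f (o.1.1.take
    t, (o.1.2.take t).length), (w.1 ++ o.1.2.take t, o.2.1, o.2.2)) := by
  rw [bind_pure_run, Act.call, map_comp]; rfl

lemma encStep_bind_run (lam : ℕ) (msk cdsk x : Str) (f : Str → β) (w : World S) :
    (encStep E lam msk cdsk x >>= fun r => pure (f r)) w = (E.enc.dist ![unary lam, msk, x]).map fun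
    ct => (f (pairS ct cdsk), w) := by
  rw [bind_pure_run, encStep_run, map_comp]; rfl

lemma encStep_bind_support {lam : ℕ} {msk cdsk x : Str} {f : Str → β} {w : World S} {o}
    (ho : o ∈ ((encStep E lam msk cdsk x >>= fun r => pure (f r)) w).support) :
    ∃ ct, (f (pairS ct cdsk), w) = o := by
  rw [encStep_bind_run, mem_support_map_iff] at ho; obtain ⟨r, _, h⟩ := ho; exact ⟨r, h⟩

lemma vrfyStep_bind_run (lam : ℕ) (vk cert : Str) (f : Str → β) (w : World S) :
    (vrfyStep D lam vk cert >>= fun r => pure (f r)) w = (D.vrfyDist lam vk cert).map fun ok =>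
    (f [ok], w) := by
  rw [bind_pure_run, vrfyStep_run, map_comp]; rfl

lemma keyStep_bind_run (lam : ℕ) (msk cdsk x : Str) (z : Bool) (f : Str × Str → β) (w : World S) :
    (keyStep E D lam msk cdsk x z >>= fun r => pure (f r)) w =
    (keyDist E D lam msk cdsk x z w.2.2).map fun o => (f o.1, (w.1 ++ o.2.1, w.2.1, o.2.2)) := by
  rw [bind_pure_run, keyStep_run, map_comp]; rfl

variable (smp : ℕ → ℕ → Str → PMF ((Str → Str) × Str × Str))
    (hyb : ℕ) (coin : Bool) (p : Pub) (s : Secrets) (x : Str) (w : World S)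

lemma coreProcs_zero : coreProcs E D C smp hyb coin 0 p s x w =
    (smp p.lam (item 0 x).length (item 1 x)).map fun o =>
      (([], ⟨o.1, o.2.1, o.2.2, []⟩), w) := lift_bind_run _ _ _

lemma coreProcs_one : coreProcs E D C smp hyb coin 1 p s x w = PMF.pure ((s.blk x, s), w) := rfl

lemma coreProcs_two : coreProcs E D C smp hyb coin 2 p s x w =
    (E.enc.dist ![unary p.lam, s.msk, x]).map fun ct => ((pairS ct s.cdsk, s), w) :=
  encStep_bind_run _ _ _ _ _ _

lemma coreProcs_three : coreProcs E D C smp hyb coin 3 p s x w =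
    (keyDist E D p.lam s.msk s.cdsk x (p.sep C x && ltN (p.cnt C) hyb) w.2.2).map fun o =>
      ((o.1.2, { s with vks := s.vks ++ [o.1.1] }), (w.1 ++ o.2.1, w.2.1, o.2.2)) :=
  keyStep_bind_run _ _ _ _ _ _ _

lemma coreProcs_four : coreProcs E D C smp hyb coin 4 p s x w =
    (D.vrfyDist p.lam (s.vks.getI (item 0 x).length) (item 1 x)).map fun ok => (([ok], s), w) :=
  vrfyStep_bind_run _ _ _ _ _

lemma coreProcs_five : coreProcs E D C smp hyb coin 5 p s x w =
    (E.enc.dist ![unary p.lam, s.msk, bif coin then p.x1 else p.x0]).map fun ct =>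
    ((pairS ct s.cdsk, s), w) :=
  encStep_bind_run _ _ _ _ _ _

end Runs

/-- Games with related procedures have the same outcome. -/
lemma game_eq {SA SB XA XB : Type} {C : FunctionClass} {PA : Procs SA XA} {PB : Procs SB XB}
    {R : Pub → XA → SA → XB → SB → Prop} {T : ℕ} (h : ∀ k p xa ea xb eb x m, R p xa ea xb eb →
    x.length ≤ T → p.guard C k x = true → Lift (fun o o' => o'.1.1 = o.1.1 ∧ o'.2.1 = o.2.1 ∧
    o'.2.2.2 = o.2.2.2 ∧ R (p.update k x o.1.1) o.1.2 o.2.2.1 o'.1.2 o'.2.2.1) (PA k p xa x ([], ea,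
    m)) (PB k p xb x ([], eb, m))) {A : Prog} {lam : ℕ} {p : Pub} {xa : XA} {xb : XB} {ea : SA}
    {eb : SB} (hR : R p xa ea xb eb) (hT : ∀ a ∈ (interact (game C PA) ((p, xa), ea) A lam).support,
    a.time ≤ T) {γ : Type} {f : State ((Pub × XA) × SA) → γ} {g : State ((Pub × XB) × SB) → γ} (hfg
    : ∀ a b, b = a.withEnv b.env → b.env.1.1 = a.env.1.1 → R a.env.1.1 a.env.1.2 a.env.2 b.env.1.2
    b.env.2 → f a = g b) : (interact (game C PA) ((p, xa), ea) A lam).map f =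
    (interact (game C PB) ((p, xb), eb) A lam).map g := by
  refine (lift_game (R := R) (BA := fun _ _ _ => False) (BB := fun _ _ _ => False)
    (fun k p xa ea xb eb x m hR hx hg => (h k p xa ea xb eb x m hR hx hg).mono fun _ _ => Or.inl)
    (fun _ _ _ _ h => h.elim) (fun _ _ _ _ h => h.elim) A
    (a := start ![unary lam] [] QMem.init ((p, xa), ea))
    (b := start ![unary lam] [] QMem.init ((p, xb), eb)) rfl rfl hR hT).map_eq ?_
  rintro a b (⟨h1, h2, h3⟩ | ⟨h, _⟩)
  · exact hfg a b h1 h2 h3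
  · exact h.elim

/-- Running time bound of a machine. -/
def TimeBound (A : Prog) (T : ℕ[X]) : Prop :=
  ∀ (lam : ℕ) (S : Type) (O : Oracle S) (e : S),
    ∀ s ∈ (A.run O (start ![unary lam] [] QMem.init e)).support, s.time ≤ T.eval lam

section PRF

lemma length_sample {lam : ℕ} {random : Bool} {a b : ℕ} {g : Str → Str}
    (hg : g ∈ (F.sample lam random a b).support) (x : Str) : (g x).length = b := by
  unfold FunFamily.sample at hg; split_ifs at hg
  · obtain ⟨R, _, rfl⟩ := (mem_support_map_iff _ _ _).1 hg; simp
  · obtain ⟨R, _, rfl⟩ := (mem_support_map_iff _ _ _).1 hg; exact F.length_eval _ _ _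

lemma ltN_zero (n : ℕ) : ltN n 0 = false := by simp [ltN]

lemma take_reply {l : Str} {n : ℕ} (h : l.length = n) : (reply l []).1.take (n + 1) = true :: l
    := by
  subst h; exact take_of_length_le (by simp [reply])

lemma exists_prf_reduction {A : Prog} {T : ℕ[X]} (hA : TimeBound A T) (c coin : Bool) : ∃ P,
    IsQPTAdversary P ∧ ∀ lam random, F.experiment P lam random = coreExp E D C
    (fun lam => sampler E D F lam random c) 0 coin A lam := by
  obtain ⟨p1, hp1⟩ := starKeys_size E D; obtain ⟨p2, hp2⟩ := keyDist_size E D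
  refine (exists_game_reduction hA C (P := prfProcs E D c coin)
    (impl_prfProcs E D c coin) (μ := fun _ => PMF.pure ([], [], []))
    (Impl.pure (f := fun _ : ℕ => (([], [], []) : Str × Str × List Str))
      fp |>.congr fun S O a w => by simp only [lift, pure_map, pure_run])
    (fin := fun a => a.2 && a.1.1.challenged) fp
    (fun lam j y => y.1.length ≤ p1.eval (lam + T.eval lam) ∧
      y.2.1.length ≤ p1.eval (lam + T.eval lam) ∧ y.2.2.length ≤ j ∧ ∀ v ∈ y.2.2,
        v.length ≤ p2.eval (lam + (p1.eval (lam + T.eval lam) + T.eval lam)))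
    (4 * p1.comp (X + T) + 5 +
      T * (2 * p2.comp (X + (p1.comp (X + T) + T)) + 1)) ?_ ?_ ?_ ?_).imp fun P h => ⟨h.1, fun lam random => ?_⟩
  rotate_right
  · have h' := congrArg (PMF.map Prod.fst) (h.2 lam _ (F.oracle lam random) none)
    rw [map_comp, PMF.pure_bind, map_comp] at h'; refine h'.trans (Eq.symm ?_)
    refine game_eq (R := fun p xa _ xb eb => p.lam = lam ∧ if p.on then
        (∃ g, eb = some (p.jb.length, g) ∧ xa.blk = g ∧ (∀ x, (g x).length = blockLen E D lam p.q) ∧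
          xb = (xa.msk, xa.cdsk, xa.vks)) else eb = none) (T := T.eval lam) ?_ ?_ ?_ ?_
    · rintro k p ⟨blk, msk, cdsk, vks⟩ - xb eb x m ⟨hl, hR⟩ - hg; subst hl
      rcases k with _ | _ | _ | _ | _ | _ | k
      · have hon := Pub.off_of_guard hg; simp only [hon, Bool.false_eq_true, if_false] at hR
        subst hR; rw [coreProcs_zero, sampler, PMF.map_bind]
        change Lift _ _ ((Act.call _ _ _ _ >>= fun _ => cond _ _ _ >>= fun _ => pure _) _)
        rw [bind_run, Act.call, bind_map]
        simp only [FunFamily.oracle, encList, item, Function.iterate_zero, id, fstS_pairS,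
          sndS_pairS, Function.iterate_succ, comp_apply, length_unary, bind_map,
          Function.comp_def]
        refine Lift.bind_same fun g hg => ?_
        cases c
        · rw [cond_false, cond_false, pure_map, pure_map, bind_pure_run, call_bind_run]
          simp only [FunFamily.oracle, if_true, pure_map,
            take_reply (length_sample hg (fstS (sndS x)))]
          exact Lift.pure ⟨rfl, rfl, rfl, rfl, g, rfl, rfl, fun y => length_sample hg y, rfl⟩
        · rw [cond_true, cond_true, map_comp, lift_bind_run]
          exact Lift.map_same fun u _ =>
            ⟨rfl, rfl, rfl, rfl, g, rfl, rfl, fun y => length_sample hg y, rfl⟩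
      all_goals
        have hon := Pub.on_of_guard hg; simp only [hon, if_true] at hR
        obtain ⟨g, rfl, rfl, hlen, rfl⟩ := hR
      · have hx : x.length = p.jb.length := by
          simp only [Pub.guard, hon, Bool.true_and, Bool.and_eq_true, eqN, decide_eq_true_eq] at hg
          exact hg.1
        rw [coreProcs_one]; change Lift _ _ ((Act.call _ _ _ _ >>= fun _ => pure _) _)
        rw [call_bind_run]; simp only [FunFamily.oracle, hx, if_true, pure_map, take_reply (hlen x)]
        refine Lift.pure ⟨rfl, rfl, rfl, rfl, ?_⟩
        rw [show (Pub.update 1 p x (blk x)).on = true from hon, if_pos rfl]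
        exact ⟨_, rfl, rfl, hlen, rfl⟩
      · rw [coreProcs_two]; change Lift _ _ ((encStep _ _ _ _ _ >>= fun _ => pure _) _)
        rw [encStep_bind_run]; refine Lift.map_same fun o _ => ⟨rfl, rfl, rfl, rfl, ?_⟩
        rw [show (Pub.update 2 p x _).on = true from hon, if_pos rfl]
        exact ⟨_, rfl, rfl, hlen, rfl⟩
      · rw [coreProcs_three]; change Lift _ _ ((keyStep _ _ _ _ _ _ _ >>= fun _ => pure _) _)
        rw [keyStep_bind_run, ltN_zero, Bool.and_false]
        refine Lift.map_same fun o _ => ⟨rfl, rfl, rfl, rfl, ?_⟩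
        rw [show (Pub.update 3 p x _).on = true from hon, if_pos rfl]
        exact ⟨_, rfl, rfl, hlen, rfl⟩
      · rw [coreProcs_four]; change Lift _ _ ((vrfyStep _ _ _ _ >>= fun _ => pure _) _)
        rw [vrfyStep_bind_run]; refine Lift.map_same fun o _ => ⟨rfl, rfl, rfl, rfl, ?_⟩
        rw [show (Pub.update 4 p x _).on = true from hon, if_pos rfl]
        exact ⟨_, rfl, rfl, hlen, rfl⟩
      · rw [coreProcs_five]; change Lift _ _ ((encStep _ _ _ _ _ >>= fun _ => pure _) _)
        rw [encStep_bind_run]; refine Lift.map_same fun o _ => ⟨rfl, rfl, rfl, rfl, ?_⟩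
        rw [show (Pub.update 5 p x _).on = true from hon, if_pos rfl]
        exact ⟨_, rfl, rfl, hlen, rfl⟩
      · cases hg
    · exact ⟨rfl, rfl⟩
    · exact hA lam _ _ _
    · intro a b hab hp _; dsimp only [comp_apply]; rw [hp, hab]; rfl
  · intro lam x hx; rw [support_pure, mem_singleton_iff] at hx; subst hx; simp
  · rintro _ j p ⟨msk, cdsk, vks⟩ k x S O u rfl hb ⟨h1, h2, h3, h4⟩ hx o ho
    rcases k with _ | _ | _ | _ | _ | _ | k
    · change o ∈ PMF.support ((Act.call _ _ _ _ >>= fun _ => cond _ _ _ >>= fun _ => pure _) _)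
        at ho
      rw [bind_run, mem_support_bind_iff] at ho; obtain ⟨r, -, ho⟩ := ho
      rw [bind_pure_run, mem_support_map_iff] at ho; obtain ⟨⟨v, w⟩, hv, rfl⟩ := ho
      have hv : v.length ≤ blockLen E D p.lam (item 0 x).length := by
        cases c
        · rw [cond_false, call_bind_run, mem_support_map_iff] at hv; obtain ⟨r, _, hr⟩ := hv
          cases hr; rw [List.length_tail, length_take]; omega
        · rw [cond_true, lift, mem_support_map_iff] at hv; obtain ⟨r, hr, hr'⟩ := hv; cases hr'
          exact (length_of_mem_uniformBits hr).le
      have h := hp1 p.lam _ (T.eval p.lam) v ((Pub.length_item_le 0 x).trans hx) hv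
      exact ⟨h.1, h.2, Nat.zero_le _, by simp⟩
    · change o ∈ PMF.support ((Act.call _ _ _ _ >>= fun _ => pure _) _) at ho
      rw [call_bind_run, mem_support_map_iff] at ho; obtain ⟨r, _, rfl⟩ := ho
      exact ⟨h1, h2, h3.trans j.le_succ, h4⟩
    · obtain ⟨r, rfl⟩ := encStep_bind_support ho
      exact ⟨h1, h2, h3.trans j.le_succ, h4⟩
    · change o ∈ PMF.support ((keyStep _ _ _ _ _ _ _ >>= fun _ => pure _) _) at ho
      rw [keyStep_bind_run, mem_support_map_iff] at ho; obtain ⟨r, hr, rfl⟩ := ho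
      refine ⟨h1, h2, by simpa using h3, fun v hv => ?_⟩; obtain hv | rfl := by simpa using hv
      · exact h4 v hv
      · exact (hp2 _ _ _ _ _ _ _ (h1.trans (Nat.le_add_right _ _))
          (h2.trans (Nat.le_add_right _ _)) (hx.trans (Nat.le_add_left _ _)) r hr).1
    · change o ∈ PMF.support ((vrfyStep _ _ _ _ >>= fun _ => pure _) _) at ho
      rw [vrfyStep_bind_run, mem_support_map_iff] at ho; obtain ⟨r, _, rfl⟩ := ho
      exact ⟨h1, h2, h3.trans j.le_succ, h4⟩
    · obtain ⟨r, rfl⟩ := encStep_bind_support ho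
      exact ⟨h1, h2, h3.trans j.le_succ, h4⟩
    · change o ∈ PMF.support (PMF.pure _) at ho; rw [support_pure, mem_singleton_iff] at ho
      subst ho; exact ⟨h1, h2, h3.trans j.le_succ, h4⟩
  · rintro lam j y ⟨h1, h2, h3, h4⟩; exact ⟨h1, h2, h3.trans j.le_succ, h4⟩
  · rintro lam j ⟨msk, cdsk, vks⟩ hj ⟨h1, h2, h3, h4⟩; dsimp only at h1 h2 h3 h4
    have h5 := length_enc_le (l := vks) h4
    have h6 := Nat.mul_le_mul_right
      (2 * p2.eval (lam + (p1.eval (lam + T.eval lam) + T.eval lam)) + 1) (h3.trans hj)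
    simp only [length_enc_pair, enc_str]; simp; omega

end PRF

/-! ### The value of a random function at one point -/

lemma uniform_update {α β : Type} [Fintype α] [DecidableEq α] [Fintype β] [Nonempty β] (i : α) :
    ((PMF.uniformOfFintype (α → β)).bind fun R => (PMF.uniformOfFintype β).map fun v =>
    update R i v) = PMF.uniformOfFintype (α → β) := by
  rw [← map_uniform_equiv (Equiv.funSplitAt i β).symm, uniform_prod]
  simp only [PMF.bind_bind, ← PMF.bind_pure_comp, PMF.pure_bind, comp_apply]; congr 1
  funext r
  have h : ∀ b v, update ((Equiv.funSplitAt i β).symm (b, r)) i v =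
      (Equiv.funSplitAt i β).symm (v, r) := fun b v => by
    funext j
    by_cases hj : j = i
    · subst hj; simp
    · simp [hj]
  simp only [h, PMF.bind_const]; rfl


lemma lift_sampler_random (lam q : ℕ) (jb : Str) : Lift (fun o o' => o.2 = o'.2 ∧ ∀ x : Str,
    x.length = jb.length → x ≠ jb → o.1 x = o'.1 x) (sampler E D F lam true false q jb)
    (sampler E D F lam true true q jb) := by
  simp only [sampler, FunFamily.sample, if_true, cond_true, cond_false, bind_map,
    Function.comp_def, pure_map, uniformBits, map_comp]
  have hj : List.ofFn (fun i : Fin jb.length => jb.getD i false) = jb :=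
    ext_getElem (by simp) fun i h1 h2 => by simp
  have hne : ∀ x : Str, x.length = jb.length → x ≠ jb →
      (fun i : Fin jb.length => x.getD i false) ≠ fun i : Fin jb.length => jb.getD i false := by
    refine fun x hx h h' => h ?_
    have hx' : List.ofFn (fun i : Fin jb.length => x.getD i false) = x :=
      ext_getElem (by simp [hx]) fun i h1 h2 => by simp [h2]
    rw [← hx', h', hj]
  conv_lhs => rw [← uniform_update fun i : Fin jb.length => jb.getD i false, PMF.bind_bind]
  refine Lift.bind_same fun R _ => ?_
  simp only [Function.comp_def, ← PMF.bind_pure_comp, PMF.bind_bind, PMF.pure_bind]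
  refine Lift.bind_same fun v _ => Lift.pure ⟨?_, fun x hx h => ?_⟩
  · simp only [Function.update_self]
  · simp only [update_of_ne (hne x hx h)]

lemma coreExp_random (coin : Bool) {A : Prog} {T : ℕ[X]} (hA : TimeBound A T) (lam : ℕ) : coreExp E
    D C (fun lam => sampler E D F lam true false) 0 coin A lam = coreExp E D C
    (fun lam => sampler E D F lam true true) 0 coin A lam := by
  refine game_eq (R := fun p xa _ xb _ => (p.on = true → ∀ x, x.length = p.jb.length → x ≠ p.jb →
    xa.blk x = xb.blk x) ∧ xb.msk = xa.msk ∧ xb.cdsk = xa.cdsk ∧ xb.vks = xa.vks) ?_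
    ⟨fun h => (by cases h), rfl, rfl, rfl⟩ (hA lam _ _ _) ?_
  · rintro k p ⟨blk, msk, cdsk, vks⟩ - ⟨blk', msk', cdsk', vks'⟩ - x m ⟨hR, h1, h2, h3⟩ - hg
    dsimp only at hR h1 h2 h3; subst h1 h2 h3; rcases k with _ | _ | _ | _ | _ | _ | k
    · rw [coreProcs_zero, coreProcs_zero]; refine Lift.map ((lift_sampler_random _ _ _).mono ?_)
      rintro ⟨g, k⟩ ⟨g', k'⟩ ⟨h, h'⟩; dsimp only at h; subst h
      exact ⟨rfl, rfl, rfl, fun _ => h', rfl, rfl, rfl⟩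
    all_goals have hR := hR (Pub.on_of_guard hg)
    · simp only [Pub.guard, Bool.and_eq_true, eqN, decide_eq_true_eq, eqS, Bool.not_eq_true',
        decide_eq_false_iff_not] at hg
      rw [coreProcs_one, coreProcs_one]
      exact Lift.pure ⟨(hR x hg.2.1 hg.2.2).symm, rfl, rfl, fun _ => hR, rfl, rfl, rfl⟩
    · rw [coreProcs_two, coreProcs_two]
      exact Lift.map_same fun _ _ => ⟨rfl, rfl, rfl, fun _ => hR, rfl, rfl, rfl⟩
    · rw [coreProcs_three, coreProcs_three]
      exact Lift.map_same fun _ _ => ⟨rfl, rfl, rfl, fun _ => hR, rfl, rfl, rfl⟩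
    · rw [coreProcs_four, coreProcs_four]
      exact Lift.map_same fun _ _ => ⟨rfl, rfl, rfl, fun _ => hR, rfl, rfl, rfl⟩
    · rw [coreProcs_five, coreProcs_five]
      exact Lift.map_same fun _ _ => ⟨rfl, rfl, rfl, fun _ => hR, rfl, rfl, rfl⟩
    · cases hg
  · intro a b hab hp _; rw [hp, hab]; rfl

/-! ### Numbers in binary -/

/-- The bit string without the zeros at its end. -/
def trimBits (s : Str) : Str :=
  s.reverse.foldl (fun t b => bif t.isEmpty && !b then [] else b :: t) []

lemma bits_isEmpty (n : ℕ) : n.bits.isEmpty = decide (n = 0) := by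
  rw [Bool.eq_iff_iff, List.isEmpty_iff, decide_eq_true_eq, ← Nat.size_eq_zero,
    ← Nat.size_eq_bits_len, List.length_eq_zero_iff]

lemma any_id_eq (t : Str) : t.any id = !(ofBits t).bits.isEmpty := by
  rw [bits_isEmpty]
  induction t with
  | nil => rfl
  | cons b t ih => rw [List.any_cons, ih, ofBits]; cases b <;> simp

lemma trimBits_eq (s : Str) : trimBits s = (ofBits s).bits := by
  rw [trimBits, List.foldl_reverse]
  induction s with
  | nil => rfl
  | cons b s ih =>
    rw [List.foldr_cons, ih, ofBits]
    by_cases h : ofBits s = 0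
    · rw [h]; cases b <;> simp
    · have h' : (ofBits s).bits.isEmpty = false := by rw [bits_isEmpty, decide_eq_false h]
      rw [h', Bool.false_and, cond_false]; cases b
      · rw [Bool.toNat_false, Nat.zero_add, Nat.bit0_bits _ h]
      · rw [Bool.toNat_true, Nat.add_comm, Nat.bit1_bits]

lemma ofBits_bits (n : ℕ) : ofBits n.bits = n := by
  induction n using Nat.binaryRec' with
  | zero => rfl
  | bit b n h ih => rw [Nat.bits_append_bit _ _ h, ofBits, ih, Nat.bit_val]; omega

/-- The successor of a number in binary. -/
def incBits (s : Str) : Str :=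
  (fun o : Bool × Str => o.2 ++ [o.1])
    (s.foldl (fun o b => (o.1 && b, o.2 ++ [xor o.1 b])) (true, []))

lemma ofBits_append (s t : Str) : ofBits (s ++ t) = ofBits s + 2 ^ s.length * ofBits t := by
  induction s with
  | nil => simp [ofBits]
  | cons b s ih => rw [List.cons_append, ofBits, ofBits, ih, length_cons]; ring

lemma incBits_aux (s : Str) : ∀ (c : Bool) (t : Str),
    (s.foldl (fun o b => (o.1 && b, o.2 ++ [xor o.1 b])) (c, t)).2.length = t.length + s.length ∧
    (fun o : Bool × Str => ofBits (o.2 ++ [o.1]))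
    (s.foldl (fun o b => (o.1 && b, o.2 ++ [xor o.1 b])) (c, t)) = ofBits t + 2 ^ t.length *
    (ofBits s + c.toNat) := by
  induction s with
  | nil => intro c t; simp [ofBits_append, ofBits]
  | cons b s ih =>
    intro c t; rw [foldl_cons]; obtain ⟨h1, h2⟩ := ih (c && b) (t ++ [xor c b])
    refine ⟨by rw [h1]; simp; omega, h2.trans ?_⟩
    rw [ofBits_append, length_append, length_singleton, ofBits, ofBits, ofBits]
    cases c <;> cases b <;> simp <;> ring

lemma ofBits_incBits (s : Str) : ofBits (incBits s) = ofBits s + 1 := by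
  have := (incBits_aux s true []).2; simpa [ofBits, incBits] using this

lemma length_incBits (s : Str) : (incBits s).length = s.length + 1 := by
  have := (incBits_aux s true []).1; simpa [incBits] using this

lemma foldl_incBits (s : Str) : ∀ t, ofBits (s.foldl (fun o _ => incBits o) t) = ofBits t + s.length
    ∧ (s.foldl (fun o _ => incBits o) t).length = t.length + s.length := by
  induction s with
  | nil => simp
  | cons b s ih =>
    intro t; rw [foldl_cons, (ih _).1, (ih _).2, ofBits_incBits, length_incBits, length_cons]; omega

lemma foldl_min (s : Str) (c : ℕ) : s.reverse.foldl (fun v b => min (b.toNat + 2 * v) c) 0 = min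
    (ofBits s) c := by
  rw [List.foldl_reverse]
  induction s with
  | nil => simp [ofBits]
  | cons b s ih => rw [List.foldr_cons, ih, ofBits]; omega

lemma foldl_le (s : Str) : ∀ (r : Bool) (t : Str), (fun o : Bool × Str => o.1 || o.2.any id)
    (s.foldl (fun o b => (bif b == o.2.headI then o.1 else o.2.headI, o.2.tail)) (r, t)) = decide
    (ofBits s + (!r).toNat ≤ ofBits t) := by
  induction s with
  | nil =>
    intro r t; rw [List.foldl_nil]; dsimp only; rw [any_id_eq, bits_isEmpty, ofBits]
    cases r <;> simp [Nat.one_le_iff_ne_zero]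
  | cons b s ih =>
    intro r t; rw [foldl_cons, ih, ofBits]
    cases t with
    | nil => cases b <;> cases r <;> simp [ofBits, Bool.toNat]
    | cons d t => cases b <;> cases r <;> cases d <;> simp [ofBits, Bool.toNat] <;> omega

namespace PT

variable {α : Type} [Code α]

lemma headS {s : α → Str} (hs : PT s) : PT fun a => (s a).headI :=
  (eqS (takeS (const 1) hs) (const [true])).of_enc_eq fun a => by
    rcases s a with _ | ⟨b, t⟩
    · rfl
    · cases b <;> rfl

lemma reverseS {s : α → Str} (hs : PT s) : PT fun a => (s a).reverse := by
  obtain ⟨q, hq⟩ := hs.size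
  have key : ∀ (s t : Str), s.foldl (fun t b => b :: t) t = s.reverse ++ t := by
    intro s
    induction s with
    | nil => simp
    | cons b s ih => intro t; rw [foldl_cons, ih]; simp
  refine (foldlS (σ := Str) (f := fun _ t b => b :: t) hs (const []) fp q
    fun a l' h => ?_).of_enc_eq fun a => by rw [key, List.append_nil]
  rw [key]; have := h.length_le; have := hq a
  simp only [enc_str, List.append_nil, List.length_reverse] at *
  omega

lemma trimBits {s : α → Str} (hs : PT s) : PT fun a => Skl.trimBits (s a) := by
  obtain ⟨q, hq⟩ := hs.size
  refine foldlS (σ := Str) (f := fun _ t b => bif t.isEmpty && !b then [] else b :: t)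
    hs.reverseS (const [])
    (by have : PT fun x : α × Str × Bool => x.2.1.isEmpty := isNilS fp
        fun_prop) q fun a l' h => ?_
  have key : ∀ s : Str, (s.foldl (fun t b => bif t.isEmpty && !b then [] else b :: t)
      []).length ≤ s.length := by
    intro s
    induction s using List.reverseRecOn with
    | nil => simp
    | append_singleton s b ih =>
      rw [List.foldl_append, foldl_cons, List.foldl_nil]; cases hh : (List.isEmpty _ && !b)
      · simpa using ih
      · simp
  have h1 := h.length_le; have := hq a; have := key l'
  simp only [enc_str, List.length_reverse] at *
  omega

@[fun_prop] lemma bitsOf {s : α → Str} (hs : PT s) : PT fun a => (ofBits (s a)).bits :=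
  hs.trimBits.of_enc_eq fun a => by rw [trimBits_eq]

lemma incBits {s : α → Str} (hs : PT s) : PT fun a => Skl.incBits (s a) := by
  obtain ⟨q, hq⟩ := hs.size
  have := foldlS (σ := Bool × Str)
    (f := fun _ o b => (o.1 && b, o.2 ++ [xor o.1 b])) hs (const (true, []))
    ((PT.and fp fp).pair (appendS fp (consS
      ((cond (c := fun x : α × (Bool × Str) × Bool => x.2.1.1) (f := fun x => !x.2.2)
        (g := fun x => x.2.2) fp fp fp).of_enc_eq
          fun x => by cases x.2.1.1 <;> simp) (const [])))) (q + 3) fun a l' h => ?_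
  · unfold Skl.incBits; fun_prop
  · have h1 := h.length_le; have := hq a; have := (incBits_aux l' true []).1; rw [length_enc_pair]
    simp only [enc_str, enc_bool, List.length_nil, length_singleton, eval_add, eval_ofNat] at *
    omega

@[fun_prop] lemma bits {n : α → ℕ} (hn : PT n) : PT fun a => (n a).bits := by
  obtain ⟨q, hq⟩ := hn.size
  refine (foldlS (σ := Str) (f := fun _ o _ => Skl.incBits o) hn.unary (const [])
    (incBits fp) q fun a l' h => ?_).bitsOf.of_enc_eq fun a => by
      rw [(foldl_incBits _ _).1, length_unary, ofBits, Nat.zero_add]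
  have h1 := h.length_le; have := hq a; have := (foldl_incBits l' []).2
  simp only [enc_str, enc_nat, length_unary, List.length_nil] at *
  omega

@[fun_prop] lemma minOfBits {s : α → Str} {c : α → ℕ} (hs : PT s) (hc : PT c) : PT fun a => min
    (ofBits (s a)) (c a) := by
  obtain ⟨q, hq⟩ := hc.size
  refine (foldlS (σ := ℕ) (f := fun a v b => min (b.toNat + 2 * v) (c a)) hs.reverseS (const 0)
    ?_ q fun a l' h => ?_).of_enc_eq fun a => by rw [foldl_min]
  · have : PT fun x : α × ℕ × Bool => min (x.2.2.toNat + 2 * x.2.1) (c x.1) :=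
      (takeS (f := fun x : α × ℕ × Bool => Skl.unary ((bif x.2.2 then 1 else 0) + 2 * x.2.1))
        (n := fun x => c x.1) fp fp).of_enc_eq fun a => by
          rw [enc_str, enc_nat, Skl.unary, List.take_replicate, Skl.unary, Nat.min_comm]
          cases a.2.2 <;> rfl
    exact this
  · refine le_trans ?_ (hq a); rcases List.eq_nil_or_concat l' with rfl | ⟨l, b, rfl⟩
    · simp [enc_nat]
    · simp [enc_nat]

@[fun_prop] lemma leBits {s t : α → Str} (hs : PT s) (ht : PT t) : PT fun a => decide
    (ofBits (s a) ≤ ofBits (t a)) := by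
  obtain ⟨q, hq⟩ := ht.size
  have h := foldlS (σ := Bool × Str)
    (f := fun _ o b => (bif b == o.2.headI then o.1 else o.2.headI, o.2.tail)) hs
    ((const true).pair ht) ?_ (q + 3) fun a l' h => ?_
  · exact (h.fst.or (isNilS h.snd.bitsOf).not).of_enc_eq fun a => by
      have := foldl_le (s a) true (t a); dsimp only at this
      rw [any_id_eq, Bool.not_true, Bool.toNat_false, Nat.add_zero] at this; rw [← this]
  · have h1 : PT fun x : α × (Bool × Str) × Bool => x.2.1.2.headI := headS fp
    have h2 : PT fun x : α × (Bool × Str) × Bool => x.2.2 == x.2.1.2.headI :=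
      (cond (c := fun x : α × (Bool × Str) × Bool => x.2.2) (f := fun x => x.2.1.2.headI)
        (g := fun x => !x.2.1.2.headI) fp fp fp).of_enc_eq
          fun x => by cases x.2.2 <;> cases x.2.1.2.headI <;> rfl
    fun_prop
  · have := hq a
    have key : ∀ (l : Str) r t, (l.foldl (fun (o : Bool × Str) b =>
        (bif b == o.2.headI then o.1 else o.2.headI, o.2.tail)) (r, t)).2.length ≤ t.length := by
      intro l
      induction l with
      | nil => simp
      | cons b l ih => intro r t; exact (ih _ _).trans (by simp)
    have := key l' true (t a); rw [length_enc_pair]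
    simp only [enc_str, enc_bool, length_singleton, eval_add, eval_ofNat] at *
    omega

/-- The value of the function family. -/
lemma evalF (F : FunFamily) {K x : α → Str} {b : α → ℕ} (hK : PT K) (hx : PT x) (hb : PT b) : PT fun
    a => F.eval (K a) (x a) (b a) :=
  of_polyTime F.poly (fun v => (v 0, v 1, (v 2).length)) (fun k => by
      fin_cases k
      · exact ⟨_, FP.id, fun v => rfl⟩
      · exact ⟨_, FP.id, fun v => rfl⟩
      · exact ⟨_, FP.id.unaryLength, fun v => rfl⟩)
    (fun i => by simp [length_unary]) (φ := fun a => (K a, x a, b a))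
    (forall_fin3 (f := fun k a => ![K a, x a, Skl.unary (b a)] k) hK hx hb.unary)

end PT

/-- Games where one samples a part of the secrets later than the other. -/
lemma game_kernel {S XA XB : Type} {C : FunctionClass} {PA : Procs S XA} {PB : Procs S XB}
    (φ : Pub → XA → PMF XB) (h : ∀ k p xa e x m, p.guard C k x = true → ((PA k p xa x ([], e,
    m)).bind fun o => (φ (p.update k x o.1.1) o.1.2).map fun xb => ((o.1.1, xb), o.2)) = (φ p
    xa).bind fun xb => PB k p xb x ([], e, m)) (A : Prog) (lam : ℕ) (p : Pub) (xa : XA) (e : S)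
    {γ : Type} (f : Pub → Bool → γ) : (interact (game C PA) ((p, xa), e) A lam).map
    (fun s => f s.env.1.1 s.guess) = (φ p xa).bind fun xb =>
    (interact (game C PB) ((p, xb), e) A lam).map fun s => f s.env.1.1 s.guess := by
  have key := Prog.run_kernel (OA := game C PA) (OB := game C PB)
    (fun e => (φ e.1.1 e.1.2).map fun xb => ((e.1.1, xb), e.2)) (fun k x e m => ?_) A
    (start ![unary lam] [] QMem.init ((p, xa), e))
  · have := congrArg (PMF.map fun s => f s.env.1.1 s.guess) key
    simp only [PMF.map_bind, bind_map, map_comp] at this; rw [interact, ← PMF.bind_pure_comp]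
    refine Eq.trans ?_ this; refine congrArg _ (funext fun s => ?_)
    change PMF.pure (f s.env.1.1 s.guess) = PMF.map (fun _ => f s.env.1.1 s.guess) _
    exact (PMF.map_const _ _).symm
  · obtain ⟨⟨p, xa⟩, e⟩ := e; simp only [game, answer, bind_map, Function.comp_def, map_comp]
    cases hg : p.guard C k x
    · simp only [cond_false, pure_run, PMF.pure_bind, pure_map]; rw [← PMF.bind_pure_comp]; rfl
    · simp only [cond_true, bind_run, pure_run, PMF.bind_bind, PMF.pure_bind, PMF.map_bind,
        pure_map]
      have := congrArg (fun μ => μ.bind fun o => PMF.pure (((true :: o.1.1, o.2.1) : Reply),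
        ((p.update k x o.1.1, o.1.2), o.2.2.1), o.2.2.2)) (h k p xa e x m hg)
      simp only [PMF.bind_bind, bind_map, Function.comp_def] at this
      simpa only [← PMF.bind_pure_comp, Function.comp_def] using this

/-! ### Averages -/

/-- The probability that the output is `true`. -/
def pr (μ : PMF Bool) : ℝ := (μ true).toReal

lemma pr_coin (f : Bool → PMF Bool) : 2 * pr ((PMF.uniformOfFintype Bool).bind f) = pr (f false) +
    pr (f true) := by
  rw [pr, pr, pr, PMF.bind_apply, tsum_fintype, Fintype.sum_bool]
  simp only [PMF.uniformOfFintype_apply, Fintype.card_bool, Nat.cast_ofNat]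
  rw [← mul_add, ENNReal.toReal_mul, ENNReal.toReal_add (PMF.apply_ne_top _ _)
    (PMF.apply_ne_top _ _), ENNReal.toReal_inv, ENNReal.toReal_ofNat]
  ring

lemma sum_pr (k : ℕ) : ∀ f : ℕ → PMF Bool, ∑ i ∈ Finset.range (2 ^ k), pr (f i) = 2 ^ k * pr
    ((uniformBits k).bind fun s => f (ofBits s)) := by
  induction k with
  | zero => intro f; simp [uniformBits_zero, ofBits]
  | succ k ih =>
    intro f
    have h : (uniformBits (k + 1)).bind (fun s => f (ofBits s)) =
        (PMF.uniformOfFintype Bool).bind fun b => (uniformBits k).bind fun s =>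
          f (2 ^ k * b.toNat + ofBits s) := by
      rw [uniformBits_succ, PMF.bind_bind]; refine congrArg _ (funext fun b => ?_); rw [bind_map]
      refine PMF.bind_congr_support fun s hs => ?_
      rw [comp_apply, ofBits_append, length_of_mem_uniformBits hs]; simp [ofBits, add_comm]
    rw [h, pow_succ, pow_succ, mul_assoc, pr_coin, mul_two, Finset.sum_range_add, ih, ih]
    simp [mul_add]

/-- A hybrid argument with a random index. -/
lemma pr_telescope {G : ℕ → PMF Bool} {H : Bool → ℕ → PMF Bool}
    (h : ∀ i, pr (G i) - pr (G (i + 1)) = pr (H false i) - pr (H true i)) (k : ℕ) : pr (G 0) - pr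
    (G (2 ^ k)) = 2 ^ k * (pr ((uniformBits k).bind fun s => H false (ofBits s)) - pr ((uniformBits
    k).bind fun s => H true (ofBits s))) := by
  rw [← Finset.sum_range_sub' fun i => pr (G i), Finset.sum_congr rfl fun i _ => h i, Finset.sum_sub_distrib,
    sum_pr, sum_pr, mul_sub]

lemma pr_split (μ : PMF Bool) (ν : PMF (Bool × Bool)) (h : ν.map Prod.fst = μ) : pr μ = pr
    (ν.map fun o => o.1 && o.2) + pr (ν.map fun o => o.1 && !o.2) := by
  subst h; simp only [pr, PMF.map_apply]; rw [← ENNReal.toReal_add, ← ENNReal.tsum_add]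
  · refine congrArg _ (tsum_congr fun o => ?_); rcases o with ⟨_ | _, _ | _⟩ <;> simp
  · exact PMF.map_apply (fun o : Bool × Bool => o.1 && o.2) ν true ▸ PMF.apply_ne_top _ _
  · exact PMF.map_apply (fun o : Bool × Bool => o.1 && !o.2) ν true ▸ PMF.apply_ne_top _ _

/-- Splitting a probability into two cases. -/
lemma pr_map_split {α : Type} (μ : PMF α) (f g : α → Bool) : pr (μ.map f) = pr
    (μ.map fun a => f a && g a) + pr (μ.map fun a => f a && !g a) := by
  have := pr_split _ (μ.map fun a => (f a, g a)) rfl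
  simpa only [map_comp, Function.comp_def] using this

/-! ### The reduction to certified deletion -/

/-- The secrets of the reduction to certified deletion. -/
structure CvaSecrets where
  /-- the number of keys before the one that is encrypted by the challenger -/
  idx : ℕ
  K : Str
  msk : Str
  /-- the secret key, if it is known -/
  cdsk : Str
  vks : List Str
  /-- the position of the key that is encrypted by the challenger -/
  star : ℕ

instance : Code CvaSecrets := ⟨fun s => enc (s.idx, s.K, s.msk, s.cdsk, s.vks, s.star)⟩

namespace PT

variable {α : Type} [Code α] {f : α → CvaSecrets}

lemma cvaTuple (hf : PT f) : PT fun a => ((f a).idx, (f a).K, (f a).msk, (f a).cdsk, (f a).vks,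
    (f a).star) := hf.of_enc_eq fun _ => rfl

@[fun_prop] lemma cvaIdx (hf : PT f) : PT fun a => (f a).idx := hf.cvaTuple.fst
@[fun_prop] lemma cvaK (hf : PT f) : PT fun a => (f a).K := hf.cvaTuple.snd.fst
@[fun_prop] lemma cvaMsk (hf : PT f) : PT fun a => (f a).msk := hf.cvaTuple.snd.snd.fst
@[fun_prop] lemma cvaCdsk (hf : PT f) : PT fun a => (f a).cdsk := hf.cvaTuple.snd.snd.snd.fst
@[fun_prop] lemma cvaVks (hf : PT f) : PT fun a => (f a).vks := hf.cvaTuple.snd.snd.snd.snd.fst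
@[fun_prop] lemma cvaStar (hf : PT f) : PT fun a => (f a).star := hf.cvaTuple.snd.snd.snd.snd.snd

@[fun_prop] lemma cvaSecrets {i s : α → ℕ} {K m c : α → Str} {v : α → List Str} (hi : PT i)
    (hK : PT K) (hm : PT m) (hc : PT c) (hv : PT v) (hs : PT s) : PT fun a => CvaSecrets.mk (i a)
    (K a) (m a) (c a) (v a) (s a) :=
  (hi.pair (hK.pair (hm.pair (hc.pair (hv.pair hs))))).of_enc_eq fun _ => rfl

end PT

section

variable (E D F C)

/-- The core game without the secret key of the encryption scheme with certified deletion.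
Answers of its challenger are cut at length `t`. -/
def cvaProcs (t : ℕ → ℕ) (coin : Bool) (S : Type) (O : Oracle S) : Procs S CvaSecrets
  | 0, p, s, x => lift (uniformBits p.lam) >>= fun K =>
      lift (E.setup.dist ![unary p.lam, unary (item 0 x).length]) >>= fun msk =>
        pure ([], ⟨s.idx, K, msk, s.cdsk, [], 0⟩)
  | 1, p, s, x => pure (F.eval s.K x (blockLen E D p.lam p.q), s)
  | 2, p, s, x => encStep E p.lam s.msk s.cdsk x >>= fun r => pure (r, s)
  | 3, p, s, x => lift (E.keyGen.dist ![unary p.lam, s.msk, x]) >>= fun fsk =>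
      cond (p.sep C x && eqN (p.cnt C) s.idx)
        (Act.call O 1 (encList [fsk, blank true fsk]) (t p.lam) >>= fun r =>
          pure (r.1.tail, ⟨s.idx, s.K, s.msk, s.cdsk, s.vks ++ [[]], p.keys.length⟩))
        (Act.call O 0 (blank (p.sep C x && ltN (p.cnt C) s.idx) fsk) (t p.lam) >>= fun r =>
          pure (sndS r.1.tail, ⟨s.idx, s.K, s.msk, s.cdsk, s.vks ++ [fstS r.1.tail], s.star⟩))
  | 4, p, s, x =>
      cond (ltN s.idx (p.cnt C) && eqN (item 0 x).length s.star)
        (Act.call O 2 (item 1 x) (t p.lam) >>= fun r => pure ([!r.1.isEmpty],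
          ⟨s.idx, s.K, s.msk, bif r.1.isEmpty then s.cdsk else r.1.tail, s.vks, s.star⟩))
        (vrfyStep D p.lam (s.vks.getI (item 0 x).length) (item 1 x) >>= fun r => pure (r, s))
  | 5, p, s, _ => encStep E p.lam s.msk s.cdsk (bif coin then p.x1 else p.x0) >>= fun r =>
      pure (r, s)
  | _, _, s, _ => pure ([], s)

lemma impl_cvaProcs (t : ℕ[X]) (coin : Bool) (k : ℕ) : Impl fun S O (a : (Pub × CvaSecrets) × Str)
    => cvaProcs E D F C (fun lam => t.eval lam) coin S O k a.1.1 a.1.2 a.2 := by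
  rcases k with _ | _ | _ | _ | _ | _ | k <;> unfold cvaProcs
  · refine Impl.bind (Impl.coins fp) (Impl.bind (Impl.ppt E.setup (forall_fin2
      (f := fun k (a : ((Pub × CvaSecrets) × Str) × Str) =>
        ![unary a.1.1.1.lam, unary (item 0 a.1.2).length] k) ?_ ?_)) (Impl.pure ?_))
    · exact PT.unary fp
    · exact PT.unary fp
    · fun_prop
  · exact Impl.pure ((PT.evalF F fp fp fp).pair fp)
  · exact Impl.bind (Impl.encStep fp fp fp fp) (Impl.pure fp)
  · have hlen : PT fun x : (((Pub × CvaSecrets) × Str) × Str) × Str × ℕ =>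
        x.1.1.1.1.keys.length := PT.length fp
    refine Impl.bind (Impl.skKeyGen fp fp fp) (Impl.cond
      fp (Impl.bind (Impl.call 1 ?_ fp) (Impl.pure ?_))
      (Impl.bind (Impl.call 0 fp fp) (Impl.pure ?_)))
    · simp only [encList]; fun_prop
    · exact PT.pair fp (PT.cvaSecrets fp fp fp fp (PT.append fp (PT.const _)) hlen)
    · exact PT.pair fp (PT.cvaSecrets fp fp fp fp (PT.append fp (PT.cons fp (PT.const _))) fp)
  · have h : PT fun x : ((Pub × CvaSecrets) × Str) × Str × ℕ => x.2.1.isEmpty :=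
      PT.isNilS fp
    exact Impl.cond fp (Impl.bind (Impl.call 2 fp fp) (Impl.pure fp)) (Impl.bind (Impl.vrfyStep fp
        (PT.getI fp fp) fp) (Impl.pure fp))
  · exact Impl.bind (Impl.encStep fp fp fp fp) (Impl.pure fp)
  · exact Impl.pure fp

end

lemma game_stable {S X : Type} {C : FunctionClass} (P : Procs S X) {B : Pub → X → Prop} (h : ∀ k p y
    x u, p.guard C k x = true → B p y → ∀ o ∈ (P k p y x u).support, B (p.update k x o.1.1) o.1.2) :
    (game C P).Stable fun e => B e.1.1 e.1.2 := by
  rintro k x ⟨⟨p, y⟩, e⟩ m hB o ho; rw [game, mem_support_map_iff] at ho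
  obtain ⟨o', ho', rfl⟩ := ho; rw [answer] at ho'; dsimp only at ho' hB ⊢; cases hg : p.guard C k x
  · rw [hg, cond_false, pure_run, support_pure, mem_singleton_iff] at ho'; subst ho'; exact hB
  · rw [hg, cond_true, bind_run, mem_support_bind_iff] at ho'; obtain ⟨o'', ho'', ho'⟩ := ho'
    rw [pure_run, support_pure, mem_singleton_iff] at ho'; subst ho'
    exact h k p y x _ hg hB o'' ho''

namespace Pub

variable {C : FunctionClass}

lemma cnt_update_three (p : Pub) (x r : Str) : (p.update 3 x r).cnt C = p.cnt C + (p.sep C x).toNat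
    := by
  change (p.keys ++ [(x, false)]).countP (fun e : Str × Bool => p.sep C e.1) = _
  rw [List.countP_append, List.countP_singleton]; cases p.sep C x <;> rfl

lemma cnt_update_four (p : Pub) (x r : Str) : (p.update 4 x r).cnt C = p.cnt C := by
  change (p.keys.zipIdx.map _).countP (fun e : Str × Bool => p.sep C e.1) =
    p.keys.countP fun e => p.sep C e.1
  conv_rhs => rw [← List.zipIdx_map_fst 0 p.keys]
  rw [List.countP_map, List.countP_map]; rfl

lemma cnt_le_update {p : Pub} (hp : p.on = true) {k : ℕ} {x : Str} (hg : p.guard C k x = true)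
    (r : Str) : p.cnt C ≤ (p.update k x r).cnt C := by
  rcases k with _ | _ | _ | _ | _ | _ | k
  · rw [off_of_guard hg] at hp; cases hp
  · exact le_rfl
  · exact le_rfl
  · rw [cnt_update_three]; exact Nat.le_add_right _ _
  · rw [cnt_update_four]
  · exact le_rfl
  · exact le_rfl

/-- The challenge index was used too early, or the challenge was given out although at most `i`
keys are separating. -/
def Early (C : FunctionClass) (i : ℕ) (p : Pub) : Prop :=
  p.on = true ∧ ((p.usedJ = true ∧ p.challenged = false) ∨ (p.challenged = true ∧ p.cnt C ≤ i))

lemma Early.update {i k : ℕ} {p : Pub} {x : Str} (hg : p.guard C k x = true) (r : Str)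
    (h : p.Early C i) : (p.update k x r).Early C i := by
  obtain ⟨hp, h⟩ := h; rcases k with _ | _ | _ | _ | _ | _ | k
  · rw [off_of_guard hg] at hp; cases hp
  · exact ⟨hp, h⟩
  · exact ⟨hp, h.imp (fun h => ⟨rfl, h.2⟩) id⟩
  · refine ⟨hp, h.imp id fun h => ⟨h.1, ?_⟩⟩
    simp only [guard, h.1, Bool.and_eq_true, Bool.not_true, Bool.false_or, Bool.not_eq_true'] at hg
    rw [cnt_update_three, hg.2.2.2]; exact h.2
  · refine ⟨hp, h.imp id fun h => ⟨h.1, ?_⟩⟩; rw [cnt_update_four]; exact h.2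
  · simp only [guard, Bool.and_eq_true, Bool.not_eq_true'] at hg; rcases h with h | h
    · rw [h.1] at hg; cases hg.2.2.1
    · rw [h.1] at hg; cases hg.2.1
  · cases hg

end Pub

/-- Hybrids agree until their first different key is generated. -/
lemma coreRun_agree (smp : ℕ → ℕ → Str → PMF ((Str → Str) × Str × Str)) (i : ℕ) (coin : Bool)
    {A : Prog} {T : ℕ[X]} (hA : TimeBound A T) (lam : ℕ) : (coreRun E D C smp i coin A lam).map (fun
    s => s.guess && s.env.1.1.challenged && !ltN i (s.env.1.1.cnt C)) =
    (coreRun E D C smp (i + 1) coin A lam).map (fun s => s.guess && s.env.1.1.challenged && !ltN i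
    (s.env.1.1.cnt C)) := by
  have hst : ∀ k (p : Pub) x r, p.guard C k x = true → (p.on = true ∧ i < p.cnt C) →
      ((p.update k x r).on = true ∧ i < (p.update k x r).cnt C) := fun k p x r hg h => by
    refine ⟨?_, h.2.trans_le (Pub.cnt_le_update h.1 hg r)⟩; rcases k with _ | _ | _ | _ | _ | _ | k
    exacts [rfl, h.1, h.1, h.1, h.1, h.1, h.1]
  refine (lift_game (XA := Secrets) (XB := Secrets) (SA := Unit) (SB := Unit)
    (R := fun _ xa _ xb _ => xb = xa)
    (BA := fun p _ _ => p.on = true ∧ i < p.cnt C) (BB := fun p _ _ => p.on = true ∧ i < p.cnt C)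
    ?_ (game_stable _ fun k p _ x _ hg h _ _ => hst k p x _ hg h)
    (game_stable _ fun k p _ x _ hg h _ _ => hst k p x _ hg h) A
    (a := start ![unary lam] [] QMem.init ((Pub.init lam, ⟨id, [], [], []⟩), ()))
    (b := start ![unary lam] [] QMem.init ((Pub.init lam, ⟨id, [], [], []⟩), ()))
    rfl rfl rfl (hA lam _ _ _)).map_eq ?_
  · rintro k p s - _ - x m rfl - hg; rcases k with _ | _ | _ | _ | _ | _ | k
    · rw [coreProcs_zero, coreProcs_zero]
      exact Lift.map_same fun _ _ => Or.inl ⟨rfl, rfl, rfl, rfl⟩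
    · exact Lift.pure (Or.inl ⟨rfl, rfl, rfl, rfl⟩)
    · rw [coreProcs_two, coreProcs_two]; exact Lift.map_same fun _ _ => Or.inl ⟨rfl, rfl, rfl, rfl⟩
    · rw [coreProcs_three, coreProcs_three]
      by_cases h : (p.sep C x && ltN (p.cnt C) i) = (p.sep C x && ltN (p.cnt C) (i + 1))
      · rw [h]; exact Lift.map_same fun _ _ => Or.inl ⟨rfl, rfl, rfl, rfl⟩
      · have h' : ∀ r, (p.update 3 x r).on = true ∧ i < (p.update 3 x r).cnt C := fun r => by
          have hon : p.on = true := Pub.on_of_guard hg; refine ⟨hon, ?_⟩; rw [Pub.cnt_update_three]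
          cases hs : p.sep C x
          · rw [hs] at h; exact absurd rfl h
          · rw [hs] at h; simp only [ltN, Bool.true_and, decide_eq_decide] at h
            rw [Bool.toNat_true]; omega
        exact Lift.of_bad fun _ _ _ _ => Or.inr ⟨h' _, h' _⟩
    · rw [coreProcs_four, coreProcs_four]
      exact Lift.map_same fun _ _ => Or.inl ⟨rfl, rfl, rfl, rfl⟩
    · rw [coreProcs_five, coreProcs_five]
      exact Lift.map_same fun _ _ => Or.inl ⟨rfl, rfl, rfl, rfl⟩
    · cases hg
  · rintro a b (⟨hab, hp, -⟩ | ⟨ha, hb⟩)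
    · rw [hp, hab]; rfl
    · simp [ltN, ha.2, hb.2]

lemma setup_size : ∃ p : ℕ[X], ∀ lam q T, q ≤ T → ∀ msk ∈
    (E.setup.dist ![unary lam, unary q]).support, msk.length ≤ p.eval (lam + T) := by
  obtain ⟨p, hp⟩ := (Impl.ppt E.setup (forall_fin2 (f := fun k (a : ℕ × ℕ) =>
    ![unary a.1, unary a.2] k) (PT.fst PT.id).unary (PT.snd PT.id).unary)).size_qubits
  refine ⟨p.comp (2 * X + 1), fun lam q T hq msk h => ?_⟩
  have h1 := (hp Unit noOracle (lam, q) ([], (), QMem.init) (msk, ([], (), QMem.init)) ((mem_support_map_iff _ _ _).2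
    ⟨msk, h, rfl⟩)).1
  simp only [length_enc_pair, enc_nat, length_unary, enc_str] at h1
  have h3 := eval_mono p (show 2 * lam + 1 + q ≤ 2 * (lam + T) + 1 by omega); simp; omega

lemma cdKeyGen_size : ∃ p : ℕ[X], ∀ lam, ∀ sk ∈ (D.keyGen.dist ![unary lam]).support, sk.length ≤
    p.eval lam := by
  obtain ⟨p, hp⟩ := (Impl.ppt D.keyGen (forall_fin1 (f := fun k (a : ℕ) =>
    ![unary a] k) PT.id.unary)).size_qubits
  refine ⟨p, fun lam sk h => ?_⟩
  have h1 := (hp Unit noOracle lam ([], (), QMem.init) (sk, ([], (), QMem.init))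
    ((mem_support_map_iff _ _ _).2 ⟨sk, h, rfl⟩)).1
  simpa only [enc_nat, length_unary, enc_str] using h1

/-- Independent keys of the challenge index. -/
lemma sampler_true (lam : ℕ) (random : Bool) (q : ℕ) (jb : Str) : sampler E D F lam random true q jb
    = (F.sample lam random jb.length (blockLen E D lam q)).bind fun g =>
    (E.setup.dist ![unary lam, unary q]).bind fun msk => (D.keyGen.dist ![unary lam]).map fun sk =>
    (g, msk, sk) := by
  rw [sampler]; refine congrArg _ (funext fun g => ?_)
  rw [cond_true, PPT.dist, PPT.dist, blockLen, uniformBits_add]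
  simp only [← PMF.bind_pure_comp, PMF.bind_bind, PMF.pure_bind, comp_apply]; rw [PMF.bind_comm]
  refine PMF.bind_congr_support fun r hr => congrArg _ (funext fun w => ?_)
  have := length_of_mem_uniformBits hr; rw [starKeys, List.take_left' this, List.drop_left' this]

/-- The core game where the secret key of the encryption scheme with certified deletion exists
from the start. -/
def presetProcs {S : Type} (E : SKFE) (D : CDSKE) (F : FunFamily) (C : FunctionClass) (hyb : ℕ)
    (coin : Bool) : Procs S Secrets
  | 0, p, s, x => lift ((uniformBits p.lam).bind fun K =>
      (E.setup.dist ![unary p.lam, unary (item 0 x).length]).map fun msk => (K, msk)) >>= fun o =>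
      pure ([], ⟨fun x' => F.eval o.1 x' (blockLen E D p.lam (item 0 x).length), o.2, s.cdsk, []⟩)
  | k + 1, p, s, x => coreProcs E D C (fun lam => sampler E D F lam false true) hyb coin (k + 1)
      p s x

lemma coreRun_preset {γ : Type} (f : Pub → Bool → γ) (hyb : ℕ) (coin : Bool) (A : Prog) (lam : ℕ) :
    (coreRun E D C (fun lam => sampler E D F lam false true) hyb coin A lam).map
    (fun s => f s.env.1.1 s.guess) = (D.keyGen.dist ![unary lam]).bind fun sk => (interact (game C
    (presetProcs E D F C hyb coin)) ((Pub.init lam, ⟨id, [], sk, []⟩), ()) A lam).map fun s => f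
    s.env.1.1 s.guess := by
  refine (game_kernel (PB := presetProcs E D F C hyb coin) (fun p xa => bif p.on then PMF.pure xa
    else (D.keyGen.dist ![unary p.lam]).map fun sk => { xa with cdsk := sk }) ?_ A lam _ _ _
    f).trans ?_
  · intro k p xa e x m hg; rcases k with _ | k
    · rw [coreProcs_zero, Pub.off_of_guard hg, cond_false]
      simp only [presetProcs, lift_bind_run, sampler_true, FunFamily.sample, Bool.false_eq_true,
        if_false, show ∀ r, (p.update 0 x r).on = true from fun r => rfl, cond_true]
      simp only [← PMF.bind_pure_comp, PMF.bind_bind, PMF.pure_bind, Function.comp_def]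
      rw [PMF.bind_comm (D.keyGen.dist _)]; exact congrArg _ (funext fun K => PMF.bind_comm _ _ _)
    · have h1 := Pub.on_of_guard hg
      have h2 : ∀ r, (p.update (k + 1) x r).on = true := fun r => by
        rcases k with _ | _ | _ | _ | _ | k <;> exact h1
      simp only [h1, h2, cond_true, PMF.pure_bind, pure_map]; exact PMF.bind_pure _
  · rw [show (Pub.init lam).on = false from rfl, cond_false, bind_map]; rfl

section

variable (E D F C)

/-- The relation between the core game and the reduction to certified deletion. -/
structure CvaRel (N i : ℕ) (sk : Str) (p : Pub) (xa : Secrets) (xb : CvaSecrets)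
    (eb : CDSKE.CvaState) : Prop where
  sk_eq : eb.sk = sk
  cdsk : xa.cdsk = sk
  idx : xb.idx = i
  off : p.on = false → p.keys = [] ∧ p.usedJ = false ∧ p.challenged = false
  blk : p.on = true → xa.blk = fun x => F.eval xb.K x (blockLen E D p.lam p.q)
  msk : p.on = true → xb.msk = xa.msk
  size : p.on = true → xa.msk.length ≤ N
  lenA : p.on = true → xa.vks.length = p.keys.length
  lenB : p.on = true → xb.vks.length = p.keys.length
  vks : p.on = true → ∀ t, (i < p.cnt C → t ≠ xb.star) → xb.vks.getI t = xa.vks.getI t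
  fresh : p.cnt C ≤ i → eb.vk = none
  star : i < p.cnt C → eb.vk = some (xa.vks.getI xb.star) ∧ ∃ e, p.keys[xb.star]? = some e ∧
    p.sep C e.1 = true ∧ (e.2 = true → xb.cdsk = sk)
  used : p.usedJ = true → p.challenged = true
  chal : p.challenged = true → i < p.cnt C ∧ xb.cdsk = sk

variable {E D F C}

lemma getI_concat {α : Type} [Inhabited α] (l : List α) (a : α) (t : ℕ) : (l ++ [a]).getI t = if t =
    l.length then a else l.getI t := by
  rcases lt_trichotomy t l.length with h | h | h
  · rw [if_neg h.ne, getI_append _ _ _ h]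
  · subst h; rw [if_pos rfl, List.getI_append_right _ _ _ le_rfl]; simp
  · rw [if_neg h.ne', List.getI_append_right _ _ _ h.le, List.getI_eq_default, List.getI_eq_default]
    · exact h.le
    · simp; omega

lemma Pub.cnt_le_length (p : Pub) : p.cnt C ≤ p.keys.length := List.countP_le_length

lemma Pub.getElem?_update_four (p : Pub) (x r : Str) (t : ℕ) : (p.update 4 x r).keys[t]? =
    p.keys[t]?.map fun e => (e.1, e.2 || (eqN t (item 0 x).length && eqS r [true])) := by
  change (p.keys.zipIdx.map _)[t]? = _; rw [List.getElem?_map, List.getElem?_zipIdx, Option.map_map]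
  simp [Function.comp_def]

/-- The coupling of one call of the core game and of the reduction to certified deletion. -/
lemma lift_cvaProcs {N i T : ℕ} {t : ℕ → ℕ} {sk : Str} {b coin : Bool} {lam : ℕ} (hN : ∀ q ≤ T, ∀
    msk ∈ (E.setup.dist ![unary lam, unary q]).support, msk.length ≤ N) (ht : ∀ msk f z m,
    msk.length ≤ N → f.length ≤ T → ∀ o ∈ (keyDist E D lam msk sk f z m).support, 2 * o.1.1.length +
    o.1.2.length + 2 ≤ t lam ∧ o.2.1.length ≤ t lam) (hsk : sk.length + 1 ≤ t lam) (k : ℕ) (p : Pub)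
    (xa : Secrets) (ea : Unit) (xb : CvaSecrets) (eb : CDSKE.CvaState) (x : Str) (m : QMem)
    (hl : p.lam = lam) (hR : CvaRel E D F C N i sk p xa xb eb) (hx : x.length ≤ T)
    (hg : p.guard C k x = true) : Lift (fun o o' => (o'.1.1 = o.1.1 ∧ o'.2.1 = o.2.1 ∧ o'.2.2.2 =
    o.2.2.2 ∧ (p.update k x o.1.1).lam = lam ∧ CvaRel E D F C N i sk (p.update k x o.1.1) o.1.2
    o'.1.2 o'.2.2.1) ∨ ((p.update k x o.1.1).Early C i ∧ (p.update k x o'.1.1).Early C i))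
    (presetProcs E D F C (i + b.toNat) coin k p xa x ([], ea, m)) (cvaProcs E D F C t coin
    CDSKE.CvaState (D.cvaOracle lam b) k p xb x ([], eb, m)) := by
  subst hl; obtain ⟨blk, amsk, acdsk, avks⟩ := xa; obtain ⟨idx, K, bmsk, bcdsk, bvks, star⟩ := xb
  obtain ⟨esk, evk⟩ := eb
  obtain ⟨rfl, h2, rfl, hoff, hblk, hmsk, hsize, hlenA, hlenB, hvks, hfresh, hstar, hused, hchal⟩ := hR
  dsimp only at h2 hblk hmsk hsize hlenA hlenB hvks hfresh hstar hused hchal; subst h2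
  rcases k with _ | k
  · obtain ⟨hk, hu, hc⟩ := hoff (Pub.off_of_guard hg)
    change Lift _ ((lift _ >>= fun _ => pure _) _)
      ((lift _ >>= fun _ => lift _ >>= fun _ => pure _) _)
    rw [lift_bind_run, bind_run, lift, PMF.map_bind, bind_map]; refine Lift.bind_same fun K' _ => ?_
    rw [comp_apply, lift_bind_run, map_comp]
    refine Lift.map_same fun msk hm => Or.inl ⟨rfl, rfl, rfl, rfl, ?_⟩
    have hcnt : ∀ p' : Pub, p'.keys = [] → p'.cnt C = 0 := fun p' h => by rw [Pub.cnt, h]; rfl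
    have hcnt0 : p.cnt C ≤ idx := by rw [hcnt p hk]; exact Nat.zero_le _
    have hcnt' : (p.update 0 x []).cnt C = 0 := hcnt _ hk
    exact {
      sk_eq := rfl
      cdsk := rfl
      idx := rfl
      off := fun h => by cases h
      blk := fun _ => rfl
      msk := fun _ => rfl
      size := fun _ => hN _ ((Pub.length_item_le 0 x).trans hx) msk hm
      lenA := fun _ => by change 0 = p.keys.length; rw [hk]; rfl
      lenB := fun _ => by change 0 = p.keys.length; rw [hk]; rfl
      vks := fun _ _ _ => rfl
      fresh := fun _ => hfresh hcnt0
      star := fun h => by change idx < (p.update 0 x []).cnt C at h; rw [hcnt'] at h; omega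
      used := fun h => by change p.usedJ = true at h; rw [hu] at h; cases h
      chal := fun h => by change p.challenged = true at h; rw [hc] at h; cases h }
  have hon := Pub.on_of_guard hg; have hblk := hblk hon; have hmsk := hmsk hon
  have hsize := hsize hon; have hlenA := hlenA hon; have hlenB := hlenB hon; have hvks := hvks hon
  subst hblk hmsk
  have hR : CvaRel E D F C N idx acdsk p
      ⟨fun x => F.eval K x (blockLen E D p.lam p.q), bmsk, acdsk, avks⟩
      ⟨idx, K, bmsk, bcdsk, bvks, star⟩ ⟨acdsk, evk⟩ :=
    ⟨rfl, rfl, rfl, hoff, fun _ => rfl, fun _ => rfl, fun _ => hsize, fun _ => hlenA,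
      fun _ => hlenB, fun _ => hvks, hfresh, hstar, hused, hchal⟩
  rcases k with _ | _ | _ | _ | _ | k
  · exact Lift.pure (Or.inl ⟨rfl, rfl, rfl, rfl, hR⟩)
  · rw [presetProcs, coreProcs_two]; change Lift _ _ ((encStep _ _ _ _ _ >>= fun _ => pure _) _)
    rw [encStep_bind_run]
    by_cases hc : p.challenged = true
    · obtain rfl : bcdsk = acdsk := (hchal hc).2
      exact Lift.map_same fun o _ => Or.inl ⟨rfl, rfl, rfl, rfl, { hR with
        off := fun h => by cases hon.symm.trans h
        used := fun _ => hc }⟩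
    · exact Lift.of_bad fun _ _ _ _ => Or.inr
        ⟨⟨hon, Or.inl ⟨rfl, eq_false_of_ne_true hc⟩⟩, ⟨hon, Or.inl ⟨rfl, eq_false_of_ne_true hc⟩⟩⟩
  · have hcnt := p.cnt_update_three (C := C) x
    have hsz : ∀ fsk ∈ (E.keyGen.dist ![unary p.lam, bmsk, x]).support, ∀ z,
        ∀ o ∈ (D.encDist p.lam acdsk (blank z fsk) m).support,
          2 * o.1.1.length + o.1.2.1.length + 2 ≤ t p.lam ∧ o.1.2.2.length ≤ t p.lam :=
      fun fsk hf z o ho => ht bmsk x z m hsize hx ((o.1.1, o.1.2.1), o.1.2.2, o.2)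
        ((mem_support_bind_iff _ _ _).2 ⟨fsk, hf, (mem_support_map_iff _ _ _).2 ⟨o, ho, rfl⟩⟩)
    have hlen : ∀ r, (p.update 3 x r).keys.length = p.keys.length + 1 := fun r => by
      simp [Pub.update]
    rw [presetProcs, coreProcs_three, keyDist, PMF.map_bind]
    change Lift _ _ ((lift _ >>= fun _ => cond _ _ _) _); rw [bind_run, lift, bind_map]
    refine Lift.bind_same fun fsk hf => ?_
    have hsz := hsz fsk hf; rw [map_comp, comp_apply]; dsimp only
    cases hs : p.sep C x && eqN (p.cnt C) idx
    · have hz : (p.sep C x && ltN (p.cnt C) (idx + b.toNat)) =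
          (p.sep C x && ltN (p.cnt C) idx) := by
        cases hsep : p.sep C x
        · rfl
        · rw [hsep, Bool.true_and, eqN, decide_eq_false_iff_not] at hs; cases b
          · rfl
          · simp only [ltN, Bool.true_and, Bool.toNat_true, decide_eq_decide]; omega
      have hlt : ∀ r, idx < (p.update 3 x r).cnt C ↔ idx < p.cnt C := fun r => by
        rw [hcnt]; cases hsep : p.sep C x
        · rfl
        · rw [hsep, Bool.true_and, eqN, decide_eq_false_iff_not] at hs; rw [Bool.toNat_true]; omega
      rw [cond_false, call_bind_run, hz]; simp only [CDSKE.cvaOracle, map_comp]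
      refine Lift.map_same fun o ho => Or.inl ?_
      obtain ⟨h1, h2⟩ := hsz _ o ho
      have h3 : (reply (pairS o.1.1 o.1.2.1) o.1.2.2).1.take (t p.lam) =
          true :: pairS o.1.1 o.1.2.1 := take_of_length_le (by
        simp only [reply, length_cons, length_pairS]; omega)
      have h4 : (reply (pairS o.1.1 o.1.2.1) o.1.2.2).2.take (t p.lam) = o.1.2.2 :=
        take_of_length_le h2
      simp only [comp_apply, h3, h4, tail_cons, sndS_pairS, fstS_pairS]
      exact ⟨trivial, trivial, trivial, rfl, { hR with
        off := fun h => by cases hon.symm.trans h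
        lenA := fun _ => by rw [hlen, length_append, hlenA]; rfl
        lenB := fun _ => by rw [hlen, length_append, hlenB]; rfl
        vks := fun _ j hj => by
          dsimp only; rw [getI_concat, getI_concat, hlenA, hlenB, hvks j fun h => hj ((hlt _).2 h)]
        fresh := fun h => hfresh (not_lt.1 fun h' => absurd ((hlt _).2 h') (not_lt.2 h))
        star := fun h => by
          obtain ⟨g1, e, he, g2⟩ := hstar ((hlt _).1 h)
          have hst : star < p.keys.length := (List.getElem?_eq_some_iff.1 he).1
          refine ⟨?_, e, ?_, g2⟩
          · dsimp only; rw [getI_concat, if_neg (show ¬star = avks.length by omega), g1]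
          · exact (List.getElem?_append_left hst).trans he
        chal := fun h => ⟨(hlt _).2 (hchal h).1, (hchal h).2⟩ }⟩
    · rw [Bool.and_eq_true, eqN, decide_eq_true_eq] at hs
      have hz : (p.sep C x && ltN (p.cnt C) (idx + b.toNat)) = b := by
        rw [hs.1, hs.2]; cases b <;> simp [ltN]
      have hcnt' : ∀ r, (p.update 3 x r).cnt C = idx + 1 := fun r => by rw [hcnt, hs.1, hs.2]; rfl
      obtain rfl := hfresh hs.2.le; rw [cond_true, call_bind_run, hz]
      have hm : (if b then blank true fsk else fsk) = blank b fsk := by cases b <;> rfl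
      have hl : fsk.length = (blank true fsk).length := by simp [blank]
      simp only [CDSKE.cvaOracle, encList, item, Function.iterate_zero, id, fstS_pairS,
        Function.iterate_succ, comp_apply, sndS_pairS]
      rw [if_pos hl, map_comp, hm]; refine Lift.map_same fun o ho => Or.inl ?_
      obtain ⟨h1, h2⟩ := hsz _ o ho
      have h3 : (reply o.1.2.1 o.1.2.2).1.take (t p.lam) = true :: o.1.2.1 := take_of_length_le (by
        simp only [reply, length_cons]; omega)
      have h4 : (reply o.1.2.1 o.1.2.2).2.take (t p.lam) = o.1.2.2 := take_of_length_le h2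
      simp only [comp_apply, h3, h4, tail_cons]
      exact ⟨trivial, trivial, trivial, rfl, { hR with
        off := fun h => by cases hon.symm.trans h
        lenA := fun _ => by rw [hlen, length_append, hlenA]; rfl
        lenB := fun _ => by rw [hlen, length_append, hlenB]; rfl
        vks := fun _ j hj => by
          have hj := hj (by rw [hcnt']; omega); dsimp only at hj ⊢
          rw [getI_concat, getI_concat, if_neg (by omega), if_neg (by omega),
            hvks j fun h => by omega]
        fresh := fun h => by rw [hcnt'] at h; omega
        star := fun _ => by
          refine ⟨?_, (x, false), ?_, hs.1, fun h => by cases h⟩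
          · dsimp only; rw [getI_concat, if_pos hlenA.symm]
          · exact (List.getElem?_append_right le_rfl).trans (by simp)
        chal := fun h => by have := (hchal h).1; omega }⟩
  · have hlen : ∀ r, (p.update 4 x r).keys.length = p.keys.length := fun r => by
      simp [Pub.update]
    have hcnt := p.cnt_update_four (C := C) x; rw [presetProcs, coreProcs_four]
    change Lift _ _ ((cond _ _ _ : Act _ _) _); dsimp only
    cases hs : ltN idx (p.cnt C) && eqN (item 0 x).length star
    · rw [cond_false, vrfyStep_bind_run]
      have hs' : idx < p.cnt C → (item 0 x).length ≠ star := fun h h' => by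
        rw [ltN, eqN, decide_eq_true h, decide_eq_true h'] at hs; cases hs
      rw [hvks _ hs']
      refine Lift.map_same fun o _ => Or.inl ⟨rfl, rfl, rfl, rfl, { hR with
        off := fun h => by cases hon.symm.trans h
        lenA := fun _ => by rw [hlen, hlenA]
        lenB := fun _ => by rw [hlen, hlenB]
        vks := fun _ j hj => hvks j fun h => hj (by rw [hcnt]; exact h)
        fresh := fun h => hfresh (by rwa [hcnt] at h)
        star := fun h => ?_
        chal := fun h => ⟨by rw [hcnt]; exact (hchal h).1, (hchal h).2⟩ }⟩
      rw [hcnt] at h; obtain ⟨g1, e, he, g2, g3⟩ := hstar h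
      refine ⟨g1, _, (p.getElem?_update_four x [o] star).trans (congrArg _ he), g2, fun h' => g3 ?_⟩
      change (e.2 || (eqN star (item 0 x).length && eqS [o] [true])) = true at h'
      rw [eqN, decide_eq_false fun h' => hs' h h'.symm, Bool.false_and, Bool.or_false] at h'
      exact h'
    · rw [Bool.and_eq_true, ltN, eqN, decide_eq_true_eq, decide_eq_true_eq] at hs
      obtain ⟨hs1, hs2⟩ := hs; obtain ⟨g1, e, he, g2, g3⟩ := hstar hs1; subst g1
      rw [cond_true, call_bind_run, hs2]; simp only [CDSKE.cvaOracle, map_comp]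
      refine Lift.map_same fun o _ => Or.inl ?_
      have ht1 : ((if o = true then reply acdsk [] else bot).1.take (t p.lam)) =
          bif o then true :: acdsk else [] := by
        cases o
        · simp [bot]
        · exact take_of_length_le (by simpa [reply] using hsk)
      have ht2 : ((if o = true then reply acdsk [] else bot).2.take (t p.lam)) = [] := by
        cases o <;> simp [bot, reply]
      simp only [comp_apply, ht1, ht2]
      refine ⟨by cases o <;> rfl, rfl, trivial, rfl, { hR with
        off := fun h => by cases hon.symm.trans h
        lenA := fun _ => by rw [hlen, hlenA]
        lenB := fun _ => by rw [hlen, hlenB]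
        vks := fun _ j hj => hvks j fun h => hj (by rw [hcnt]; exact h)
        fresh := fun h => hfresh (by rwa [hcnt] at h)
        star := fun h => ?_
        chal := fun h => ⟨by rw [hcnt]; exact (hchal h).1, ?_⟩ }⟩
      · refine ⟨rfl, _, (p.getElem?_update_four x [o] star).trans (congrArg _ he), g2, fun h' => ?_⟩
        cases o
        · exact g3 (by simpa [eqS] using h')
        · rfl
      · cases o
        · exact (hchal h).2
        · rfl
  · rw [presetProcs, coreProcs_five]; change Lift _ _ ((encStep _ _ _ _ _ >>= fun _ => pure _) _)
    rw [encStep_bind_run]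
    by_cases hc : p.cnt C ≤ idx
    · exact Lift.of_bad fun _ _ _ _ => Or.inr ⟨⟨hon, Or.inr ⟨rfl, hc⟩⟩, ⟨hon, Or.inr ⟨rfl, hc⟩⟩⟩
    · have hsk : bcdsk = acdsk := by
        obtain ⟨-, e, he, hs, h⟩ := hstar (by omega)
        simp only [Pub.guard, Bool.and_eq_true, List.all_eq_true] at hg
        have := hg.2.2.2 e (List.mem_of_getElem? he); rw [hs] at this; exact h (by simpa using this)
      subst hsk
      exact Lift.map_same fun o _ => Or.inl ⟨rfl, rfl, rfl, rfl, { hR with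
        off := fun h => by cases hon.symm.trans h
        used := fun _ => rfl
        chal := fun _ => ⟨by change idx < p.cnt C; omega, rfl⟩ }⟩
  · cases hg

end

/-- The procedures of the reduction to certified deletion keep the size of the secrets bounded. -/
lemma cvaProcs_bounded {N lam T j : ℕ} {t : ℕ → ℕ} {coin : Bool} {S : Type} {O : Oracle S} (hN : ∀ q
    ≤ T, ∀ msk ∈ (E.setup.dist ![unary lam, unary q]).support, msk.length ≤ N) {k : ℕ} {p : Pub}
    {y : CvaSecrets} {x : Str} {u : World S} (hl : p.lam = lam) (hb : p.Bounded T j)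
    (hx : x.length ≤ T) (h : y.K.length ≤ lam ∧ y.msk.length ≤ N ∧ y.cdsk.length ≤ t lam ∧
    y.vks.length ≤ j ∧ (∀ v ∈ y.vks, v.length ≤ t lam) ∧ y.star ≤ j) {o}
    (ho : o ∈ (cvaProcs E D F C t coin S O k p y x u).support) : o.1.2.K.length ≤ lam ∧
    o.1.2.msk.length ≤ N ∧ o.1.2.cdsk.length ≤ t lam ∧ o.1.2.vks.length ≤ j + 1 ∧
    (∀ v ∈ o.1.2.vks, v.length ≤ t lam) ∧ o.1.2.star ≤ j + 1 := by
  subst hl; obtain ⟨idx, K, msk, cdsk, vks, star⟩ := y; obtain ⟨h2, h3, h4, h5, h6, h7⟩ := h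
  dsimp only at h2 h3 h4 h5 h6 h7; rcases k with _ | _ | _ | _ | _ | _ | k
  · change o ∈ PMF.support ((lift _ >>= fun _ => lift _ >>= fun _ => pure _) _) at ho
    rw [bind_run, lift, bind_map, mem_support_bind_iff] at ho; obtain ⟨K', hK, ho⟩ := ho
    rw [comp_apply, lift_bind_run, mem_support_map_iff] at ho; obtain ⟨msk', hm, rfl⟩ := ho
    exact ⟨(length_of_mem_uniformBits hK).le, hN _ ((Pub.length_item_le 0 x).trans hx) msk' hm,
      h4, Nat.zero_le _, by simp, Nat.zero_le _⟩
  · change o ∈ PMF.support (PMF.pure _) at ho; rw [support_pure, mem_singleton_iff] at ho; subst ho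
    exact ⟨h2, h3, h4, h5.trans j.le_succ, h6, h7.trans j.le_succ⟩
  · obtain ⟨r, rfl⟩ := encStep_bind_support ho
    exact ⟨h2, h3, h4, h5.trans j.le_succ, h6, h7.trans j.le_succ⟩
  · change o ∈ PMF.support ((lift _ >>= fun _ => cond _ _ _) _) at ho
    rw [bind_run, mem_support_bind_iff] at ho; obtain ⟨r, -, ho⟩ := ho
    have hv : ∀ v : Str, v.length ≤ t p.lam → ∀ w ∈ vks ++ [v], w.length ≤ t p.lam :=
      fun v hv w hw => by
        rcases List.mem_append.1 hw with hw | hw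
        · exact h6 w hw
        · rw [List.mem_singleton.1 hw]; exact hv
    have h5' : ∀ v : Str, (vks ++ [v]).length ≤ j + 1 := fun v => by simpa using h5
    dsimp only at ho; cases hc : p.sep C x && eqN (p.cnt C) idx
    · rw [hc, cond_false, call_bind_run, mem_support_map_iff] at ho; obtain ⟨s, -, rfl⟩ := ho
      refine ⟨h2, h3, h4, h5' _, hv _ ?_, h7.trans j.le_succ⟩; refine (length_fstS_le _).trans ?_
      rw [List.length_tail, length_take]; omega
    · rw [hc, cond_true, call_bind_run, mem_support_map_iff] at ho; obtain ⟨s, -, rfl⟩ := ho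
      exact ⟨h2, h3, h4, h5' _, hv _ (Nat.zero_le _), hb.keys.trans j.le_succ⟩
  · change o ∈ PMF.support ((cond _ _ _ : Act _ _) _) at ho; dsimp only at ho
    cases hc : ltN idx (p.cnt C) && eqN (item 0 x).length star
    · rw [hc, cond_false, vrfyStep_bind_run, mem_support_map_iff] at ho; obtain ⟨s, -, rfl⟩ := ho
      exact ⟨h2, h3, h4, h5.trans j.le_succ, h6, h7.trans j.le_succ⟩
    · rw [hc, cond_true, call_bind_run, mem_support_map_iff] at ho; obtain ⟨s, -, rfl⟩ := ho
      refine ⟨h2, h3, ?_, h5.trans j.le_succ, h6, h7.trans j.le_succ⟩; dsimp only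
      cases (s.1.1.take (t p.lam)).isEmpty
      · rw [cond_false, List.length_tail, length_take]; omega
      · exact h4
  · obtain ⟨r, rfl⟩ := encStep_bind_support ho
    exact ⟨h2, h3, h4, h5.trans j.le_succ, h6, h7.trans j.le_succ⟩
  · change o ∈ PMF.support (PMF.pure _) at ho; rw [support_pure, mem_singleton_iff] at ho; subst ho
    exact ⟨h2, h3, h4, h5.trans j.le_succ, h6, h7.trans j.le_succ⟩

lemma cvaProcs_idx {t : ℕ → ℕ} {coin : Bool} {S : Type} {O : Oracle S} {k : ℕ} {p : Pub}
    {y : CvaSecrets} {x : Str} {u : World S} {o}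
    (ho : o ∈ (cvaProcs E D F C t coin S O k p y x u).support) : o.1.2.idx = y.idx := by
  rcases k with _ | _ | _ | _ | _ | _ | k
  · change o ∈ PMF.support ((lift _ >>= fun _ => lift _ >>= fun _ => pure _) _) at ho
    rw [bind_run, mem_support_bind_iff] at ho; obtain ⟨K', -, ho⟩ := ho
    rw [lift_bind_run, mem_support_map_iff] at ho; obtain ⟨_, _, rfl⟩ := ho; rfl
  · cases (mem_support_pure_iff _ _).1 ho; rfl
  · obtain ⟨r, rfl⟩ := encStep_bind_support ho; rfl
  · change o ∈ PMF.support ((lift _ >>= fun _ => cond _ _ _) _) at ho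
    rw [bind_run, mem_support_bind_iff] at ho; obtain ⟨r, -, ho⟩ := ho
    cases hc : p.sep C x && eqN (p.cnt C) y.idx
    all_goals
      rw [hc] at ho
      first | rw [cond_false] at ho | rw [cond_true] at ho
      rw [call_bind_run, mem_support_map_iff] at ho; obtain ⟨s, -, rfl⟩ := ho; rfl
  · change o ∈ PMF.support ((cond _ _ _ : Act _ _) _) at ho
    cases hc : ltN y.idx (p.cnt C) && eqN (item 0 x).length y.star
    · rw [hc, cond_false, vrfyStep_bind_run, mem_support_map_iff] at ho; obtain ⟨s, -, rfl⟩ := ho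
      rfl
    · rw [hc, cond_true, call_bind_run, mem_support_map_iff] at ho; obtain ⟨s, -, rfl⟩ := ho; rfl
  · obtain ⟨r, rfl⟩ := encStep_bind_support ho; rfl
  · cases (mem_support_pure_iff _ _).1 ho; rfl

lemma ofBits_lt (s : Str) : ofBits s < 2 ^ s.length := by
  induction s with
  | nil => simp [ofBits]
  | cons b s ih => rw [ofBits, length_cons, pow_succ]; cases b <;> simp <;> omega

lemma two_pow_size_le (n : ℕ) : 2 ^ n.size ≤ 2 * n + 1 := by
  rcases Nat.eq_zero_or_pos n with rfl | h
  · simp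
  · have h1 : 0 < n.size := Nat.size_pos.2 h
    have h2 : 2 ^ (n.size - 1) ≤ n := Nat.lt_size.1 (Nat.sub_lt h1 one_pos)
    have h3 : 2 ^ n.size = 2 ^ (n.size - 1) * 2 := by rw [← pow_succ, Nat.sub_add_cancel h1]
    omega

variable (F) in
lemma exists_cva_reduction {A : Prog} {T : ℕ[X]} (hA : TimeBound A T) (coin : Bool) : ∃ P,
    IsQPTAdversary P ∧ ∀ lam b, D.cvaExperiment P lam b = (uniformBits (T.eval lam).size).bind fun s
    => (coreRun E D C (fun lam => sampler E D F lam false true) (ofBits s + b.toNat) coin A lam).map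
    fun st => st.guess && st.env.1.1.challenged && ltN (ofBits s) (st.env.1.1.cnt C) := by
  obtain ⟨p1, hp1⟩ := setup_size (E := E); obtain ⟨p2, hp2⟩ := keyDist_size E D
  obtain ⟨p3, hp3⟩ := cdKeyGen_size (D := D)
  set t : ℕ[X] := 3 * p2.comp (X + (p1.comp (X + T) + p3 + T)) + p3 + 2 with ht
  refine (exists_game_reduction hA C (P := cvaProcs E D F C (fun lam => t.eval lam) coin)
    (impl_cvaProcs E D F C t coin) (μ := fun lam => (uniformBits (T.eval lam).bits.length).map
      fun s => (⟨min (ofBits s) (2 * T.eval lam + 1), [], [], [], [], 0⟩ : CvaSecrets))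
    ?_ (fin := fun a => a.2 && a.1.1.challenged && ltN a.1.2.idx (a.1.1.cnt C)) fp
    (fun lam j y => y.idx ≤ 2 * T.eval lam + 1 ∧ y.K.length ≤ lam ∧
      y.msk.length ≤ p1.eval (lam + T.eval lam) ∧
      y.cdsk.length ≤ t.eval lam ∧ y.vks.length ≤ j ∧ (∀ v ∈ y.vks, v.length ≤ t.eval lam) ∧
      y.star ≤ j)
    (4 * T + 2 + 2 * X + 2 * p1.comp (X + T) + 2 * t + 7 + 2 * (T * (2 * t + 1)) + T) ?_ ?_ ?_
      ?_).imp fun P h => ⟨h.1, fun lam b => ?_⟩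
  rotate_right
  · rw [CDSKE.cvaExperiment]
    have h1 : ∀ sk, (interact (D.cvaOracle lam b) ⟨sk, none⟩ P lam).map State.guess = _ :=
      fun sk => by
        have h' := congrArg (PMF.map Prod.fst) (h.2 lam _ (D.cvaOracle lam b) ⟨sk, none⟩)
        simp only [map_comp, PMF.map_bind, bind_map, Function.comp_def] at h'; exact h'
    simp only [h1]; rw [PMF.bind_comm, Nat.size_eq_bits_len]
    refine PMF.bind_congr_support fun s hs => ?_
    have hlen := length_of_mem_uniformBits hs
    have hmin : min (ofBits s) (2 * T.eval lam + 1) = ofBits s := min_eq_left (by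
      have h1 := ofBits_lt s; have h2 := two_pow_size_le (T.eval lam); rw [hlen] at h1; omega)
    rw [hmin]; rw [coreRun_preset (fun p g => g && p.challenged && ltN (ofBits s) (p.cnt C))]
    refine PMF.bind_congr_support fun sk hsk => Eq.symm ?_
    refine (lift_game (R := fun p xa _ xb eb => p.lam = lam ∧
        CvaRel E D F C (p1.eval (lam + T.eval lam)) (ofBits s) sk p xa xb eb)
      (BA := fun p _ _ => p.Early C (ofBits s)) (BB := fun p y _ => p.Early C (ofBits s) ∧ y.idx = ofBits s)
      ?_ (game_stable _ (B := fun p _ => p.Early C (ofBits s))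
        fun k p _ x _ hg h _ _ => h.update hg _)
      (game_stable _ (B := fun p y => p.Early C (ofBits s) ∧ y.idx = ofBits s) fun k p y x u hg h o ho => ⟨h.1.update hg _, (cvaProcs_idx ho).trans h.2⟩) A
      (a := start ![unary lam] [] QMem.init ((Pub.init lam, ⟨id, [], sk, []⟩), ()))
      (b := start ![unary lam] [] QMem.init ((Pub.init lam, ⟨ofBits s, [], [], [], [], 0⟩),
        (⟨sk, none⟩ : CDSKE.CvaState)))
      rfl rfl ⟨rfl, ?_⟩ (hA lam _ _ _)).map_eq ?_
    · rintro k p xa ea xb eb x m ⟨hl, hR⟩ hx hg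
      refine (lift_cvaProcs (fun q hq msk hm => hp1 lam q _ hq msk hm) ?_ ?_ k p xa ea xb eb x m hl
        hR hx hg).mem.mono fun o o' h => h.1.imp id fun h' => ⟨h'.1, h'.2,
          (cvaProcs_idx h.2.2).trans hR.idx⟩
      · intro msk f z m hm hf o ho; have h4 := hp3 lam sk hsk
        obtain ⟨g1, g2, g3⟩ := hp2 lam msk sk f z m
          (p1.eval (lam + T.eval lam) + p3.eval lam + T.eval lam) (by omega) (by omega) (by omega)
          o ho
        rw [ht]; simp; omega
      · have h4 := hp3 lam sk hsk; rw [ht]; simp; omega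
    · exact {
        sk_eq := rfl
        cdsk := rfl
        idx := rfl
        off := fun _ => ⟨rfl, rfl, rfl⟩
        blk := fun h => by cases h
        msk := fun h => by cases h
        size := fun h => by cases h
        lenA := fun h => by cases h
        lenB := fun h => by cases h
        vks := fun h => by cases h
        fresh := fun _ => rfl
        star := fun h => absurd h (Nat.not_lt_zero _)
        used := fun h => by cases h
        chal := fun h => by cases h }
    · rintro a b (⟨hab, hp, -, hR⟩ | ⟨ha, hb⟩)
      · rw [hp, hR.idx, hab]; rfl
      · have key : ∀ p : Pub, p.Early C (ofBits s) →
            (p.challenged && ltN (ofBits s) (p.cnt C)) = false := fun p hp => by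
          rcases hp.2 with h | h
          · rw [h.2]; rfl
          · rw [h.1, ltN, decide_eq_false (not_lt.2 h.2)]; rfl
        rw [hb.2, Bool.and_assoc, Bool.and_assoc, key _ ha, key _ hb.1, Bool.and_false,
          Bool.and_false]
  · refine (Impl.bind (Impl.coins (n := fun lam => (T.eval lam).bits.length) fp)
      (g' := fun _ _ lam s => pure (⟨min (ofBits s) (2 * T.eval lam + 1), [], [], [], [], 0⟩ :
        CvaSecrets)) (Impl.pure fp)).congr fun S O a w => by
      rw [Act.lift_map]
  · intro lam y hy; obtain ⟨s, -, rfl⟩ := (mem_support_map_iff _ _ _).1 hy; simp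
  · intro lam j p y k x S O u hl hb hy hx o ho
    exact ⟨(cvaProcs_idx ho).le.trans hy.1, cvaProcs_bounded
      (fun q hq msk hm => hp1 lam q _ hq msk hm) hl hb hx hy.2 ho⟩
  · rintro lam j y ⟨h1, h2, h3, h4, h5, h6, h7⟩
    exact ⟨h1, h2, h3, h4, h5.trans j.le_succ, h6, h7.trans j.le_succ⟩
  · rintro lam j ⟨idx, K, msk, cdsk, vks, star⟩ hj ⟨h1, h2, h3, h4, h5, h6, h7⟩
    dsimp only at h1 h2 h3 h4 h5 h6 h7; change (enc (idx, K, msk, cdsk, vks, star)).length ≤ _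
    have h8 := length_enc_le (l := vks) h6
    have h9 := Nat.mul_le_mul_right (2 * t.eval lam + 1) (h5.trans hj)
    clear_value t
    simp only [length_enc_pair, enc_str, enc_nat, length_unary]; simp; omega

lemma pr_coreExp_sub (smp : ℕ → ℕ → Str → PMF ((Str → Str) × Str × Str)) (i : ℕ) (coin : Bool)
    {A : Prog} {T : ℕ[X]} (hA : TimeBound A T) (lam : ℕ) : pr (coreExp E D C smp i coin A lam) - pr
    (coreExp E D C smp (i + 1) coin A lam) = pr ((coreRun E D C smp i coin A lam).map fun st =>
    st.guess && st.env.1.1.challenged && ltN i (st.env.1.1.cnt C)) - pr ((coreRun E D C smp (i + 1)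
    coin A lam).map fun st => st.guess && st.env.1.1.challenged && ltN i (st.env.1.1.cnt C)) := by
  have h1 := pr_map_split (coreRun E D C smp i coin A lam)
    (fun s => s.guess && s.env.1.1.challenged) fun s => ltN i (s.env.1.1.cnt C)
  have h2 := pr_map_split (coreRun E D C smp (i + 1) coin A lam)
    (fun s => s.guess && s.env.1.1.challenged) fun s => ltN i (s.env.1.1.cnt C)
  rw [coreExp, coreExp, h1, h2, coreRun_agree smp i coin hA lam]; ring

variable (E D C) in
/-- The event that the adversary outputs `1` after the challenge in the core game with `hyb`
replaced keys, and there are more than `i` keys whose functions separate the challenge plaintexts. -/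
def stepExp (smp : ℕ → ℕ → Str → PMF ((Str → Str) × Str × Str)) (i hyb : ℕ) (coin : Bool) (A : Prog)
    (lam : ℕ) : PMF Bool :=
  (coreRun E D C smp hyb coin A lam).map fun st =>
    st.guess && st.env.1.1.challenged && ltN i (st.env.1.1.cnt C)

lemma pr_hybrid {A : Prog} {T : ℕ[X]} (hA : TimeBound A T)
    (smp : ℕ → ℕ → Str → PMF ((Str → Str) × Str × Str)) (coin : Bool) (lam k : ℕ) : pr
    (coreExp E D C smp 0 coin A lam) - pr (coreExp E D C smp (2 ^ k) coin A lam) = 2 ^ k * (pr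
    ((uniformBits k).bind fun s => stepExp E D C smp (ofBits s) (ofBits s + false.toNat) coin A lam)
    - pr ((uniformBits k).bind fun s => stepExp E D C smp (ofBits s) (ofBits s + true.toNat) coin A
    lam)) :=
  pr_telescope (G := fun i => coreExp E D C smp i coin A lam)
    (H := fun b i => stepExp E D C smp i (i + b.toNat) coin A lam)
    (fun i => pr_coreExp_sub smp i coin hA lam) k

variable (F) in
lemma exists_hybrid_reduction {A : Prog} {T : ℕ[X]} (hA : TimeBound A T) (coin : Bool) : ∃ P,
    IsQPTAdversary P ∧ ∀ lam, pr (coreExp E D C (fun lam => sampler E D F lam false true) 0 coin A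
    lam) - pr (coreExp E D C (fun lam => sampler E D F lam false true) (2 ^ (T.eval lam).size) coin
    A lam) = 2 ^ (T.eval lam).size *
    (pr (D.cvaExperiment P lam false) - pr (D.cvaExperiment P lam true)) := by
  obtain ⟨P, hP, h⟩ := exists_cva_reduction (E := E) (D := D) F (C := C) hA coin
  refine ⟨P, hP, fun lam => ?_⟩; rw [h, h]; exact pr_hybrid hA _ coin lam _

/-! ### The reduction to indistinguishability -/

/-- The secrets of the reduction to indistinguishability. -/
structure IndSecrets where
  K : Str
  /-- a master key for the keys that are replaced by zeros -/
  msk : Str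
  cdsk : Str
  vks : List Str
  /-- the challenge ciphertext -/
  ct : Str

instance : Code IndSecrets := ⟨fun s => enc (s.K, s.msk, s.cdsk, s.vks, s.ct)⟩

namespace PT

variable {α : Type} [Code α] {f : α → IndSecrets}

lemma indTuple (hf : PT f) : PT fun a => ((f a).K, (f a).msk, (f a).cdsk, (f a).vks, (f a).ct) :=
  hf.of_enc_eq fun _ => rfl

@[fun_prop] lemma indK (hf : PT f) : PT fun a => (f a).K := hf.indTuple.fst
@[fun_prop] lemma indMsk (hf : PT f) : PT fun a => (f a).msk := hf.indTuple.snd.fst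
@[fun_prop] lemma indCdsk (hf : PT f) : PT fun a => (f a).cdsk := hf.indTuple.snd.snd.fst
@[fun_prop] lemma indVks (hf : PT f) : PT fun a => (f a).vks := hf.indTuple.snd.snd.snd.fst
@[fun_prop] lemma indCt (hf : PT f) : PT fun a => (f a).ct := hf.indTuple.snd.snd.snd.snd

@[fun_prop] lemma indSecrets {K m c t : α → Str} {v : α → List Str} (hK : PT K) (hm : PT m)
    (hc : PT c) (hv : PT v) (ht : PT t) : PT fun a => IndSecrets.mk (K a) (m a) (c a) (v a) (t a) :=
  (hK.pair (hm.pair (hc.pair (hv.pair ht)))).of_enc_eq fun _ => rfl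

end PT

lemma ppt_size (A : PPT 3) : ∃ p : ℕ[X], ∀ lam a b N, a.length ≤ N → b.length ≤ N → ∀ o ∈
    (A.dist ![unary lam, a, b]).support, o.length ≤ p.eval (lam + N) := by
  obtain ⟨p, hp⟩ := (Impl.ppt A (forall_fin3 (f := fun k (a : ℕ × Str × Str) =>
    ![unary a.1, a.2.1, a.2.2] k) (PT.fst PT.id).unary (PT.fst (PT.snd PT.id))
      (PT.snd (PT.snd PT.id)))).size_qubits
  refine ⟨p.comp (4 * X + 2), fun lam a b N ha hb o ho => ?_⟩
  have h := (hp Unit noOracle (lam, a, b) ([], (), QMem.init) (o, ([], (), QMem.init))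
    ((mem_support_map_iff _ _ _).2 ⟨o, ho, rfl⟩)).1
  simp only [length_enc_pair, enc_nat, length_unary, enc_str] at h
  have h3 := eval_mono p (show 2 * lam + 1 + (2 * a.length + 1 + b.length) ≤
    4 * (lam + N) + 2 by omega)
  simp; omega

lemma encDist_size (D : CDSKE) : ∃ p : ℕ[X], ∀ lam a b m N, a.length ≤ N → b.length ≤ N → ∀ o ∈
    (D.encDist lam a b m).support, o.1.1.length ≤ p.eval (lam + N) := by
  obtain ⟨p, hp⟩ := (Impl.encrypt D (α := ℕ × Str × Str) (lam := fun a => a.1)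
    (sk := fun a => a.2.1) (m := fun a => a.2.2) fp fp
    fp).size_qubits
  refine ⟨p.comp (4 * X + 2), fun lam a b m N ha hb o ho => ?_⟩
  have h := (hp Unit noOracle (lam, a, b) ([], (), m)
    ((o.1.1, o.1.2.1, o.1.2.2.length), ([] ++ o.1.2.2, (), o.2))
    ((mem_support_map_iff _ _ _).2 ⟨o, ho, rfl⟩)).1
  simp only [length_enc_pair, enc_nat, length_unary, enc_str] at h
  have h3 := eval_mono p (show 2 * lam + 1 + (2 * a.length + 1 + b.length) ≤
    4 * (lam + N) + 2 by omega)
  simp; omega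

section

variable (E D F C)

/-- The core game where all keys for separating functions are replaced by zeros, without the master
key. Answers of its challenger are cut at length `t`. -/
def indProcs (t : ℕ → ℕ) (S : Type) (O : Oracle S) : Procs S IndSecrets
  | 0, p, _, x => lift (uniformBits p.lam) >>= fun K =>
      lift (E.setup.dist ![unary p.lam, unary (item 0 x).length]) >>= fun msk =>
        lift (D.keyGen.dist ![unary p.lam]) >>= fun cdsk =>
          Act.call O 0 (encList [unary (item 0 x).length, item 2 x, item 3 x]) (t p.lam) >>=
            fun r => pure ([], ⟨K, msk, cdsk, [], r.1.tail⟩)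
  | 1, p, s, x => pure (F.eval s.K x (blockLen E D p.lam p.q), s)
  | 2, p, s, x => Act.call O 1 x (t p.lam) >>= fun r => pure (pairS r.1.tail s.cdsk, s)
  | 3, p, s, x => cond (p.sep C x)
      (lift (E.keyGen.dist ![unary p.lam, s.msk, x]) >>= fun fsk => pure (blank true fsk))
      (Act.call O 2 x (t p.lam) >>= fun r => pure r.1.tail) >>= fun fsk =>
        Act.encrypt D p.lam s.cdsk fsk >>= fun o =>
          pure (o.2.1, ⟨s.K, s.msk, s.cdsk, s.vks ++ [o.1], s.ct⟩)
  | 4, p, s, x => vrfyStep D p.lam (s.vks.getI (item 0 x).length) (item 1 x) >>= fun r =>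
      pure (r, s)
  | 5, _, s, _ => pure (pairS s.ct s.cdsk, s)
  | _, _, s, _ => pure ([], s)

lemma impl_indProcs (t : ℕ[X]) (k : ℕ) : Impl fun S O (a : (Pub × IndSecrets) × Str) => indProcs E D
    F C (fun lam => t.eval lam) S O k a.1.1 a.1.2 a.2 := by
  rcases k with _ | _ | _ | _ | _ | _ | k <;> unfold indProcs
  · refine Impl.bind (Impl.coins fp) (Impl.bind (Impl.ppt E.setup (forall_fin2
      (f := fun k (a : ((Pub × IndSecrets) × Str) × Str) =>
        ![unary a.1.1.1.lam, unary (item 0 a.1.2).length] k) ?_ ?_)) (Impl.bind (Impl.ppt D.keyGen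
          (forall_fin1 (f := fun k (a : (((Pub × IndSecrets) × Str) × Str) × Str)
            => ![unary a.1.1.1.1.lam] k) ?_)) (Impl.bind (Impl.call 0 ?_ fp) (Impl.pure fp))))
    · exact PT.unary fp
    · exact PT.unary fp
    · exact PT.unary fp
    · simp only [encList]; fun_prop
  · exact Impl.pure ((PT.evalF F fp fp fp).pair fp)
  · exact Impl.bind (Impl.call 1 fp fp) (Impl.pure fp)
  · refine Impl.bind (Impl.cond fp (Impl.bind (Impl.skKeyGen fp fp
      fp) (Impl.pure fp)) (Impl.bind (Impl.call 2 fp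
        fp) (Impl.pure fp))) (Impl.bind (Impl.encrypt D fp fp fp) (Impl.pure ?_))
    exact PT.pair fp (PT.indSecrets fp fp fp (PT.append fp (PT.cons fp (PT.const _))) fp)
  · exact Impl.bind (Impl.vrfyStep fp (PT.getI fp fp) fp) (Impl.pure fp)
  · exact Impl.pure fp
  · exact Impl.pure fp

/-- The core game where the challenge ciphertext is generated at the start. -/
def eagerProcs {S : Type} (smp : ℕ → ℕ → Str → PMF ((Str → Str) × Str × Str))
    (hyb : ℕ) (coin : Bool) : Procs S (Secrets × Str)
  | 0, p, _, x => lift ((smp p.lam (item 0 x).length (item 1 x)).bind fun o =>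
      bif p.challenged then PMF.pure (o, []) else
        (E.enc.dist ![unary p.lam, o.2.1, bif coin then item 3 x else item 2 x]).map fun ct =>
          (o, ct)) >>= fun o => pure ([], ⟨o.1.1, o.1.2.1, o.1.2.2, []⟩, o.2)
  | 5, _, s, _ => pure (pairS s.2 s.1.cdsk, s.1, [])
  | k, p, s, x => coreProcs E D C smp hyb coin k p s.1 x >>= fun o => pure (o.1, o.2, s.2)

variable {E D F C}

lemma coreProcs_msk {S : Type} {smp : ℕ → ℕ → Str → PMF ((Str → Str) × Str × Str)} {hyb : ℕ}
    {coin : Bool} {k : ℕ} {p : Pub} {s : Secrets} {x : Str} {w : World S} {o}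
    (ho : o ∈ (coreProcs E D C smp hyb coin (k + 1) p s x w).support) : o.1.2.msk = s.msk := by
  rcases k with _ | _ | _ | _ | _ | k
  · cases (mem_support_pure_iff _ _).1 ho; rfl
  · rw [coreProcs_two, mem_support_map_iff] at ho; obtain ⟨_, _, rfl⟩ := ho; rfl
  · rw [coreProcs_three, mem_support_map_iff] at ho; obtain ⟨_, _, rfl⟩ := ho; rfl
  · rw [coreProcs_four, mem_support_map_iff] at ho; obtain ⟨_, _, rfl⟩ := ho; rfl
  · rw [coreProcs_five, mem_support_map_iff] at ho; obtain ⟨_, _, rfl⟩ := ho; rfl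
  · cases (mem_support_pure_iff _ _).1 ho; rfl

lemma coreRun_eager {γ : Type} (f : Pub → Bool → γ)
    (smp : ℕ → ℕ → Str → PMF ((Str → Str) × Str × Str)) (hyb : ℕ) (coin : Bool) (A : Prog) (lam : ℕ)
    : (coreRun E D C smp hyb coin A lam).map (fun s => f s.env.1.1 s.guess) = (interact (game C
    (eagerProcs E D C smp hyb coin)) ((Pub.init lam, ⟨id, [], [], []⟩, []), ()) A lam).map fun s =>
    f s.env.1.1 s.guess := by
  refine (game_kernel (PB := eagerProcs E D C smp hyb coin) (fun p xa => bif p.on && !p.challenged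
    then (E.enc.dist ![unary p.lam, xa.msk, bif coin then p.x1 else p.x0]).map fun ct => (xa, ct)
    else PMF.pure (xa, [])) ?_ A lam _ _ _ f).trans ?_
  · intro k p xa e x m hg; rcases k with _ | k
    · have hoff := Pub.off_of_guard hg
      rw [hoff, Bool.false_and, cond_false, PMF.pure_bind, coreProcs_zero, bind_map]
      change _ = (lift _ >>= fun _ => pure _) _; rw [lift_bind_run, PMF.map_bind]
      refine congrArg _ (funext fun o => ?_); rw [comp_apply]
      change PMF.map _ (bif !p.challenged then _ else _) = _; cases p.challenged
      · simp only [Bool.not_false, cond_true, cond_false]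
        exact (map_comp _ _ _).trans (by rw [map_comp]; rfl)
      · simp only [Bool.not_true, cond_true, cond_false]
        exact (pure_map _ _).trans (by rw [pure_map])
    · have hon : p.on = true := Pub.on_of_guard hg
      have hon' : ∀ r, (p.update (k + 1) x r).on = true := fun r => by
        rcases k with _ | _ | _ | _ | _ | k <;> exact hon
      simp only [hon, hon', Bool.true_and]
      by_cases hk : k = 4
      · subst hk; simp only [Pub.guard, Bool.and_eq_true, Bool.not_eq_true'] at hg
        rw [coreProcs_five, hg.2.1, Bool.not_false, cond_true, bind_map, bind_map]
        refine congrArg _ (funext fun ct => ?_); exact pure_map _ _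
      · have h1 : ∀ (s : Secrets) ct, eagerProcs E D C smp hyb coin (k + 1) p (s, ct) x ([], e, m) =
            (coreProcs E D C smp hyb coin (k + 1) p s x ([], e, m)).map fun o =>
              ((o.1.1, o.1.2, ct), o.2) := fun s ct => by
          rw [eagerProcs, bind_pure_run]
          · simp
          · simpa using hk
        have h2 : ∀ r, (p.update (k + 1) x r).challenged = p.challenged ∧
            (p.update (k + 1) x r).x0 = p.x0 ∧ (p.update (k + 1) x r).x1 = p.x1 := fun r => by
          rcases k with _ | _ | _ | _ | _ | k <;>
            first | exact (hk rfl).elim | exact ⟨rfl, rfl, rfl⟩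
        simp only [h2, Pub.update_lam]; cases p.challenged
        · simp only [Bool.not_false, cond_true, bind_map, map_comp, Function.comp_def, h1]
          rw [PMF.bind_congr_support (g := fun o => (E.enc.dist ![unary p.lam, xa.msk,
            bif coin then p.x1 else p.x0]).map fun ct => ((o.1.1, o.1.2, ct), o.2)) fun o ho => by
              rw [coreProcs_msk ho]]
          simp only [← PMF.bind_pure_comp]; exact PMF.bind_comm _ _ _
        · simp only [Bool.not_true, cond_false, PMF.pure_bind, pure_map, h1]
          exact PMF.bind_pure_comp _ _
  · exact PMF.pure_bind _ _

end

lemma encrypt_bind_run {S β : Type} (D : CDSKE) (lam : ℕ) (sk m : Str) (f : Str × Str × ℕ → β)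
    (w : World S) : (Act.encrypt D lam sk m >>= fun r => pure (f r)) w =
    (D.encDist lam sk m w.2.2).map fun o =>
    (f (o.1.1, o.1.2.1, o.1.2.2.length), (w.1 ++ o.1.2.2, w.2.1, o.2)) := by
  rw [bind_pure_run, Act.encrypt, map_comp]; rfl

/-- The distribution of a replaced key does not depend on the master key. -/
lemma keyDist_blank (hlen : E.PublicKeyLength C) {lam q : ℕ} {msk msk' f : Str}
    (hm : msk ∈ (E.setup.dist ![unary lam, unary q]).support)
    (hm' : msk' ∈ (E.setup.dist ![unary lam, unary q]).support) (hf : C.F lam f = true) (cdsk : Str)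
    (m : QMem) : keyDist E D lam msk cdsk f true m = keyDist E D lam msk' cdsk f true m := by
  obtain ⟨len, hlen⟩ := hlen lam q f hf
  have key : ∀ msk ∈ (E.setup.dist ![unary lam, unary q]).support,
      keyDist E D lam msk cdsk f true m =
        (D.encDist lam cdsk (List.replicate len false) m).map fun o =>
          ((o.1.1, o.1.2.1), o.1.2.2, o.2) := fun msk hm => by
    rw [keyDist]; refine (PMF.bind_congr_support fun fsk h => ?_).trans (PMF.bind_const _ _)
    obtain ⟨r, hr, rfl⟩ := (mem_support_map_iff _ _ _).1 hm
    obtain ⟨r', hr', rfl⟩ := (mem_support_map_iff _ _ _).1 h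
    rw [blank, cond_true, hlen r r' (length_of_mem_uniformBits hr) (length_of_mem_uniformBits hr')]
  rw [key msk hm, key msk' hm']

variable (E D F) in
/-- The relation between the core game and the reduction to indistinguishability. -/
structure IndRel (p : Pub) (xa : Secrets × Str) (xb : IndSecrets)
    (eb : Option SKFE.IndState) : Prop where
  off : p.on = false → p.keys = [] ∧ p.challenged = false ∧ eb = none
  blk : p.on = true → xa.1.blk = fun x => F.eval xb.K x (blockLen E D p.lam p.q)
  cdsk : p.on = true → xb.cdsk = xa.1.cdsk
  vks : p.on = true → xb.vks = xa.1.vks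
  ct : p.on = true → p.challenged = false → xb.ct = xa.2
  st : p.on = true → ∃ n ≤ p.keys.length, eb = some ⟨p.q, p.x0, p.x1, xa.1.msk, n⟩
  mskA : p.on = true → xa.1.msk ∈ (E.setup.dist ![unary p.lam, unary p.q]).support
  mskB : p.on = true → xb.msk ∈ (E.setup.dist ![unary p.lam, unary p.q]).support

lemma lift_indProcs {T hyb : ℕ} {t : ℕ → ℕ} {coin : Bool} {lam : ℕ} (hlen : E.PublicKeyLength C) (ht
    : ∀ q ≤ T, ∀ msk ∈ (E.setup.dist ![unary lam, unary q]).support, ∀ x, x.length ≤ T → (∀ o ∈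
    (E.enc.dist ![unary lam, msk, x]).support, o.length + 1 ≤ t lam) ∧ ∀ o ∈ (E.keyGen.dist ![unary
    lam, msk, x]).support, o.length + 1 ≤ t lam) (hT : T < hyb) (k : ℕ) (p : Pub)
    (xa : Secrets × Str) (ea : Unit) (xb : IndSecrets) (eb : Option SKFE.IndState) (x : Str)
    (m : QMem) (hl : p.lam = lam) (hq : p.q ≤ T) (hR : IndRel E D F p xa xb eb) (hx : x.length ≤ T)
    (hg : p.guard C k x = true) : Lift (fun o o' => o'.1.1 = o.1.1 ∧ o'.2.1 = o.2.1 ∧ o'.2.2.2 =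
    o.2.2.2 ∧ ((p.update k x o.1.1).lam = lam ∧ (p.update k x o.1.1).q ≤ T) ∧ IndRel E D F (p.update
    k x o.1.1) o.1.2 o'.1.2 o'.2.2.1) (eagerProcs E D C (fun lam => sampler E D F lam false true)
    hyb coin k p xa x ([], ea, m))
    (indProcs E D F C t _ (E.indOracle C lam coin) k p xb x ([], eb, m)) := by
  subst hl; obtain ⟨⟨blk, amsk, acdsk, avks⟩, act⟩ := xa; obtain ⟨K, bmsk, bcdsk, bvks, bct⟩ := xb
  obtain ⟨hoff, hblk, hcdsk, hvks, hct, hst, hmskA, hmskB⟩ := hR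
  dsimp only at hoff hblk hcdsk hvks hct hst hmskA hmskB
  have htake : ∀ s : Str, s.length + 1 ≤ t p.lam →
      (reply s []).1.take (t p.lam) = true :: s := fun s h =>
    take_of_length_le (by simpa [reply] using h)
  have htake' : ∀ s : Str, (reply s []).2.take (t p.lam) = [] := fun _ => take_nil
  rcases k with _ | k
  · obtain ⟨hk, hc, rfl⟩ := hoff (Pub.off_of_guard hg)
    have hX : C.X p.lam (item 2 x) = true ∧ C.X p.lam (item 3 x) = true := by
      simpa [Pub.guard, Pub.off_of_guard hg] using hg
    change Lift _ ((lift _ >>= fun _ => pure _) _)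
      ((lift _ >>= fun _ => lift _ >>= fun _ => lift _ >>= fun _ =>
        Act.call _ _ _ _ >>= fun _ => pure _) _)
    beta_reduce
    rw [lift_bind_run, sampler_true, FunFamily.sample, hc]
    simp only [Bool.false_eq_true, if_false, cond_false, PMF.bind_bind, bind_map, PMF.map_bind,
      Function.comp_def, map_comp]
    rw [bind_run, lift, bind_map]; refine Lift.bind_same fun K' _ => ?_
    rw [comp_apply, bind_run, lift, bind_map]; refine Lift.bind_right fun bmsk' hb => ?_
    rw [comp_apply, bind_run, lift, bind_map, PMF.bind_comm]; refine Lift.bind_same fun sk _ => ?_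
    rw [comp_apply, call_bind_run]
    have hi : ∀ a b c, item 0 (encList [a, b, c]) = a ∧ item 1 (encList [a, b, c]) = b ∧
        item 2 (encList [a, b, c]) = c := fun a b c => by simp [encList, item, fstS_pairS, sndS_pairS]
    simp only [SKFE.indOracle, hi, length_unary]; rw [if_pos hX, PMF.map_bind]
    refine Lift.bind_same fun msk hm => ?_
    rw [map_comp]; have hq : (item 0 x).length ≤ T := (Pub.length_item_le 0 x).trans hx
    have hxc : (bif coin then item 3 x else item 2 x) = if coin then item 3 x else item 2 x := by
      cases coin <;> rfl
    have hxl : (bif coin then item 3 x else item 2 x).length ≤ T := by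
      cases coin <;> exact (Pub.length_item_le _ x).trans hx
    rw [hxc]; refine Lift.map_same fun ct hct' => ?_
    have h3 := htake ct ((ht _ hq msk hm _ hxl).1 ct (by rw [hxc]; exact hct'))
    simp only [comp_apply, h3, tail_cons, htake']
    exact ⟨trivial, rfl, trivial, ⟨rfl, hq⟩, {
      off := fun h => by cases h
      blk := fun _ => rfl
      cdsk := fun _ => rfl
      vks := fun _ => rfl
      ct := fun _ _ => rfl
      st := fun _ => ⟨0, Nat.zero_le _, rfl⟩
      mskA := fun _ => hm
      mskB := fun _ => hb }⟩
  have hon := Pub.on_of_guard hg; have hblk := hblk hon; have hcdsk := hcdsk hon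
  have hvks := hvks hon; have hct := hct hon; obtain ⟨n, hn, rfl⟩ := hst hon
  have hmskA := hmskA hon; have hmskB := hmskB hon; subst hblk hcdsk hvks
  have hR : IndRel E D F p (⟨fun x => F.eval K x (blockLen E D p.lam p.q), amsk, bcdsk, bvks⟩, act)
      ⟨K, bmsk, bcdsk, bvks, bct⟩ (some ⟨p.q, p.x0, p.x1, amsk, n⟩) :=
    ⟨hoff, fun _ => rfl, fun _ => rfl, fun _ => rfl, fun _ => hct, fun _ => ⟨n, hn, rfl⟩,
      fun _ => hmskA, fun _ => hmskB⟩
  have hkey := ht _ hq amsk hmskA x hx; rcases k with _ | _ | _ | _ | _ | k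
  · change Lift _ ((_ >>= fun _ => pure _ : Act _ _) _) (PMF.pure _)
    rw [bind_pure_run, coreProcs_one, pure_map]; exact Lift.pure ⟨rfl, rfl, rfl, ⟨rfl, hq⟩, hR⟩
  · change Lift _ ((_ >>= fun _ => pure _ : Act _ _) _) _
    rw [bind_pure_run, coreProcs_two, map_comp]
    change Lift _ _ ((Act.call _ _ _ _ >>= fun _ => pure _) _)
    have hX : C.X p.lam x = true := by simpa [Pub.guard, hon] using hg
    rw [call_bind_run]; simp only [SKFE.indOracle]; rw [if_pos hX, map_comp]
    refine Lift.map_same fun ct hc => ?_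
    simp only [comp_apply, htake ct (hkey.1 ct hc), tail_cons, htake']
    exact ⟨trivial, rfl, trivial, ⟨rfl, hq⟩, { hR with
      off := fun h => by cases hon.symm.trans h }⟩
  · have hupd : ∀ r v (n' : ℕ), n' ≤ p.keys.length + 1 → IndRel E D F (p.update 3 x r)
        (⟨fun x => F.eval K x (blockLen E D p.lam p.q), amsk, bcdsk, bvks ++ [v]⟩, act)
        ⟨K, bmsk, bcdsk, bvks ++ [v], bct⟩ (some ⟨p.q, p.x0, p.x1, amsk, n'⟩) :=
      fun r v n' hn' => { hR with
        off := fun h => by cases hon.symm.trans h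
        vks := fun _ => rfl
        st := fun _ => ⟨n', by simpa [Pub.update] using hn', rfl⟩ }
    have hg' : C.F p.lam x = true ∧ p.keys.length < p.q := by
      simp only [Pub.guard, Bool.and_eq_true, ltN, decide_eq_true_eq] at hg
      exact ⟨hg.2.1, hg.2.2.1⟩
    change Lift _ ((_ >>= fun _ => pure _ : Act _ _) _) _
    rw [bind_pure_run, coreProcs_three, map_comp]
    change Lift _ _ ((cond _ _ _ >>= fun _ => Act.encrypt _ _ _ _ >>= fun _ => pure _) _)
    dsimp only; cases hs : p.sep C x
    · rw [Bool.false_and, cond_false, keyDist, PMF.map_bind, bind_run, call_bind_run]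
      have heq : C.eval p.lam x p.x0 = C.eval p.lam x p.x1 := by simpa [Pub.sep, eqS] using hs
      simp only [SKFE.indOracle]; rw [if_pos ⟨hg'.1, by omega, heq⟩, map_comp, bind_map]
      refine Lift.bind_same fun fsk hf => ?_
      simp only [comp_apply, htake fsk (hkey.2 fsk hf), tail_cons, htake',
        encrypt_bind_run, blank, cond_false, map_comp]
      exact Lift.map_same fun o _ => ⟨rfl, rfl, rfl, ⟨rfl, hq⟩, hupd _ _ _ (by omega)⟩
    · have hlt : ltN (p.cnt C) hyb = true := by
        have := p.cnt_le_length (C := C); simp only [ltN, decide_eq_true_eq]; omega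
      rw [Bool.true_and, hlt, cond_true, keyDist_blank hlen hmskA hmskB hg'.1, keyDist,
        PMF.map_bind, bind_run, lift_bind_run, bind_map]
      refine Lift.bind_same fun fsk hf => ?_
      simp only [comp_apply, encrypt_bind_run, map_comp]
      exact Lift.map_same fun o _ => ⟨rfl, rfl, rfl, ⟨rfl, hq⟩, hupd _ _ _ (by omega)⟩
  · change Lift _ ((_ >>= fun _ => pure _ : Act _ _) _) _
    rw [bind_pure_run, coreProcs_four, map_comp]
    change Lift _ _ ((vrfyStep _ _ _ _ >>= fun _ => pure _) _); rw [vrfyStep_bind_run]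
    refine Lift.map_same fun o _ => ⟨rfl, rfl, rfl, ⟨rfl, hq⟩, { hR with
      off := fun h => by cases hon.symm.trans h
      st := fun _ => ⟨n, by simpa [Pub.update] using hn, rfl⟩ }⟩
  · have hc : p.challenged = false := by
      simp only [Pub.guard, Bool.and_eq_true, Bool.not_eq_true'] at hg; exact hg.2.1
    obtain rfl := hct hc
    exact Lift.pure ⟨rfl, rfl, rfl, ⟨rfl, hq⟩, { hR with
      off := fun h => by cases hon.symm.trans h
      ct := fun _ h => by cases h }⟩
  · cases hg

variable (F) in
lemma indProcs_bounded {N V lam T j : ℕ} {t : ℕ → ℕ} {S : Type} {O : Oracle S} (hN : ∀ q ≤ T, ∀ msk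
    ∈ (E.setup.dist ![unary lam, unary q]).support, msk.length ≤ N)
    (hN' : ∀ sk ∈ (D.keyGen.dist ![unary lam]).support, sk.length ≤ N) (hV : ∀ msk cdsk x,
    msk.length ≤ N → cdsk.length ≤ N → x.length ≤ T → ∀ fsk, fsk ∈ (E.keyGen.dist ![unary lam, msk,
    x]).support ∨ fsk.length ≤ t lam → ∀ m, ∀ o ∈ (D.encDist lam cdsk (blank true fsk) m).support ∪
    (D.encDist lam cdsk fsk m).support, o.1.1.length ≤ V) {k : ℕ} {p : Pub} {y : IndSecrets}
    {x : Str} {u : World S} (hl : p.lam = lam) (hx : x.length ≤ T) (h : y.K.length ≤ lam ∧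
    y.msk.length ≤ N ∧ y.cdsk.length ≤ N ∧ y.vks.length ≤ j ∧ (∀ v ∈ y.vks, v.length ≤ V) ∧
    y.ct.length ≤ t lam) {o} (ho : o ∈ (indProcs E D F C t S O k p y x u).support) : o.1.2.K.length
    ≤ lam ∧ o.1.2.msk.length ≤ N ∧ o.1.2.cdsk.length ≤ N ∧ o.1.2.vks.length ≤ j + 1 ∧
    (∀ v ∈ o.1.2.vks, v.length ≤ V) ∧ o.1.2.ct.length ≤ t lam := by
  subst hl; obtain ⟨K, msk, cdsk, vks, ct⟩ := y; obtain ⟨h2, h3, h4, h5, h6, h7⟩ := h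
  dsimp only at h2 h3 h4 h5 h6 h7
  have h5' : ∀ v : Str, (vks ++ [v]).length ≤ j + 1 := fun v => by simpa using h5
  have hv : ∀ v : Str, v.length ≤ V → ∀ w ∈ vks ++ [v], w.length ≤ V := fun v hv w hw => by
    rcases List.mem_append.1 hw with hw | hw
    · exact h6 w hw
    · rw [List.mem_singleton.1 hw]; exact hv
  rcases k with _ | _ | _ | _ | _ | _ | k
  · change o ∈ PMF.support ((lift _ >>= fun _ => lift _ >>= fun _ => lift _ >>=
      fun _ => Act.call _ _ _ _ >>= fun _ => pure _) _) at ho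
    rw [bind_run, lift, bind_map, mem_support_bind_iff] at ho; obtain ⟨K', hK, ho⟩ := ho
    rw [comp_apply, bind_run, lift, bind_map, mem_support_bind_iff] at ho
    obtain ⟨msk', hm, ho⟩ := ho
    rw [comp_apply, bind_run, lift, bind_map, mem_support_bind_iff] at ho
    obtain ⟨sk, hsk, ho⟩ := ho; rw [comp_apply, call_bind_run, mem_support_map_iff] at ho
    obtain ⟨r, -, rfl⟩ := ho
    refine ⟨(length_of_mem_uniformBits hK).le, hN _ ((Pub.length_item_le 0 x).trans hx) msk' hm,
      hN' sk hsk, Nat.zero_le _, by simp, ?_⟩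
    simp only [List.length_tail, length_take]; omega
  · cases (mem_support_pure_iff _ _).1 ho; exact ⟨h2, h3, h4, h5.trans j.le_succ, h6, h7⟩
  · change o ∈ PMF.support ((Act.call _ _ _ _ >>= fun _ => pure _) _) at ho
    rw [call_bind_run, mem_support_map_iff] at ho; obtain ⟨r, -, rfl⟩ := ho
    exact ⟨h2, h3, h4, h5.trans j.le_succ, h6, h7⟩
  · change o ∈ PMF.support ((cond _ _ _ >>= fun _ => Act.encrypt _ _ _ _ >>= fun _ => pure _) _)
      at ho
    dsimp only at ho; rw [bind_run, mem_support_bind_iff] at ho; obtain ⟨fsk, hf, ho⟩ := ho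
    rw [encrypt_bind_run, mem_support_map_iff] at ho; obtain ⟨r, hr, rfl⟩ := ho
    refine ⟨h2, h3, h4, h5' _, hv _ ?_, h7⟩; cases hs : p.sep C x
    · rw [hs, cond_false, call_bind_run, mem_support_map_iff] at hf; obtain ⟨s, -, rfl⟩ := hf
      refine hV msk cdsk x h3 h4 hx _ (Or.inr ?_) _ r (Or.inr hr)
      simp only [List.length_tail, length_take]; omega
    · rw [hs, cond_true, lift_bind_run, mem_support_map_iff] at hf; obtain ⟨s, hs, rfl⟩ := hf
      exact hV msk cdsk x h3 h4 hx s (Or.inl hs) _ r (Or.inl hr)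
  · change o ∈ PMF.support ((vrfyStep _ _ _ _ >>= fun _ => pure _) _) at ho
    rw [vrfyStep_bind_run, mem_support_map_iff] at ho; obtain ⟨r, -, rfl⟩ := ho
    exact ⟨h2, h3, h4, h5.trans j.le_succ, h6, h7⟩
  · cases (mem_support_pure_iff _ _).1 ho; exact ⟨h2, h3, h4, h5.trans j.le_succ, h6, h7⟩
  · cases (mem_support_pure_iff _ _).1 ho; exact ⟨h2, h3, h4, h5.trans j.le_succ, h6, h7⟩

variable (D F) in
lemma exists_ind_reduction (hlen : E.PublicKeyLength C) {A : Prog} {T : ℕ[X]} (hA : TimeBound A T) :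
    ∃ P, IsQPTAdversary P ∧ ∀ lam coin, E.indExperiment C P lam coin = coreExp E D C
    (fun lam => sampler E D F lam false true) (2 ^ (T.eval lam).size) coin A lam := by
  obtain ⟨p1, hp1⟩ := setup_size (E := E); obtain ⟨p2, hp2⟩ := ppt_size E.enc
  obtain ⟨p3, hp3⟩ := cdKeyGen_size (D := D); obtain ⟨p4, hp4⟩ := ppt_size E.keyGen
  obtain ⟨p5, hp5⟩ := encDist_size D; set N : ℕ[X] := p1.comp (X + T) + p3 + T with hN
  set t : ℕ[X] := p2.comp (X + N) + p4.comp (X + N) + 1 with ht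
  set V : ℕ[X] := p5.comp (X + (N + t)) with hV
  have h1 : ∀ lam, ∀ q ≤ T.eval lam, ∀ msk ∈ (E.setup.dist ![unary lam, unary q]).support,
      msk.length ≤ N.eval lam := fun lam q hq msk h => by
    have := hp1 lam q _ hq msk h; rw [hN]; simp; omega
  have h2 : ∀ lam msk x, msk.length ≤ N.eval lam → x.length ≤ T.eval lam →
      (∀ o ∈ (E.enc.dist ![unary lam, msk, x]).support, o.length + 1 ≤ t.eval lam) ∧
      ∀ o ∈ (E.keyGen.dist ![unary lam, msk, x]).support, o.length + 1 ≤ t.eval lam :=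
    fun lam msk x hm hx => by
      have hx : x.length ≤ N.eval lam := hx.trans (by rw [hN]; simp)
      have g1 := hp2 lam msk x _ hm hx; have g2 := hp4 lam msk x _ hm hx
      clear_value N
      rw [ht]
      exact ⟨fun o ho => by have := g1 o ho; simp; omega,
        fun o ho => by have := g2 o ho; simp; omega⟩
  refine (exists_game_reduction hA C (P := indProcs E D F C (fun lam => t.eval lam))
    (impl_indProcs E D F C t) (μ := fun _ => PMF.pure ⟨[], [], [], [], []⟩)
    (Impl.pure (f := fun _ : ℕ => (⟨[], [], [], [], []⟩ : IndSecrets))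
      fp |>.congr fun S O a w => by simp only [lift, pure_map, pure_run])
    (fin := fun a => a.2 && a.1.1.challenged) fp
    (fun lam j y => y.K.length ≤ lam ∧ y.msk.length ≤ N.eval lam ∧ y.cdsk.length ≤ N.eval lam ∧
      y.vks.length ≤ j ∧ (∀ v ∈ y.vks, v.length ≤ V.eval lam) ∧ y.ct.length ≤ t.eval lam)
    (2 * X + 4 * N + 4 + 2 * (T * (2 * V + 1)) + t) ?_ ?_ ?_ ?_).imp fun P h =>
      ⟨h.1, fun lam coin => ?_⟩
  rotate_right
  · have h' := congrArg (PMF.map Prod.fst) (h.2 lam _ (E.indOracle C lam coin) none)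
    rw [map_comp, PMF.pure_bind, map_comp] at h'; refine h'.trans (Eq.symm ?_)
    rw [coreExp, coreRun_eager fun p g => g && p.challenged]
    refine game_eq (R := fun p xa _ xb eb => (p.lam = lam ∧ p.q ≤ T.eval lam) ∧
      IndRel E D F p xa xb eb) (T := T.eval lam) ?_ ?_ (hA lam _ _ _) ?_
    · rintro k p xa ea xb eb x m ⟨⟨hl, hq⟩, hR⟩ hx hg
      refine lift_indProcs hlen (fun q hq msk hm x hx => h2 lam msk x (h1 lam q hq msk hm) hx)
        ?_ k p xa ea xb eb x m hl hq hR hx hg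
      exact Nat.lt_size_self _
    · exact ⟨⟨rfl, Nat.zero_le _⟩, {
        off := fun _ => ⟨rfl, rfl, rfl⟩
        blk := fun h => by cases h
        cdsk := fun h => by cases h
        vks := fun h => by cases h
        ct := fun h => by cases h
        st := fun h => by cases h
        mskA := fun h => by cases h
        mskB := fun h => by cases h }⟩
    · intro a b hab hp _; rw [comp_apply, hp, hab]; rfl
  · intro lam y hy; rw [support_pure, mem_singleton_iff] at hy; subst hy; simp
  · intro lam j p y k x S O u hl _ hy hx o ho
    refine indProcs_bounded F (h1 lam) (fun sk hsk => ?_) ?_ hl hx hy ho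
    · have := hp3 lam sk hsk; rw [hN]; simp; omega
    · intro msk cdsk x hm hc hx fsk hf m o ho
      have hf : fsk.length ≤ N.eval lam + t.eval lam := by
        rcases hf with hf | hf
        · have := (h2 lam msk x hm hx).2 fsk hf; omega
        · omega
      have hc : cdsk.length ≤ N.eval lam + t.eval lam := by omega
      rw [hV, eval_comp, eval_add, eval_add, eval_X]; rcases ho with ho | ho
      · exact hp5 lam cdsk _ m _ hc (by simpa [blank] using hf) o ho
      · exact hp5 lam cdsk _ m _ hc hf o ho
  · rintro lam j y ⟨h1, h2, h3, h4, h5, h6⟩; exact ⟨h1, h2, h3, h4.trans j.le_succ, h5, h6⟩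
  · rintro lam j ⟨K, msk, cdsk, vks, ct⟩ hj ⟨h1, h2, h3, h4, h5, h6⟩
    dsimp only at h1 h2 h3 h4 h5 h6; change (enc (K, msk, cdsk, vks, ct)).length ≤ _
    have h8 := length_enc_le (l := vks) h5
    have h9 := Nat.mul_le_mul_right (2 * V.eval lam + 1) (h4.trans hj)
    clear_value V t N
    simp only [length_enc_pair, enc_str]; simp; omega

/-! ### From the leasing experiment to the core game -/

/-- The index `j ∈ [n]` as a bit string, for `n` and `j` in binary. -/
def indexS (n j : Str) : Str :=
  (j ++ List.replicate (ofBits n).bits.length false).take (ofBits n).bits.length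

lemma testBit_ofBits (s : Str) : ∀ i, (ofBits s).testBit i = s.getD i false := by
  induction s with
  | nil => simp [ofBits]
  | cons b s ih =>
    intro i; rw [ofBits]
    cases i with
    | zero => cases b <;> simp
    | succ i =>
      rw [Nat.testBit_succ, List.getD_cons_succ, ← ih]; congr 1; cases b <;> simp <;> omega

lemma indexS_eq (n j : Str) : indexS n j = Construction.indexBits (ofBits n) (ofBits j) := by
  refine ext_getElem ?_ fun i h1 h2 => ?_
  · simp [indexS, Construction.indexBits, Nat.size_eq_bits_len]
  · simp only [Construction.indexBits, List.getElem_ofFn, testBit_ofBits, indexS, List.getElem_take]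
    rw [List.getD_eq_getElem?_getD]
    by_cases h : i < j.length
    · rw [List.getElem_append_left h, List.getElem?_eq_getElem h]; rfl
    · rw [List.getElem_append_right (not_lt.1 h), List.getElem_replicate,
        List.getElem?_eq_none (not_lt.1 h)]; rfl

lemma indexBits_inj {n j j' : ℕ} (hj : j ≤ n) (hj' : j' ≤ n) : Construction.indexBits n j =
    Construction.indexBits n j' ↔ j = j' := by
  refine ⟨fun h => Nat.eq_of_testBit_eq fun i => ?_, fun h => by rw [h]⟩
  by_cases hi : i < n.size
  · exact congrFun (List.ofFn_injective h) ⟨i, hi⟩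
  · have hn : n < 2 ^ i := (Nat.lt_size_self n).trans_le
      (Nat.pow_le_pow_right (by norm_num) (not_lt.1 hi))
    rw [Nat.testBit_lt_two_pow (hj.trans_lt hn), Nat.testBit_lt_two_pow (hj'.trans_lt hn)]

namespace PT

variable {α : Type} [Code α]

@[fun_prop] lemma indexS {n j : α → Str} (hn : PT n) (hj : PT j) : PT fun a => Skl.indexS (n a)
    (j a) := by
  have hl : PT fun a => (ofBits (n a)).bits.length := hn.bitsOf.lengthS
  exact takeS hl (hj.appendS (replicate hl false))

@[fun_prop] lemma itemAt {k : α → ℕ} {s : α → Str} (hk : PT k) (hs : PT s) : PT fun a => Skl.item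
    (k a) (s a) := by
  obtain ⟨q, hq⟩ := hs.size
  have key : ∀ (l s : Str), l.foldl (fun s _ => Skl.sndS s) s = Skl.sndS^[l.length] s := by
    intro l
    induction l with
    | nil => intro s; rfl
    | cons b l ih => intro s; rw [foldl_cons, ih]; rfl
  refine (foldlS (σ := Str) (f := fun _ s _ => Skl.sndS s) hk.unary hs fp q
    fun a l' h => ?_).fstS.of_enc_eq fun a => by rw [key, length_unary]; rfl
  refine le_trans ?_ (hq a); rw [key, enc_str, enc_str]; generalize l'.length = n
  induction n with
  | zero => exact le_rfl
  | succ n ih => rw [iterate_succ_apply']; exact (length_sndS_le _).trans ih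

end PT

/-- The private state of the reduction from the leasing experiment: the public part of the game,
the total number of indices and the challenge index in binary, the verification keys, and whether
the experiment has failed. -/
abbrev LeaseState := Pub × (Str × Str) × List (List Str) × Bool

section

variable (E D) {S : Type} (O : Oracle S) (t : ℕ) (s : LeaseState)

/-- Key generation at index `i + 1`. -/
def leaseKey (x : Str) (i : ℕ) : Act S (Str × Str × ℕ) :=
  cond (eqS (indexS s.2.1.1 (i + 1).bits) s.1.jb)
    (Act.call O 3 x t >>= fun r => pure ([], r.1.tail, r.2))
    (Act.call O 1 (indexS s.2.1.1 (i + 1).bits) t >>= fun r =>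
      lift (E.keyGen.dist ![unary s.1.lam, (starKeys E D s.1.lam s.1.q r.1.tail).1, x]) >>=
        fun fsk => Act.encrypt D s.1.lam (starKeys E D s.1.lam s.1.q r.1.tail).2 fsk)

/-- Verification of a part of a certificate for the key number `k`. -/
def leaseVrfyAt (cert : Str) (k i : ℕ) : Act S Str :=
  cond (eqS (indexS s.2.1.1 (i + 1).bits) s.1.jb)
    (Act.call O 4 (encList [unary k, item i cert]) 2 >>= fun r => pure [eqS r.1 [true, true]])
    (vrfyStep D s.1.lam ((s.2.2.1.getI k).getI i) (item i cert))

/-- Verification of a certificate for the key number `k`. -/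
def leaseVrfy (x : Str) (k : ℕ) : Act S ((Str × Bool) × Bool) :=
  cond (eqS (s.1.keys.getI k).1 (item 0 x))
    (Act.mapA (leaseVrfyAt D O s (item 1 x) k) (List.range (s.2.2.1.getI k).length) >>= fun r =>
      pure (((s.1.keys.getI k).1, (s.1.keys.getI k).2 || r.all fun c => eqS c [true]),
        r.all fun c => eqS c [true]))
    (pure (s.1.keys.getI k, false))

end

/-- The number of indices if it is at most `b`, otherwise `b + 1`. -/
def LeaseState.num (b : ℕ) (s : LeaseState) : ℕ := min (ofBits s.2.1.1) (b + 1)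

/-- The reduction from the leasing experiment, where the number of indices is at most `b` if keys
are generated. Answers in the core game are cut at length `t`. -/
def leaseHandlers (E : SKFE) (D : CDSKE) (C : FunctionClass) (b t : ℕ[X]) : Handlers LeaseState
  | 0, _, O, (s, x) =>
      cond (!s.1.on && (decide (ofBits [true] ≤ ofBits (item 2 x)) &&
          (decide (ofBits (item 2 x) ≤ ofBits (item 1 x)) &&
            (C.X s.1.lam (item 3 x) && C.X s.1.lam (item 4 x)))))
        (Act.call O 0 (encList [item 0 x, indexS (item 1 x) (item 2 x), item 3 x, item 4 x]) 0 >>=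
          fun _ => pure ([true], (s.1.update 0
            (encList [item 0 x, indexS (item 1 x) (item 2 x), item 3 x, item 4 x]) [],
              (item 1 x, item 2 x), s.2.2)))
        (pure ([], s))
  | 1, _, O, (s, x) =>
      cond (s.1.on && (!s.2.2.2 && (decide (ofBits [true] ≤ ofBits (item 0 x)) &&
          (decide (ofBits (item 0 x) ≤ ofBits s.2.1.1) && C.X s.1.lam (item 1 x)))))
        (cond (eqS (indexS s.2.1.1 (item 0 x)) s.1.jb)
          (Act.call O 2 (item 1 x) (t.eval s.1.lam) >>= fun r =>
            pure (true :: encList [(ofBits (item 0 x)).bits, fstS r.1.tail, sndS r.1.tail],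
              (s.1.update 2 [] [], s.2)))
          (Act.call O 1 (indexS s.2.1.1 (item 0 x)) (t.eval s.1.lam) >>= fun r =>
            lift (E.enc.dist ![unary s.1.lam, (starKeys E D s.1.lam s.1.q r.1.tail).1,
              item 1 x]) >>= fun ct => pure (true :: encList [(ofBits (item 0 x)).bits, ct,
                (starKeys E D s.1.lam s.1.q r.1.tail).2], s)))
        (pure ([], s))
  | 2, _, O, (s, x) =>
      cond (s.1.guard C 3 x && (!s.2.2.2 && ltN (s.num (b.eval s.1.lam)) (b.eval s.1.lam + 1)))
        (Act.mapA (leaseKey E D O (t.eval s.1.lam) s x) (List.range (s.num (b.eval s.1.lam))) >>=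
          fun o => pure (true :: encList (o.map fun c => pairS c.2.1 (unary c.2.2)),
            (s.1.update 3 x [], s.2.1, s.2.2.1 ++ [o.map fun c => c.1.take (t.eval s.1.lam)],
              s.2.2.2)))
        (pure ([], s))
  | 3, _, O, (s, x) =>
      cond (s.1.on && (!s.2.2.2 && ltN (s.num (b.eval s.1.lam)) (b.eval s.1.lam + 1)))
        (Act.mapA (leaseVrfy D O s x) (List.range s.1.keys.length) >>= fun o =>
          pure (bif o.any Prod.snd then [true] else [], ({ s.1 with keys := o.map Prod.fst }, s.2)))
        (pure ([], s))
  | 4, _, O, (s, _) =>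
      cond (s.1.on && (!s.2.2.2 && !s.1.challenged)) (cond (s.1.guard C 5 [])
          (Act.call O 5 [] (t.eval s.1.lam) >>= fun r =>
            pure (true :: encList [(ofBits s.2.1.2).bits, fstS r.1.tail, sndS r.1.tail],
              (s.1.update 5 [] [], s.2)))
          (pure ([], (s.1, s.2.1, s.2.2.1, true))))
        (pure ([], s))
  | _, _, _, (s, _) => pure ([], s)

namespace Impl

variable {α : Type} [Code α]

lemma leaseKey {t : ℕ[X]} : Impl fun _ O (a : (LeaseState × Str) × ℕ) => Skl.leaseKey E D O
    (t.eval a.1.1.1.lam) a.1.1 a.1.2 a.2 := by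
  unfold Skl.leaseKey
  refine cond fp (bind (call 3 fp fp) (pure fp)) (bind (call 1 fp fp) ?_)
  have hs : PT fun x : ((LeaseState × Str) × ℕ) × Str × ℕ =>
      starKeys E D x.1.1.1.1.lam x.1.1.1.1.q x.2.1.tail := PT.starKeys fp fp
    fp
  exact bind (skKeyGen fp hs.fst fp) (encrypt D fp (hs.comp (g := Prod.fst) fp).snd fp)

lemma leaseVrfy : Impl fun _ O (a : (LeaseState × Str) × ℕ) => Skl.leaseVrfy D O a.1.1 a.1.2 a.2
    := by
  have hk : PT fun a : (LeaseState × Str) × ℕ => a.1.1.1.keys.getI a.2 := PT.getI fp fp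
  have hv : PT fun a : (LeaseState × Str) × ℕ => a.1.1.2.2.1.getI a.2 := PT.getI fp fp
  unfold Skl.leaseVrfy; refine cond fp (bind (mapA (PT.range hv.length) ?_) (pure ?_)) (pure fp)
  · have hv' : PT fun a : ((LeaseState × Str) × ℕ) × ℕ =>
        (a.1.1.1.2.2.1.getI a.1.2).getI a.2 :=
      PT.getI fp (hv.comp (g := Prod.fst) fp)
    unfold Skl.leaseVrfyAt; refine cond fp (bind (call 4 ?_ fp) (pure fp)) ?_
    · simp only [encList]; fun_prop
    · exact vrfyStep fp hv' fp
  · have ha : PT fun x : ((LeaseState × Str) × ℕ) × List Str =>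
        x.2.all fun c => eqS c [true] := PT.all (f := fun _ c => eqS c [true]) fp fp
    have hk' : PT fun x : ((LeaseState × Str) × ℕ) × List Str =>
      x.1.1.1.1.keys.getI x.1.2 := hk.comp (g := Prod.fst) fp
    fun_prop

lemma leaseHandlers (C : FunctionClass) (b t : ℕ[X]) (k : ℕ) : Impl (Skl.leaseHandlers E D C b t k)
    := by
  have hnum : PT fun a : LeaseState × Str => a.1.num (b.eval a.1.1.lam) := by
    unfold LeaseState.num; fun_prop
  have hupd : ∀ (k : ℕ) {f : LeaseState × Str → Str}, PT f →
      PT fun a : LeaseState × Str => a.1.1.update k (f a) [] := fun k f hf =>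
    (PT.update k).comp (g := fun a : LeaseState × Str => (a.1.1, f a, [])) fp
  rcases k with _ | _ | _ | _ | _ | k
  · have he : PT fun a : LeaseState × Str => encList [item 0 a.2,
        indexS (item 1 a.2) (item 2 a.2), item 3 a.2, item 4 a.2] := by
      simp only [encList]; fun_prop
    have hu := (hupd 0 he).comp (g := fun a : (LeaseState × Str) × Str × ℕ => a.1) fp
    exact cond fp (bind (call 0 he fp) (pure fp)) (pure fp)
  · have hs : PT fun x : (LeaseState × Str) × Str × ℕ =>
        starKeys E D x.1.1.1.lam x.1.1.1.q x.2.1.tail := PT.starKeys fp fp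
      fp
    have hs' := hs.comp (g := fun x : ((LeaseState × Str) × Str × ℕ) × Str => x.1) fp
    refine cond fp (cond fp (bind (call 2 fp fp) (pure ?_)) (bind (call 1 fp fp) (bind (skEnc fp
        hs.fst fp) (pure ?_)))) (pure fp)
    · have hu := (hupd 2 (PT.const [])).comp (g := fun a : (LeaseState × Str) × Str × ℕ => a.1) fp
      simp only [encList]; fun_prop
    · exact ((PT.const true).consS (PT.pairS fp (PT.pairS fp
        (hs'.snd.pairS (PT.const []))))).pair fp
  · have hg : PT fun a : LeaseState × Str => a.1.1.guard C 3 a.2 :=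
      (PT.guard C 3).comp (g := fun a : LeaseState × Str => (a.1.1, a.2)) fp
    refine cond fp (bind (mapA (PT.range hnum) leaseKey) (pure ?_)) (pure fp)
    have hu := (hupd 3 (f := fun a => a.2) fp).comp
      (g := fun a : (LeaseState × Str) × List (Str × Str × ℕ) => a.1)
      fp
    have h1 : PT fun a : (LeaseState × Str) × List (Str × Str × ℕ) =>
        encList (a.2.map fun c => pairS c.2.1 (unary c.2.2)) :=
      (PT.map (l := fun a : (LeaseState × Str) × List (Str × Str × ℕ) => a.2)
        (f := fun _ c => pairS c.2.1 (unary c.2.2)) fp fp).of_enc_eq fun a => by simp [enc, map_map]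
    have h2 : PT fun a : (LeaseState × Str) × List (Str × Str × ℕ) =>
        a.2.map fun c => c.1.take (t.eval a.1.1.1.lam) :=
      PT.map (l := fun a : (LeaseState × Str) × List (Str × Str × ℕ) => a.2)
        (f := fun (a : (LeaseState × Str) × List (Str × Str × ℕ)) c =>
        c.1.take (t.eval a.1.1.1.lam)) fp fp
    have h3 : PT fun a : (LeaseState × Str) × List (Str × Str × ℕ) =>
        a.1.1.2.2.1 ++ [a.2.map fun c => c.1.take (t.eval a.1.1.1.lam)] :=
      PT.append fp (PT.cons h2 (PT.const _))
    fun_prop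
  · have hl : PT fun a : LeaseState × Str => a.1.1.keys.length := PT.length fp
    refine cond fp (bind (mapA (PT.range hl) leaseVrfy) (pure ?_)) (pure fp)
    have h1 : PT fun a : (LeaseState × Str) × List ((Str × Bool) × Bool) =>
      a.2.map Prod.fst := PT.map fp fp
    have h2 : PT fun a : (LeaseState × Str) × List ((Str × Bool) × Bool) =>
      a.2.any Prod.snd := PT.any
        (l := fun a : (LeaseState × Str) × List ((Str × Bool) × Bool) => a.2)
        (f := fun _ c => c.2) fp fp
    have h3 : PT fun a : (LeaseState × Str) × List ((Str × Bool) × Bool) =>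
        ({ a.1.1.1 with keys := a.2.map Prod.fst } : Pub) :=
      PT.pub fp fp fp fp fp fp h1 fp fp
    exact PT.pair fp (h3.pair fp)
  · have hg : PT fun a : LeaseState × Str => a.1.1.guard C 5 [] :=
      (PT.guard C 5).comp (g := fun a : LeaseState × Str => (a.1.1, [])) fp
    refine cond fp (cond hg (bind (call 5 fp fp) (pure ?_)) (pure fp)) (pure fp)
    have hu := (hupd 5 (PT.const [])).comp (g := fun a : (LeaseState × Str) × Str × ℕ => a.1) fp
    simp only [encList]; fun_prop
  · exact pure fp

end Impl

lemma lift_seqQ {α β γ S : Type} {g : α → QMem → PMF (β × QMem)} {g' : ℕ → Act S γ} {u : ℕ → α}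
    (J : List β → List γ → World S → Prop) {n : ℕ} (h : ∀ i < n, ∀ bs cs w, bs.length = i → J bs cs
    w → Lift (fun b o => J (bs ++ [b.1]) (cs ++ [o.1]) o.2 ∧ o.2.2.2 = b.2) (g (u i) w.2.2) (g' i
    w)) {w : World S} (hw : J [] [] w) : Lift
    (fun b o => b.1.length = n ∧ J b.1 o.1 o.2 ∧ o.2.2.2 = b.2)
    (seqQ g ((List.range n).map u) w.2.2) (Act.mapA g' (List.range n) w) := by
  have key : ∀ r k bs cs (w : World S), bs.length = k → k + r = n → J bs cs w →
      Lift (fun b o => (bs ++ b.1).length = n ∧ J (bs ++ b.1) (cs ++ o.1) o.2 ∧ o.2.2.2 = b.2)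
        (seqQ g ((List.range' k r).map u) w.2.2) (Act.mapA g' (List.range' k r) w) := by
    intro r
    induction r with
    | zero =>
      intro k bs cs w hk hn hJ; exact Lift.pure ⟨by simpa [hk] using hn, by simpa using hJ, rfl⟩
    | succ r ih =>
      intro k bs cs w hk hn hJ; rw [List.range'_succ, List.map_cons, seqQ, Act.mapA, bind_run]
      refine (h k (by omega) bs cs w hk hJ).bind fun b o hbo => ?_
      rw [bind_pure_run, ← hbo.2]
      refine Lift.map ((ih (k + 1) (bs ++ [b.1]) (cs ++ [o.1]) o.2 (by simp [hk]) (by omega)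
        hbo.1).mono ?_)
      rintro b' o' ⟨h1, h2, h3⟩; simp only [List.append_assoc, List.singleton_append] at h1 h2
      exact ⟨h1, h2, h3⟩
  simpa [List.range_eq_range'] using key n 0 [] [] w rfl (by simp) hw

lemma seqQ_classical {α β : Type} (g : α → PMF β) (m : QMem) : ∀ l : List α,
    seqQ (fun a m => (g a).map fun b => (b, m)) l m = (seqP g l).map fun o => (o, m)
  | [] => by rw [seqQ, seqP, pure_map]
  | a :: l => by
    simp only [seqQ, seqP, bind_map, PMF.map_bind, map_comp, Function.comp_def,
      seqQ_classical g m l]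

lemma call_game_run {S X : Type} {C : FunctionClass} {P : Procs S X} {k : ℕ} {p : Pub} {x : Str}
    (hg : p.guard C k x = true) (y : X) (e : S) (t : ℕ) (l : List ℕ) (m : QMem) : Act.call
    (game C P) k x t (l, ((p, y), e), m) = (P k p y x ([], e, m)).map fun o => (((true ::
    o.1.1).take t, (o.2.1.take t).length), (l ++ o.2.1.take t, ((p.update k x o.1.1, o.1.2),
    o.2.2.1), o.2.2.2)) := by
  rw [Act.call, game, answer]; dsimp only; rw [hg, cond_true, bind_pure_run, map_comp, map_comp]
  rfl

lemma lift_cond {S α β : Type} {Q : α → β × World S → Prop} {μ : PMF α} {c : Bool} {f g : Act S β}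
    {w : World S} (h1 : c = true → Lift Q μ (f w)) (h2 : c = false → Lift Q μ (g w)) : Lift Q μ
    ((cond c f g : Act S β) w) := by
  cases c
  · exact h2 rfl
  · exact h1 rfl

lemma lift_ite_cond {S α β : Type} {Q : α → β × World S → Prop} {μ ν : PMF α} {P : Prop}
    [Decidable P] {c : Bool} {f g : Act S β} {w : World S} (hc : c = true ↔ P)
    (h1 : P → Lift Q μ (f w)) (h2 : ¬P → Lift Q ν (g w)) : Lift Q (if P then μ else ν)
    ((cond c f g : Act S β) w) := by
  by_cases h : P
  · rw [if_pos h, hc.2 h]; exact h1 h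
  · rw [if_neg h, Bool.eq_false_iff.2 (mt hc.1 h)]; exact h2 h

/-- The key list `l'` has the same functions as `l`, and at least the same accepted certificates. -/
def KeyRel (l l' : List (Str × Bool)) : Prop :=
  l'.map Prod.fst = l.map Prod.fst ∧ ∀ i, (l.getI i).2 = true → (l'.getI i).2 = true

section

section

variable (lam : ℕ) (st : LessorState (scheme E D F))

/-- The public part of the core game that corresponds to a state of the leasing experiment. -/
def pubOf (keys : List (Str × Bool)) : Pub :=
  ⟨lam, true, st.q, st.x0, st.x1, indexBits st.n st.j, keys, st.usedJ, st.challenged⟩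

/-- The functions of the keys, and whether a certificate was accepted. -/
def keysOf : List (Str × Bool) := st.leased.map fun t => (t.f, t.returned)

def leaseOf (ns js : Str) : LeaseState :=
  (pubOf lam st (keysOf st), (ns, js),
    st.leased.map fun t => List.set (α := Str) t.vk (st.j - 1) [], st.failed)

/-- The coins of the keys for the index `j`. -/
def coinsAt (K : Str) (j : ℕ) : Str := F.eval K (indexBits st.n j) (blockLen E D lam st.q)

def secretsOf (K : Str) : Secrets :=
  ⟨fun x => F.eval K x (blockLen E D lam st.q), (starKeys E D lam st.q (coinsAt lam st K st.j)).1,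
    (starKeys E D lam st.q (coinsAt lam st K st.j)).2,
    st.leased.map fun t => List.getI (α := Str) t.vk (st.j - 1)⟩

/-- Invariants of the coupling of the leasing experiment and the core game. -/
structure LeaseInv (T : ℕ) (ns js K : Str) (keys : List (Str × Bool)) : Prop where
  n : ofBits ns = st.n
  j : ofBits js = st.j
  pos : 1 ≤ st.j
  le : st.j ≤ st.n
  q : st.q ≤ T
  x0 : st.x0.length ≤ T
  x1 : st.x1.length ≤ T
  msk : st.msk = (⟨st.q, st.n, K⟩ : MasterKey)
  vks : ∀ t ∈ st.leased, List.length (α := Str) t.vk = st.n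
  rel : KeyRel (keysOf st) keys

/-- The relation between the leasing experiment and the reduction in the core game. -/
def LeaseRel (T : ℕ) : Option (LessorState (scheme E D F)) →
    LeaseState × ((Pub × Secrets) × Unit) → Prop
  | none, e => e = ((Pub.init lam, ([], []), [], false), ((Pub.init lam, ⟨id, [], [], []⟩), ()))
  | some st, e => ∃ ns js K keys, LeaseInv st T ns js K keys ∧
      e = (leaseOf lam st ns js, ((pubOf lam st keys, secretsOf lam st K), ()))

/-- The relation between answers. -/
abbrev LeasePost (T : ℕ) (o : Reply × Option (LessorState (scheme E D F)) × QMem)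
    (o' : (Str × LeaseState) × World ((Pub × Secrets) × Unit)) : Prop :=
  o'.1.1 = o.1.1 ∧ o'.2.1 = o.1.2 ∧ o'.2.2.2 = o.2.2 ∧ LeaseRel lam T o.2.1 (o'.1.2, o'.2.2.1)

end

variable (E D) in
/-- The length `t` suffices for the answers of the core game. -/
structure LeaseBound (lam T t : ℕ) : Prop where
  block : ∀ q ≤ T, blockLen E D lam q + 1 ≤ t
  enc : ∀ q ≤ T, ∀ u, u.length ≤ blockLen E D lam q → ∀ x, x.length ≤ T →
    ∀ ct ∈ (E.enc.dist ![unary lam, (starKeys E D lam q u).1, x]).support,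
      2 * ct.length + (starKeys E D lam q u).2.length + 2 ≤ t
  key : ∀ q ≤ T, ∀ u, u.length ≤ blockLen E D lam q → ∀ x, x.length ≤ T → ∀ m,
    ∀ o ∈ (keyDist E D lam (starKeys E D lam q u).1 (starKeys E D lam q u).2 x false m).support,
      o.1.1.length ≤ t ∧ o.1.2.length + 1 ≤ t ∧ o.2.1.length ≤ t

variable {lam T : ℕ} {b t : ℕ[X]} {coin : Bool} {x ns js K : Str}
  {keys : List (Str × Bool)} {st : LessorState (scheme E D F)}

local notation "core" => game C (coreProcs (S := Unit) E D C (fun lam => sampler E D F lam false false) 0 coin)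

lemma eqS_indexS {n j j' : ℕ} {s s' : Str} (hs : ofBits s = n) (hs' : ofBits s' = j') (hj : j ≤ n)
    (hj' : j' ≤ n) : eqS (indexS s s') (indexBits n j) = decide (j' = j) := by
  rw [eqS, indexS_eq, hs, hs', decide_eq_decide]; exact indexBits_inj hj' hj

lemma sampler_false (q : ℕ) (jb : Str) : sampler E D F lam false false q jb = (uniformBits lam).map
    fun K => (fun x => F.eval K x (blockLen E D lam q), starKeys E D lam q (F.eval K jb (blockLen E
    D lam q))) := by
  rw [sampler, FunFamily.sample, if_neg Bool.false_ne_true, bind_map]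
  simp only [cond_false, pure_map, Function.comp_def]; rfl

lemma LeaseInv.enc (hst : LeaseInv st T ns js K keys) (j : ℕ) (y : Str) : (scheme E D F).enc lam
    st.msk j y = (E.enc.dist ![unary lam, (starKeys E D lam st.q (coinsAt lam st K j)).1, y]).map
    fun ct => encList [j.bits, ct, (starKeys E D lam st.q (coinsAt lam st K j)).2] := by
  rw [hst.msk]; rfl

lemma item_encList (a b c d : Str) : item 0 (encList [a, b, c, d]) = a ∧
    item 1 (encList [a, b, c, d]) = b ∧ item 2 (encList [a, b, c, d]) = c ∧
    item 3 (encList [a, b, c, d]) = d := by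
  simp [encList, item, fstS_pairS, sndS_pairS]

lemma lift_lease_zero (hx : x.length ≤ T) (m : QMem) : Lift (LeasePost lam T)
    (lessorOracle (scheme E D F) C b lam coin 0 x none m) (leaseHandlers E D C b t 0 _ core
    ((Pub.init lam, ([], []), [], false), x) ([], ((Pub.init lam, ⟨id, [], [], []⟩), ()), m)) := by
  have hone : ofBits [true] = 1 := rfl
  refine lift_ite_cond ?_ (fun h => ?_) fun _ => Lift.pure ⟨rfl, rfl, rfl, rfl⟩
  · simp [Pub.init, hone]
  · have hg : (Pub.init lam).guard C 0 (encList [item 0 x, indexS (item 1 x) (item 2 x), item 3 x,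
        item 4 x]) = true := by
      simp [Pub.guard, item_encList, Pub.init, h.2.2.1, h.2.2.2]
    rw [bind_pure_run, call_game_run hg, coreProcs_zero]; simp only [sampler_false, map_comp]
    refine (congrArg (Lift _ · _) (map_comp _ _ _)).mpr (Lift.map_same fun K _ =>
      ⟨rfl, take_nil, rfl, item 1 x, item 2 x, K, [], {
        n := rfl
        j := rfl
        pos := h.1
        le := h.2.1
        q := (Pub.length_item_le _ _).trans hx
        x0 := (Pub.length_item_le _ _).trans hx
        x1 := (Pub.length_item_le _ _).trans hx
        msk := rfl
        vks := fun t ht => by cases ht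
        rel := ⟨rfl, fun i h => h⟩ }, ?_⟩)
    simp only [Pub.update, item_encList, indexS_eq, comp_apply]; rfl

lemma take_pairS {n : ℕ} {s s' : Str} (h : 2 * s.length + s'.length + 2 ≤ n) :
    (true :: pairS s s').take n = true :: pairS s s' :=
  take_of_length_le (by rw [length_cons, length_pairS]; omega)

lemma lift_lease_one (hb : LeaseBound E D lam T (t.eval lam)) (hx : x.length ≤ T)
    (hst : LeaseInv st T ns js K keys) (m : QMem) : Lift (LeasePost lam T)
    (lessorOracle (scheme E D F) C b lam coin 1 x (some st) m) (leaseHandlers E D C b t 1 _ core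
    (leaseOf lam st ns js, x) ([], ((pubOf lam st keys, secretsOf lam st K), ()), m)) := by
  have hone : ofBits [true] = 1 := rfl
  refine lift_ite_cond ?_ (fun h => ?_) fun _ => Lift.pure
    ⟨rfl, rfl, rfl, ns, js, K, keys, hst, rfl⟩
  · simp [leaseOf, pubOf, hone, hst.n]
  have hy : (item 1 x).length ≤ T := (Pub.length_item_le _ _).trans hx
  have hstar : eqS (indexS ns (item 0 x)) (indexBits st.n st.j) =
    decide (ofBits (item 0 x) = st.j) := eqS_indexS hst.n rfl hst.le h.2.2.1
  have hcoins : ∀ j, (coinsAt lam st K j).length ≤ blockLen E D lam st.q :=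
    fun j => (F.length_eval _ _ _).le
  rw [hst.enc]
  refine (congrArg (Lift _ · _) (map_comp _ _ _)).mpr (lift_cond (fun hj => ?_) fun hj => ?_)
  · have hj : ofBits (item 0 x) = st.j := of_decide_eq_true (hstar.symm.trans hj)
    rw [bind_pure_run, call_game_run (by simpa [Pub.guard, pubOf] using h.2.2.2),
      coreProcs_two, map_comp, map_comp, hj]
    refine Lift.map_same fun ct hct => ?_
    have h1 := take_pairS (hb.enc st.q hst.q _ (hcoins st.j) _ hy ct hct)
    refine ⟨(congrArg (fun s : Str => true :: encList [st.j.bits, fstS s.tail,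
      sndS s.tail]) h1).trans ?_, take_nil, rfl, ns, js, K, keys, { hst with }, ?_⟩
    · rw [tail_cons, fstS_pairS, sndS_pairS]; rfl
    · rw [decide_eq_true rfl, Bool.or_true]; rfl
  · have hj' : decide (ofBits (item 0 x) = st.j) = false := hstar.symm.trans hj
    have hg : (pubOf lam st keys).guard C 1 (indexS ns (item 0 x)) = true := by
      have : (indexS ns (item 0 x)).length = (indexBits st.n st.j).length := by
        rw [indexS_eq, hst.n]; simp [indexBits]
      simp [Pub.guard, pubOf, hstar, hj', eqN, this]
    have h2 : (true :: coinsAt lam st K (ofBits (item 0 x))).take (t.eval lam) =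
      true :: coinsAt lam st K (ofBits (item 0 x)) := take_of_length_le (by
        have := hb.block st.q hst.q; have := hcoins (ofBits (item 0 x)); rw [length_cons]; omega)
    have h3 : (secretsOf lam st K).blk (indexS ns (item 0 x)) =
      coinsAt lam st K (ofBits (item 0 x)) := by rw [indexS_eq, hst.n]; rfl
    refine (congrArg (Lift _ _) (bind_run _ _ _)).mpr ?_
    refine (congrArg (fun μ => Lift _ _ (PMF.bind μ _)) (call_game_run hg _ _ _ _ _)).mpr ?_
    rw [coreProcs_one, pure_map, PMF.pure_bind]; dsimp only; rw [h3]
    refine (congrArg (Lift _ _) (lift_bind_run _ _ _)).mpr ?_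
    have h4 : (starKeys E D lam st.q ((true :: coinsAt lam st K (ofBits (item 0 x))).take
      (t.eval lam)).tail) = _ := congrArg (fun s => starKeys E D lam st.q (List.tail s)) h2
    rw [hj', Bool.or_false]
    refine (congrArg (fun k : Str × Str => Lift _ _ (PMF.map (fun ct => ((true ::
      encList [(ofBits (item 0 x)).bits, ct, k.2], _), _)) (E.enc.dist ![unary lam, k.1,
        item 1 x]))) h4).mpr (Lift.map_same fun ct _ => ?_)
    exact ⟨rfl, take_nil, rfl, ns, js, K, keys, hst, rfl⟩

lemma lift_lease_four (hb : LeaseBound E D lam T (t.eval lam)) (hst : LeaseInv st T ns js K keys)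
    (m : QMem) : Lift (LeasePost lam T) (lessorOracle (scheme E D F) C b lam coin 4 x (some st) m)
    (leaseHandlers E D C b t 4 _ core (leaseOf lam st ns js, x) ([], ((pubOf lam st keys, secretsOf
    lam st K), ()), m)) := by
  by_cases h : st.failed = true ∨ st.challenged = true
  · refine (congrArg (Lift _ · _) (if_pos h)).mpr (lift_cond (fun h' => ?_) fun _ => Lift.pure
      ⟨rfl, rfl, rfl, ns, js, K, keys, hst, rfl⟩)
    exfalso
    rcases h with h | h <;> simp [leaseOf, pubOf, h] at h'
  have hf : st.failed = false := by simpa using fun h' => h (Or.inl h')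
  have hc : st.challenged = false := by simpa using fun h' => h (Or.inr h')
  refine (congrArg (Lift _ · _) (if_neg h)).mpr (lift_cond (fun _ => ?_) fun h' => ?_)
  swap
  · simp [leaseOf, pubOf, hf, hc] at h'
  refine lift_ite_cond ?_ (fun h => ?_) fun _ => Lift.pure
    ⟨rfl, rfl, rfl, ns, js, K, keys, { hst with }, rfl⟩
  · simp [Pub.guard, leaseOf, pubOf, hc, keysOf, Pub.sep, eqS, imp_iff_not_or, or_comm]
  have hg : (pubOf lam st keys).guard C 5 [] = true := by
    have hall : ∀ e ∈ keys, (pubOf lam st keys).sep C e.1 = true → e.2 = true := by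
      intro e he hs; obtain ⟨i, hi, rfl⟩ := List.mem_iff_getElem.1 he
      have hi' : i < (keysOf st).length := by
        have := congrArg List.length hst.rel.1; simp only [length_map] at this; omega
      have h1 : keys[i].1 = (keysOf st)[i].1 := by
        have := List.getElem_of_eq hst.rel.1 (i := i) (by simpa using hi); simpa using this
      have h2 := hst.rel.2 i; rw [getI_eq_getElem _ hi, getI_eq_getElem _ hi'] at h2; refine h2 ?_
      rw [h1] at hs; have hl : i < st.leased.length := by simpa [keysOf] using hi'
      have h3 := h.2 _ (List.getElem_mem hl); simp only [keysOf, List.getElem_map] at hs ⊢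
      exact h3 (of_decide_eq_false ((Bool.not_eq_true' _).mp hs))
    simpa [Pub.guard, pubOf, hc, h.1, ← imp_iff_not_or] using fun a b => hall (a, b)
  rw [hst.enc]; refine (congrArg (Lift _ · _) (map_comp _ _ _)).mpr ?_
  rw [bind_pure_run, call_game_run hg, coreProcs_five, map_comp, map_comp]
  have hy : (bif coin then st.x1 else st.x0) = if coin then st.x1 else st.x0 := by
    cases coin <;> rfl
  refine (congrArg (fun y => Lift _ _ (PMF.map _ (E.enc.dist ![_, _, y]))) hy).mpr ?_
  refine Lift.map_same fun ct hct => ?_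
  have h1 := take_pairS (hb.enc st.q hst.q _ (F.length_eval _ _ _).le _ (by
    cases coin; exacts [hst.x0, hst.x1]) ct hct)
  refine ⟨(congrArg (fun s : Str => true :: encList [(ofBits js).bits, fstS s.tail,
    sndS s.tail]) h1).trans ?_, take_nil, rfl, ns, js, K, keys, { hst with }, ?_⟩
  · rw [tail_cons, fstS_pairS, sndS_pairS, hst.j]; rfl
  · rfl

lemma keyGenAt_eq (k : MasterKey) (f : Str) (j : ℕ) (m : QMem) : Construction.keyGenAt E D F lam k f
    j m = (keyDist E D lam (starKeys E D lam k.q (F.eval k.K (indexBits k.n j) (blockLen E D lam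
    k.q))).1 (starKeys E D lam k.q (F.eval k.K (indexBits k.n j) (blockLen E D lam k.q))).2 f false
    m).map fun o => ((o.1.1, (o.1.2, o.2.1)), o.2.2) := by
  rw [keyDist, PMF.map_bind]; simp only [map_comp]
  exact congrArg _ (funext fun fsk => (PMF.map_id _).symm)

lemma keyGen_encrypt_run {S : Type} (msk cdsk f : Str) (w : World S) : (lift (E.keyGen.dist ![unary
    lam, msk, f]) >>= fun fsk => Act.encrypt D lam cdsk fsk) w =
    (keyDist E D lam msk cdsk f false w.2.2).map fun o =>
    ((o.1.1, o.1.2, o.2.1.length), (w.1 ++ o.2.1, w.2.1, o.2.2)) := by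
  rw [bind_run, lift, bind_map, keyDist, PMF.map_bind]; simp only [map_comp]; rfl

lemma set_append_singleton_of_length_eq {α : Type} (l : List α) (a c : α) {i : ℕ} (h : l.length = i)
    : l.set i c ++ [c] = (l ++ [a]).set i c := by
  subst h; rw [List.set_append_right _ _ le_rfl, List.set_eq_of_length_le le_rfl]; simp

lemma set_append_singleton_of_length_ne {α : Type} (l : List α) (a c : α) {i : ℕ} (h : l.length ≠ i)
    : l.set i c ++ [a] = (l ++ [a]).set i c := by
  rcases lt_or_ge i l.length with hi | hi
  · rw [List.set_append_left _ _ hi]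
  · rw [List.set_append_right _ _ hi, List.set_eq_of_length_le hi,
      List.set_eq_of_length_le (by simp; omega)]

lemma getI_append_singleton {α : Type} [Inhabited α] (l : List α) (a : α) {i : ℕ} (h : l.length = i)
    : (l ++ [a]).getI i = a := by
  subst h; rw [getI_eq_getElem _ (by simp)]; simp

/-- The coupling of the generation of a leased key. -/
structure KeysInv (t : ℕ) (x : Str) (p : Pub) (s : Secrets) (j : ℕ)
    (bs : List (Str × CDCt)) (cs : List (Str × Str × ℕ))
    (w : World ((Pub × Secrets) × Unit)) : Prop where
  cts : cs.map (fun c => c.2) = bs.map fun b => (b.2.1, b.2.2.length)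
  vks : cs.map (fun c => c.1.take t) = (bs.map Prod.fst).set (j - 1) []
  qubits : w.1 = bs.flatMap fun b => b.2.2
  env : w.2.1 = if j ≤ bs.length then
    ((p.update 3 x [], { s with vks := s.vks ++ [(bs.map Prod.fst).getI (j - 1)] }), ()) else
    ((p, s), ())

lemma lift_leaseKeys (hb : LeaseBound E D lam T (t.eval lam)) (hx : x.length ≤ T) {k : MasterKey}
    (hk : k.q ≤ T) {j : ℕ} (hj1 : 1 ≤ j) (hj : j ≤ k.n) {s0 : LeaseState}
    (h1 : ofBits s0.2.1.1 = k.n) (h2 : s0.1.lam = lam) (h3 : s0.1.q = k.q)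
    (h4 : s0.1.jb = indexBits k.n j) {p : Pub} (hg : p.guard C 3 x = true) (hl : p.lam = lam)
    (hjb : p.jb = indexBits k.n j) {s : Secrets}
    (hblk : ∀ y, s.blk y = F.eval k.K y (blockLen E D lam k.q)) (hs : (s.msk, s.cdsk) = starKeys E D
    lam k.q (F.eval k.K (indexBits k.n j) (blockLen E D lam k.q))) (m : QMem) : Lift (fun b o =>
    b.1.length = k.n ∧ KeysInv (t.eval lam) x p s j b.1 o.1 o.2 ∧ o.2.2.2 = b.2) (seqQ
    (Construction.keyGenAt E D F lam k x) (Construction.indices k.n) m) (Act.mapA (leaseKey E D core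
    (t.eval lam) s0 x) (List.range k.n) ([], ((p, s), ()), m)) := by
  have hind : Construction.indices k.n = (List.range k.n).map fun i => i + 1 := by
    rw [Construction.indices, List.range'_eq_map_range]; simp only [add_comm]
  rw [hind]
  refine lift_seqQ (KeysInv (t.eval lam) x p s j) (w := ([], ((p, s), ()), m)) ?_ ⟨rfl, rfl, rfl,
    by rw [if_neg (by simp; omega)]⟩
  rintro i hi bs cs ⟨l, e, m⟩ hbs ⟨g1, g2, g3, g4⟩; dsimp only at g3 g4; subst g3
  have hlen : ∀ j, (F.eval k.K (indexBits k.n j) (blockLen E D lam k.q)).length ≤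
    blockLen E D lam k.q := fun j => (F.length_eval _ _ _).le
  rw [keyGenAt_eq, leaseKey, h4, eqS_indexS h1 (ofBits_bits _) hj (by omega)]
  by_cases hij : i + 1 = j
  · rw [if_neg (by omega)] at g4; subst g4
    rw [decide_eq_true hij, cond_true, bind_pure_run, call_game_run hg, coreProcs_three, ltN_zero,
      Bool.and_false, map_comp, map_comp, hl, hij, ← hs]
    refine Lift.map_same fun o ho => ?_
    obtain ⟨b1, b2, b3⟩ := hb.key _ hk _ (hlen j) _ hx _ o (hs ▸ ho)
    have ht : (true :: o.1.2).take (t.eval lam) = true :: o.1.2 :=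
      take_of_length_le (by rw [length_cons]; omega)
    have hq : o.2.1.take (t.eval lam) = o.2.1 := take_of_length_le b3
    refine ⟨⟨?_, ?_, ?_, ?_⟩, rfl⟩
    · simp [g1, ht, b3]
    · simp only [map_append, List.map_cons, List.map_nil, g2, take_nil, comp_apply]
      exact set_append_singleton_of_length_eq _ _ _ (by simp; omega)
    · simp [hq]
    · rw [if_pos (by simp; omega), map_append, List.map_singleton,
        getI_append_singleton _ _ (by simp; omega)]
      rfl
  · rw [decide_eq_false hij, cond_false]
    have hgen : ∀ p' s', p'.lam = lam → p'.on = true → p'.jb = indexBits k.n j →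
        (∀ y, s'.blk y = F.eval k.K y (blockLen E D lam k.q)) → e = ((p', s'), ()) →
        Lift (fun b o => KeysInv (t.eval lam) x p s j (bs ++ [b.1]) (cs ++ [o.1]) o.2 ∧
            o.2.2.2 = b.2)
          ((keyDist E D lam (starKeys E D lam k.q (F.eval k.K (indexBits k.n (i + 1))
            (blockLen E D lam k.q))).1 (starKeys E D lam k.q (F.eval k.K (indexBits k.n (i + 1))
            (blockLen E D lam k.q))).2 x false m).map fun o => ((o.1.1, (o.1.2, o.2.1)), o.2.2))
          ((Act.call core 1 (indexS s0.2.1.1 (i + 1).bits) (t.eval lam) >>= fun r =>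
            lift (E.keyGen.dist ![unary s0.1.lam, (starKeys E D s0.1.lam s0.1.q
              r.1.tail).1, x]) >>= fun fsk => Act.encrypt D s0.1.lam (starKeys E D s0.1.lam
                s0.1.q r.1.tail).2 fsk) (bs.flatMap fun b => b.2.2, e, m)) := by
      rintro p' s' hl' hon hjb' hblk' rfl
      have hi1 : indexS s0.2.1.1 (i + 1).bits = indexBits k.n (i + 1) := by
        rw [indexS_eq, h1, ofBits_bits]
      have hg1 : p'.guard C 1 (indexS s0.2.1.1 (i + 1).bits) = true := by
        have : indexBits k.n (i + 1) ≠ indexBits k.n j := mt (indexBits_inj (by omega) hj).1 hij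
        have h5 : (indexBits k.n (i + 1)).length = (indexBits k.n j).length := by simp [indexBits]
        simp [Pub.guard, hon, hjb', hi1, eqN, eqS, this, h5]
      have ht : (true :: F.eval k.K (indexBits k.n (i + 1)) (blockLen E D lam k.q)).take
          (t.eval lam) = true :: F.eval k.K (indexBits k.n (i + 1)) (blockLen E D lam k.q) :=
        take_of_length_le (by have := hb.block _ hk; have := hlen (i + 1); rw [length_cons]; omega)
      rw [bind_run, call_game_run hg1, coreProcs_one, pure_map, PMF.pure_bind]; dsimp only
      rw [hblk', hi1, ht, h2, h3, tail_cons, keyGen_encrypt_run]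
      refine Lift.map_same fun o ho => ?_
      obtain ⟨b1, b2, b3⟩ := hb.key _ hk _ (hlen (i + 1)) _ hx _ o ho
      refine ⟨⟨?_, ?_, ?_, ?_⟩, rfl⟩
      · simp [g1]
      · simp only [map_append, List.map_cons, List.map_nil, g2, take_of_length_le b1]
        exact set_append_singleton_of_length_ne _ _ _ (by simp; omega)
      · simp
      · refine (show _ = ((p', s'), ()) from rfl).trans (g4.trans ?_)
        by_cases hle : j ≤ bs.length
        · rw [if_pos hle, if_pos (by simp; omega), map_append, getI_append _ _ _ (by simp; omega)]
        · rw [if_neg hle, if_neg (by simp; omega)]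
    have hon := Pub.on_of_guard hg; dsimp only; split_ifs at g4
    · exact hgen (p.update 3 x [])
        { s with vks := s.vks ++ [(bs.map Prod.fst).getI (j - 1)] } hl hon hjb hblk g4
    · exact hgen _ _ hl hon hjb hblk g4

lemma KeyRel.length_eq {l l' : List (Str × Bool)} (h : KeyRel l l') : l'.length = l.length := by
  simpa using congrArg List.length h.1

lemma KeyRel.append {l l' : List (Str × Bool)} (h : KeyRel l l') (e : Str × Bool) : KeyRel
    (l ++ [e]) (l' ++ [e]) := by
  refine ⟨by simp [h.1], fun i hi => ?_⟩; rcases lt_trichotomy i l.length with h' | h' | h'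
  · rw [getI_append _ _ _ h'] at hi; rw [getI_append _ _ _ (h'.trans_eq h.length_eq.symm)]
    exact h.2 i hi
  · rw [getI_append_singleton _ _ h'.symm] at hi
    rwa [getI_append_singleton _ _ (h.length_eq.trans h'.symm)]
  · rw [List.getI_eq_default _ (by simp; omega)] at hi; cases hi

lemma lift_lease_two (hb : LeaseBound E D lam T (t.eval lam)) (hx : x.length ≤ T)
    (hst : LeaseInv st T ns js K keys) (m : QMem) : Lift (LeasePost lam T)
    (lessorOracle (scheme E D F) C b lam coin 2 x (some st) m) (leaseHandlers E D C b t 2 _ core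
    (leaseOf lam st ns js, x) ([], ((pubOf lam st keys, secretsOf lam st K), ()), m)) := by
  have hlen : keys.length = st.leased.length := by simpa [keysOf] using hst.rel.length_eq
  refine lift_ite_cond ?_ (fun h => ?_) fun _ => Lift.pure
    ⟨rfl, rfl, rfl, ns, js, K, keys, hst, rfl⟩
  · simp [Pub.guard, leaseOf, pubOf, LeaseState.num, hst.n, ltN, keysOf, Pub.sep, eqS,
      imp_iff_not_or]
    tauto
  have hg : (pubOf lam st keys).guard C 3 x = true := by
    have h5 := h.2.2.2.2; rw [imp_iff_not_or] at h5
    simpa [Pub.guard, pubOf, ltN, hlen, Pub.sep, eqS, h.2.2.1, h.2.2.2.1] using h5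
  have hnum : (leaseOf lam st ns js).num (b.eval lam) = st.n := by
    rw [LeaseState.num]; refine (congrArg (fun i => min i _) hst.n).trans (min_eq_left ?_)
    have := h.2.1; omega
  refine (congrArg (fun k => Lift _ (PMF.map _ ((scheme E D F).keyGen lam k x m)) _) hst.msk).mpr ?_
  refine (congrArg (Lift _ · _) (map_comp _ _ _)).mpr ?_; rw [bind_pure_run]
  refine (congrArg (fun i => Lift _ _ (PMF.map _ (Act.mapA _ (List.range i) _))) hnum).mpr ?_
  refine Lift.map ((lift_leaseKeys hb hx (k := ⟨st.q, st.n, K⟩) hst.q hst.pos hst.le hst.n rfl rfl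
    rfl hg rfl rfl (fun _ => rfl) rfl m).mono ?_)
  rintro o o' ⟨h1, ⟨h2, h3, h4, h5⟩, h6⟩; have h5' := h5.trans (if_pos (hst.le.trans_eq h1.symm))
  have hcts : o'.1.map (fun c => pairS c.2.1 (unary c.2.2)) =
      (o.1.map Prod.snd).map fun ct => pairS ct.1 (unary ct.2.length) := by
    have := congrArg (List.map fun c : Str × ℕ => pairS c.1 (unary c.2)) h2
    simp only [map_map] at this ⊢; exact this
  have hvks : ∀ {β : Type} (g : List Str → β), List.map (fun t => g t.vk) (st.leased ++
      [⟨x, (o.1.map Prod.fst : List Str), false⟩]) =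
        st.leased.map (fun t => g t.vk) ++ [g (o.1.map Prod.fst)] := fun g => map_append
  have hkeys : List.map (fun t => (t.f, t.returned)) (st.leased ++
      [⟨x, (o.1.map Prod.fst : List Str), false⟩]) = keysOf st ++ [(x, false)] :=
    map_append
  refine ⟨congrArg (fun l => true :: encList l) hcts, h4.trans (List.flatMap_map ..).symm, h6, ns,
    js, K, keys ++ [(x, false)], { hst with
      vks := fun e he => ?_
      rel := ?_ }, ?_⟩
  · rcases List.mem_append.1 he with he | he
    · exact hst.vks e he
    · rw [List.mem_singleton.1 he]; exact (length_map _).trans h1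
  · exact (congrArg (KeyRel · _) hkeys).mpr (hst.rel.append _)
  · refine Prod.ext (Prod.ext ?_ (Prod.ext rfl (Prod.ext ?_ rfl))) (h5'.trans ?_)
    · exact congrArg (pubOf lam st) hkeys.symm
    · refine (congrArg (_ ++ [·]) h3).trans ?_; exact (hvks fun vk => vk.set (st.j - 1) []).symm
    · refine congrArg (fun l => ((_, (⟨_, _, _, l⟩ : Secrets)), ())) ?_
      exact (hvks fun vk => vk.getI (st.j - 1)).symm

lemma KeyRel.refl (l : List (Str × Bool)) : KeyRel l l := ⟨rfl, fun _ => id⟩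

lemma KeyRel.trans {l l' l'' : List (Str × Bool)} (h : KeyRel l l') (h' : KeyRel l' l'') :
    KeyRel l l'' := ⟨h'.1.trans h.1, fun i hi => h'.2 i (h.2 i hi)⟩

lemma item_zero_encList (a : Str) (l : List Str) : item 0 (encList (a :: l)) = a := by
  simp [encList, item, fstS_pairS]

lemma item_one_encList (a a' : Str) (l : List Str) : item 1 (encList (a :: a' :: l)) = a' := by
  simp [encList, item, fstS_pairS, sndS_pairS]

lemma getI_snd_update_four (p : Pub) (x r : Str) {i : ℕ} (hi : i < p.keys.length) :
    ((p.update 4 x r).keys.getI i).2 =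
    ((p.keys.getI i).2 || (eqN i (item 0 x).length && eqS r [true])) := by
  rw [List.getI_eq_getElem?_getD, Pub.getElem?_update_four, List.getElem?_eq_getElem hi,
    getI_eq_getElem _ hi]
  rfl

lemma keyRel_update_four (p : Pub) (x r : Str) : KeyRel p.keys (p.update 4 x r).keys := by
  refine ⟨?_, fun i hi => ?_⟩
  · refine List.ext_getElem? fun i => ?_
    rw [List.getElem?_map, Pub.getElem?_update_four, List.getElem?_map, Option.map_map]; rfl
  · rcases lt_or_ge i p.keys.length with h | h
    · rw [getI_snd_update_four _ _ _ h, hi, Bool.true_or]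
    · rw [List.getI_eq_default _ h] at hi; cases hi

lemma zip_range_eq {α : Type} [Inhabited α] (l : List α) : (List.range l.length).zip l =
    (List.range l.length).map fun i => (i, l.getI i) := by
  refine ext_getElem (by simp) fun i h1 h2 => ?_
  have : i < l.length := by simpa using h1
  simp [getI_eq_getElem, this]

lemma getI_set_ne {α : Type} [Inhabited α] (l : List α) (a : α) {i j : ℕ} (h : i ≠ j) :
    (l.set i a).getI j = l.getI j := by
  rw [List.getI_eq_getElem?_getD, List.getI_eq_getElem?_getD, List.getElem?_set_ne h]

/-- The coupling of the verification of a certificate for the key number `k`. -/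
structure VrfyInv (p : Pub) (s : Secrets) (keys : List (Str × Bool)) (k j : ℕ)
    (bs : Str) (cs : List Str) (w : World ((Pub × Secrets) × Unit)) : Prop where
  ok : cs = bs.map fun b => [b]
  qubits : w.1 = []
  env : ∃ keys', w.2.1 = (({ p with keys := keys' }, s), ()) ∧ KeyRel keys keys' ∧
    (j - 1 < bs.length → bs.getI (j - 1) = true → (keys'.getI k).2 = true)

lemma lift_leaseVrfyAt {p : Pub} {s : Secrets} {s0 : LeaseState} {n j k : ℕ} (hj1 : 1 ≤ j)
    (hj : j ≤ n) (h1 : ofBits s0.2.1.1 = n) (h2 : s0.1.lam = lam) (hl : p.lam = lam)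
    (hon : p.on = true) (h4 : s0.1.jb = indexBits n j) {vk : List Str}
    (hvk : vk.length = n) (hk0 : s0.2.2.1.getI k = vk.set (j - 1) [])
    (hks : s.vks.getI k = vk.getI (j - 1)) (hk : k < keys.length) (cert : Str) (m : QMem) :
    Lift (fun ok o => (∃ bs, bs.length = n ∧ VrfyInv p s keys k j bs o.1 o.2 ∧
        ok = bs.all id) ∧ o.2.2.2 = m)
      ((scheme E D F).vrfy lam (vk : List Str) cert)
      (Act.mapA (leaseVrfyAt D core s0 cert k) (List.range n)
        ([], (({ p with keys := keys }, s), ()), m)) := by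
  subst hl
  have hmain : Lift (fun b o => b.1.length = n ∧ VrfyInv p s keys k j b.1 o.1 o.2 ∧ o.2.2.2 = b.2)
      (seqQ (fun (i : ℕ × Str) m => (D.vrfyDist p.lam i.2 (item i.1 cert)).map fun b => (b, m))
        ((List.range n).map fun i => (i, vk.getI i)) m)
      (Act.mapA (leaseVrfyAt D core s0 cert k) (List.range n)
        ([], (({ p with keys := keys }, s), ()), m)) := by
    refine lift_seqQ (VrfyInv p s keys k j) (w := ([], (({ p with keys := keys }, s), ()), m)) ?_
      ⟨rfl, rfl, keys, rfl, KeyRel.refl _, fun h => by cases h⟩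
    rintro i hi bs cs ⟨l, e, m⟩ hbs ⟨g1, g2, keys', g3, g4, g5⟩; dsimp only at g2 g3; subst g2 g3
    rw [leaseVrfyAt, h4, eqS_indexS h1 (ofBits_bits _) hj (by omega)]
    have hk' : k < keys'.length := hk.trans_eq g4.length_eq.symm
    by_cases hij : i + 1 = j
    · have hg : Pub.guard C 4 { p with keys := keys' } (encList [unary k, item i cert]) = true := by
        simpa [Pub.guard, hon, ltN, item_zero_encList, length_unary] using hk'
      rw [decide_eq_true hij, cond_true, bind_pure_run, call_game_run hg, coreProcs_four,
        map_comp, map_comp, item_zero_encList, item_one_encList, length_unary, hks,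
        ← hij, Nat.add_sub_cancel]
      refine Lift.map_same fun o ho => ⟨⟨?_, ?_, _, rfl, g4.trans (keyRel_update_four
        { p with keys := keys' } (encList [unary k, item i cert]) [o]), fun _ h => ?_⟩, rfl⟩
      · rw [g1, map_append]; cases o <;> rfl
      · rfl
      · rw [getI_append_singleton _ _ (by omega)] at h; subst h
        refine (getI_snd_update_four { p with keys := keys' } (encList [unary k, item i cert])
          [true] hk').trans ?_
        simp [eqN, eqS, item_zero_encList, length_unary]
    · have hne : j - 1 ≠ i := by omega
      rw [decide_eq_false hij, cond_false, vrfyStep_run, hk0, getI_set_ne _ _ hne, h2]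
      refine Lift.map_same fun o ho => ⟨⟨?_, rfl, keys', rfl, g4, fun h1 h2 => ?_⟩, rfl⟩
      · rw [g1, map_append]; rfl
      · have h3 : j - 1 < bs.length := by simp at h1; omega
        rw [getI_append _ _ _ h3] at h2; exact g5 h3 h2
  rw [seqQ_classical] at hmain
  have := (Lift.map (f := fun b : Str × QMem => b.1.all id) (g := id)
    (Q := fun ok o => (∃ bs, bs.length = n ∧ VrfyInv p s keys k j bs o.1 o.2 ∧
        ok = bs.all id) ∧ o.2.2.2 = m) (hmain.mem.mono ?_))
  · rw [PMF.map_id, map_comp] at this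
    refine (congrArg (fun l => Lift _ (PMF.map _ (seqP _ l)) _) ?_).mpr this
    refine (zip_range_eq vk).trans ?_; rw [hvk]
  · rintro o o' ⟨⟨h1, h2, h3⟩, h4, -⟩; obtain ⟨c, -, rfl⟩ := (mem_support_map_iff _ _ _).1 h4
    exact ⟨⟨_, h1, h2, rfl⟩, h3⟩

/-- The coupling of the verification of a certificate for all keys. -/
structure LeaseVrfyInv (l : List (Entry (List Str))) (p : Pub) (s : Secrets)
    (keys : List (Str × Bool)) (bs : List (Entry (List Str) × Bool))
    (cs : List ((Str × Bool) × Bool)) (w : World ((Pub × Secrets) × Unit)) : Prop where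
  entries : bs.map (fun o => (o.1.f, o.1.vk)) = (l.take bs.length).map fun e => (e.f, e.vk)
  results : cs = bs.map fun o => ((o.1.f, o.1.returned), o.2)
  qubits : w.1 = []
  env : ∃ keys', w.2.1 = (({ p with keys := keys' }, s), ()) ∧ KeyRel keys keys' ∧
    ∀ i (h : i < bs.length), bs[i].1.returned = true → (keys'.getI i).2 = true

lemma lift_leaseVrfy {l : List (Entry (List Str))} {p : Pub} {s : Secrets}
    {s0 : LeaseState} {n j : ℕ} (hj1 : 1 ≤ j)
    (hj : j ≤ n) (h1 : ofBits s0.2.1.1 = n) (h2 : s0.1.lam = lam) (hl : p.lam = lam)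
    (hon : p.on = true) (h4 : s0.1.jb = indexBits n j) (hvk : ∀ e ∈ l, e.vk.length = n)
    (hkeys : s0.1.keys = l.map fun e => (e.f, e.returned))
    (hvks : s0.2.2.1 = l.map fun e => e.vk.set (j - 1) [])
    (hs : s.vks = l.map fun e => e.vk.getI (j - 1))
    (hrel : KeyRel s0.1.keys keys) (x : Str) (m : QMem) :
    Lift (fun b o => b.length = l.length ∧ LeaseVrfyInv l p s keys b o.1 o.2 ∧ o.2.2.2 = m)
      (seqP (fun e : Entry (List Str) => if e.f = item 0 x then
        ((scheme E D F).vrfy lam e.vk (item 1 x)).map fun ok =>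
          (({ e with returned := e.returned || ok } : Entry (List Str)), ok)
        else PMF.pure (e, false)) l)
      (Act.mapA (leaseVrfy D core s0 x) (List.range l.length)
        ([], (({ p with keys := keys }, s), ()), m)) := by
  have hl' : l = (List.range l.length).map fun i => l.getD i ⟨[], [], false⟩ := by
    refine ext_getElem (by simp) fun i h1 h2 => ?_
    simp [h1]
  have hmain : Lift (fun b o => b.1.length = l.length ∧ LeaseVrfyInv l p s keys b.1 o.1 o.2 ∧
        o.2.2.2 = b.2)
      (seqQ (fun (e : Entry (List Str)) m => (if e.f = item 0 x then
        ((scheme E D F).vrfy lam e.vk (item 1 x)).map fun ok =>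
          (({ e with returned := e.returned || ok } : Entry (List Str)), ok)
        else PMF.pure (e, false)).map fun b => (b, m))
        ((List.range l.length).map fun i => l.getD i ⟨[], [], false⟩) m)
      (Act.mapA (leaseVrfy D core s0 x) (List.range l.length)
        ([], (({ p with keys := keys }, s), ()), m)) := by
    refine lift_seqQ (LeaseVrfyInv l p s keys) (w := ([], (({ p with keys := keys }, s), ()), m)) ?_
      ⟨by simp, rfl, rfl, keys, rfl, KeyRel.refl _, fun i h => by cases h⟩
    rintro i hi bs cs ⟨q, e, m⟩ hbs ⟨g1, g2, g3, keys', g4, g5, g6⟩; dsimp only at g3 g4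
    subst g3 g4
    have hki : s0.1.keys.getI i = (l[i].f, l[i].returned) := by
      rw [hkeys, getI_eq_getElem _ (by simpa using hi), List.getElem_map]
    have hrel' := hrel.trans g5
    have hpost : ∀ (ok : Bool) keys'', KeyRel keys' keys'' →
        (ok = true → (keys''.getI i).2 = true) →
        LeaseVrfyInv l p s keys (bs ++ [(({ l[i] with returned := l[i].returned || ok } :
          Entry (List Str)), ok)]) (cs ++ [((l[i].f, l[i].returned || ok), ok)])
          ([], (({ p with keys := keys'' }, s), ()), m) := by
      refine fun ok keys'' h5 h6 => ⟨?_, ?_, rfl, keys'', rfl, g5.trans h5, fun i' hi' h' => ?_⟩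
      · subst hbs
        rw [map_append, g1, length_append, length_singleton,
          List.take_succ_eq_append_getElem hi, map_append]
        rfl
      · simp [g2]
      · rcases lt_or_ge i' bs.length with h'' | h''
        · rw [List.getElem_append_left h''] at h'; exact h5.2 _ (g6 i' h'' h')
        · have hi'' : i' = i := by simp at hi'; omega
          rw [List.getElem_append_right h''] at h'
          simp only [List.getElem_singleton, Bool.or_eq_true] at h'; subst hi''
          refine h'.elim (fun h' => h5.2 _ (hrel'.2 _ ?_)) h6; rw [hki]; exact h'
    rw [List.getD_eq_getElem _ _ hi, leaseVrfy, hki]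
    by_cases hf : l[i].f = item 0 x
    · have hvki : s0.2.2.1.getI i = l[i].vk.set (j - 1) [] := by
        rw [hvks, getI_eq_getElem _ (by simpa using hi), List.getElem_map]
      have hlen := hvk _ (List.getElem_mem hi)
      rw [if_pos hf, map_comp, eqS, decide_eq_true hf, cond_true, bind_pure_run, hvki,
        List.length_set, hlen]
      refine Lift.map ((lift_leaseVrfyAt hj1 hj h1 h2 hl hon h4 hlen hvki ?_ ?_ (item 1 x)
        m).mono ?_)
      · rw [hs, getI_eq_getElem _ (by simpa using hi), List.getElem_map]
      · have := congrArg List.length hkeys; have h' := hrel'.length_eq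
        simp only [length_map] at this; omega
      · rintro ok ⟨cs', w⟩ ⟨⟨bs', c1, ⟨c2, c3, keys'', c4, c5, c6⟩, rfl⟩, c7⟩
        obtain ⟨w1, w2, w3⟩ := w; dsimp only at c2 c3 c4 c7; subst c2 c3 c4 c7
        have hall : ((bs'.map fun b => [b]).all fun c => eqS c [true]) = bs'.all id := by
          rw [List.all_map]; congr 1
          funext c
          cases c <;> rfl
        refine ⟨?_, rfl⟩; dsimp only; rw [hall]; refine hpost _ _ c5 fun h => c6 (by omega) ?_
        rw [getI_eq_getElem _ (by omega)]; exact List.all_eq_true.1 h _ (List.getElem_mem _)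
    · rw [if_neg hf, pure_map, eqS, decide_eq_false hf, cond_false]; refine Lift.pure ⟨?_, rfl⟩
      have := hpost false keys' (KeyRel.refl _) (fun h => by cases h); simpa using this
  rw [seqQ_classical, ← hl'] at hmain
  have := Lift.map (f := fun b : List (Entry (List Str) × Bool) × QMem => b.1)
    (g := id) (Q := fun b o => b.length = l.length ∧ LeaseVrfyInv l p s keys b o.1 o.2 ∧
      o.2.2.2 = m) (hmain.mem.mono ?_)
  · rw [PMF.map_id, map_comp] at this; exact (congrArg (Lift _ · _) (PMF.map_id _)).mp this
  · rintro o o' ⟨⟨h1, h2, h3⟩, h4, -⟩; obtain ⟨c, -, rfl⟩ := (mem_support_map_iff _ _ _).1 h4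
    exact ⟨h1, h2, h3⟩

lemma lift_lease_three (hst : LeaseInv st T ns js K keys) (m : QMem) : Lift (LeasePost lam T)
    (lessorOracle (scheme E D F) C b lam coin 3 x (some st) m) (leaseHandlers E D C b t 3 _ core
    (leaseOf lam st ns js, x) ([], ((pubOf lam st keys, secretsOf lam st K), ()), m)) := by
  refine lift_ite_cond ?_ (fun h => ?_) fun _ => Lift.pure
    ⟨rfl, rfl, rfl, ns, js, K, keys, hst, rfl⟩
  · simp [leaseOf, pubOf, LeaseState.num, hst.n, ltN]
  refine (congrArg (Lift _ · _) (map_comp _ _ _)).mpr ?_; rw [bind_pure_run]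
  refine (congrArg (fun i => Lift _ _ (PMF.map _ (Act.mapA _ (List.range i) _)))
    (length_map (as := st.leased) fun t => (t.f, t.returned))).mpr ?_
  refine Lift.map ((lift_leaseVrfy (l := st.leased) (p := pubOf lam st keys)
    (s := secretsOf lam st K) (s0 := leaseOf lam st ns js) hst.pos hst.le hst.n rfl rfl rfl rfl
    hst.vks rfl rfl rfl hst.rel x m).mono ?_)
  rintro o ⟨cs, w1, w2, w3⟩ ⟨h1, ⟨h2, h3, h4, keys', h5, h6, h7⟩, h8⟩; dsimp only at h3 h4 h5 h8
  subst h3 h4 h5 h8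
  replace h2 := h2.trans (congrArg (List.map _) (take_of_length_le h1.ge))
  have hvks : ∀ {β : Type} (g : List Str → β),
      (o.map Prod.fst).map (fun t => g t.vk) = st.leased.map fun t => g t.vk := fun g => by
    have := congrArg (List.map fun a => g a.2) h2; simp only [map_map] at this ⊢
    exact this.trans (map_map ..)
  have hf : (o.map Prod.fst).map (fun t => t.f) = st.leased.map fun t => t.f := by
    have := congrArg (List.map fun a => a.1) h2; simp only [map_map] at this ⊢
    exact this.trans (map_map ..)
  have hfst : ((o.map Prod.fst).map fun t => (t.f, t.returned)).map Prod.fst =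
      (o.map Prod.fst).map fun t => t.f := by
    simp only [map_map]; rfl
  have hreply : (if o.any Prod.snd = true then reply [] [] else bot) =
      ((bif o.any Prod.snd then [true] else []), []) := by
    cases o.any Prod.snd <;> rfl
  have hkeys : (o.map fun o => ((o.1.f, o.1.returned), o.2)).map Prod.fst =
      (o.map Prod.fst).map fun t => (t.f, t.returned) := by
    simp only [map_map]; rfl
  refine ⟨?_, (congrArg Prod.snd hreply).symm, rfl, ns, js, K, keys', { hst with
      vks := fun e he => ?_
      rel := ⟨?_, fun i hi => ?_⟩ }, ?_⟩
  · refine Eq.trans ?_ (congrArg Prod.fst hreply).symm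
    exact congrArg (fun c : Bool => bif c then [true] else []) List.any_map
  · have := (congrArg (List.length (α := Str) e.vk ∈ ·) (hvks List.length)).mp
      (List.mem_map_of_mem he)
    obtain ⟨e', he', h'⟩ := List.mem_map.1 this; exact h'.symm.trans (hst.vks e' he')
  · exact h6.1.trans (hst.rel.1.trans ((map_map ..).trans (hf.symm.trans hfst.symm)))
  · rcases lt_or_ge i o.length with h' | h'
    · refine h7 i h' ?_
      have h9 : ((o.map Prod.fst).map fun t => (t.f, t.returned)).getI i =
          (o[i].1.f, o[i].1.returned) := by
        rw [getI_eq_getElem _ (by simpa using h')]; simp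
      exact (congrArg Prod.snd h9).symm.trans hi
    · have h9 : ((o.map Prod.fst).map fun t => (t.f, t.returned)).getI i = default :=
        List.getI_eq_default _ (by simpa using h')
      have := (congrArg Prod.snd h9).symm.trans hi; cases this
  · refine Prod.ext (Prod.ext ?_ (Prod.ext rfl (Prod.ext ?_ rfl))) ?_
    · exact congrArg (pubOf lam st) hkeys
    · exact (hvks fun vk => vk.set (st.j - 1) []).symm
    · refine congrArg (fun l => ((_, (⟨_, _, _, l⟩ : Secrets)), ())) ?_
      exact (hvks fun vk => vk.getI (st.j - 1)).symm

end

lemma mapA_support {S α β : Type} {g : α → Act S β} {Q : β → Prop} {l : List α} : ∀ {w : World S},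
    (∀ a ∈ l, ∀ w, ∀ o ∈ (g a w).support, Q o.1) → ∀ o ∈ (Act.mapA g l w).support, o.1.length =
    l.length ∧ ∀ c ∈ o.1, Q c := by
  induction l with
  | nil =>
    intro w _ o ho; rw [Act.mapA, pure_run, support_pure, mem_singleton_iff] at ho; subst ho
    exact ⟨rfl, fun c hc => by cases hc⟩
  | cons a l ih =>
    intro w h o ho; rw [Act.mapA, bind_run, mem_support_bind_iff] at ho; obtain ⟨o1, ho1, ho⟩ := ho
    rw [bind_pure_run, mem_support_map_iff] at ho; obtain ⟨o2, ho2, rfl⟩ := ho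
    obtain ⟨h1, h2⟩ := ih (fun a' ha' => h a' (List.mem_cons_of_mem _ ha')) o2 ho2
    refine ⟨by simp [h1], fun c hc => ?_⟩; rcases List.mem_cons.1 hc with rfl | hc
    · exact h a List.mem_cons_self _ o1 ho1
    · exact h2 c hc

lemma length_bits_ofBits_le (s : Str) : (ofBits s).bits.length ≤ s.length := by
  rw [Nat.size_eq_bits_len, Nat.size_le]; exact ofBits_lt s

/-- Size invariant of the private state: `j` bounds the number of calls. -/
structure LeaseBounded (lam T N t j : ℕ) (s : LeaseState) : Prop where
  lam : s.1.lam = lam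
  pub : s.1.Bounded T j
  num : s.2.1.1.length ≤ T
  idx : s.2.1.2.length ≤ T
  vks : s.2.2.1.length ≤ j
  vk : ∀ v ∈ s.2.2.1, v.length ≤ N + 1 ∧ ∀ y ∈ v, y.length ≤ t

lemma LeaseBounded.succ {lam T N t j : ℕ} {s : LeaseState} (h : LeaseBounded lam T N t j s) :
    LeaseBounded lam T N t (j + 1) s :=
  { h with
    pub := h.pub.succ
    vks := h.vks.trans j.le_succ }

lemma LeaseBounded.size {lam T N t j : ℕ} {s : LeaseState} (h : LeaseBounded lam T N t j s) :
    (enc s).length ≤ 2 * (2 * lam + 20 + 8 * T + 2 * (j * (4 * T + 5))) + 6 * T + 2 *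
    (j * (2 * ((N + 1) * (2 * t + 1)) + 1)) + 10 := by
  obtain ⟨p, ⟨ns, js⟩, vks, f⟩ := s; have h1 := h.pub.size
  have h2 : (enc vks).length ≤ j * (2 * ((N + 1) * (2 * t + 1)) + 1) := by
    refine (length_enc_le (N := (N + 1) * (2 * t + 1)) fun v hv => ?_).trans
      (Nat.mul_le_mul_right _ h.vks)
    refine (length_enc_le (N := t) fun y hy => ?_).trans (Nat.mul_le_mul_right _ (h.vk v hv).1)
    rw [enc_str]; exact (h.vk v hv).2 y hy
  have h3 := h.num; have h4 := h.idx; have h5 := h.lam; dsimp only at h1 h3 h4 h5; rw [h5] at h1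
  simp only [length_enc_pair, enc_str, enc_bool, length_singleton]; omega

lemma leaseHandlers_bounded {b t : ℕ[X]} {lam T j : ℕ} {s : LeaseState} (k : ℕ) {x : Str} {S : Type}
    {O : Oracle S} {u : World S} (h : LeaseBounded lam T (b.eval lam) (t.eval lam) j s)
    (hx : x.length ≤ T) : ∀ o ∈ (leaseHandlers E D C b t k S O (s, x) u).support, LeaseBounded lam T
    (b.eval lam) (t.eval lam) (j + 1) o.1.2 := by
  have hpure : ∀ {y : Str} {s' : LeaseState},
      LeaseBounded lam T (b.eval lam) (t.eval lam) (j + 1) s' →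
        ∀ o ∈ ((pure (y, s') : Act S _) u).support,
          LeaseBounded lam T (b.eval lam) (t.eval lam) (j + 1) o.1.2 := fun h o ho => by
    rw [pure_run, support_pure, mem_singleton_iff] at ho; subst ho; exact h
  have hbind : ∀ {α : Type} {g : Act S α} {f : α → Str × LeaseState},
      (∀ o ∈ (g u).support, LeaseBounded lam T (b.eval lam) (t.eval lam) (j + 1) (f o.1).2) →
        ∀ o ∈ ((g >>= fun a => pure (f a)) u).support,
          LeaseBounded lam T (b.eval lam) (t.eval lam) (j + 1) o.1.2 := fun h o ho => by
    rw [bind_pure_run, mem_support_map_iff] at ho; obtain ⟨o', ho', rfl⟩ := ho; exact h o' ho'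
  have hcond : ∀ {c : Bool} {f g : Act S (Str × LeaseState)},
      (∀ o ∈ (f u).support, LeaseBounded lam T (b.eval lam) (t.eval lam) (j + 1) o.1.2) →
      (∀ o ∈ (g u).support, LeaseBounded lam T (b.eval lam) (t.eval lam) (j + 1) o.1.2) →
        ∀ o ∈ ((cond c f g : Act S _) u).support,
          LeaseBounded lam T (b.eval lam) (t.eval lam) (j + 1) o.1.2 := fun {c} _ _ h1 h2 => by
    cases c
    · exact h2
    · exact h1
  have hitem : ∀ k, (item k x).length ≤ T := fun k => (Pub.length_item_le k x).trans hx
  have hupd := fun (k : ℕ) {y : Str} (hy : y.length ≤ T) => h.pub.update hy [] k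
  have hlam := fun (k : ℕ) (y : Str) => (s.1.update_lam y [] k).trans h.lam
  have hs := h.succ; rcases k with _ | _ | _ | _ | _ | k
  · refine hcond (hbind fun o _ => ?_) (hpure hs)
    have hjb : (indexS (item 1 x) (item 2 x)).length ≤ T := by
      rw [indexS, length_take]
      exact (min_le_left _ _).trans ((length_bits_ofBits_le _).trans (hitem 1))
    exact { hs with
      lam := hlam 0 _
      num := hitem 1
      idx := hitem 2
      pub := { hs.pub with
        q := by simpa only [Pub.update, item_encList] using hitem 0
        jb := by simpa only [Pub.update, item_encList] using hjb
        x0 := by simpa only [Pub.update, item_encList] using hitem 3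
        x1 := by simpa only [Pub.update, item_encList] using hitem 4 } }
  · exact hcond (hcond (hbind fun o _ => { hs with
      lam := hlam 2 []
      pub := hupd 2 (y := []) (Nat.zero_le _) }) (by
        intro o ho; rw [bind_run, mem_support_bind_iff] at ho; obtain ⟨o1, ho1, ho⟩ := ho
        rw [bind_pure_run, mem_support_map_iff] at ho; obtain ⟨o2, ho2, rfl⟩ := ho
        exact hs)) (hpure hs)
  · refine hcond (hbind fun o ho => { hs with
      lam := hlam 3 x
      pub := hupd 3 hx
      vks := by simpa using h.vks
      vk := fun v hv => ?_ }) (hpure hs)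
    rcases List.mem_append.1 hv with hv | hv
    · exact h.vk v hv
    · have hl := (mapA_support (Q := fun _ => True) (fun _ _ _ _ _ => trivial) o ho).1
      rw [List.mem_singleton.1 hv]; refine ⟨?_, fun y hy => ?_⟩
      · rw [length_map, hl, List.length_range, LeaseState.num, h.lam]; exact min_le_right _ _
      · obtain ⟨c, -, rfl⟩ := List.mem_map.1 hy; rw [length_take, h.lam]; exact min_le_left _ _
  · refine hcond (hbind fun o ho => ?_) (hpure hs)
    obtain ⟨h1, h2⟩ := mapA_support (Q := fun c : (Str × Bool) × Bool => c.1.1.length ≤ T) (by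
      intro i hi w o ho; rw [leaseVrfy] at ho
      have hk : (s.1.keys.getI i).1.length ≤ T := by
        rw [getI_eq_getElem _ (List.mem_range.1 hi)]; exact h.pub.key _ (List.getElem_mem _)
      cases hc : eqS (s.1.keys.getI i).1 (item 0 x)
      · rw [hc, cond_false, pure_run, support_pure, mem_singleton_iff] at ho; subst ho; exact hk
      · rw [hc, cond_true, bind_pure_run, mem_support_map_iff] at ho; obtain ⟨o', ho', rfl⟩ := ho
        exact hk) o ho
    exact { hs with
      pub := { hs.pub with
        keys := by rw [length_map, h1, List.length_range]; exact hs.pub.keys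
        key := fun e he => by obtain ⟨c, hc, rfl⟩ := List.mem_map.1 he; exact h2 c hc } }
  · exact hcond (hcond (hbind fun o _ => { hs with
      lam := hlam 5 []
      pub := hupd 5 (y := []) (Nat.zero_le _) }) (hpure { hs with })) (hpure hs)
  · exact hpure hs

lemma leaseBound_exists (T : ℕ[X]) : ∃ t : ℕ[X], ∀ lam, LeaseBound E D lam (T.eval lam) (t.eval lam)
    := by
  obtain ⟨p1, hp1⟩ := starKeys_size E D; obtain ⟨p2, hp2⟩ := keyDist_size E D
  obtain ⟨p3, hp3⟩ := blockLen_size E D; obtain ⟨p4, hp4⟩ := ppt_size E.enc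
  set N : ℕ[X] := p1.comp (X + T) + T with hN
  refine ⟨p2.comp (X + N) + p3.comp (X + T) + 2 * p4.comp (X + N) + N + 2, fun lam => ?_⟩
  have hNe : N.eval lam = p1.eval (lam + T.eval lam) + T.eval lam := by simp [hN]
  have hte : (p2.comp (X + N) + p3.comp (X + T) + 2 * p4.comp (X + N) + N + 2).eval lam =
      p2.eval (lam + N.eval lam) + p3.eval (lam + T.eval lam) + 2 * p4.eval (lam + N.eval lam) +
        N.eval lam + 2 := by simp
  rw [hte]
  refine ⟨fun q hq => ?_, fun q hq u hu x hx ct hct => ?_, fun q hq u hu x hx m o ho => ?_⟩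
  · have := hp3 lam q _ hq; omega
  · obtain ⟨h1, h2⟩ := hp1 lam q _ u hq hu
    have := hp4 lam _ x (N.eval lam) (by omega) (by omega) ct hct; omega
  · obtain ⟨h1, h2⟩ := hp1 lam q _ u hq hu
    have := hp2 lam _ _ x false m (N.eval lam) (by omega) (by omega) (by omega) o ho; omega

lemma exists_lessor_reduction {A : Prog} {T : ℕ[X]} (hA : TimeBound A T) (b : ℕ[X]) : ∃ P,
    IsQPTAdversary P ∧ ∀ lam coin, (scheme E D F).lessorExperiment C b A lam coin = (coreRun E D C
    (fun lam => sampler E D F lam false false) 0 coin P lam).map State.guess := by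
  obtain ⟨t, ht⟩ := leaseBound_exists (E := E) (D := D) T
  refine (exists_reduction hA (h := leaseHandlers E D C b t) (Impl.leaseHandlers C b t)
    (μ := fun lam => PMF.pure (Pub.init lam, ([], []), [], false))
    (Impl.pure (f := fun lam : ℕ => ((Pub.init lam, ([], []), [], false) : LeaseState))
      (by unfold Pub.init; fun_prop) |>.congr fun S O a w => by
        simp only [lift, pure_map, pure_run])
    (fin := fun a => a.2 && !a.1.2.2.2) fp
    (fun lam j s => LeaseBounded lam (T.eval lam) (b.eval lam) (t.eval lam) j s)
    (2 * (2 * X + 20 + 8 * T + 2 * (T * (4 * T + 5))) + 6 * T +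
      2 * (T * (2 * ((b + 1) * (2 * t + 1)) + 1)) + 10) ?_
    (fun lam j a k x S O u o ho h hx => leaseHandlers_bounded k h hx o ho) ?_).imp
      fun P h => ⟨h.1, fun lam coin => ?_⟩
  · intro lam a ha; rw [support_pure, mem_singleton_iff] at ha; subst ha
    exact ⟨rfl, Pub.bounded_init _ _ _, Nat.zero_le _, Nat.zero_le _, Nat.zero_le _,
      fun v hv => by cases hv⟩
  · intro lam j a hj h; have h1 := h.size; have h2 := Nat.mul_le_mul_right (4 * T.eval lam + 5) hj
    have h3 := Nat.mul_le_mul_right (2 * ((b.eval lam + 1) * (2 * t.eval lam + 1)) + 1) hj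
    simp; omega
  · have h' := congrArg (PMF.map Prod.fst) (h.2 lam _ (game C (coreProcs (S := Unit) E D C
      (fun lam => sampler E D F lam false false) 0 coin)) ((Pub.init lam, ⟨id, [], [], []⟩), ()))
    rw [map_comp, PMF.pure_bind, map_comp] at h'; refine Eq.trans ?_ h'.symm
    refine (Prog.run_envRel (R := LeaseRel lam (T.eval lam)) (BA := fun _ => False)
      (BB := fun _ => False) (T := T.eval lam) (fun _ _ _ _ h => h.elim)
      (fun _ _ _ _ h => h.elim) ?_ A (start ![unary lam] [] QMem.init none)
      (start ![unary lam] [] QMem.init _) (Or.inl ⟨rfl, rfl⟩) (hA lam _ _ _)).map_eq ?_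
    · intro k x e e' m he hx
      have hpost : Lift (LeasePost lam (T.eval lam))
          (lessorOracle (scheme E D F) C b lam coin k x e m)
          (leaseHandlers E D C b t k _ (game C (coreProcs (S := Unit) E D C
            (fun lam => sampler E D F lam false false) 0 coin)) (e'.1, x) ([], e'.2, m)) := by
        rcases e with _ | st
        · subst he; rcases k with _ | _ | _ | _ | _ | k
          · exact lift_lease_zero hx m
          all_goals exact Lift.pure ⟨rfl, rfl, rfl, rfl⟩
        · obtain ⟨ns, js, K, keys, hst, rfl⟩ := he; rcases k with _ | _ | _ | _ | _ | k
          · exact Lift.pure ⟨rfl, rfl, rfl, ns, js, K, keys, hst, rfl⟩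
          · exact lift_lease_one (ht lam) hx hst m
          · exact lift_lease_two (ht lam) hx hst m
          · exact lift_lease_three hst m
          · exact lift_lease_four (ht lam) hst m
          · exact Lift.pure ⟨rfl, rfl, rfl, ns, js, K, keys, hst, rfl⟩
      refine Lift.of_map_right (hpost.mono ?_); rintro o o' ⟨h1, h2, h3, h4⟩
      exact Or.inl ⟨Prod.ext h1 h2, h3, h4⟩
    · rintro a a' (⟨h1, h2⟩ | ⟨h, -⟩)
      · rw [h1]; obtain ⟨c, q, m, e, t⟩ := a; rcases e with _ | st
        · change a'.env = _ at h2; change State.guess _ = (State.guess _ && !a'.env.1.2.2.2)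
          rw [h2]; exact (Bool.and_true _).symm
        · obtain ⟨ns, js, K, keys, -, h2⟩ := h2; change _ = (State.guess _ && !a'.env.1.2.2.2)
          rw [h2]; exact Bool.and_comm _ _
      · exact h.elim

open Asymptotics Filter

lemma coreProcs_coin (smp : ℕ → ℕ → Str → PMF ((Str → Str) × Str × Str)) (hyb : ℕ) {k : ℕ}
    (hk : k ≠ 5) : coreProcs (S := Unit) E D C smp hyb false k = coreProcs E D C smp hyb true k
    := by
  funext p s x w
  rcases k with _ | _ | _ | _ | _ | _ | k
  · exact (coreProcs_zero ..).trans (coreProcs_zero ..).symm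
  · exact (coreProcs_one ..).trans (coreProcs_one ..).symm
  · exact (coreProcs_two ..).trans (coreProcs_two ..).symm
  · exact (coreProcs_three ..).trans (coreProcs_three ..).symm
  · exact (coreProcs_four ..).trans (coreProcs_four ..).symm
  · exact absurd rfl hk
  · simp only [coreProcs]

/-- Until the challenge ciphertext is given out, the core game does not depend on the coin. -/
lemma coreRun_unchallenged (smp : ℕ → ℕ → Str → PMF ((Str → Str) × Str × Str)) (hyb : ℕ) {A : Prog}
    {T : ℕ[X]} (hA : TimeBound A T) (lam : ℕ) : ((coreRun E D C smp hyb false A lam).map fun s =>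
    s.guess && !s.env.1.1.challenged) = (coreRun E D C smp hyb true A lam).map fun s => s.guess &&
    !s.env.1.1.challenged := by
  have hst : ∀ coin, (game C (coreProcs (S := Unit) E D C smp hyb coin)).Stable fun e =>
      e.1.1.challenged = true := fun coin =>
    game_stable _ (B := fun p _ => p.challenged = true) fun k p y x u _ h o _ => by
      rcases k with _ | _ | _ | _ | _ | _ | k <;> first | exact h | rfl
  refine (lift_game (T := T.eval lam) (R := fun _ xa ea xb eb => xb = xa ∧ eb = ea)
    (BA := fun p _ _ => p.challenged = true) (BB := fun p _ _ => p.challenged = true) ?_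
    (hst false) (hst true) A (a := start ![unary lam] [] QMem.init _) (b := start ![unary lam] []
      QMem.init _) rfl rfl ⟨rfl, rfl⟩ (hA lam _ _ _)).map_eq ?_
  · rintro k p xa ea xb eb x m ⟨rfl, rfl⟩ - -
    by_cases hk : k = 5
    · subst hk; exact Lift.of_bad fun _ _ _ _ => Or.inr ⟨rfl, rfl⟩
    · rw [coreProcs_coin smp hyb hk]; exact Lift.refl fun _ _ => Or.inl ⟨rfl, rfl, rfl, rfl, rfl⟩
  · rintro a b (⟨h1, h2, -⟩ | ⟨h1, h2⟩)
    · rw [h2, h1]; rfl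
    · rw [h1, h2]; simp

lemma abs_sub_le_chain (a a' b b' d d' e e' : ℝ) :
    |a - a'| ≤ |a - b| + |d - b| + |a' - b'| + |d' - b'| + |d - e| + |d' - e'| + |e - e'| := by
  refine abs_le.2 ⟨?_, ?_⟩ <;>
  linarith [le_abs_self (a - b), neg_abs_le (a - b), le_abs_self (d - b), neg_abs_le (d - b),
    le_abs_self (a' - b'), neg_abs_le (a' - b'), le_abs_self (d' - b'), neg_abs_le (d' - b'),
    le_abs_self (d - e), neg_abs_le (d - e), le_abs_self (d' - e'), neg_abs_le (d' - e'),
    le_abs_self (e - e'), neg_abs_le (e - e')]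

lemma lessor_sub_eq {A : Prog} {T : ℕ[X]} (hA : TimeBound A T) (b : ℕ[X]) : ∃ P, IsQPTAdversary P ∧
    ∀ lam, pr ((scheme E D F).lessorExperiment C b A lam false) - pr
    ((scheme E D F).lessorExperiment C b A lam true) = pr (coreExp E D C (fun lam => sampler E D F
    lam false false) 0 false P lam) - pr (coreExp E D C (fun lam => sampler E D F lam false false) 0
    true P lam) := by
  obtain ⟨P, hP, h⟩ := exists_lessor_reduction (E := E) (D := D) (F := F) (C := C) hA b
  refine ⟨P, hP, fun lam => ?_⟩; obtain ⟨T', hT'⟩ := hP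
  have key : ∀ coin, pr ((coreRun E D C (fun lam => sampler E D F lam false false) 0 coin P lam).map
      State.guess) = pr (coreExp E D C (fun lam => sampler E D F lam false false) 0 coin P lam) +
        pr ((coreRun E D C (fun lam => sampler E D F lam false false) 0 coin P lam).map
          fun s => s.guess && !s.env.1.1.challenged) := fun coin => pr_map_split _ _ _
  rw [h, h, key, key, coreRun_unchallenged _ _ (T := T') hT']; ring

lemma selectivelyStrongLessorSecure (hlen : E.PublicKeyLength C) (hE : E.SelectivelyIndSecure C)
    (hD : D.IndCvaCdSecure) (hF : F.IsPRF) : (scheme E D F).SelectivelyStrongLessorSecure C := by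
  rintro b A ⟨T0, hT0⟩
  obtain ⟨P, ⟨T, hT⟩, hP⟩ := lessor_sub_eq (E := E) (D := D) (F := F) (C := C) (T := T0) hT0 b
  choose R hR hR' using fun c coin =>
    exists_prf_reduction (E := E) (D := D) (F := F) (C := C) (T := T) hT c coin
  choose H hH hH' using fun coin =>
    exists_hybrid_reduction (E := E) (D := D) (C := C) F (T := T) hT coin
  obtain ⟨I, hI, hI'⟩ := exists_ind_reduction (E := E) (C := C) D F hlen (T := T) hT
  set S : Polynomial ℝ := (2 * T + 1).map (Nat.castRingHom ℝ) with hS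
  have hneg := ((((((hF _ (hR false false)).add (hF _ (hR true false))).add
    (hF _ (hR false true))).add (hF _ (hR true true))).add
    ((hD _ (hH false)).polynomial_mul S)).add ((hD _ (hH true)).polynomial_mul S)).add (hE _ hI)
  refine hneg.trans_abs_le fun lam => ?_
  have h2 : ((2 ^ (T.eval lam).size : ℕ) : ℝ) ≤ S.eval (lam : ℝ) := by
    have h3 : S.eval (lam : ℝ) = ((2 * T.eval lam + 1 : ℕ) : ℝ) := by
      rw [hS, Polynomial.eval_natCast_map]; simp
    rw [h3]
    exact_mod_cast two_pow_size_le (T.eval lam)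
  have hhyb : ∀ coin, |pr (coreExp E D C (fun lam => sampler E D F lam false true) 0 coin P lam) -
      pr (coreExp E D C (fun lam => sampler E D F lam false true) (2 ^ (T.eval lam).size) coin P
        lam)| ≤ S.eval (lam : ℝ) *
          |pr (D.cvaExperiment (H coin) lam false) - pr (D.cvaExperiment (H coin) lam true)| :=
    fun coin => by
      rw [hH', abs_mul, abs_of_nonneg (by positivity)]
      exact mul_le_mul_of_nonneg_right (by exact_mod_cast h2) (abs_nonneg _)
  have hprf : ∀ c coin, |pr (coreExp E D C (fun lam => sampler E D F lam false c) 0 coin P lam) -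
      pr (coreExp E D C (fun lam => sampler E D F lam true true) 0 coin P lam)| =
        |pr (F.experiment (R c coin) lam false) - pr (F.experiment (R c coin) lam true)| :=
    fun c coin => by
      rw [hR', hR']; cases c
      · rw [coreExp_random coin (T := T) hT]
      · rfl
  have h1 := hprf false false; have h3 := hprf true false; have h4 := hprf false true
  have h5 := hprf true true; have h6 := hhyb false; have h7 := hhyb true
  have h8 : |pr (coreExp E D C (fun lam => sampler E D F lam false true) (2 ^ (T.eval lam).size)
      false P lam) - pr (coreExp E D C (fun lam => sampler E D F lam false true)
        (2 ^ (T.eval lam).size) true P lam)| =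
      |pr (E.indExperiment C I lam false) - pr (E.indExperiment C I lam true)| := by
    rw [hI', hI']
  refine (abs_abs _).trans_le (le_trans ?_ (le_abs_self _))
  refine (congrArg abs (hP lam)).trans_le ?_
  change _ ≤ |pr (F.experiment (R false false) lam false) - pr (F.experiment _ lam true)| +
    |pr (F.experiment (R true false) lam false) - pr (F.experiment _ lam true)| +
    |pr (F.experiment (R false true) lam false) - pr (F.experiment _ lam true)| +
    |pr (F.experiment (R true true) lam false) - pr (F.experiment _ lam true)| +
    S.eval (lam : ℝ) * |pr (D.cvaExperiment (H false) lam false) - pr (D.cvaExperiment _ lam true)| +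
    S.eval (lam : ℝ) * |pr (D.cvaExperiment (H true) lam false) - pr (D.cvaExperiment _ lam true)| +
    |pr (E.indExperiment C I lam false) - pr (E.indExperiment C I lam true)|
  rw [← h1, ← h3, ← h4, ← h5, ← h8]
  refine (abs_sub_le_chain _ _ _ _ _ _ _ _).trans
    (add_le_add_left (add_le_add (add_le_add_right h6 _) h7) _)

end Skl

end

theorem mainTheorem4 (C : Skl.FunctionClass) (E : Skl.SKFE) (D : Skl.CDSKE) (F : Skl.FunFamily)
    (hlen : E.PublicKeyLength C)
    (hE : E.SelectivelyIndSecure C)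
    (hD : D.IndCvaCdSecure)
    (hF : F.IsPRF) :
    (Skl.Construction.scheme E D F).SelectivelyStrongLessorSecure C :=
  Skl.selectivelyStrongLessorSecure hlen hE hD hF
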